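/- **Conventions.** For words $f,g\in(\mathbb F_q^m)^N$ let $\Delta(f,g)$ be the fraction of coordinates $i\in[N]$ with $f(i)\neq g(i)$ (symbols in $\mathbb F_q^m$). An $\mathbb F_q$-linear code $\mathcal C\subseteq(\mathbb F_q^m)^N$ (a linear subspace over $\mathbb F_q$; $N,m\ge 1$) has distance (at least) $\Delta\in(0,1]$ if $\Delta(f,g)\ge\Delta$ for all distinct $f,g\in\mathcal C$. Put $\mathcal L(g,\eta)=\{h\in\mathcal C:\Delta(g,h)<\eta\}$. The machine is a deterministic word RAM: a fixed finite program works on a constant number of arrays of words with random access; each addition, truncated subtraction, multiplication, integer division, remainder, comparison and memory access on words costs one unit of time, and results that do not fit into a word are not allowed. The field $\mathbb F_q$, $q=p^e$, is given as $\mathbb F_p[X]/(M)$ by $p$, $e$ and the coefficients of a monic irreducible polynomial $M\in\mathbb F_p[X]$ of degree $e$; a field element is stored as $e$ numbers in $\{0,\dots,p-1\}$, and field operations are not primitive. **Theorem.** There are a single program and an absolute constant $c\in\mathbb N$ such that the following holds for every finite field $\mathbb F_q$ (presented as above), all integers $N,m\ge1$ and $k\ge 0$, every $\mathbb F_q$-linear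 code $\mathcal C\subseteq(\mathbb F_q^m)^N$ of distance (at least) $\Delta$, where $\Delta\in(0,1]$ is rational, every rational $\varepsilon\in(0,\Delta)$, every received word $g\in(\mathbb F_q^m)^N$, and every affine subspace $\mathcal H\subseteq\mathcal C$ over $\mathbb F_q$ with $\dim\mathcal H=k$, given by a point $h_0\in\mathcal H$ and a basis of its direction space. On input the presentation of the field, the numbers $N,m,k$, the numerators and denominators of $\Delta$ and $\varepsilon$, the word $g$, the point $h_0$ and the basis, the program halts after at most $$\left(\tfrac2\varepsilon\right)^{c\,2^k}\cdot N\,m\cdot(\log_2 q)^c$$ units of time and outputs a list, without repetitions, of exactly the codewords in $\mathcal H\cap\mathcal L(g,\Delta-\varepsilon)$. This holds for every word range $\{0,\dots,W-1\}$ with $W\ge\bigl((2/\varepsilon)^{2^k}\cdot N\,m\,q\,\operatorname{den}(\Delta)\operatorname{den}(\varepsilon)\bigr)^c$. -/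

import Mathlib

/-! ### Codes with alphabet `F^m` and block length `N` -/

namespace LinCode

/-- Words of length `N` over the alphabet `F^m`. -/
abbrev Word (F : Type*) (N m : ℕ) : Type _ := Fin N → Fin m → F

/-- The normalized Hamming distance: the fraction of the `N` coordinates (each a symbol
of `F^m`) in which `f` and `g` differ. -/
def relDist {F : Type*} [DecidableEq F] {N m : ℕ} (f g : Word F N m) : ℚ :=
  (hammingDist f g : ℚ) / N

/-- The code `C` has distance (at least) `Δ`. -/
def HasDistance {F : Type*} [Field F] [DecidableEq F] {N m : ℕ}
    (C : Submodule F (Word F N m)) (Δ : ℚ) : Prop :=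
  ∀ f ∈ C, ∀ g ∈ C, f ≠ g → Δ ≤ relDist f g

/-- The list of codewords of `C` whose distance from `g` is less than `η`. -/
def codeList {F : Type*} [Field F] [DecidableEq F] {N m : ℕ}
    (C : Submodule F (Word F N m)) (g : Word F N m) (η : ℚ) : Set (Word F N m) :=
  {h | h ∈ C ∧ relDist g h < η}

end LinCode

/-! ### A word RAM with unit-cost instructions

The memory consists of arrays of words with random access; a word is a natural number
less than `W` (so the word length is `log₂ W` bits). A program is a finite piece of code, which
mentions finitely many arrays. Every elementary operation costs one unit of time, and an operation
whose result does not fit into a word has no result (the run is then stuck). -/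

namespace WordRAM

/-- Memory contents: `σ a i` is cell `i` of array `a`. -/
abbrev Mem : Type := ℕ → ℕ → ℕ

/-- The elementary operations on words. -/
inductive Op : Type
  | add | sub | mul | div | mod | lt | eq

/-- Meaning of the operations: `sub` is truncated at `0`, `div` and `mod` are quotient and
remainder, comparisons return `1` (true) or `0` (false). -/
def Op.apply : Op → ℕ → ℕ → ℕ
  | .add, x, y => x + y
  | .sub, x, y => x - y
  | .mul, x, y => x * y
  | .div, x, y => x / y
  | .mod, x, y => x % y
  | .lt, x, y => if x < y then 1 else 0
  | .eq, x, y => if x = y then 1 else 0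

/-- Expressions: constants, contents of the cell of array `a` with computed index, operations. -/
inductive Expr : Type
  | const (n : ℕ)
  | read (a : ℕ) (i : Expr)
  | bin (o : Op) (x y : Expr)

/-- The value of an expression; `none` if some intermediate result is not below `W`. -/
def Expr.eval (W : ℕ) (σ : Mem) : Expr → Option ℕ
  | .const n => if n < W then some n else none
  | .read a i => (i.eval W σ).map (σ a)
  | .bin o x y =>
      (x.eval W σ).bind fun u => (y.eval W σ).bind fun v =>
        if o.apply u v < W then some (o.apply u v) else none

/-- The time for evaluating an expression: the number of constants, memory accesses and
operations in it. -/
def Expr.cost : Expr → ℕ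
  | .const _ => 1
  | .read _ i => i.cost + 1
  | .bin _ x y => x.cost + y.cost + 1

/-- Programs. `store a i v` writes the value of `v` into the cell of array `a` whose index is the
value of `i`; a condition is true when its value is not `0`. -/
inductive Program : Type
  | skip
  | store (a : ℕ) (i v : Expr)
  | seq (P Q : Program)
  | ite (b : Expr) (P Q : Program)
  | loop (b : Expr) (P : Program)

/-- `Exec W P σ t σ'`: on the machine with words below `W`, program `P` started with memory `σ`
halts after `t` units of time with memory `σ'`. -/
inductive Exec (W : ℕ) : Program → Mem → ℕ → Mem → Prop
  | skip {σ : Mem} : Exec W .skip σ 1 σ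
  | store {σ : Mem} {a : ℕ} {i v : Expr} {x y : ℕ} :
      i.eval W σ = some x → v.eval W σ = some y →
      Exec W (.store a i v) σ (i.cost + v.cost + 1)
        (Function.update σ a (Function.update (σ a) x y))
  | seq {P Q : Program} {σ σ₁ σ₂ : Mem} {s t : ℕ} :
      Exec W P σ s σ₁ → Exec W Q σ₁ t σ₂ → Exec W (.seq P Q) σ (s + t) σ₂
  | ite_true {b : Expr} {P Q : Program} {σ σ₁ : Mem} {x t : ℕ} :
      b.eval W σ = some x → x ≠ 0 → Exec W P σ t σ₁ →
      Exec W (.ite b P Q) σ (b.cost + 1 + t) σ₁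
  | ite_false {b : Expr} {P Q : Program} {σ σ₁ : Mem} {t : ℕ} :
      b.eval W σ = some 0 → Exec W Q σ t σ₁ →
      Exec W (.ite b P Q) σ (b.cost + 1 + t) σ₁
  | loop_done {b : Expr} {P : Program} {σ : Mem} :
      b.eval W σ = some 0 → Exec W (.loop b P) σ (b.cost + 1) σ
  | loop_step {b : Expr} {P : Program} {σ σ₁ σ₂ : Mem} {x s t : ℕ} :
      b.eval W σ = some x → x ≠ 0 → Exec W P σ s σ₁ → Exec W (.loop b P) σ₁ t σ₂ →
      Exec W (.loop b P) σ (b.cost + 1 + s + t) σ₂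

/-- Programs are deterministic: time and result of a run are determined by the initial memory. -/
theorem Exec.deterministic {W : ℕ} {P : Program} {σ σ₁ : Mem} {t₁ : ℕ}
    (h₁ : Exec W P σ t₁ σ₁) :
    ∀ {t₂ : ℕ} {σ₂ : Mem}, Exec W P σ t₂ σ₂ → t₁ = t₂ ∧ σ₁ = σ₂ := by
  induction h₁ with
  | skip => intro t₂ σ₂ h; cases h; exact ⟨rfl, rfl⟩
  | store hi hv =>
    intro t₂ σ₂ h
    cases h with
    | store hi' hv' =>
      obtain rfl := Option.some.inj (hi.symm.trans hi')
      obtain rfl := Option.some.inj (hv.symm.trans hv')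
      exact ⟨rfl, rfl⟩
  | seq _ _ ih₁ ih₂ =>
    intro t₂ σ₂ h
    cases h with
    | seq h₁ h₂ =>
      obtain ⟨rfl, rfl⟩ := ih₁ h₁
      obtain ⟨rfl, rfl⟩ := ih₂ h₂
      exact ⟨rfl, rfl⟩
  | ite_true hb hx _ ih =>
    intro t₂ σ₂ h
    cases h with
    | ite_true hb' hx' h =>
      obtain ⟨rfl, rfl⟩ := ih h
      exact ⟨rfl, rfl⟩
    | ite_false hb' h => exact absurd (Option.some.inj (hb.symm.trans hb')) hx
  | ite_false hb _ ih =>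
    intro t₂ σ₂ h
    cases h with
    | ite_true hb' hx' h => exact absurd (Option.some.inj (hb'.symm.trans hb)) hx'
    | ite_false hb' h =>
      obtain ⟨rfl, rfl⟩ := ih h
      exact ⟨rfl, rfl⟩
  | loop_done hb =>
    intro t₂ σ₂ h
    cases h with
    | loop_done _ => exact ⟨rfl, rfl⟩
    | loop_step hb' hx' _ _ => exact absurd (Option.some.inj (hb'.symm.trans hb)) hx'
  | loop_step hb hx _ _ ih₁ ih₂ =>
    intro t₂ σ₂ h
    cases h with
    | loop_done hb' => exact absurd (Option.some.inj (hb.symm.trans hb')) hx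
    | loop_step _ _ h₁ h₂ =>
      obtain ⟨rfl, rfl⟩ := ih₁ h₁
      obtain ⟨rfl, rfl⟩ := ih₂ h₂
      exact ⟨rfl, rfl⟩

end WordRAM

/-! ### Input and output format

The field `F` with `q = p ^ e` elements is presented as `𝔽_p[X] / (M)`, that is, through a power
basis `1, γ, …, γ ^ (e - 1)` of `F` over `𝔽_p`; here `M` is the minimal polynomial of `γ`. A field
element is stored as its `e` coordinates, each a number in `{0, …, p - 1}`. -/

namespace Format

open WordRAM LinCode

variable {p : ℕ} [Fact p.Prime] {F : Type*} [Field F] [Algebra (ZMod p) F]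

/-- The `e` coordinates of a field element. -/
noncomputable def encElem (pb : PowerBasis (ZMod p) F) (x : F) : List ℕ :=
  List.ofFn fun t : Fin pb.dim => (pb.basis.repr x t).val

/-- The `N * m` field elements of a word over `F^m`, in order, each as `e` numbers. -/
noncomputable def encWord (pb : PowerBasis (ZMod p) F) {N m : ℕ} (v : Word F N m) : List ℕ :=
  (List.finRange N).flatMap fun i => (List.finRange m).flatMap fun j => encElem pb (v i j)

/-- The coefficients of `1, X, …, X ^ (e - 1)` in the (monic) modulus `M`. -/
noncomputable def encModulus (pb : PowerBasis (ZMod p) F) : List ℕ :=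
  List.ofFn fun t : Fin pb.dim => ((minpoly (ZMod p) pb.gen).coeff t).val

/-- The input: array `0` holds the numerical parameters, array `1` the modulus, array `2` the
received word, array `3` a point `h₀` and array `4` a basis `b₁, …, b_k` of the direction of an
affine subspace. All other cells are `0`. -/
noncomputable def input (pb : PowerBasis (ZMod p) F) {N m k : ℕ} (Δ ε : ℚ)
    (g h₀ : Word F N m) (b : Fin k → Word F N m) : Mem
  | 0, x => [p, pb.dim, N, m, k, Δ.num.toNat, Δ.den, ε.num.toNat, ε.den].getD x 0
  | 1, x => (encModulus pb).getD x 0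
  | 2, x => (encWord pb g).getD x 0
  | 3, x => (encWord pb h₀).getD x 0
  | 4, x => ((List.finRange k).flatMap fun r => encWord pb (b r)).getD x 0
  | _, _ => 0

/-- The output: the list `l` of words, its length in cell `0` of array `5` and its members one
after the other in array `6`. -/
def Outputs (pb : PowerBasis (ZMod p) F) {N m : ℕ} (σ : Mem) (l : List (Word F N m)) : Prop :=
  σ 5 0 = l.length ∧
    ∀ (x : ℕ) (hx : x < (l.flatMap (encWord pb)).length), σ 6 x = (l.flatMap (encWord pb))[x]

end Format

/-!
# List decoding in an affine subspace of a linear code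

Let `c 0 = h₀ - g`, let `c 1, …, c k` be the basis of the direction of `H`, and put `K = k + 1`. The
words `f ∈ H` correspond to the vectors `x ∈ F ^ K` with `x 0 = 1`, through `f - g = ∑ l, x l • c l`,
or to the lines in `F ^ K` that are not contained in the hyperplane `x 0 = 0`. Let `S i` be the
subspace of all `x` for which this combination vanishes at coordinate `i`. The codewords in the list
are the lines that are not contained in fewer than `(Δ - ε) N` of the subspaces `S i`
(`isNear_span_iff`).

The program keeps a queue of subspaces of `F ^ K` such that every line that has to be found lies in a
member of the queue or has already been accepted (`mainLoop_spec`). It starts with the whole space. A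
line is tested directly. Let `L` be a subspace of dimension `r ≥ 2` that contains a vector `x` of a
line that has to be found. As `L` contains a vector `v ≠ 0` with `v 0 = 0`, which gives a nonzero
codeword, of weight at least `Δ N`, there are more than `ε N` coordinates `i` with `x ∈ S i` and
`v ∉ S i` (`two_mul_offCount_le`). So `x` lies in at least a fraction `2 / D` of the proper subspaces
`L ⊓ S i` of `L`, where `D = ⌊2 / ε⌋ + 1`.

Such heavy vectors are found by counting with few buckets. The stream of the subspaces `L ⊓ S i` is
distributed into `D` buckets for equal subspaces; when all buckets are in use, one copy is removed
from each of them, and the pairwise intersections of the subspaces in the buckets are written to a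
second stream. A heavy vector lies in a subspace that is left in a bucket at the end, or it lies in a
fraction of at least `2 / D ^ 2` of the members of the second stream (`Grouped.left_or_next`). The
second stream is treated in the same way with `D ^ 2` buckets, and so on with `D ^ 2 ^ v` buckets at
level `v`. The intersections are of different subspaces, so the dimensions drop with every level, and
after `r - 1` levels only zero subspaces are left in the stream. Hence `x` lies in a subspace that is
left in a bucket, and these subspaces are put into the queue (`levels_spec`).

At level `v` there are at most `D ^ 2 ^ v` such subspaces, of dimension at most `r - 1 - v`. So if a
subspace of dimension `d` has potential `D ^ 2 ^ d`, then the potential of the subspaces that `L`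
adds to the queue is less than that of `L` (`sum_potential_lt`). The number of subspaces that are
ever in the queue is therefore at most `D ^ 2 ^ K`, and the work for each of them is `N m` times a
polynomial in `D ^ 2 ^ k` and `log q` (`time_growth`). All numbers that occur are polynomially
bounded in the quantity that bounds the word size (`word_growth`).

Subspaces are stored as square matrices whose first rows are a basis and whose other rows are
equations, so that intersecting with a hyperplane is one elimination step (`cut_spec`), and equality
of subspaces can be tested by the rank of the intersection (`find_spec`). A field element is packed
into a single word, and the only operation on field elements is a fused multiplication and addition
(`fma_spec`). The elimination does not divide; the inverses that are needed to scale the accepted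
vectors to `x 0 = 1` are computed as powers with exponent `q - 2` (`output_spec`). Programs are
verified with a program logic for total correctness with time bounds (`Runs`), whose assertions
include the condition that all intermediate results fit into words.
-/


set_option linter.unusedSimpArgs false

/-! ### A program logic for the word RAM -/

namespace WordRAM

instance (n : ℕ) : OfNat Expr n := ⟨.const n⟩
instance : Add Expr := ⟨.bin .add⟩
instance : Sub Expr := ⟨.bin .sub⟩
instance : Mul Expr := ⟨.bin .mul⟩
instance : Div Expr := ⟨.bin .div⟩
instance : Mod Expr := ⟨.bin .mod⟩

/-- The scalar variable `a`: cell `0` of array `a`. -/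
def Expr.var (a : ℕ) : Expr := .read a 0

/-- The test `x < y`. -/
def Expr.ltE (x y : Expr) : Expr := .bin .lt x y

/-- The test `x = y`. -/
def Expr.eqE (x y : Expr) : Expr := .bin .eq x y

/-- The value of an expression, disregarding the word size. -/
def Expr.val (σ : Mem) : Expr → ℕ
  | .const n => n
  | .read a i => σ a (i.val σ)
  | .bin o x y => o.apply (x.val σ) (y.val σ)

/-- A sufficient condition for an expression to evaluate on words below `W`: constants, sums and
products are bounded by `W`; for the other operations, whose results do not exceed their first
operand or `1`, it is the first operand that has to be bounded. -/
def Expr.Safe (W : ℕ) (σ : Mem) : Expr → Prop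
  | .const n => n < W
  | .read _ i => i.Safe W σ
  | .bin .add x y => x.Safe W σ ∧ y.Safe W σ ∧ x.val σ + y.val σ < W
  | .bin .mul x y => x.Safe W σ ∧ y.Safe W σ ∧ x.val σ * y.val σ < W
  | .bin .sub x y => x.Safe W σ ∧ y.Safe W σ ∧ x.val σ < W
  | .bin .div x y => x.Safe W σ ∧ y.Safe W σ ∧ x.val σ < W
  | .bin .mod x y => x.Safe W σ ∧ y.Safe W σ ∧ x.val σ < W
  | .bin .lt x y => x.Safe W σ ∧ y.Safe W σ
  | .bin .eq x y => x.Safe W σ ∧ y.Safe W σ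

theorem Expr.eval_of_safe {W : ℕ} (hW : 1 < W) {σ : Mem} :
    ∀ {x : Expr}, x.Safe W σ → x.eval W σ = some (x.val σ)
  | .const n, h => by
      have h' : n < W := h
      simp [Expr.eval, Expr.val, h']
  | .read a i, h => by
      have h' : i.Safe W σ := h
      simp [Expr.eval, Expr.val, Expr.eval_of_safe hW h']
  | .bin o x y, h => by
      have h' : x.Safe W σ ∧ y.Safe W σ ∧ o.apply (x.val σ) (y.val σ) < W := by
        cases o
        · exact h
        · exact ⟨h.1, h.2.1, (Nat.sub_le _ _).trans_lt h.2.2⟩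
        · exact h
        · exact ⟨h.1, h.2.1, (Nat.div_le_self _ _).trans_lt h.2.2⟩
        · exact ⟨h.1, h.2.1, (Nat.mod_le _ _).trans_lt h.2.2⟩
        · refine ⟨h.1, h.2, ?_⟩
          simp only [Op.apply]; split_ifs <;> omega
        · refine ⟨h.1, h.2, ?_⟩
          simp only [Op.apply]; split_ifs <;> omega
      simp [Expr.eval, Expr.val, Expr.eval_of_safe hW h'.1, Expr.eval_of_safe hW h'.2.1, h'.2.2]

section simps

variable (W : ℕ) (σ : Mem) (x y : Expr) (n a : ℕ)

@[simp] theorem Expr.val_const : (Expr.const n).val σ = n := rfl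
@[simp] theorem Expr.val_zero : (0 : Expr).val σ = 0 := rfl
@[simp] theorem Expr.val_one : (1 : Expr).val σ = 1 := rfl
@[simp] theorem Expr.val_read : (Expr.read a x).val σ = σ a (x.val σ) := rfl
@[simp] theorem Expr.val_var : (Expr.var a).val σ = σ a 0 := rfl
@[simp] theorem Expr.val_add : (x + y).val σ = x.val σ + y.val σ := rfl
@[simp] theorem Expr.val_sub : (x - y).val σ = x.val σ - y.val σ := rfl
@[simp] theorem Expr.val_mul : (x * y).val σ = x.val σ * y.val σ := rfl
@[simp] theorem Expr.val_div : (x / y).val σ = x.val σ / y.val σ := rfl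
@[simp] theorem Expr.val_mod : (x % y).val σ = x.val σ % y.val σ := rfl
@[simp] theorem Expr.val_ltE : (x.ltE y).val σ = if x.val σ < y.val σ then 1 else 0 := rfl
@[simp] theorem Expr.val_eqE : (x.eqE y).val σ = if x.val σ = y.val σ then 1 else 0 := rfl

@[simp] theorem Expr.safe_const : (Expr.const n).Safe W σ ↔ n < W := Iff.rfl
@[simp] theorem Expr.safe_zero : (0 : Expr).Safe W σ ↔ 0 < W := Iff.rfl
@[simp] theorem Expr.safe_one : (1 : Expr).Safe W σ ↔ 1 < W := Iff.rfl
@[simp] theorem Expr.safe_read : (Expr.read a x).Safe W σ ↔ x.Safe W σ := Iff.rfl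
@[simp] theorem Expr.safe_var : (Expr.var a).Safe W σ ↔ 0 < W := Iff.rfl
@[simp] theorem Expr.safe_add : (x + y).Safe W σ ↔
    x.Safe W σ ∧ y.Safe W σ ∧ x.val σ + y.val σ < W := Iff.rfl
@[simp] theorem Expr.safe_sub : (x - y).Safe W σ ↔
    x.Safe W σ ∧ y.Safe W σ ∧ x.val σ < W := Iff.rfl
@[simp] theorem Expr.safe_mul : (x * y).Safe W σ ↔
    x.Safe W σ ∧ y.Safe W σ ∧ x.val σ * y.val σ < W := Iff.rfl
@[simp] theorem Expr.safe_div : (x / y).Safe W σ ↔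
    x.Safe W σ ∧ y.Safe W σ ∧ x.val σ < W := Iff.rfl
@[simp] theorem Expr.safe_mod : (x % y).Safe W σ ↔
    x.Safe W σ ∧ y.Safe W σ ∧ x.val σ < W := Iff.rfl
@[simp] theorem Expr.safe_ltE : (x.ltE y).Safe W σ ↔ x.Safe W σ ∧ y.Safe W σ := Iff.rfl
@[simp] theorem Expr.safe_eqE : (x.eqE y).Safe W σ ↔ x.Safe W σ ∧ y.Safe W σ := Iff.rfl

@[simp] theorem Expr.cost_const : (Expr.const n).cost = 1 := rfl
@[simp] theorem Expr.cost_zero : (0 : Expr).cost = 1 := rfl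
@[simp] theorem Expr.cost_one : (1 : Expr).cost = 1 := rfl
@[simp] theorem Expr.cost_read : (Expr.read a x).cost = x.cost + 1 := rfl
@[simp] theorem Expr.cost_var : (Expr.var a).cost = 2 := rfl
@[simp] theorem Expr.cost_add : (x + y).cost = x.cost + y.cost + 1 := rfl
@[simp] theorem Expr.cost_sub : (x - y).cost = x.cost + y.cost + 1 := rfl
@[simp] theorem Expr.cost_mul : (x * y).cost = x.cost + y.cost + 1 := rfl
@[simp] theorem Expr.cost_div : (x / y).cost = x.cost + y.cost + 1 := rfl
@[simp] theorem Expr.cost_mod : (x % y).cost = x.cost + y.cost + 1 := rfl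
@[simp] theorem Expr.cost_ltE : (x.ltE y).cost = x.cost + y.cost + 1 := rfl
@[simp] theorem Expr.cost_eqE : (x.eqE y).cost = x.cost + y.cost + 1 := rfl

end simps

/-- The memory after writing `y` into cell `x` of array `a`. -/
def put (σ : Mem) (a x y : ℕ) : Mem := Function.update σ a (Function.update (σ a) x y)

@[simp] theorem put_same (σ : Mem) (a x y : ℕ) : put σ a x y a = Function.update (σ a) x y := by
  simp [put]

@[simp] theorem put_ne (σ : Mem) {a b : ℕ} (h : b ≠ a) (x y : ℕ) : put σ a x y b = σ b := by
  simp [put, h]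

/-- Assignment to a scalar variable. -/
def Program.set (a : ℕ) (v : Expr) : Program := .store a 0 v

/-- The counting loop `for v = 0, …, b - 1 do P`. -/
def Program.forLoop (v : ℕ) (b : Expr) (P : Program) : Program :=
  .seq (.set v 0) (.loop ((Expr.var v).ltE b) (.seq P (.set v (Expr.var v + 1))))

/-- `P.writesIn lo hi` checks that all arrays to which `P` writes have a number in `[lo, hi)`. -/
def Program.writesIn (lo hi : ℕ) : Program → Bool
  | .skip => true
  | .store a _ _ => decide (lo ≤ a) && decide (a < hi)
  | .seq P Q => P.writesIn lo hi && Q.writesIn lo hi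
  | .ite _ P Q => P.writesIn lo hi && Q.writesIn lo hi
  | .loop _ P => P.writesIn lo hi

/-- `P.avoids v` checks that `P` does not write to array `v`. -/
def Program.avoids (v : ℕ) : Program → Bool
  | .skip => true
  | .store a _ _ => decide (a ≠ v)
  | .seq P Q => P.avoids v && Q.avoids v
  | .ite _ P Q => P.avoids v && Q.avoids v
  | .loop _ P => P.avoids v

theorem Exec.avoids {W : ℕ} {P : Program} {σ τ : Mem} {t v : ℕ} (h : Exec W P σ t τ) :
    P.avoids v = true → τ v = σ v := by
  induction h with
  | skip => intro _; rfl
  | store hi hv =>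
    intro hw
    simp only [Program.avoids, decide_eq_true_eq] at hw
    exact Function.update_of_ne (Ne.symm hw) _ _
  | seq _ _ ih₁ ih₂ =>
    intro hw
    simp only [Program.avoids, Bool.and_eq_true] at hw
    rw [ih₂ hw.2, ih₁ hw.1]
  | ite_true _ _ _ ih =>
    intro hw
    simp only [Program.avoids, Bool.and_eq_true] at hw
    exact ih hw.1
  | ite_false _ _ ih =>
    intro hw
    simp only [Program.avoids, Bool.and_eq_true] at hw
    exact ih hw.2
  | loop_done _ => intro _; rfl
  | loop_step _ _ _ _ ih₁ ih₂ =>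
    intro hw
    rw [ih₂ hw, ih₁ hw]

theorem Program.avoids_of_writesIn {lo hi v : ℕ} (hv : v < lo ∨ hi ≤ v) :
    ∀ {P : Program}, P.writesIn lo hi = true → P.avoids v = true
  | .skip, _ => rfl
  | .store a i x, h => by
      simp only [Program.writesIn, Bool.and_eq_true, decide_eq_true_eq] at h
      simp only [Program.avoids, decide_eq_true_eq]
      omega
  | .seq P Q, h => by
      simp only [Program.writesIn, Bool.and_eq_true] at h
      simp [Program.avoids, avoids_of_writesIn hv h.1, avoids_of_writesIn hv h.2]
  | .ite b P Q, h => by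
      simp only [Program.writesIn, Bool.and_eq_true] at h
      simp [Program.avoids, avoids_of_writesIn hv h.1, avoids_of_writesIn hv h.2]
  | .loop b P, h => by
      simp only [Program.writesIn] at h
      simp [Program.avoids, avoids_of_writesIn hv h]

theorem Program.writesIn_mono {lo hi lo' hi' : ℕ} (h₁ : lo' ≤ lo) (h₂ : hi ≤ hi') :
    ∀ {P : Program}, P.writesIn lo hi = true → P.writesIn lo' hi' = true
  | .skip, _ => rfl
  | .store a i x, h => by
      simp only [Program.writesIn, Bool.and_eq_true, decide_eq_true_eq] at h ⊢
      omega
  | .seq P Q, h => by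
      simp only [Program.writesIn, Bool.and_eq_true] at h
      simp [Program.writesIn, writesIn_mono h₁ h₂ h.1, writesIn_mono h₁ h₂ h.2]
  | .ite b P Q, h => by
      simp only [Program.writesIn, Bool.and_eq_true] at h
      simp [Program.writesIn, writesIn_mono h₁ h₂ h.1, writesIn_mono h₁ h₂ h.2]
  | .loop b P, h => by
      simp only [Program.writesIn] at h
      simp [Program.writesIn, writesIn_mono h₁ h₂ h]

/-- `Runs W P σ T Q`: started in `σ`, program `P` halts after at most `T` units of time in a
memory that satisfies `Q`. -/
def Runs (W : ℕ) (P : Program) (σ : Mem) (T : ℕ) (Q : Mem → Prop) : Prop :=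
  ∃ t τ, Exec W P σ t τ ∧ t ≤ T ∧ Q τ

namespace Runs

variable {W : ℕ} {P P' : Program} {σ : Mem} {T T' : ℕ} {Q R : Mem → Prop}

theorem le (h : Runs W P σ T Q) (hT : T ≤ T') : Runs W P σ T' Q := by
  obtain ⟨t, τ, h, ht, hQ⟩ := h
  exact ⟨t, τ, h, ht.trans hT, hQ⟩

theorem mono (h : Runs W P σ T Q) (hQR : ∀ τ, Q τ → R τ) : Runs W P σ T R := by
  obtain ⟨t, τ, h, ht, hQ⟩ := h
  exact ⟨t, τ, h, ht, hQR τ hQ⟩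

/-- Arrays to which a program does not write are unchanged. -/
theorem frame (lo hi : ℕ) (hw : P.writesIn lo hi = true) (h : Runs W P σ T Q) :
    Runs W P σ T (fun τ => Q τ ∧ ∀ a, a < lo ∨ hi ≤ a → τ a = σ a) := by
  obtain ⟨t, τ, h, ht, hQ⟩ := h
  exact ⟨t, τ, h, ht, hQ, fun a ha => h.avoids (Program.avoids_of_writesIn ha hw)⟩

theorem skip (hQ : Q σ) : Runs W .skip σ 1 Q := ⟨1, σ, .skip, le_rfl, hQ⟩

theorem store {a : ℕ} {i v : Expr} (hW : 1 < W) (hi : i.Safe W σ) (hv : v.Safe W σ)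
    (hQ : Q (put σ a (i.val σ) (v.val σ))) :
    Runs W (.store a i v) σ (i.cost + v.cost + 1) Q :=
  ⟨_, _, .store (Expr.eval_of_safe hW hi) (Expr.eval_of_safe hW hv), le_rfl, hQ⟩

theorem set {a : ℕ} {v : Expr} (hW : 1 < W) (hv : v.Safe W σ)
    (hQ : Q (put σ a 0 (v.val σ))) : Runs W (.set a v) σ (v.cost + 2) Q :=
  (store hW (by simp; omega) hv hQ).le (by simp; omega)

theorem seq (h : Runs W P σ T Q) (h' : ∀ τ, Q τ → Runs W P' τ T' R) :
    Runs W (.seq P P') σ (T + T') R := by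
  obtain ⟨t, τ, h, ht, hQ⟩ := h
  obtain ⟨t', τ', h', ht', hR⟩ := h' τ hQ
  exact ⟨_, τ', .seq h h', by omega, hR⟩

/-- Assignment followed by further commands. -/
theorem set_seq {a : ℕ} {v : Expr} (hW : 1 < W) (hv : v.Safe W σ)
    (h : Runs W P (put σ a 0 (v.val σ)) T Q) :
    Runs W (.seq (.set a v) P) σ (v.cost + 2 + T) Q :=
  seq (Q := fun τ => τ = put σ a 0 (v.val σ)) (set hW hv rfl) (by rintro _ rfl; exact h)

theorem set_seq_val {a : ℕ} {v : Expr} {n : ℕ} (hW : 1 < W) (hv : v.Safe W σ) (hn : v.val σ = n)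
    (h : Runs W P (put σ a 0 n) T Q) :
    Runs W (.seq (.set a v) P) σ (v.cost + 2 + T) Q := by
  subst hn; exact set_seq hW hv h

/-- Writing to an array followed by further commands. -/
theorem store_seq {a : ℕ} {i v : Expr} (hW : 1 < W) (hi : i.Safe W σ) (hv : v.Safe W σ)
    (h : Runs W P (put σ a (i.val σ) (v.val σ)) T Q) :
    Runs W (.seq (.store a i v) P) σ (i.cost + v.cost + 1 + T) Q :=
  seq (Q := fun τ => τ = put σ a (i.val σ) (v.val σ)) (store hW hi hv rfl)
    (by rintro _ rfl; exact h)

theorem ite {b : Expr} (hW : 1 < W) (hb : b.Safe W σ) (h : b.val σ ≠ 0 → Runs W P σ T Q)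
    (h' : b.val σ = 0 → Runs W P' σ T' Q) : Runs W (.ite b P P') σ (b.cost + 1 + (T + T')) Q := by
  by_cases h0 : b.val σ = 0
  · obtain ⟨t, τ, h, ht, hQ⟩ := h' h0
    exact ⟨_, τ, .ite_false (by rw [Expr.eval_of_safe hW hb, h0]) h, by omega, hQ⟩
  · obtain ⟨t, τ, h, ht, hQ⟩ := h h0
    exact ⟨_, τ, .ite_true (Expr.eval_of_safe hW hb) h0 h, by omega, hQ⟩

/-- A loop whose invariant `I n` says that at most `n` further rounds are possible. -/
theorem loop {b : Expr} (hW : 1 < W) (I : ℕ → Mem → Prop)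
    (hb : ∀ n τ, I n τ → b.Safe W τ)
    (hstep : ∀ n τ, I n τ → b.val τ ≠ 0 →
      0 < n ∧ Runs W P τ T (fun τ' => ∃ n' < n, I n' τ'))
    (hQ : ∀ n τ, I n τ → b.val τ = 0 → Q τ) :
    ∀ n σ, I n σ → Runs W (.loop b P) σ (n * (b.cost + 1 + T) + (b.cost + 1)) Q := by
  intro n
  induction n using Nat.strong_induction_on with
  | _ n ih =>
    intro σ hI
    by_cases h0 : b.val σ = 0
    · exact ⟨_, σ, .loop_done (by rw [Expr.eval_of_safe hW (hb _ _ hI), h0]), by omega,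
        hQ _ _ hI h0⟩
    · obtain ⟨hn, t, τ, h, ht, n', hn', hI'⟩ := hstep _ _ hI h0
      obtain ⟨t', τ', h', ht', hQ'⟩ := ih n' hn' τ hI'
      refine ⟨_, τ', .loop_step (Expr.eval_of_safe hW (hb _ _ hI)) h0 h h', ?_, hQ'⟩
      have : (n' + 1) * (b.cost + 1 + T) ≤ n * (b.cost + 1 + T) := Nat.mul_le_mul_right _ hn'
      rw [add_mul, one_mul] at this
      omega

/-- The rule for counting loops with invariant `I`. The invariant need not mention the counter,
nor the arrays to which the body does not write. -/
theorem forLoop {v : ℕ} {b : Expr} {n : ℕ} (lo hi : ℕ) (I : ℕ → Mem → Prop) (hW : 1 < W)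
    (hn : n < W) (hwr : P.writesIn lo hi = true) (hv : P.avoids v = true)
    (h0 : I 0 (put σ v 0 0))
    (hb : ∀ i τ, i ≤ n → (∀ a, a ≠ v → a < lo ∨ hi ≤ a → τ a = σ a) → τ v 0 = i → I i τ →
      b.Safe W τ ∧ b.val τ = n)
    (hstep : ∀ i τ, i < n → (∀ a, a ≠ v → a < lo ∨ hi ≤ a → τ a = σ a) → τ v 0 = i → I i τ →
      Runs W P τ T (fun τ' => I (i + 1) (put τ' v 0 (i + 1))))
    (hQ : ∀ τ, (∀ a, a ≠ v → a < lo ∨ hi ≤ a → τ a = σ a) → τ v 0 = n → I n τ → Q τ) :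
    Runs W (.forLoop v b P) σ (n * (b.cost + T + 10) + (b.cost + 9)) Q := by
  have hloop := loop (W := W) (P := .seq P (.set v (Expr.var v + 1)))
    (b := (Expr.var v).ltE b) (T := T + 6) (Q := Q) hW
    (fun j τ => ∃ i, i + j = n ∧ (∀ a, a ≠ v → a < lo ∨ hi ≤ a → τ a = σ a) ∧ τ v 0 = i ∧ I i τ)
    (by
      rintro j τ ⟨i, hij, hfr, hvi, hI⟩
      exact ⟨by simp; omega, (hb i τ (by omega) hfr hvi hI).1⟩)
    (by
      rintro j τ ⟨i, hij, hfr, hvi, hI⟩ hlt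
      have hin : i < n := by
        by_contra hc
        apply hlt
        simp [hvi, (hb i τ (by omega) hfr hvi hI).2]
        omega
      refine ⟨by omega, ?_⟩
      obtain ⟨t, τ', h, ht, hI'⟩ := hstep i τ hin hfr hvi hI
      have hvi' : τ' v 0 = i := by rw [h.avoids hv, hvi]
      refine seq (Q := fun ρ => ρ = τ') (T := T) (T' := 6) ⟨t, τ', h, ht, rfl⟩ ?_
      rintro _ rfl
      refine (set hW (by simp; omega) ?_).le (by simp)
      refine ⟨j - 1, by omega, i + 1, by omega, fun a hav ha => ?_, ?_, ?_⟩
      · rw [put_ne _ hav, h.avoids (Program.avoids_of_writesIn ha hwr), hfr a hav ha]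
      · simp [hvi']
      · simpa [hvi'] using hI')
    (by
      rintro j τ ⟨i, hij, hfr, hvi, hI⟩ hlt
      have hin : i = n := by
        by_contra hc
        have hlt' : (if τ v 0 < b.val τ then 1 else 0) = 0 := hlt
        rw [hvi, (hb i τ (by omega) hfr hvi hI).2, if_pos (by omega)] at hlt'
        exact one_ne_zero hlt'
      subst hin
      exact hQ τ hfr hvi hI)
  have h1 := set_seq (σ := σ) (a := v) (v := 0) hW (by simp; omega)
    (hloop n (put σ v 0 0) ⟨0, by omega, fun a hav _ => put_ne _ hav _ _, by simp, h0⟩)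
  refine h1.le ?_
  have h2 : (Expr.ltE (Expr.var v) b).cost + 1 + (T + 6) = b.cost + T + 10 := by
    simp only [Expr.cost_ltE, Expr.cost_var]; omega
  rw [h2]
  simp only [Expr.cost_ltE, Expr.cost_var, Expr.cost_zero]
  omega

end Runs

end WordRAM

/-! ### Field elements as single words -/

namespace LinCode

open Finset

section digits

variable {p : ℕ}

theorem sum_digits_lt (hp : 0 < p) (f : ℕ → ℕ) (n : ℕ) :
    ∑ s ∈ range n, (f s % p) * p ^ s < p ^ n := by
  induction n with
  | zero => simp
  | succ n ih =>
    rw [sum_range_succ, pow_succ]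
    have h1 : f n % p + 1 ≤ p := Nat.mod_lt _ hp
    have h2 := Nat.mul_le_mul_right (p ^ n) h1
    rw [add_mul, one_mul] at h2
    rw [mul_comm (p ^ n) p]
    omega

theorem sum_digits_digit (hp : 0 < p) (f : ℕ → ℕ) {n t : ℕ} (ht : t < n) :
    (∑ s ∈ range n, (f s % p) * p ^ s) / p ^ t % p = f t % p := by
  induction n with
  | zero => omega
  | succ n ih =>
    rw [sum_range_succ]
    rcases Nat.lt_succ_iff_lt_or_eq.mp ht with h | rfl
    · obtain ⟨d, rfl⟩ := Nat.exists_eq_add_of_lt h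
      have h1 : f (t + d + 1) % p * p ^ (t + d + 1) =
          p ^ t * (p * (f (t + d + 1) % p * p ^ d)) := by
        ring
      rw [h1, Nat.add_mul_div_left _ _ (pow_pos hp t), Nat.add_mul_mod_self_left, ih h]
    · rw [Nat.add_mul_div_right _ _ (pow_pos hp t), Nat.div_eq_of_lt (sum_digits_lt hp f t),
        zero_add, Nat.mod_mod]

theorem sum_digits_self (hp : 0 < p) {c n : ℕ} (hc : c < p ^ n) :
    ∑ s ∈ range n, (c / p ^ s % p) * p ^ s = c := by
  induction n generalizing c with
  | zero => simp at hc ⊢; omega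
  | succ n ih =>
    rw [sum_range_succ]
    have h1 : c / p ^ n < p := by
      rw [Nat.div_lt_iff_lt_mul (pow_pos hp n)]; rwa [pow_succ, mul_comm] at hc
    have h2 : ∀ s ∈ range n, c / p ^ s % p * p ^ s = (c % p ^ n) / p ^ s % p * p ^ s := by
      intro s hs
      congr 1
      obtain ⟨d, rfl⟩ := Nat.exists_eq_add_of_lt (mem_range.mp hs)
      have : c = c % p ^ (s + d + 1) + p ^ s * (p * (p ^ d * (c / p ^ (s + d + 1)))) := by
        conv_lhs => rw [← Nat.mod_add_div c (p ^ (s + d + 1))]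
        ring
      conv_lhs => rw [this]
      rw [Nat.add_mul_div_left _ _ (pow_pos hp s), Nat.add_mul_mod_self_left]
    rw [sum_congr rfl h2, ih (Nat.mod_lt _ (pow_pos hp n)), Nat.mod_eq_of_lt h1, mul_comm,
      Nat.mod_add_div]

end digits

variable {p : ℕ} [Fact p.Prime] {F : Type*} [Field F] [Algebra (ZMod p) F]
  (pb : PowerBasis (ZMod p) F)

/-- The field element whose coordinates are the base-`p` digits of `c`. -/
noncomputable def dec (c : ℕ) : F := ∑ t ∈ range pb.dim, ((c / p ^ t % p : ℕ) : F) * pb.gen ^ t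

/-- The code of a field element: the number below `p ^ e` whose base-`p` digits are its
coordinates. -/
noncomputable def enc (x : F) : ℕ :=
  ∑ t ∈ range pb.dim, (if h : t < pb.dim then (pb.basis.repr x ⟨t, h⟩).val else 0) % p * p ^ t

theorem prime_pos : 0 < p := (Fact.out : p.Prime).pos

theorem cast_eq_algebraMap {p : ℕ} {F : Type*} [Field F] [Algebra (ZMod p) F] (n : ℕ) :
    (n : F) = algebraMap (ZMod p) F n := by simp

theorem cast_mod {p : ℕ} {F : Type*} [Field F] [Algebra (ZMod p) F] (n : ℕ) :
    ((n % p : ℕ) : F) = (n : F) := by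
  rw [cast_eq_algebraMap (p := p), cast_eq_algebraMap (p := p) n, ZMod.natCast_mod]

theorem dec_sum_digits (f : ℕ → ℕ) :
    dec pb (∑ s ∈ range pb.dim, (f s % p) * p ^ s) =
      ∑ s ∈ range pb.dim, (f s : F) * pb.gen ^ s := by
  refine sum_congr rfl fun t ht => ?_
  rw [sum_digits_digit prime_pos f (mem_range.mp ht), cast_mod (p := p)]

theorem enc_lt (x : F) : enc pb x < p ^ pb.dim := sum_digits_lt prime_pos _ _

theorem enc_digit (x : F) (t : Fin pb.dim) :
    enc pb x / p ^ (t : ℕ) % p = (pb.basis.repr x t).val := by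
  rw [enc, sum_digits_digit prime_pos _ t.2]
  simp [Nat.mod_eq_of_lt (ZMod.val_lt _)]

theorem dec_enc (x : F) : dec pb (enc pb x) = x := by
  conv_rhs => rw [← pb.basis.sum_repr x]
  rw [dec, ← Fin.sum_univ_eq_sum_range
    (fun t => ((enc pb x / p ^ t % p : ℕ) : F) * pb.gen ^ t) pb.dim]
  refine sum_congr rfl fun t _ => ?_
  rw [enc_digit, pb.coe_basis, Algebra.smul_def, cast_eq_algebraMap (p := p), ZMod.natCast_val,
    ZMod.cast_id', id]

theorem repr_dec {c : ℕ} (t : Fin pb.dim) :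
    pb.basis.repr (dec pb c) t = ((c / p ^ (t : ℕ) % p : ℕ) : ZMod p) := by
  have : dec pb c = ∑ t : Fin pb.dim, ((c / p ^ (t : ℕ) % p : ℕ) : ZMod p) • pb.basis t := by
    rw [dec, ← Fin.sum_univ_eq_sum_range
      (fun t => ((c / p ^ t % p : ℕ) : F) * pb.gen ^ t) pb.dim]
    refine sum_congr rfl fun t _ => ?_
    rw [pb.coe_basis, Algebra.smul_def, cast_eq_algebraMap (p := p)]
  rw [this, pb.basis.repr_sum_self]

theorem enc_dec {c : ℕ} (hc : c < p ^ pb.dim) : enc pb (dec pb c) = c := by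
  conv_rhs => rw [← sum_digits_self prime_pos hc]
  refine sum_congr rfl fun t ht => ?_
  rw [dif_pos (mem_range.mp ht), repr_dec, ZMod.val_natCast, Nat.mod_mod, Nat.mod_mod]

theorem dec_zero : dec pb 0 = 0 := by simp [dec]

theorem dec_eq_zero_iff {c : ℕ} (hc : c < p ^ pb.dim) : dec pb c = 0 ↔ c = 0 := by
  constructor
  · intro h
    rw [← enc_dec pb hc, h, ← dec_zero pb, enc_dec pb (pow_pos prime_pos _)]
  · rintro rfl; exact dec_zero pb

theorem dec_one : dec pb 1 = 1 := by
  obtain ⟨n, hn⟩ := Nat.exists_eq_succ_of_ne_zero pb.dim_pos.ne'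
  rw [dec, hn, sum_range_succ', sum_eq_zero]
  · simp [Nat.mod_eq_of_lt (Fact.out : p.Prime).one_lt]
  · intro t _
    rw [Nat.div_eq_of_lt (Nat.one_lt_pow (by omega) (Fact.out : p.Prime).one_lt)]
    simp

theorem dec_pred : dec pb (p - 1) = -1 := by
  have hp := (Fact.out : p.Prime).one_lt
  obtain ⟨n, hn⟩ := Nat.exists_eq_succ_of_ne_zero pb.dim_pos.ne'
  rw [dec, hn, sum_range_succ', sum_eq_zero]
  · have : ((p : ℕ) : F) = 0 := by rw [cast_eq_algebraMap (p := p)]; simp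
    simp only [pow_zero, Nat.div_one, cast_mod (p := p), mul_one, zero_add]
    rw [Nat.cast_sub hp.le, this]; simp
  · intro t _
    rw [Nat.div_eq_of_lt]
    · simp
    · calc p - 1 < p ^ 1 := by simp; omega
        _ ≤ p ^ (t + 1) := Nat.pow_le_pow_right (by omega) (by omega)

theorem gen_pow_dim : pb.gen ^ pb.dim =
    ∑ s ∈ range pb.dim, ((p - ((minpoly (ZMod p) pb.gen).coeff s).val : ℕ) : F) * pb.gen ^ s := by
  have h := minpoly.aeval (ZMod p) pb.gen
  rw [Polynomial.aeval_eq_sum_range, pb.natDegree_minpoly, sum_range_succ] at h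
  have hm : (minpoly (ZMod p) pb.gen).coeff pb.dim = 1 := by
    have := minpoly.monic pb.isIntegral_gen
    rw [Polynomial.Monic, Polynomial.leadingCoeff, pb.natDegree_minpoly] at this
    exact this
  rw [hm, one_smul, add_comm] at h
  rw [eq_neg_of_add_eq_zero_left h, ← sum_neg_distrib]
  refine sum_congr rfl fun s _ => ?_
  have : ((p : ℕ) : F) = 0 := by rw [cast_eq_algebraMap (p := p)]; simp
  rw [Nat.cast_sub (ZMod.val_lt _).le, this, zero_sub, neg_mul, Algebra.smul_def,
    cast_eq_algebraMap (p := p), ZMod.natCast_val, ZMod.cast_id', id]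

/-- Multiplication by the generator: the digits are shifted, and the top digit is reduced with the
minimal polynomial. -/
theorem gen_mul_dec {c : ℕ} (hc : c < p ^ pb.dim) :
    ∑ s ∈ range pb.dim, (((c * p / p ^ s) % p + c / p ^ (pb.dim - 1) *
      (p - ((minpoly (ZMod p) pb.gen).coeff s).val) : ℕ) : F) * pb.gen ^ s =
    pb.gen * dec pb c := by
  have h1 : c / p ^ (pb.dim - 1) = c / p ^ (pb.dim - 1) % p := by
    rw [Nat.mod_eq_of_lt]
    rw [Nat.div_lt_iff_lt_mul (pow_pos prime_pos _)]
    rwa [← pow_succ', Nat.sub_add_cancel pb.dim_pos]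
  simp only [Nat.cast_add, add_mul, sum_add_distrib]
  simp only [Nat.cast_mul, mul_assoc, ← mul_sum]
  rw [← gen_pow_dim]
  obtain ⟨n, hn⟩ := Nat.exists_eq_succ_of_ne_zero pb.dim_pos.ne'
  rw [hn] at h1
  rw [dec, hn, sum_range_succ', sum_range_succ, mul_add, mul_sum]
  simp only [Nat.succ_eq_add_one, Nat.add_sub_cancel] at h1 ⊢
  rw [← h1]
  congr 1
  · simp only [pow_zero, Nat.div_one, Nat.mul_mod_left, Nat.cast_zero, zero_mul, add_zero]
    refine sum_congr rfl fun s _ => ?_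
    rw [pow_succ p s, Nat.mul_div_mul_right _ _ prime_pos]
    ring
  · ring

end LinCode

namespace ListDec

open WordRAM LinCode Finset Matrix
open WordRAM.Expr (var)

/-! ### Field arithmetic on the word RAM -/

section

infixr:60 " ;; " => Program.seq

-- The arrays of the program have names that begin with `v` for scalar variables, of which only cell
-- `0` is used, and with `a` otherwise. They are notation for numerals, so that `decide` and `omega`
-- can check which of them lie in the range to which a piece of the program writes. Operands `vX`,
-- `vY`, `vZ` and result `vR` of the field operation, its working variables, and the table `aPow` of
-- the powers of `p`.
notation "vX" => (10 : ℕ)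
notation "vY" => (11 : ℕ)
notation "vZ" => (12 : ℕ)
notation "vR" => (13 : ℕ)
notation "vAcc" => (14 : ℕ)
notation "vNew" => (15 : ℕ)
notation "vT" => (16 : ℕ)
notation "vS" => (17 : ℕ)
notation "vDig" => (18 : ℕ)
notation "vTop" => (19 : ℕ)
notation "aPow" => (105 : ℕ)

/-- The characteristic `p`, as an expression. -/
def eP : Expr := .read 0 0

/-- The degree `e`, as an expression. -/
def eE : Expr := .read 0 1

/-- The `s`-th base-`p` digit of the value of `x`. -/
def eDigit (x s : Expr) : Expr := x / .read aPow s % eP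

@[simp] theorem eP_val (σ : Mem) : eP.val σ = σ 0 0 := rfl
@[simp] theorem eP_safe (W : ℕ) (σ : Mem) : eP.Safe W σ ↔ 0 < W := Iff.rfl
@[simp] theorem eP_cost : eP.cost = 2 := rfl
@[simp] theorem eE_val (σ : Mem) : eE.val σ = σ 0 1 := rfl
@[simp] theorem eE_safe (W : ℕ) (σ : Mem) : eE.Safe W σ ↔ 1 < W := Iff.rfl
@[simp] theorem eE_cost : eE.cost = 2 := rfl

@[simp] theorem eDigit_val (σ : Mem) (x s : Expr) :
    (eDigit x s).val σ = x.val σ / σ aPow (s.val σ) % σ 0 0 := rfl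

@[simp] theorem eDigit_safe (W : ℕ) (σ : Mem) (x s : Expr) :
    (eDigit x s).Safe W σ ↔ x.Safe W σ ∧ s.Safe W σ ∧ x.val σ < W ∧ 0 < W := by
  simp only [eDigit, Expr.safe_mod, eP_safe, Expr.safe_div, Expr.safe_read, Expr.safe_zero,
    Expr.val_div, Expr.val_read]
  refine ⟨fun h => ⟨h.1.1, h.1.2.1, h.1.2.2, h.2.1⟩, fun h =>
    ⟨⟨h.1, h.2.1, h.2.2.1⟩, h.2.2.2, (Nat.div_le_self _ _).trans_lt h.2.2.1⟩⟩

@[simp] theorem eDigit_cost (x s : Expr) : (eDigit x s).cost = x.cost + s.cost + 5 := by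
  have : (eDigit x s).cost = x.cost + (s.cost + 1) + 1 + 2 + 1 := rfl
  omega

/-- Fused multiplication and addition of field elements: `vR := vZ + vX * vY`. The product is
computed by Horner's scheme in the generator. -/
def fma : Program :=
  .set vAcc 0 ;;
  .forLoop vT eE
    (.set vDig (eDigit (var vY) (eE - 1 - var vT)) ;;
     .set vTop (var vAcc / .read aPow (eE - 1)) ;;
     .set vNew 0 ;;
     .forLoop vS eE
      (.set vNew (var vNew + (eDigit (var vAcc * eP) (var vS) + var vTop * (eP - .read 1 (var vS))
        + var vDig * eDigit (var vX) (var vS)) % eP * .read aPow (var vS))) ;;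
     .set vAcc (var vNew)) ;;
  .set vR 0 ;;
  .forLoop vS eE
    (.set vR (var vR + (eDigit (var vAcc) (var vS) + eDigit (var vZ) (var vS)) % eP *
      .read aPow (var vS)))

variable {p : ℕ} [Fact p.Prime] {F : Type*} [Field F] [Algebra (ZMod p) F]
  (pb : PowerBasis (ZMod p) F)

/-- The memory holds the presentation of the field, with a table of the powers of `p`. -/
structure ArithEnv (σ : Mem) : Prop where
  char_eq : σ 0 0 = p
  deg_eq : σ 0 1 = pb.dim
  modulus : ∀ s < pb.dim, σ 1 s = ((minpoly (ZMod p) pb.gen).coeff s).val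
  pow : ∀ t ≤ pb.dim, σ aPow t = p ^ t

theorem ArithEnv.congr {pb : PowerBasis (ZMod p) F} {σ τ : Mem} (h : ArithEnv pb σ)
    (h0 : τ 0 = σ 0) (h1 : τ 1 = σ 1) (h2 : τ aPow = σ aPow) : ArithEnv pb τ where
  char_eq := by rw [h0, h.char_eq]
  deg_eq := by rw [h0, h.deg_eq]
  modulus := by rw [h1]; exact h.modulus
  pow := by rw [h2]; exact h.pow

/-- A bound for the running time of `fma`. -/
def tFma (e : ℕ) : ℕ := e * (e * 100 + 100) + e * 100 + 100

/-- Correctness of the field operation. All intermediate results are less than `4 q ^ 2`, where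
`q = p ^ e`. -/
theorem fma_spec {W : ℕ} (hW : 4 * (p ^ pb.dim) ^ 2 ≤ W) {σ : Mem} (env : ArithEnv pb σ)
    (hx : σ vX 0 < p ^ pb.dim) (hy : σ vY 0 < p ^ pb.dim) (hz : σ vZ 0 < p ^ pb.dim) :
    Runs W fma σ (tFma pb.dim) (fun τ =>
      (τ vR 0 < p ^ pb.dim ∧ dec pb (τ vR 0) = dec pb (σ vZ 0) + dec pb (σ vX 0) * dec pb (σ vY 0))
      ∧ ∀ a, a < 13 ∨ 20 ≤ a → τ a = σ a) := by
  refine Runs.frame 13 20 (by decide) ?_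
  have hp1 : 1 < p := (Fact.out : p.Prime).one_lt
  have he := pb.dim_pos
  obtain ⟨h00, h01, hM, hP⟩ := env
  set q := p ^ pb.dim with hq
  have hpq : p ≤ q := by
    calc p = p ^ 1 := (pow_one p).symm
      _ ≤ q := Nat.pow_le_pow_right (by omega) he
  have heq : pb.dim < q := Nat.lt_pow_self hp1
  have hqW : 4 * q ≤ W := by nlinarith
  have hppW : 4 * (p * p) ≤ W := by nlinarith
  have hqpW : 4 * (q * p) ≤ W := by nlinarith
  have hW1 : 1 < W := by omega
  have hpow : ∀ {t}, t ≤ pb.dim → p ^ t ≤ q := fun h => Nat.pow_le_pow_right (by omega) h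
  have hdW : ∀ {a t : ℕ}, t < pb.dim → a % p * p ^ t < W := by
    intro a t ht
    have h1 : a % p * p ^ t ≤ p * p ^ t :=
      Nat.mul_le_mul_right _ (Nat.mod_lt _ (by omega)).le
    rw [← pow_succ'] at h1
    have := hpow (show t + 1 ≤ pb.dim from ht)
    omega
  have hM' : ∀ s, p - σ 1 s ≤ p := fun s => Nat.sub_le _ _
  apply Runs.le
  · apply Runs.set_seq hW1 (by simp; omega)
    apply Runs.seq (Q := fun τ => (∀ a, a < 13 ∨ 20 ≤ a → τ a = σ a) ∧ τ vAcc 0 < q ∧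
      dec pb (τ vAcc 0) = dec pb (σ vX 0) * dec pb (σ vY 0))
    -- After `i` rounds the accumulator holds the product of `vX` with the number that is formed by
    -- the top `i` digits of `vY`.
    · apply Runs.forLoop 13 20 (n := pb.dim) (fun i τ => τ vAcc 0 < q ∧
          dec pb (τ vAcc 0) * pb.gen ^ (pb.dim - i) + (∑ s ∈ range (pb.dim - i),
            ((σ vY 0 / p ^ s % p : ℕ) : F) * pb.gen ^ s) * dec pb (σ vX 0) =
            dec pb (σ vX 0) * dec pb (σ vY 0)) hW1 (by omega) (by decide) (by decide)
      · refine ⟨by simp; omega, ?_⟩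
        simp [dec_zero]
        rw [← dec, mul_comm]
      · intro i τ hi hfr hv hI
        simp [hfr 0, h01]; omega
      · rintro i τ hi hfr hv ⟨hacc, hI⟩
        have hfr' : ∀ a, a < 13 ∨ 20 ≤ a → τ a = σ a := by
          intro a ha
          rw [hfr a (by omega) ha, put_ne _ (by omega)]
        have f0 := hfr' 0 (by omega)
        have f1 := hfr' 1 (by omega)
        have f10 := hfr' 10 (by omega)
        have f11 := hfr' 11 (by omega)
        have f105 := hfr' 105 (by omega)
        have htop : τ vAcc 0 / p ^ (pb.dim - 1) < p := by
          rw [Nat.div_lt_iff_lt_mul (pow_pos (by omega) _), ← pow_succ',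
            Nat.sub_add_cancel he]
          exact hacc
        set d := σ vY 0 / p ^ (pb.dim - 1 - i) % p with hd
        have hdp : d < p := Nat.mod_lt _ (by omega)
        have htopp : τ vAcc 0 / p ^ (pb.dim - 1) * p < p * p :=
          Nat.mul_lt_mul_of_pos_right htop (by omega)
        have hdpp : d * p < p * p := Nat.mul_lt_mul_of_pos_right hdp (by omega)
        have happ : τ vAcc 0 * p < q * p := Nat.mul_lt_mul_of_pos_right hacc (by omega)
        apply Runs.set_seq_val (n := d) hW1 (by simp [f0, f11, h01]; omega) (by
          simp [f0, f11, f105, h00, h01, hv,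
            hP _ (show pb.dim - 1 - i ≤ pb.dim by omega), hd])
        apply Runs.set_seq_val (n := τ vAcc 0 / p ^ (pb.dim - 1)) hW1
          (by simp [f0, h01]; omega)
          (by simp [f0, h01, f105, hP _ (show pb.dim - 1 ≤ pb.dim by omega)])
        apply Runs.set_seq hW1 (by simp; omega)
        -- The digits of the next accumulator before reduction modulo `p`: the shifted accumulator,
        -- the top digit that has been shifted out, reduced with the modulus, and a multiple of
        -- `vX`.
        set f : ℕ → ℕ := fun s => (τ vAcc 0 * p / p ^ s) % p + τ vAcc 0 / p ^ (pb.dim - 1) *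
          (p - ((minpoly (ZMod p) pb.gen).coeff s).val) + d * (σ vX 0 / p ^ s % p) with hf
        apply Runs.seq (Q := fun ρ => ρ vNew 0 = ∑ s ∈ range pb.dim, f s % p * p ^ s)
        · apply Runs.forLoop 15 16 (n := pb.dim)
            (fun j ρ => ρ vNew 0 = ∑ s ∈ range j, f s % p * p ^ s)
            hW1 (by omega) (by decide) (by decide)
          · simp
          · intro j ρ hj hfr2 hw hI2
            simp [hfr2 0, f0, h01]; omega
          · intro j ρ hj hfr2 hw hI2
            have hnew : ρ vNew 0 + f j % p * p ^ j < q := by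
              rw [hI2, ← sum_range_succ]
              exact (sum_digits_lt (by omega) f (j + 1)).trans_le (hpow hj)
            have g0 : ρ 0 = σ 0 := by rw [hfr2 0 (by omega) (by omega)]; simp [f0]
            have g1 : ρ 1 = σ 1 := by rw [hfr2 1 (by omega) (by omega)]; simp [f1]
            have g10 : ρ vX = σ vX := by rw [hfr2 10 (by omega) (by omega)]; simp [f10]
            have g14 : ρ vAcc = τ vAcc := by rw [hfr2 14 (by omega) (by omega)]; simp
            have g18 : ρ vDig 0 = d := by rw [hfr2 18 (by omega) (by omega)]; simp
            have g19 : ρ vTop 0 = τ vAcc 0 / p ^ (pb.dim - 1) := by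
              rw [hfr2 19 (by omega) (by omega)]; simp
            have g105 : ρ aPow j = p ^ j := by
              rw [hfr2 105 (by omega) (by omega)]; simp [f105, hP j hj.le]
            have hval : f j = (τ vAcc 0 * p / p ^ j) % p + τ vAcc 0 / p ^ (pb.dim - 1) *
                (p - σ 1 j) + d * (σ vX 0 / p ^ j % p) := by rw [hf, hM j hj]
            apply Runs.set hW1
            · simp only [eDigit_safe, eDigit_val, eP_val, eP_safe, Expr.safe_add,
                Expr.safe_mul, Expr.safe_mod, Expr.safe_div, Expr.safe_sub,
                Expr.safe_read, Expr.safe_var, Expr.safe_zero, Expr.val_var, Expr.val_read,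
                Expr.val_zero, Expr.val_add, Expr.val_mul, Expr.val_mod,
                Expr.val_div, Expr.val_sub, g0, g1, g10, g14, g18, g19, hw, g105, h00, ← hval]
              have e1 : τ vAcc 0 / p ^ (pb.dim - 1) * (p - σ 1 j) ≤
                τ vAcc 0 / p ^ (pb.dim - 1) * p := Nat.mul_le_mul_left _ (hM' j)
              have e2 : d * (σ vX 0 / p ^ j % p) ≤ d * p :=
                Nat.mul_le_mul_left _ (Nat.mod_lt _ (by omega)).le
              have e3 : τ vAcc 0 * p / p ^ j % p < p := Nat.mod_lt _ (by omega)
              have e4 := hdW (a := f j) hj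
              refine ⟨?_, ⟨⟨?_, ?_, ?_⟩, ?_, ?_⟩, ?_⟩ <;> (try refine ⟨?_, ?_, ?_⟩) <;> omega
            · simp [g0, g1, g10, g14, g18, g19, hw, g105, h00, ← hval, hI2, sum_range_succ]
          · intro ρ hfr2 hw hI2
            exact hI2
        · intro ρ hρ
          apply Runs.set hW1 (by simp; omega)
          simp only [Expr.val_var, put_ne _ (show (14:ℕ) ≠ 16 by decide), put_same,
            Function.update_self, hρ]
          refine ⟨sum_digits_lt (by omega) _ _, ?_⟩
          rw [← hI, dec_sum_digits]
          have key : ∑ s ∈ range pb.dim, (f s : F) * pb.gen ^ s =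
              pb.gen * dec pb (τ vAcc 0) + (d : F) * dec pb (σ vX 0) := by
            rw [← gen_mul_dec pb hacc, dec, mul_sum, ← sum_add_distrib]
            refine sum_congr rfl fun s _ => ?_
            rw [hf]; push_cast; ring
          rw [key]
          have h1 : pb.dim - i = (pb.dim - (i + 1)) + 1 := by omega
          rw [h1, sum_range_succ, pow_succ, hd, show pb.dim - 1 - i = pb.dim - (i + 1) by omega]
          ring
      · rintro τ hfr hv ⟨h1, h2⟩
        refine ⟨fun a ha => ?_, h1, by simpa using h2⟩
        rw [hfr a (by omega) ha, put_ne _ (by omega)]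
    · rintro τ ⟨hfr, hacc, hI⟩
      apply Runs.set_seq hW1 (by simp; omega)
      have f0 := hfr 0 (by omega)
      have f12 := hfr 12 (by omega)
      have f105 := hfr 105 (by omega)
      set f : ℕ → ℕ := fun s => τ vAcc 0 / p ^ s % p + σ vZ 0 / p ^ s % p with hf
      apply Runs.forLoop 13 14 (n := pb.dim)
        (fun j ρ => ρ vR 0 = ∑ s ∈ range j, f s % p * p ^ s)
        hW1 (by omega) (by decide) (by decide)
      · simp
      · intro j ρ hj hfr2 hw hI2
        simp [hfr2 0, f0, h01]; omega
      · intro j ρ hj hfr2 hw hI2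
        have hnew : ρ vR 0 + f j % p * p ^ j < q := by
          rw [hI2, ← sum_range_succ]
          exact (sum_digits_lt (by omega) f (j + 1)).trans_le (hpow hj)
        have g0 : ρ 0 = σ 0 := by rw [hfr2 0 (by omega) (by omega)]; simp [f0]
        have g12 : ρ vZ = σ vZ := by rw [hfr2 12 (by omega) (by omega)]; simp [f12]
        have g14 : ρ vAcc = τ vAcc := by rw [hfr2 14 (by omega) (by omega)]; simp
        have g105 : ρ aPow j = p ^ j := by
          rw [hfr2 105 (by omega) (by omega)]; simp [f105, hP j hj.le]
        have hval : f j = τ vAcc 0 / p ^ j % p + σ vZ 0 / p ^ j % p := rfl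
        apply Runs.set hW1
        · simp only [eDigit_safe, eDigit_val, eP_val, eP_safe, Expr.safe_add,
            Expr.safe_mul, Expr.safe_mod, Expr.safe_div, Expr.safe_sub,
            Expr.safe_read, Expr.safe_var, Expr.safe_zero, Expr.val_var, Expr.val_read,
            Expr.val_zero, Expr.val_add, Expr.val_mul, Expr.val_mod,
            Expr.val_div, Expr.val_sub, g0, g12, g14, hw, g105, h00, ← hval]
          have e3 : τ vAcc 0 / p ^ j % p < p := Nat.mod_lt _ (by omega)
          have e5 : σ vZ 0 / p ^ j % p < p := Nat.mod_lt _ (by omega)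
          have e6 : τ vAcc 0 / p ^ j ≤ τ vAcc 0 := Nat.div_le_self _ _
          have e7 : σ vZ 0 / p ^ j ≤ σ vZ 0 := Nat.div_le_self _ _
          have e4 := hdW (a := f j) hj
          refine ⟨?_, ⟨⟨?_, ?_, ?_⟩, ?_, ?_⟩, ?_⟩ <;> (try refine ⟨?_, ?_, ?_⟩) <;> omega
        · simp [g0, g12, g14, hw, g105, h00, ← hval, hI2, sum_range_succ]
      · intro ρ hfr2 hw hI2
        refine ⟨?_, ?_⟩
        · rw [hI2]; exact sum_digits_lt (by omega) _ _
        · rw [hI2, dec_sum_digits, ← hI, dec, dec, ← sum_add_distrib]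
          refine sum_congr rfl fun s _ => ?_
          rw [hf]; push_cast; ring
  · simp only [eDigit_cost, eE_cost, eP_cost, Expr.cost_add, Expr.cost_mul, Expr.cost_mod,
      Expr.cost_div, Expr.cost_sub, Expr.cost_read, Expr.cost_var, Expr.cost_zero, Expr.cost_one,
      tFma]
    ring_nf
    nlinarith

end

/-! ### Subspaces of `F ^ K` and elimination without division -/

section

section cut

variable {F : Type*} [Field F] {K : ℕ}

/-- The hyperplane of all `x` with `∑ c, a c * x c = 0` (everything if `a = 0`). -/
def perp (a : Fin K → F) : Submodule F (Fin K → F) where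
  carrier := {x | a ⬝ᵥ x = 0}
  add_mem' := by
    intro x y hx hy
    simp only [Set.mem_ofPred_eq] at *
    rw [dotProduct_add, hx, hy, add_zero]
  zero_mem' := by simp
  smul_mem' := by
    intro c x hx
    simp only [Set.mem_ofPred_eq] at *
    rw [dotProduct_smul, hx, smul_zero]

theorem mem_perp {a x : Fin K → F} : x ∈ perp a ↔ a ⬝ᵥ x = 0 := Iff.rfl

/-- One elimination step: with `w j` as pivot, and the last vector moved to the place of the pivot,
the remaining vectors are made orthogonal to `a`. -/
theorem span_cut (a : Fin K → F) (w w' : ℕ → Fin K → F) {r j : ℕ} (hj : j < r)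
    (ha : a ⬝ᵥ w j ≠ 0)
    (hw' : ∀ l < r - 1, w' l = (a ⬝ᵥ w j) • (if l = j then w (r - 1) else w l) -
      (a ⬝ᵥ (if l = j then w (r - 1) else w l)) • w j) :
    Submodule.span F (w' '' Set.Iio (r - 1)) = Submodule.span F (w '' Set.Iio r) ⊓ perp a := by
  apply le_antisymm
  · rw [Submodule.span_le]
    rintro _ ⟨l, hl, rfl⟩
    have hl' : l < r - 1 := hl
    have hin : (if l = j then w (r - 1) else w l) ∈ Submodule.span F (w '' Set.Iio r) := by
      split_ifs
      · exact Submodule.subset_span ⟨r - 1, by simp; omega, rfl⟩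
      · exact Submodule.subset_span ⟨l, by simp; omega, rfl⟩
    rw [hw' l hl']
    refine ⟨Submodule.sub_mem _ (Submodule.smul_mem _ _ hin) (Submodule.smul_mem _ _
      (Submodule.subset_span ⟨j, hj, rfl⟩)), ?_⟩
    simp only [SetLike.mem_coe, mem_perp, dotProduct_sub, dotProduct_smul, smul_eq_mul]
    ring
  · rintro x ⟨hx, hxa⟩
    have key : ∀ y ∈ Submodule.span F (w '' Set.Iio r),
        (a ⬝ᵥ w j) • y - (a ⬝ᵥ y) • w j ∈ Submodule.span F (w' '' Set.Iio (r - 1)) := by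
      intro y hy
      induction hy using Submodule.span_induction with
      | mem y hy =>
        obtain ⟨l, hl, rfl⟩ := hy
        have hl : l < r := hl
        by_cases hlj : l = j
        · subst hlj; rw [sub_self]; exact Submodule.zero_mem _
        · by_cases hlr : l = r - 1
          · have h := hw' j (by omega)
            rw [if_pos rfl] at h
            rw [hlr, ← h]
            exact Submodule.subset_span ⟨j, by simp; omega, rfl⟩
          · have h := hw' l (by omega)
            rw [if_neg hlj] at h
            rw [← h]
            exact Submodule.subset_span ⟨l, by simp; omega, rfl⟩
      | zero => simp
      | add y z _ _ hy hz =>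
        have := Submodule.add_mem _ hy hz
        rw [dotProduct_add]
        convert this using 1
        module
      | smul c y _ hy =>
        have := Submodule.smul_mem _ c hy
        rw [dotProduct_smul]
        convert this using 1
        rw [smul_eq_mul]
        module
    have h := key x hx
    rw [mem_perp.mp hxa, zero_smul, sub_zero] at h
    exact (Submodule.smul_mem_iff _ ha).mp h

theorem finrank_inf_perp (L : Submodule F (Fin K → F)) {a v : Fin K → F} (hv : v ∈ L)
    (ha : a ⬝ᵥ v ≠ 0) :
    Module.finrank F (L ⊓ perp a : Submodule F (Fin K → F)) + 1 = Module.finrank F L := by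
  let φ : L →ₗ[F] F :=
    { toFun := fun x => a ⬝ᵥ (x : Fin K → F)
      map_add' := fun x y => by simp
      map_smul' := fun c x => by simp }
  have hsurj : Function.Surjective φ := by
    intro y
    refine ⟨(y * (a ⬝ᵥ v)⁻¹) • ⟨v, hv⟩, ?_⟩
    rw [map_smul]
    change (y * (a ⬝ᵥ v)⁻¹) • (a ⬝ᵥ v) = y
    rw [smul_eq_mul, mul_assoc, inv_mul_cancel₀ ha, mul_one]
  have h1 := φ.finrank_range_add_finrank_ker
  rw [LinearMap.range_eq_top.mpr hsurj, finrank_top, Module.finrank_self] at h1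
  have h2 : LinearMap.ker φ = (L ⊓ perp a).comap L.subtype := by
    ext x
    simp [φ, mem_perp]
  have h3 := (Submodule.comapSubtypeEquivOfLe (inf_le_left : L ⊓ perp a ≤ L)).finrank_eq
  rw [← h2] at h3
  omega

end cut

/-! ### Subspaces stored in memory -/

-- The heap: entries of the matrices of the objects, and their ranks.
notation "aHM" => (9 : ℕ)
notation "aHR" => (8 : ℕ)

variable {p : ℕ} [Fact p.Prime] {F : Type*} [Field F] [Algebra (ZMod p) F]
  (pb : PowerBasis (ZMod p) F) (K : ℕ)

/-- The vector whose codes are stored in array `A` from address `x` on. -/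
noncomputable def vec (A : ℕ → ℕ) (x : ℕ) : Fin K → F := fun c => dec pb (A (x + c))

/-- The subspace that is stored as object `o`: the matrix array `A` holds `K * K` entries for each
object, and the first `R o` rows of the matrix span the subspace. -/
noncomputable def sp (A R : ℕ → ℕ) (o : ℕ) : Submodule F (Fin K → F) :=
  Submodule.span F ((fun l => vec pb K A (o * (K * K) + l * K)) '' Set.Iio (R o))

/-- Object `o` is well-formed: the first `R o` rows of its matrix are a basis of the subspace
`sp A R o`, and the other rows are equations whose common kernel is this subspace. -/
structure WF (A R : ℕ → ℕ) (o : ℕ) : Prop where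
  rank_le : R o ≤ K
  finrank_eq : Module.finrank F (sp pb K A R o) = R o
  mem_iff : ∀ x, x ∈ sp pb K A R o ↔
    ∀ l, R o ≤ l → l < K → vec pb K A (o * (K * K) + l * K) ⬝ᵥ x = 0

variable {pb K}

theorem idx_lt {l c : ℕ} (hl : l < K) (hc : c < K) : l * K + c < K * K := by
  have := Nat.mul_le_mul_right K hl
  rw [Nat.succ_mul] at this
  omega

theorem vec_congr {A A' : ℕ → ℕ} {x x' : ℕ} (h : ∀ c < K, A' (x' + c) = A (x + c)) :
    vec pb K A' x' = vec pb K A x := by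
  funext c; simp only [vec]; rw [h c c.2]

theorem sp_congr {A R A' R' : ℕ → ℕ} {o o' : ℕ} (hRK : R o ≤ K)
    (hA : ∀ x < K * K, A' (o' * (K * K) + x) = A (o * (K * K) + x)) (hR : R' o' = R o) :
    sp pb K A' R' o' = sp pb K A R o := by
  rw [sp, sp, hR]
  congr 1
  refine Set.image_congr fun l hl => vec_congr fun c hc => ?_
  have hl : l < R o := hl
  rw [add_assoc, hA _ (idx_lt (by omega) hc), add_assoc]

theorem WF.congr {A R A' R' : ℕ → ℕ} {o o' : ℕ} (h : WF pb K A R o)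
    (hA : ∀ x < K * K, A' (o' * (K * K) + x) = A (o * (K * K) + x)) (hR : R' o' = R o) :
    WF pb K A' R' o' := by
  have hs := sp_congr (pb := pb) h.rank_le hA hR
  refine ⟨by rw [hR]; exact h.rank_le, by rw [hs, hR]; exact h.finrank_eq, fun x => ?_⟩
  rw [hs, h.mem_iff, hR]
  refine forall_congr' fun l => forall_congr' fun _ => forall_congr' fun hl => ?_
  have hv : vec pb K A' (o' * (K * K) + l * K) = vec pb K A (o * (K * K) + l * K) :=
    vec_congr fun c hc => by rw [add_assoc, hA _ (idx_lt hl hc), add_assoc]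
  rw [hv]

/-- The objects below `n` are the same in the heaps `A, R` and `A', R'`. -/
structure SameBelow (K n : ℕ) (A R A' R' : ℕ → ℕ) : Prop where
  mat : ∀ x < n * (K * K), A' x = A x
  rank : ∀ o < n, R' o = R o

theorem SameBelow.refl (n : ℕ) (A R : ℕ → ℕ) : SameBelow K n A R A R :=
  ⟨fun _ _ => rfl, fun _ _ => rfl⟩

theorem SameBelow.trans {n : ℕ} {A R A' R' A'' R'' : ℕ → ℕ} (h : SameBelow K n A R A' R')
    (h' : SameBelow K n A' R' A'' R'') : SameBelow K n A R A'' R'' :=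
  ⟨fun x hx => (h'.mat x hx).trans (h.mat x hx), fun o ho => (h'.rank o ho).trans (h.rank o ho)⟩

theorem SameBelow.mono {n n' : ℕ} {A R A' R' : ℕ → ℕ} (h : SameBelow K n A R A' R')
    (hn : n' ≤ n) : SameBelow K n' A R A' R' :=
  ⟨fun x hx => h.mat x (hx.trans_le (Nat.mul_le_mul_right _ hn)), fun o ho => h.rank o (by omega)⟩

theorem obj_lt {n o x : ℕ} (ho : o < n) (hx : x < K * K) : o * (K * K) + x < n * (K * K) := by
  have := Nat.mul_le_mul_right (K * K) ho
  rw [Nat.succ_mul] at this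
  omega

theorem SameBelow.wf {n : ℕ} {A R A' R' : ℕ → ℕ} (h : SameBelow K n A R A' R') {o : ℕ}
    (ho : o < n) (hw : WF pb K A R o) : WF pb K A' R' o :=
  hw.congr (fun _ hx => h.mat _ (obj_lt ho hx)) (h.rank o ho)

theorem SameBelow.sp_eq {n : ℕ} {A R A' R' : ℕ → ℕ} (h : SameBelow K n A R A' R') {o : ℕ}
    (ho : o < n) (hw : WF pb K A R o) : sp pb K A' R' o = sp pb K A R o :=
  sp_congr hw.rank_le (fun _ hx => h.mat _ (obj_lt ho hx)) (h.rank o ho)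

end

/-! ### Elimination on the word RAM -/

section

-- Loop variables `vC` for columns and `vL` for rows; address `vBase` of a vector; dot products
-- `aDv`; copy `aPv` of the pivot row; rank `vRk`; number `vPiv` of the pivot row; multipliers
-- `vDp`, `vNd`; address `vOff` of the matrix of an object; equation vector `aEv`; number `vHp` of
-- objects on the heap; number `vK` of columns.
notation "vC" => (20 : ℕ)
notation "vBase" => (21 : ℕ)
notation "aDv" => (22 : ℕ)
notation "aPv" => (23 : ℕ)
notation "vL" => (24 : ℕ)
notation "vRk" => (25 : ℕ)
notation "vPiv" => (26 : ℕ)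
notation "vDp" => (27 : ℕ)
notation "vNd" => (28 : ℕ)
notation "vOff" => (29 : ℕ)
notation "aEv" => (32 : ℕ)
notation "vHp" => (40 : ℕ)
notation "vK" => (100 : ℕ)

/-- Copies `vZ` cells of array `src`, from address `vY` on, to array `dst`, from address `vX` on. -/
def copyCells (dst src : ℕ) : Program :=
  .forLoop vC (var vZ) (.store dst (var vX + var vC) (.read src (var vY + var vC)))

/-- The two ranges have to be disjoint or equal if they lie in the same array. -/
theorem copyCells_spec {W : ℕ} {σ : Mem} {dst src d s n : ℕ} (hdst : dst = 9 ∨ 20 < dst)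
    (hsrc : src = 9 ∨ 20 < src)
    (hW : 1 < W) (hd : σ vX 0 = d) (hs : σ vY 0 = s) (hn : σ vZ 0 = n) (hdn : d + n < W)
    (hsn : s + n < W) (hdis : dst = src → s = d ∨ s + n ≤ d ∨ d + n ≤ s) :
    Runs W (copyCells dst src) σ (n * 30 + 30) (fun τ =>
      (∀ x < n, τ dst (d + x) = σ src (s + x)) ∧
      (∀ x, x < d ∨ d + n ≤ x → τ dst x = σ dst x) ∧
      ∀ a, a ≠ vC → a ≠ dst → τ a = σ a) := by
  have hstore : (Program.store dst (var vX + var vC) (.read src (var vY + var vC))).writesIn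
    dst (dst + 1) = true := by simp [Program.writesIn]
  apply Runs.le
  · apply Runs.forLoop dst (dst + 1) (n := n) (fun i τ =>
      (∀ x < i, τ dst (d + x) = σ src (s + x)) ∧
      (∀ x, x < d ∨ d + i ≤ x → τ dst x = σ dst x)) hW (by omega) hstore
      (by simp [Program.avoids]; omega)
    · refine ⟨by simp, fun x _ => ?_⟩
      rw [put_ne _ (by omega)]
    · intro i τ hi hfr hv hI
      have h12 : τ 12 = σ 12 := by rw [hfr 12 (by omega) (by omega)]
      exact ⟨by simp; omega, by simp [h12, hn]⟩
    · rintro i τ hi hfr hv ⟨h1, h2⟩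
      have h10 : τ 10 = σ 10 := by rw [hfr 10 (by omega) (by omega)]
      have h11 : τ 11 = σ 11 := by rw [hfr 11 (by omega) (by omega)]
      have hread : τ src (s + i) = σ src (s + i) := by
        by_cases hds : dst = src
        · subst hds
          apply h2
          rcases hdis rfl with h | h | h <;> omega
        · rw [hfr src (by omega) (by omega)]
      apply Runs.store hW
      · simp [h10, hv, hd]; omega
      · simp [h11, hv, hs]; omega
      · have hval : (Expr.read src (var vY + var vC)).val τ = σ src (s + i) := by
          simp [h11, hs, hv, hread]
        have hval' : (var vX + var vC).val τ = d + i := by simp [h10, hd, hv]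
        rw [hval, hval']
        refine ⟨fun x hx => ?_, fun x hx => ?_⟩
        · rw [put_ne _ (by omega), put_same, Function.update_apply]
          split_ifs with h
          · rw [show x = i by omega]
          · exact h1 x (by omega)
        · rw [put_ne _ (by omega), put_same, Function.update_of_ne (by omega)]
          exact h2 x (by omega)
    · rintro τ hfr hv ⟨h1, h2⟩
      refine ⟨h1, h2, fun a ha hb => ?_⟩
      exact hfr a ha (by omega)
  · simp; omega

/-- `vR` becomes the dot product of the equation vector with the vector at address `vBase` of
array `arr`. -/
def dot (arr : ℕ) : Program :=
  .set vR 0 ;;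
  .forLoop vC (var vK)
    (.set vX (.read aEv (var vC)) ;; .set vY (.read arr (var vBase + var vC)) ;;
     .set vZ (var vR) ;; fma)

/-- A bound for the running time of `dot`. -/
def tDot (e K : ℕ) : ℕ := K * (tFma e + 100) + 100

variable {p : ℕ} [Fact p.Prime] {F : Type*} [Field F] [Algebra (ZMod p) F]
  {pb : PowerBasis (ZMod p) F} {K : ℕ}

theorem Runs.fma_then {W : ℕ} (hW : 4 * (p ^ pb.dim) ^ 2 ≤ W) {σ : Mem} (env : ArithEnv pb σ)
    (hx : σ vX 0 < p ^ pb.dim) (hy : σ vY 0 < p ^ pb.dim) (hz : σ vZ 0 < p ^ pb.dim)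
    {Q : Mem → Prop} (hQ : ∀ τ, τ vR 0 < p ^ pb.dim →
      dec pb (τ vR 0) = dec pb (σ vZ 0) + dec pb (σ vX 0) * dec pb (σ vY 0) →
      (∀ a, a < 13 ∨ 20 ≤ a → τ a = σ a) → Q τ) :
    Runs W fma σ (tFma pb.dim) Q :=
  (fma_spec pb hW env hx hy hz).mono fun τ h => hQ τ h.1.1 h.1.2 h.2

theorem one_lt_of_le {W : ℕ} (hW : 4 * (p ^ pb.dim) ^ 2 ≤ W) : 1 < W := by
  have : 0 < p ^ pb.dim := pow_pos prime_pos _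
  nlinarith

theorem dot_spec {W : ℕ} (hW : 4 * (p ^ pb.dim) ^ 2 ≤ W) {σ : Mem} (env : ArithEnv pb σ)
    {arr base : ℕ} (harr : arr = 9 ∨ 20 < arr) (hK : σ vK 0 = K) (hKW : base + K < W)
    (hbase : σ vBase 0 = base)
    (hE : ∀ c < K, σ aEv c < p ^ pb.dim) (hA : ∀ x, σ arr x < p ^ pb.dim) :
    Runs W (dot arr) σ (tDot pb.dim K) (fun τ =>
      (τ vR 0 < p ^ pb.dim ∧ dec pb (τ vR 0) = vec pb K (σ aEv) 0 ⬝ᵥ vec pb K (σ arr) base) ∧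
      ∀ a, a < 10 ∨ 21 ≤ a → τ a = σ a) := by
  have hW1 := one_lt_of_le hW
  refine Runs.frame 10 21 rfl ?_
  apply Runs.le
  · apply Runs.set_seq_val (n := 0) hW1 (by simp; omega) rfl
    apply Runs.forLoop 10 20 (n := K) (fun i τ => τ vR 0 < p ^ pb.dim ∧
      dec pb (τ vR 0) = ∑ c ∈ range i, dec pb (σ aEv c) * dec pb (σ arr (base + c)))
      hW1 (by omega) rfl rfl
    · simp [pow_pos prime_pos, dec_zero]
    · intro i τ hi hfr hv hI
      have h : τ 100 = σ 100 := by rw [hfr 100 (by omega) (by omega)]; simp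
      simp [h, hK]; omega
    · rintro i τ hi hfr hv ⟨h1, h2⟩
      have f21 : τ 21 = σ 21 := by rw [hfr 21 (by omega) (by omega)]; simp
      have f32 : τ 32 = σ 32 := by rw [hfr 32 (by omega) (by omega)]; simp
      have farr : τ arr = σ arr := by
        rw [hfr arr (by omega) (by omega), put_ne _ (by omega)]
      have fe : ArithEnv pb τ := env.congr (by rw [hfr 0 (by omega) (by omega)]; simp)
        (by rw [hfr 1 (by omega) (by omega)]; simp) (by rw [hfr 105 (by omega) (by omega)]; simp)
      apply Runs.set_seq_val (n := σ aEv i) hW1 (by simp; omega) (by simp [f32, hv])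
      apply Runs.set_seq_val (n := σ arr (base + i)) hW1 (by simp [f21, hbase, hv]; omega)
        (by simp [f21, hbase, hv, put_ne _ (show arr ≠ 10 by omega), farr])
      apply Runs.set_seq_val (n := τ vR 0) hW1 (by simp; omega) (by simp)
      apply Runs.fma_then hW (fe.congr (by simp) (by simp) (by simp))
      · simpa using hE i hi
      · simpa using hA _
      · simpa using h1
      · intro ρ hr1 hr2 hr3
        refine ⟨by simpa using hr1, ?_⟩
        rw [put_ne _ (by decide), hr2, sum_range_succ, ← h2]
        simp
    · rintro τ hfr hv ⟨h1, h2⟩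
      refine ⟨h1, ?_⟩
      rw [h2, dotProduct, ← Fin.sum_univ_eq_sum_range
        (fun c => dec pb (σ aEv c) * dec pb (σ arr (base + c)))]
      simp [vec]
  · simp only [tDot, Expr.cost_var, Expr.cost_read, Expr.cost_add, Expr.cost_zero]
    nlinarith

end

section

/-- Computes the products of the equation vector with the basis rows of object `vHp`, and a row
with nonzero product (`vPiv`), if there is one. -/
def cutDots : Program :=
  .set vOff (var vHp * (var vK * var vK)) ;;
  .set vRk (.read aHR (var vHp)) ;;
  .set vPiv (var vRk) ;;
  .forLoop vL (var vRk)
    (.set vBase (var vOff + var vL * var vK) ;; dot aHM ;; .store aDv (var vL) (var vR) ;;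
     .ite (var vR) (.set vPiv (var vL)) .skip)

/-- Replaces row `vL` by the combination `vDp * row + vNd * pivot row`. -/
def combRow : Program :=
  .forLoop vC (var vK)
    (.set vX (var vDp) ;; .set vY (.read aHM (var vOff + var vL * var vK + var vC)) ;;
     .set vZ 0 ;; fma ;;
     .set vX (var vNd) ;; .set vY (.read aPv (var vC)) ;; .set vZ (var vR) ;; fma ;;
     .store aHM (var vOff + var vL * var vK + var vC) (var vR))

/-- Moves the last basis row to the place of the pivot row, eliminates with the pivot row, and
stores the equation vector in the place that has become free. -/
def cutElim : Program :=
  .set vDp (.read aDv (var vPiv)) ;;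
  .set vX 0 ;; .set vY (var vOff + var vPiv * var vK) ;; .set vZ (var vK) ;;
  copyCells aPv aHM ;;
  .set vX (var vOff + var vPiv * var vK) ;; .set vY (var vOff + (var vRk - 1) * var vK) ;;
  copyCells aHM aHM ;;
  .store aDv (var vPiv) (.read aDv (var vRk - 1)) ;;
  .forLoop vL (var vRk - 1)
    (.set vX (eP - 1) ;; .set vY (.read aDv (var vL)) ;; .set vZ 0 ;; fma ;;
     .set vNd (var vR) ;; combRow) ;;
  .set vX (var vOff + (var vRk - 1) * var vK) ;; .set vY 0 ;; .set vZ (var vK) ;;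
  copyCells aHM aEv ;;
  .store aHR (var vHp) (var vRk - 1)

/-- Intersects object `vHp` with the hyperplane that is given by the equation vector. -/
def cut : Program :=
  cutDots ;; .ite ((var vPiv).ltE (var vRk)) cutElim .skip

variable {p : ℕ} [Fact p.Prime] {F : Type*} [Field F] [Algebra (ZMod p) F]
  {pb : PowerBasis (ZMod p) F} {K : ℕ}

/-- The memory holds the presentation of the field and a heap of matrices with `K` columns, all of
whose entries are codes of field elements. -/
structure HeapEnv (pb : PowerBasis (ZMod p) F) (K : ℕ) (σ : Mem) : Prop where
  arith : ArithEnv pb σ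
  width : σ vK 0 = K
  cells : ∀ x, σ aHM x < p ^ pb.dim

theorem HeapEnv.congr {σ τ : Mem} (h : HeapEnv pb K σ) (h0 : τ 0 = σ 0) (h1 : τ 1 = σ 1)
    (h2 : τ aPow = σ aPow) (h3 : τ vK = σ vK) (h4 : ∀ x, τ aHM x < p ^ pb.dim) :
    HeapEnv pb K τ :=
  ⟨h.arith.congr h0 h1 h2, by rw [h3, h.width], h4⟩

theorem le_mul_self' (K : ℕ) : K ≤ K * K := Nat.le_mul_self K

/-- Either the hyperplane contains all basis rows, and `vPiv` is the rank of the object, or `vPiv`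
is the number of a basis row outside the hyperplane. -/
theorem cutDots_spec {W : ℕ} (hW : 4 * (p ^ pb.dim) ^ 2 ≤ W) {σ : Mem} (env : HeapEnv pb K σ)
    {o : ℕ} (ho : σ vHp 0 = o) (hroom : (o + 1) * (K * K) < W) (hr : σ aHR o ≤ K)
    (hE : ∀ c < K, σ aEv c < p ^ pb.dim) :
    Runs W cutDots σ (K * (tDot pb.dim K + 100) + 100) (fun τ =>
      (τ vOff 0 = o * (K * K) ∧ τ vRk 0 = σ aHR o ∧
      (∀ l < σ aHR o, τ aDv l < p ^ pb.dim ∧ dec pb (τ aDv l) =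
        vec pb K (σ aEv) 0 ⬝ᵥ vec pb K (σ aHM) (o * (K * K) + l * K)) ∧
      ((τ vPiv 0 = σ aHR o ∧ ∀ l < σ aHR o,
        vec pb K (σ aEv) 0 ⬝ᵥ vec pb K (σ aHM) (o * (K * K) + l * K) = 0) ∨
       (τ vPiv 0 < σ aHR o ∧
        vec pb K (σ aEv) 0 ⬝ᵥ vec pb K (σ aHM) (o * (K * K) + τ vPiv 0 * K) ≠ 0))) ∧
      ∀ a, a < 10 ∨ 30 ≤ a → τ a = σ a) := by
  have hW1 := one_lt_of_le hW
  have hKK := le_mul_self' K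
  have hroom' : o * (K * K) + K * K < W := by rwa [Nat.succ_mul] at hroom
  refine Runs.frame 10 30 rfl ?_
  set r := σ aHR o with hrdef
  set d : ℕ → F := fun l => vec pb K (σ aEv) 0 ⬝ᵥ vec pb K (σ aHM) (o * (K * K) + l * K) with hd
  apply Runs.le
  · apply Runs.set_seq_val (n := o * (K * K)) hW1
      (by simp [ho, env.width]; omega)
      (by simp [ho, env.width])
    apply Runs.set_seq_val (n := r) hW1 (by simp; omega) (by simp [ho, hrdef])
    apply Runs.set_seq_val (n := r) hW1 (by simp; omega) (by simp)
    apply Runs.forLoop 10 27 (n := r) (fun i τ =>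
      (∀ l < i, τ aDv l < p ^ pb.dim ∧ dec pb (τ aDv l) = d l) ∧
      ((τ vPiv 0 = r ∧ ∀ l < i, d l = 0) ∨ (τ vPiv 0 < r ∧ d (τ vPiv 0) ≠ 0)) ∧ τ vRk 0 = r)
      hW1 (by omega) rfl rfl
    · simp
    · rintro i τ hi hfr hv ⟨-, -, hI⟩
      simp [hI]; omega
    · rintro i τ hi hfr hv ⟨h1, h2, h3⟩
      have f40 : τ 40 = σ 40 := by rw [hfr 40 (by omega) (by omega)]; simp
      have f9 : τ 9 = σ 9 := by rw [hfr 9 (by omega) (by omega)]; simp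
      have f32 : τ 32 = σ 32 := by rw [hfr 32 (by omega) (by omega)]; simp
      have f100 : τ 100 = σ 100 := by rw [hfr 100 (by omega) (by omega)]; simp
      have f29 : τ 29 0 = o * (K * K) := by rw [hfr 29 (by omega) (by omega)]; simp
      have fe : ArithEnv pb τ := env.arith.congr (by rw [hfr 0 (by omega) (by omega)]; simp)
        (by rw [hfr 1 (by omega) (by omega)]; simp) (by rw [hfr 105 (by omega) (by omega)]; simp)
      have hi' : i * K + K ≤ K * K := by
        have := Nat.mul_le_mul_right K (show i + 1 ≤ K by omega)
        rwa [Nat.succ_mul] at this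
      apply Runs.set_seq_val (n := o * (K * K) + i * K) hW1
        (by simp [f29, hv, f100, env.width]; omega) (by simp [f29, hv, f100, env.width])
      apply Runs.seq (dot_spec (K := K) hW (fe.congr (by simp) (by simp) (by simp)) (Or.inl rfl)
        (by simp [f100, env.width]) (base := o * (K * K) + i * K) (by omega) (by simp)
        (by simpa [f32] using hE) (by simpa [f9] using env.cells))
      rintro ρ ⟨⟨g1, g2⟩, gfr⟩
      have g24 : ρ 24 = τ 24 := by rw [gfr 24 (by omega)]; simp
      have g22 : ρ 22 = τ 22 := by rw [gfr 22 (by omega)]; simp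
      have g25 : ρ 25 = τ 25 := by rw [gfr 25 (by omega)]; simp
      have g26 : ρ 26 = τ 26 := by rw [gfr 26 (by omega)]; simp
      have g2' : dec pb (ρ 13 0) = d i := by
        rw [g2]; simp [f32, f9, hd]
      apply Runs.store_seq (σ := ρ) hW1 (by simp; omega) (by simp; omega)
      simp only [Expr.val_var, g24, hv]
      have hD : ∀ l < i + 1, Function.update (τ 22) i (ρ 13 0) l < p ^ pb.dim ∧
          dec pb (Function.update (τ 22) i (ρ 13 0) l) = d l := by
        intro l hl
        rw [Function.update_apply]
        split_ifs with h
        · subst h; exact ⟨g1, g2'⟩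
        · exact h1 l (by omega)
      apply Runs.ite hW1 (by simp; omega)
      · intro h0
        apply Runs.set hW1 (by simp; omega)
        refine ⟨by simpa [g22] using hD, Or.inr ?_, by simp [g25, h3]⟩
        simp [g24, hv]
        refine ⟨hi, ?_⟩
        rw [← g2']
        simp at h0
        exact (dec_eq_zero_iff pb g1).not.mpr h0
      · intro h0
        simp at h0
        apply Runs.skip
        refine ⟨by simpa [g22] using hD, ?_, by simp [g25, h3]⟩
        simp only [put_ne _ (show (26:ℕ) ≠ 24 by decide), put_ne _ (show (26:ℕ) ≠ 22 by decide),
          g26]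
        rcases h2 with ⟨h2, h2'⟩ | h2
        · refine Or.inl ⟨h2, fun l hl => ?_⟩
          by_cases hli : l = i
          · rw [hli, ← g2', h0, dec_zero]
          · exact h2' l (by omega)
        · exact Or.inr h2
    · rintro τ hfr hv ⟨h1, h2, h3⟩
      refine ⟨?_, h3, h1, h2⟩
      rw [hfr 29 (by omega) (by omega)]; simp
  · simp only [Expr.cost_mul, Expr.cost_var, Expr.cost_read, Expr.cost_add]
    have := Nat.mul_le_mul_right (tDot pb.dim K + 100) hr
    nlinarith

theorem combRow_spec {W : ℕ} (hW : 4 * (p ^ pb.dim) ^ 2 ≤ W) {σ : Mem} (env : HeapEnv pb K σ)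
    {off l : ℕ} (hoff : σ vOff 0 = off) (hl : σ vL 0 = l) (hroom : off + l * K + K < W)
    (hdp : σ vDp 0 < p ^ pb.dim) (hnd : σ vNd 0 < p ^ pb.dim)
    (hpv : ∀ c < K, σ aPv c < p ^ pb.dim) :
    Runs W combRow σ (K * (2 * tFma pb.dim + 100) + 100) (fun τ =>
      ((∀ x, τ aHM x < p ^ pb.dim) ∧
      vec pb K (τ aHM) (off + l * K) = dec pb (σ vDp 0) • vec pb K (σ aHM) (off + l * K) +
        dec pb (σ vNd 0) • vec pb K (σ aPv) 0 ∧
      ∀ x, x < off + l * K ∨ off + l * K + K ≤ x → τ aHM x = σ aHM x) ∧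
      ∀ a, a < 9 ∨ 21 ≤ a → τ a = σ a) := by
  have hW1 := one_lt_of_le hW
  refine Runs.frame 9 21 rfl ?_
  apply Runs.le
  · apply Runs.forLoop 9 20 (n := K) (fun i τ => (∀ x, τ aHM x < p ^ pb.dim) ∧
      (∀ c < i, dec pb (τ aHM (off + l * K + c)) = dec pb (σ vDp 0) *
        dec pb (σ aHM (off + l * K + c)) + dec pb (σ vNd 0) * dec pb (σ aPv c)) ∧
      ∀ x, x < off + l * K ∨ off + l * K + i ≤ x → τ aHM x = σ aHM x)
      hW1 (by omega) rfl rfl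
    · simpa using env.cells
    · intro i τ hi hfr hv hI
      have h : τ 100 = σ 100 := hfr 100 (by omega) (by omega)
      simp [h, env.width]; omega
    · rintro i τ hi hfr hv ⟨h1, h2, h3⟩
      have fe : ArithEnv pb τ := env.arith.congr (hfr 0 (by omega) (by omega))
        (hfr 1 (by omega) (by omega)) (hfr 105 (by omega) (by omega))
      have f23 := hfr 23 (by omega) (by omega)
      have f24 := hfr 24 (by omega) (by omega)
      have f27 := hfr 27 (by omega) (by omega)
      have f28 := hfr 28 (by omega) (by omega)
      have f29 := hfr 29 (by omega) (by omega)
      have f100 := hfr 100 (by omega) (by omega)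
      have hK := env.width
      apply Runs.set_seq_val (n := σ 27 0) hW1 (by simp; omega) (by simp [f27])
      apply Runs.set_seq_val (n := σ 9 (off + l * K + i)) hW1
        (by simp [f29, f24, f100, hoff, hl, hK, hv]; omega)
        (by simp [f29, f24, f100, hoff, hl, hK, hv, h3])
      apply Runs.set_seq_val (n := 0) hW1 (by simp; omega) (by simp)
      apply Runs.seq (fma_spec pb hW (fe.congr (by simp) (by simp) (by simp))
          (by simpa using hdp) (by simpa using env.cells _) (by simp [pow_pos prime_pos]))
      · rintro ρ ⟨⟨g1, g2⟩, gfr⟩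
        have g2' : dec pb (ρ 13 0) = dec pb (σ 27 0) * dec pb (σ 9 (off + l * K + i)) := by
          rw [g2]; simp [dec_zero]
        have ge : ArithEnv pb ρ := fe.congr (by rw [gfr 0 (by omega)]; simp)
          (by rw [gfr 1 (by omega)]; simp) (by rw [gfr 105 (by omega)]; simp)
        have g28 : ρ 28 = σ 28 := by rw [gfr 28 (by omega)]; simp [f28]
        have g23 : ρ 23 = σ 23 := by rw [gfr 23 (by omega)]; simp [f23]
        have g20 : ρ 20 = τ 20 := by rw [gfr 20 (by omega)]; simp
        apply Runs.set_seq_val (n := σ 28 0) hW1 (by simp; omega) (by simp [g28])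
        apply Runs.set_seq_val (n := σ 23 i) hW1 (by simp; omega) (by simp [g23, g20, hv])
        apply Runs.set_seq_val (n := ρ 13 0) hW1 (by simp; omega) (by simp)
        apply Runs.seq (fma_spec pb hW (ge.congr (by simp) (by simp) (by simp))
            (by simpa using hnd) (by simpa using hpv i hi) (by simpa using g1))
        · rintro π ⟨⟨k1, k2⟩, kfr⟩
          have k9 : π 9 = τ 9 := by rw [kfr 9 (by omega)]; simp [gfr 9]
          have k20 : π 20 = τ 20 := by rw [kfr 20 (by omega)]; simp [gfr 20]
          have k24 : π 24 = σ 24 := by rw [kfr 24 (by omega)]; simp [gfr 24, f24]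
          have k29 : π 29 = σ 29 := by rw [kfr 29 (by omega)]; simp [gfr 29, f29]
          have k100 : π 100 = σ 100 := by rw [kfr 100 (by omega)]; simp [gfr 100, f100]
          have k2' : dec pb (π 13 0) = dec pb (σ 27 0) * dec pb (σ 9 (off + l * K + i)) +
              dec pb (σ 28 0) * dec pb (σ 23 i) := by
            rw [k2]; simp [g2']
          have hidx : (var 29 + var 24 * var 100 + var 20).val π = off + l * K + i := by
            simp [k29, k24, k100, k20, hoff, hl, hK, hv]
          apply Runs.store hW1
          · simp [k29, k24, k100, k20, hoff, hl, hK, hv]; omega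
          · simp; omega
          · rw [hidx]
            simp only [Expr.val_var, put_ne _ (show (9:ℕ) ≠ 20 by decide), put_same, k9]
            refine ⟨fun x => ?_, fun c hc => ?_, fun x hx => ?_⟩
            · rw [Function.update_apply]; split_ifs
              · exact k1
              · exact h1 x
            · rw [Function.update_apply]; split_ifs with h
              · rw [show c = i by omega]; exact k2'
              · exact h2 c (by omega)
            · rw [Function.update_of_ne (by omega)]
              exact h3 x (by omega)
    · rintro τ hfr hv ⟨h1, h2, h3⟩
      refine ⟨h1, ?_, h3⟩
      funext c
      simpa [vec] using h2 c c.2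
  · simp only [Expr.cost_mul, Expr.cost_var, Expr.cost_read, Expr.cost_add, Expr.cost_zero]
    nlinarith

end

section

variable {p : ℕ} [Fact p.Prime] {F : Type*} [Field F] [Algebra (ZMod p) F]
  {pb : PowerBasis (ZMod p) F} {K : ℕ}

theorem row_le {l r : ℕ} (h : l < r) : l * K + K ≤ r * K := by
  have := Nat.mul_le_mul_right K (show l + 1 ≤ r by omega)
  rwa [Nat.succ_mul] at this

/-- A bound for the running time of `cutElim`. -/
def tElim (e K : ℕ) : ℕ := K * (K * (2 * tFma e + 100) + tFma e + 200) + K * 100 + 300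

/-- Elimination with pivot row `j`, where `d l` is the product of the equation vector with row `l`.
Every new row is `d j` times an old row minus `d l` times the pivot row: the rows are only scaled,
so no division in the field is needed. -/
theorem cutElim_spec {W : ℕ} (hW : 4 * (p ^ pb.dim) ^ 2 ≤ W) {σ : Mem} (env : HeapEnv pb K σ)
    {o r j : ℕ} (ho : σ vHp 0 = o) (hroom : (o + 1) * (K * K) < W)
    (hoff : σ vOff 0 = o * (K * K))
    (hr : σ vRk 0 = r) (hrK : r ≤ K) (hj : σ vPiv 0 = j) (hjr : j < r)
    (hE : ∀ c < K, σ aEv c < p ^ pb.dim) (d : ℕ → F)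
    (hD : ∀ l < r, σ aDv l < p ^ pb.dim ∧ dec pb (σ aDv l) = d l) :
    Runs W cutElim σ (tElim pb.dim K) (fun τ =>
      ((∀ x, τ aHM x < p ^ pb.dim) ∧
      (∀ l < r - 1, vec pb K (τ aHM) (o * (K * K) + l * K) =
        d j • vec pb K (σ aHM) (o * (K * K) + (if l = j then r - 1 else l) * K) -
        d (if l = j then r - 1 else l) • vec pb K (σ aHM) (o * (K * K) + j * K)) ∧
      vec pb K (τ aHM) (o * (K * K) + (r - 1) * K) = vec pb K (σ aEv) 0 ∧
      (∀ x, x < o * (K * K) ∨ o * (K * K) + r * K ≤ x → τ aHM x = σ aHM x) ∧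
      τ aHR = Function.update (σ aHR) o (r - 1)) ∧
      ∀ a, a < 8 ∨ 30 ≤ a → τ a = σ a) := by
  have hW1 := one_lt_of_le hW
  have hroom' : o * (K * K) + K * K < W := by rwa [Nat.succ_mul] at hroom
  refine Runs.frame 8 30 rfl ?_
  set off := o * (K * K) with hoffdef
  have hjK : j * K + K ≤ r * K := row_le hjr
  have hr1K : (r - 1) * K + K = r * K := by
    rw [← Nat.succ_mul]; congr 1; omega
  have hrKK : r * K ≤ K * K := Nat.mul_le_mul_right K hrK
  have hjr1 : j ≠ r - 1 → j * K + K ≤ (r - 1) * K := fun h => row_le (by omega)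
  have hK := env.width
  have hp1 : 1 < p := (Fact.out : p.Prime).one_lt
  have hpq : p ≤ p ^ pb.dim := by
    calc p = p ^ 1 := (pow_one p).symm
      _ ≤ _ := Nat.pow_le_pow_right (by omega) pb.dim_pos
  have hpW : p < W := by nlinarith
  apply Runs.le
  · apply Runs.set_seq_val (n := σ aDv j) hW1 (by simp; omega) (by simp [hj])
    apply Runs.set_seq_val (n := 0) hW1 (by simp; omega) (by simp)
    apply Runs.set_seq_val (n := off + j * K) hW1 (by simp [hoff, hj, hK]; omega)
      (by simp [hoff, hj, hK])
    apply Runs.set_seq_val (n := K) hW1 (by simp; omega) (by simp [hK])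
    apply Runs.seq (copyCells_spec (dst := aPv) (src := aHM) (d := 0) (s := off + j * K) (n := K)
      (by omega) (by omega) hW1 (by simp) (by simp) (by simp) (by omega) (by omega) (by omega))
    rintro τ ⟨hpv, -, hfr⟩
    have f25 : τ 25 = σ 25 := by rw [hfr 25 (by omega) (by omega)]; simp
    have f26 : τ 26 = σ 26 := by rw [hfr 26 (by omega) (by omega)]; simp
    have f29 : τ 29 = σ 29 := by rw [hfr 29 (by omega) (by omega)]; simp
    have f9 : τ 9 = σ 9 := by rw [hfr 9 (by omega) (by omega)]; simp
    have f8 : τ 8 = σ 8 := by rw [hfr 8 (by omega) (by omega)]; simp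
    have f100 : τ 100 = σ 100 := by rw [hfr 100 (by omega) (by omega)]; simp
    have f12 : τ 12 0 = K := by rw [hfr 12 (by omega) (by omega)]; simp
    have f22 : τ 22 = σ 22 := by rw [hfr 22 (by omega) (by omega)]; simp
    have f27 : τ 27 0 = σ 22 j := by rw [hfr 27 (by omega) (by omega)]; simp
    have f32 : τ 32 = σ 32 := by rw [hfr 32 (by omega) (by omega)]; simp
    have f40 : τ 40 = σ 40 := by rw [hfr 40 (by omega) (by omega)]; simp
    have fe : ArithEnv pb τ := env.arith.congr (by rw [hfr 0 (by omega) (by omega)]; simp)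
      (by rw [hfr 1 (by omega) (by omega)]; simp) (by rw [hfr 105 (by omega) (by omega)]; simp)
    simp only [Nat.zero_add, put_ne _ (show (9:ℕ) ≠ 12 by decide),
      put_ne _ (show (9:ℕ) ≠ 11 by decide), put_ne _ (show (9:ℕ) ≠ 10 by decide),
      put_ne _ (show (9:ℕ) ≠ 27 by decide)] at hpv
    apply Runs.set_seq_val (n := off + j * K) hW1 (by simp [hoff, hj, hK, f29, f26, f100]; omega)
      (by simp [hoff, hj, hK, f29, f26, f100])
    apply Runs.set_seq_val (n := off + (r - 1) * K) hW1
      (by simp [hoff, hr, hK, f29, f25, f100]; omega)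
      (by simp [hoff, hr, hK, f29, f25, f100])
    apply Runs.seq (copyCells_spec (dst := aHM) (src := aHM) (d := off + j * K)
      (s := off + (r - 1) * K) (n := K)
      (by omega) (by omega) hW1 (by simp) (by simp) (by simp [f12]) (by omega) (by omega) (by
        intro _
        by_cases h : j = r - 1
        · left; rw [h]
        · have := hjr1 h; omega))
    rintro ρ ⟨hrow, hother, gfr⟩
    simp only [put_ne _ (show (9:ℕ) ≠ 11 by decide), put_ne _ (show (9:ℕ) ≠ 10 by decide), f9]
      at hrow hother
    have g8 : ρ 8 = σ 8 := by rw [gfr 8 (by omega) (by omega)]; simp [f8]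
    have g22 : ρ 22 = σ 22 := by rw [gfr 22 (by omega) (by omega)]; simp [f22]
    have g23 : ρ 23 = τ 23 := by rw [gfr 23 (by omega) (by omega)]; simp
    have g25 : ρ 25 0 = r := by rw [gfr 25 (by omega) (by omega)]; simp [f25, hr]
    have g26 : ρ 26 0 = j := by rw [gfr 26 (by omega) (by omega)]; simp [f26, hj]
    have g27 : ρ 27 0 = σ 22 j := by rw [gfr 27 (by omega) (by omega)]; simp [f27]
    have g29 : ρ 29 0 = off := by rw [gfr 29 (by omega) (by omega)]; simp [f29, hoff]
    have g32 : ρ 32 = σ 32 := by rw [gfr 32 (by omega) (by omega)]; simp [f32]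
    have g40 : ρ 40 = σ 40 := by rw [gfr 40 (by omega) (by omega)]; simp [f40]
    have g100 : ρ 100 = σ 100 := by rw [gfr 100 (by omega) (by omega)]; simp [f100]
    have g0 : ρ 0 = τ 0 := by rw [gfr 0 (by omega) (by omega)]; simp
    have g1 : ρ 1 = τ 1 := by rw [gfr 1 (by omega) (by omega)]; simp
    have g105 : ρ 105 = τ 105 := by rw [gfr 105 (by omega) (by omega)]; simp
    have ge : ArithEnv pb ρ := fe.congr g0 g1 g105
    have gcells : ∀ x, ρ 9 x < p ^ pb.dim := by
      intro x
      by_cases hx : x < off + j * K ∨ off + j * K + K ≤ x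
      · rw [hother x hx]; exact env.cells x
      · obtain ⟨y, rfl⟩ := Nat.exists_eq_add_of_le (show off + j * K ≤ x by omega)
        rw [hrow y (by omega)]; exact env.cells _
    -- The rows after the last basis row has been moved to the place of the pivot row.
    have hu : ∀ l < r, vec pb K (ρ 9) (off + l * K) =
        vec pb K (σ 9) (off + (if l = j then r - 1 else l) * K) := by
      intro l hl
      apply vec_congr
      intro c hc
      split_ifs with h
      · subst h; exact hrow c hc
      · apply hother
        rcases Nat.lt_or_gt_of_ne h with h | h
        · have := row_le (K := K) h; omega
        · have := row_le (K := K) h; omega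
    apply Runs.store_seq (σ := ρ) hW1 (by simp; omega) (by simp [g25]; omega)
    simp only [Expr.val_var, Expr.val_read, Expr.val_sub, Expr.val_one, g25, g26, g22]
    set DV := Function.update (σ 22) j (σ 22 (r - 1)) with hDV
    have hDV' : ∀ l < r, DV l < p ^ pb.dim ∧ dec pb (DV l) = d (if l = j then r - 1 else l) := by
      intro l hl
      rw [hDV, Function.update_apply]
      split_ifs with h
      · exact hD _ (by omega)
      · exact hD _ hl
    have hρ' : put ρ 22 j (σ 22 (r - 1)) 22 = DV := by simp [hDV, g22]
    set ρ' := put ρ 22 j (σ 22 (r - 1)) with hρdef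
    have hne : ∀ a, a ≠ 22 → ρ' a = ρ a := fun a ha => put_ne _ ha _ _
    apply Runs.seq (Q := fun π => (∀ x, π 9 x < p ^ pb.dim) ∧
      (∀ l < r - 1, vec pb K (π 9) (off + l * K) =
        d j • vec pb K (ρ 9) (off + l * K) - d (if l = j then r - 1 else l) •
          vec pb K (τ 23) 0) ∧
      (∀ x, x < off ∨ off + (r - 1) * K ≤ x → π 9 x = ρ 9 x) ∧
      ∀ a, a ≠ 24 → a < 9 ∨ 29 ≤ a ∨ a = 25 → π a = ρ' a)
    · apply Runs.forLoop 9 29 (n := r - 1) (fun i π => (∀ x, π 9 x < p ^ pb.dim) ∧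
        (∀ l < i, vec pb K (π 9) (off + l * K) =
          d j • vec pb K (ρ 9) (off + l * K) - d (if l = j then r - 1 else l) •
            vec pb K (τ 23) 0) ∧
        (∀ x, x < off ∨ off + i * K ≤ x → π 9 x = ρ 9 x) ∧
        π 25 = ρ 25 ∧ π 22 = DV ∧ π 23 = τ 23 ∧ π 27 = ρ 27)
        hW1 (by omega) rfl rfl
      · refine ⟨by simpa [hne] using gcells, by simp, by simp [hne], by simp [hne],
          by simp [hρ'], by simp [hne, g23], by simp [hne]⟩
      · rintro i π hi kfr hv ⟨-, -, -, k25, -⟩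
        simp [k25, g25]; omega
      · rintro i π hi kfr hv ⟨k1, k2, k3, k25, k22, k23, k27⟩
        have k0 : π 0 = τ 0 := by rw [kfr 0 (by omega) (by omega), hne _ (by omega), g0]
        have k1' : π 1 = τ 1 := by rw [kfr 1 (by omega) (by omega), hne _ (by omega), g1]
        have k105 : π 105 = τ 105 := by rw [kfr 105 (by omega) (by omega), hne _ (by omega), g105]
        have k100 : π 100 = σ 100 := by rw [kfr 100 (by omega) (by omega), hne _ (by omega), g100]
        have k29 : π 29 0 = off := by rw [kfr 29 (by omega) (by omega), hne _ (by omega), g29]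
        have ke : ArithEnv pb π := fe.congr k0 k1' k105
        have hp0 : π 0 0 = p := ke.char_eq
        have hi' : i * K + K ≤ (r - 1) * K := row_le hi
        apply Runs.set_seq_val (n := p - 1) hW1 (by simp [hp0]; omega) (by simp [hp0])
        apply Runs.set_seq_val (n := DV i) hW1 (by simp; omega) (by simp [hv, k22])
        apply Runs.set_seq_val (n := 0) hW1 (by simp; omega) (by simp)
        apply Runs.seq (fma_spec pb hW (ke.congr (by simp) (by simp) (by simp))
          (by simp; omega) (by simpa using (hDV' i (by omega)).1)
          (by simp [pow_pos prime_pos]))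
        rintro α ⟨⟨a1, a2⟩, afr⟩
        have a2' : dec pb (α 13 0) = - d (if i = j then r - 1 else i) := by
          rw [a2]; simp [dec_zero, dec_pred, (hDV' i (by omega)).2]
        have l9 : α 9 = π 9 := by rw [afr 9 (by omega)]; simp
        have l24 : α 24 = π 24 := by rw [afr 24 (by omega)]; simp
        have l27 : α 27 = ρ 27 := by rw [afr 27 (by omega)]; simp [k27]
        have l29 : α 29 = π 29 := by rw [afr 29 (by omega)]; simp
        have l23 : α 23 = τ 23 := by rw [afr 23 (by omega)]; simp [k23]
        have l22 : α 22 = DV := by rw [afr 22 (by omega)]; simp [k22]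
        have l25 : α 25 = ρ 25 := by rw [afr 25 (by omega)]; simp [k25]
        have le : HeapEnv pb K α :=
          ⟨ke.congr (by rw [afr 0 (by omega)]; simp) (by rw [afr 1 (by omega)]; simp)
            (by rw [afr 105 (by omega)]; simp),
            by rw [afr 100 (by omega)]; simp [k100, hK], by rw [l9]; exact k1⟩
        apply Runs.set_seq_val (n := α 13 0) hW1 (by simp; omega) (by simp)
        refine (combRow_spec (pb := pb) (K := K) (off := off) (l := i) hW
          (le.congr (by simp) (by simp) (by simp) (by simp) (by simpa using le.cells))
          (by simp [l29, k29]) (by simp [l24, hv]) (by omega)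
          (by simpa [l27, g27] using (hD j hjr).1) (by simpa using a1)
          (by
            intro c hc
            simp only [put_ne _ (show (23:ℕ) ≠ 28 by decide), l23, hpv c hc]
            exact env.cells _)).mono ?_
        rintro β ⟨⟨b1, b2, b3⟩, bfr⟩
        refine ⟨by simpa using b1, fun l hl => ?_, fun x hx => ?_, ?_, ?_, ?_, ?_⟩
        · simp only [put_ne _ (show (9:ℕ) ≠ 24 by decide)]
          by_cases hli : l = i
          · subst hli
            rw [b2]
            simp only [put_same, Function.update_self, put_ne _ (show (27:ℕ) ≠ 28 by decide),
              put_ne _ (show (9:ℕ) ≠ 28 by decide), put_ne _ (show (23:ℕ) ≠ 28 by decide),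
              a2', l27, g27, (hD j hjr).2, l9, l23, neg_smul, ← sub_eq_add_neg]
            congr 2
            apply vec_congr
            intro c hc
            apply k3; omega
          · have h1 : l * K + K ≤ i * K := row_le (by omega)
            rw [← k2 l (by omega)]
            apply vec_congr
            intro c hc
            rw [b3 _ (by omega)]
            simp [l9]
        · have hsucc : (i + 1) * K = i * K + K := Nat.succ_mul i K
          rw [put_ne _ (by decide), b3 x (by omega), put_ne _ (by decide), l9]
          exact k3 x (by omega)
        · rw [put_ne _ (by decide), bfr 25 (by omega), put_ne _ (by decide), l25]
        · rw [put_ne _ (by decide), bfr 22 (by omega), put_ne _ (by decide), l22]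
        · rw [put_ne _ (by decide), bfr 23 (by omega), put_ne _ (by decide), l23]
        · rw [put_ne _ (by decide), bfr 27 (by omega), put_ne _ (by decide), l27]
      · rintro π kfr hv ⟨k1, k2, k3, k25, k22, k23, k27⟩
        refine ⟨k1, k2, k3, fun a ha ha' => ?_⟩
        rcases ha' with h | h | h
        · exact kfr a ha (by omega)
        · exact kfr a ha (by omega)
        · subst h; rw [k25, hne _ (by omega)]
    · rintro π ⟨k1, k2, k3, kfr⟩
      have k25 : π 25 0 = r := by rw [kfr 25 (by omega) (by omega), hne _ (by omega), g25]
      have k29 : π 29 0 = off := by rw [kfr 29 (by omega) (by omega), hne _ (by omega), g29]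
      have k8 : π 8 = σ 8 := by rw [kfr 8 (by omega) (by omega), hne _ (by omega), g8]
      have k32 : π 32 = σ 32 := by rw [kfr 32 (by omega) (by omega), hne _ (by omega), g32]
      have k40 : π 40 = σ 40 := by rw [kfr 40 (by omega) (by omega), hne _ (by omega), g40]
      have k100 : π 100 = σ 100 := by rw [kfr 100 (by omega) (by omega), hne _ (by omega), g100]
      apply Runs.set_seq_val (n := off + (r - 1) * K) hW1
        (by simp [k29, k25, k100, hK]; omega) (by simp [k29, k25, k100, hK])
      apply Runs.set_seq_val (n := 0) hW1 (by simp; omega) (by simp)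
      apply Runs.set_seq_val (n := K) hW1 (by simp; omega) (by simp [k100, hK])
      apply Runs.seq (copyCells_spec (dst := aHM) (src := aEv) (d := off + (r - 1) * K) (s := 0)
        (n := K) (by omega) (by omega) hW1 (by simp) (by simp) (by simp) (by omega) (by omega)
        (by omega))
      rintro α ⟨a1, a2, afr⟩
      have l40 : α 40 = σ 40 := by rw [afr 40 (by omega) (by omega)]; simp [k40]
      have l25 : α 25 0 = r := by rw [afr 25 (by omega) (by omega)]; simp [k25]
      have l8 : α 8 = σ 8 := by rw [afr 8 (by omega) (by omega)]; simp [k8]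
      simp only [Nat.zero_add, put_ne _ (show (9:ℕ) ≠ 12 by decide),
        put_ne _ (show (9:ℕ) ≠ 11 by decide), put_ne _ (show (9:ℕ) ≠ 10 by decide),
        put_ne _ (show (32:ℕ) ≠ 12 by decide), put_ne _ (show (32:ℕ) ≠ 11 by decide),
        put_ne _ (show (32:ℕ) ≠ 10 by decide), k32] at a1 a2
      apply Runs.store hW1 (by simp; omega) (by simp [l25]; omega)
      simp only [Expr.val_var, Expr.val_sub, Expr.val_one, l40, ho, l25,
        put_ne _ (show (9:ℕ) ≠ 8 by decide), put_same, l8]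
      refine ⟨fun x => ?_, fun l hl => ?_, ?_, fun x hx => ?_, trivial⟩
      · by_cases hx : x < off + (r - 1) * K ∨ off + (r - 1) * K + K ≤ x
        · rw [a2 x hx]; exact k1 x
        · obtain ⟨y, rfl⟩ := Nat.exists_eq_add_of_le (show off + (r - 1) * K ≤ x by omega)
          rw [a1 y (by omega)]; exact hE _ (by omega)
      · have h1 : l * K + K ≤ (r - 1) * K := row_le hl
        have e1 : vec pb K (α 9) (off + l * K) = vec pb K (π 9) (off + l * K) :=
          vec_congr fun c hc => a2 _ (by omega)
        have e2 : vec pb K (τ 23) 0 = vec pb K (σ 9) (off + j * K) :=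
          vec_congr fun c hc => by rw [Nat.zero_add]; exact hpv c hc
        rw [e1, k2 l hl, hu l (by omega), e2]
      · exact vec_congr fun c hc => by rw [Nat.zero_add]; exact a1 c hc
      · rw [a2 x (by omega), k3 x (by omega)]
        apply hother; omega
  · simp only [Expr.cost_mul, Expr.cost_var, Expr.cost_read, Expr.cost_add, Expr.cost_zero,
      Expr.cost_sub, Expr.cost_one, eP_cost, tElim]
    have := Nat.mul_le_mul_right (K * (2 * tFma pb.dim + 100) + tFma pb.dim + 200)
      (show r - 1 ≤ K by omega)
    nlinarith

/-- A bound for the running time of `cut`. -/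
def tCut (e K : ℕ) : ℕ := K * (tDot e K + 100) + tElim e K + 200

/-- The basis rows and the equations stay complementary: if the rank drops, the row that is no
longer needed for the basis takes the new equation. -/
theorem cut_spec {W : ℕ} (hW : 4 * (p ^ pb.dim) ^ 2 ≤ W) {σ : Mem} (env : HeapEnv pb K σ)
    {o : ℕ} (ho : σ vHp 0 = o) (hroom : (o + 1) * (K * K) < W)
    (hE : ∀ c < K, σ aEv c < p ^ pb.dim) (hwf : WF pb K (σ aHM) (σ aHR) o) :
    Runs W cut σ (tCut pb.dim K) (fun τ =>
      ((∀ x, τ aHM x < p ^ pb.dim) ∧ WF pb K (τ aHM) (τ aHR) o ∧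
      sp pb K (τ aHM) (τ aHR) o = sp pb K (σ aHM) (σ aHR) o ⊓ perp (vec pb K (σ aEv) 0) ∧
      SameBelow K o (σ aHM) (σ aHR) (τ aHM) (τ aHR)) ∧
      ∀ a, a < 8 ∨ 30 ≤ a → τ a = σ a) := by
  have hW1 := one_lt_of_le hW
  refine Runs.frame 8 30 rfl ?_
  have hrK := hwf.rank_le
  apply Runs.le
  · apply Runs.seq (cutDots_spec hW env ho hroom hrK hE)
    rintro τ ⟨⟨h29, h25, hD, hpiv⟩, hfr⟩
    have f8 := hfr 8 (by omega)
    have f9 := hfr 9 (by omega)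
    have f32 := hfr 32 (by omega)
    apply Runs.ite hW1 (by simp; omega)
    · intro h0
      have hlt : τ 26 0 < σ 8 o := by
        by_contra hc
        simp [h25, hc] at h0
      have hne : vec pb K (σ aEv) 0 ⬝ᵥ vec pb K (σ aHM) (o * (K * K) + τ vPiv 0 * K) ≠ 0 := by
        rcases hpiv with h | h
        · omega
        · exact h.2
      refine (cutElim_spec (pb := pb) (K := K) (r := σ 8 o) (j := τ 26 0) hW
        (env.congr (hfr 0 (by omega)) (hfr 1 (by omega)) (hfr 105 (by omega)) (hfr 100 (by omega))
          (by rw [f9]; exact env.cells)) (by rw [hfr 40 (by omega), ho]) hroom h29 h25 hrK rfl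
          hlt (by rw [f32]; exact hE)
          (fun l => vec pb K (σ aEv) 0 ⬝ᵥ vec pb K (σ aHM) (o * (K * K) + l * K)) hD).mono ?_
      rintro ρ ⟨⟨g1, g2, g3, g4, g5⟩, -⟩
      rw [f9] at g2
      rw [f32] at g3
      have hsp : sp pb K (ρ 9) (ρ 8) o =
          sp pb K (σ aHM) (σ aHR) o ⊓ perp (vec pb K (σ aEv) 0) := by
        have h8 : ρ 8 o = σ 8 o - 1 := by rw [g5, Function.update_self]
        rw [sp, h8, sp]
        refine span_cut _ (fun l => vec pb K (σ aHM) (o * (K * K) + l * K)) _ hlt hne ?_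
        intro l hl
        simp only [g2 l hl]
        split_ifs <;> rfl
      have hmem : vec pb K (σ aHM) (o * (K * K) + τ vPiv 0 * K) ∈ sp pb K (σ 9) (σ 8) o :=
        Submodule.subset_span ⟨τ vPiv 0, hlt, rfl⟩
      have h8 : ρ 8 o = σ 8 o - 1 := by rw [g5, Function.update_self]
      refine ⟨g1, ⟨by rw [h8]; omega, ?_, fun x => ?_⟩, hsp, ?_⟩
      · have := finrank_inf_perp _ hmem hne
        rw [hwf.finrank_eq] at this
        rw [hsp, h8]; omega
      · rw [hsp, Submodule.mem_inf, hwf.mem_iff, h8, mem_perp]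
        have hrow : ∀ l, σ 8 o ≤ l → vec pb K (ρ 9) (o * (K * K) + l * K) =
            vec pb K (σ 9) (o * (K * K) + l * K) := by
          intro l hl
          apply vec_congr
          intro c hc
          have := Nat.mul_le_mul_right K hl
          rw [g4 _ (by right; omega), f9]
        constructor
        · rintro ⟨h1, h2⟩ l hl hlK
          by_cases hlr : l = σ 8 o - 1
          · rw [hlr, g3]; exact h2
          · rw [hrow l (by omega)]; exact h1 l (by omega) hlK
        · intro h
          refine ⟨fun l hl hlK => ?_, ?_⟩
          · rw [← hrow l hl]; exact h l (by omega) hlK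
          · rw [← g3]; exact h _ le_rfl (by omega)
      · refine ⟨fun x hx => by rw [g4 x (by omega), f9], fun o' ho' => ?_⟩
        rw [g5, Function.update_of_ne (by omega), f8]
    · intro h0
      have hlt : ¬ τ 26 0 < σ 8 o := by
        intro hc
        simp [h25, hc] at h0
      have hz : ∀ l < σ 8 o,
          vec pb K (σ aEv) 0 ⬝ᵥ vec pb K (σ aHM) (o * (K * K) + l * K) = 0 := by
        rcases hpiv with h | h
        · exact h.2
        · omega
      apply Runs.skip
      rw [f8, f9]
      refine ⟨env.cells, hwf, ?_, SameBelow.refl _ _ _⟩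
      rw [eq_comm, inf_eq_left, sp, Submodule.span_le]
      rintro _ ⟨l, hl, rfl⟩
      exact hz l hl
  · simp only [Expr.cost_ltE, Expr.cost_var, tCut]
    omega

end

/-! ### Operations on stored subspaces -/

section

-- Loop variables `vJ` for the entries of a symbol, `vI` for coordinates, `vRow` for equations and
-- `vB` for positions in a list; arguments `vMA`, `vMB` of an intersection; result `vFound` of a
-- search; codes `aC` of the entries of the words that are combined.
notation "vJ" => (33 : ℕ)
notation "vI" => (34 : ℕ)
notation "vRow" => (35 : ℕ)
notation "vMA" => (36 : ℕ)
notation "vMB" => (37 : ℕ)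
notation "vFound" => (41 : ℕ)
notation "vB" => (42 : ℕ)
notation "aC" => (103 : ℕ)

/-- The block length `N`, as an expression. -/
def eN : Expr := .read 0 2

/-- The length `m` of a symbol, as an expression. -/
def eM : Expr := .read 0 3

@[simp] theorem eN_val (σ : Mem) : eN.val σ = σ 0 2 := rfl
@[simp] theorem eN_safe (W : ℕ) (σ : Mem) : eN.Safe W σ ↔ 2 < W := Iff.rfl
@[simp] theorem eN_cost : eN.cost = 2 := rfl
@[simp] theorem eM_val (σ : Mem) : eM.val σ = σ 0 3 := rfl
@[simp] theorem eM_safe (W : ℕ) (σ : Mem) : eM.Safe W σ ↔ 3 < W := Iff.rfl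
@[simp] theorem eM_cost : eM.cost = 2 := rfl

/-- Loads the equation that belongs to entry `vJ` of the symbol at coordinate `vI`. -/
def loadEq : Program :=
  .forLoop vC (var vK)
    (.store aEv (var vC) (.read aC (var vC * (eN * eM) + (var vI * eM + var vJ))))

/-- Intersects object `vHp` with the subspace that belongs to coordinate `vI`. -/
def cutCoord : Program := .forLoop vJ eM (loadEq ;; cut)

/-- Copies object `vMA` to object `vHp`. -/
def copyObj : Program :=
  .set vX (var vHp * (var vK * var vK)) ;; .set vY (var vMA * (var vK * var vK)) ;;
  .set vZ (var vK * var vK) ;; copyCells aHM aHM ;;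
  .store aHR (var vHp) (.read aHR (var vMA))

/-- Object `vHp` becomes the intersection of the objects `vMA` and `vMB`. -/
def meet : Program :=
  copyObj ;;
  .forLoop vRow (var vK - .read aHR (var vMB))
    (.set vX 0 ;;
     .set vY (var vMB * (var vK * var vK) + (.read aHR (var vMB) + var vRow) * var vK) ;;
     .set vZ (var vK) ;; copyCells aEv aHM ;; cut)

/-- Looks for an object that is equal to object `vMB` among the objects whose numbers are stored in
array `aI`, restricted to the positions below `vLen` at which array `aFl` is not zero. The position
found is stored in `vFound`, which is the value of `vLen` if there is none. -/
def find (aI aFl vLen : ℕ) : Program :=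
  .set vFound (var vLen) ;;
  .forLoop vB (var vLen)
    (.ite (.read aFl (var vB))
      (.set vMA (.read aI (var vB)) ;; meet ;;
       .ite (((Expr.read aHR (var vHp)).eqE (.read aHR (var vMB))) *
          ((Expr.read aHR (var vHp)).eqE (.read aHR (var vMA))))
        (.set vFound (var vB)) .skip)
      .skip)

variable {p : ℕ} [Fact p.Prime] {F : Type*} [Field F] [Algebra (ZMod p) F]

/-- The coefficient vector of the equation for entry `j` of the symbol at coordinate `i`. -/
noncomputable def eqVec (pb : PowerBasis (ZMod p) F) (K N m : ℕ) (C : ℕ → ℕ) (i j : ℕ) :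
    Fin K → F := fun l => dec pb (C (l * (N * m) + (i * m + j)))

/-- The subspace of all vectors of coefficients for which the combination of the stored words
vanishes at coordinate `i`. -/
noncomputable def coordSub (pb : PowerBasis (ZMod p) F) (K N m : ℕ) (C : ℕ → ℕ) (i : ℕ) :
    Submodule F (Fin K → F) := ⨅ j : Fin m, perp (eqVec pb K N m C i j)

variable {pb : PowerBasis (ZMod p) F} {K N m : ℕ}

theorem mem_coordSub {C : ℕ → ℕ} {i : ℕ} {x : Fin K → F} :
    x ∈ coordSub pb K N m C i ↔ ∀ j < m, eqVec pb K N m C i j ⬝ᵥ x = 0 := by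
  simp only [coordSub, Submodule.mem_iInf, mem_perp]
  exact ⟨fun h j hj => h ⟨j, hj⟩, fun h j => h j j.2⟩

/-- The memory holds the field, a heap, and an array of `K` words of length `N` over `F ^ m`. -/
structure CoordEnv (pb : PowerBasis (ZMod p) F) (K N m : ℕ) (σ : Mem) : Prop
    extends HeapEnv pb K σ where
  N_eq : σ 0 2 = N
  m_eq : σ 0 3 = m
  words : ∀ x, σ aC x < p ^ pb.dim

theorem CoordEnv.congr {σ τ : Mem} (h : CoordEnv pb K N m σ) (h0 : τ 0 = σ 0) (h1 : τ 1 = σ 1)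
    (h2 : τ aPow = σ aPow) (h3 : τ vK = σ vK) (h4 : ∀ x, τ aHM x < p ^ pb.dim)
    (h5 : τ aC = σ aC) : CoordEnv pb K N m τ :=
  ⟨h.toHeapEnv.congr h0 h1 h2 h3 h4, by rw [h0, h.N_eq], by rw [h0, h.m_eq],
    by rw [h5]; exact h.words⟩

/-- The words of the machine are large enough for the parameters of the input and for addresses in a
heap of `H` objects. -/
structure Room (pb : PowerBasis (ZMod p) F) (W K N m H : ℕ) : Prop where
  field : 4 * (p ^ pb.dim) ^ 2 ≤ W
  words : K * (N * m) < W
  heap : H * (K * K) < W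
  objects : H < W
  width_pos : 0 < K
  N_pos : 0 < N
  m_pos : 0 < m
  three_lt : 3 < W

theorem loadEq_spec {W H : ℕ} (hW : Room pb W K N m H) {σ : Mem} (env : CoordEnv pb K N m σ)
    {i j : ℕ} (hi : σ vI 0 = i) (hj : σ vJ 0 = j) (hiN : i < N) (hjm : j < m) :
    Runs W loadEq σ (K * 50 + 50) (fun τ =>
      ((∀ c < K, τ aEv c < p ^ pb.dim) ∧ vec pb K (τ aEv) 0 = eqVec pb K N m (σ aC) i j) ∧
      ∀ a, a ≠ vC → a ≠ aEv → τ a = σ a) := by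
  have hW1 := one_lt_of_le hW.field
  have h3 := hW.three_lt
  have hwords := hW.words
  have hij : i * m + j < N * m := by
    have := Nat.mul_le_mul_right m (show i + 1 ≤ N by omega)
    rw [Nat.succ_mul] at this
    omega
  have hKpos := hW.width_pos
  have hNm : N * m ≤ K * (N * m) := Nat.le_mul_of_pos_left _ hKpos
  have hKNm : K ≤ K * (N * m) :=
    Nat.le_mul_of_pos_right _ (Nat.mul_pos hW.N_pos hW.m_pos)
  apply Runs.le
  · apply Runs.forLoop 32 33 (n := K)
      (fun l τ => ∀ c < l, τ aEv c = σ aC (c * (N * m) + (i * m + j))) hW1 (by omega) rfl rfl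
    · simp
    · intro l τ hl hfr hv hI
      have h : τ 100 = σ 100 := hfr 100 (by omega) (by omega)
      simp [h, env.width]; omega
    · intro l τ hl hfr hv hI
      have f0 := hfr 0 (by omega) (by omega)
      have f33 := hfr 33 (by omega) (by omega)
      have f34 := hfr 34 (by omega) (by omega)
      have f103 := hfr 103 (by omega) (by omega)
      have hlN : l * (N * m) + N * m ≤ K * (N * m) := row_le hl
      apply Runs.store hW1 (by simp; omega)
      · simp [f0, f33, f34, hi, hj, hv, env.N_eq, env.m_eq]
        omega
      · intro c hc
        simp only [Expr.val_var, Expr.val_read, Expr.val_add, Expr.val_mul, eN_val, eM_val, f0, f33,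
          f34, f103, hi, hj, hv, env.N_eq, env.m_eq, put_ne _ (show (32:ℕ) ≠ 20 by decide),
          put_same]
        rw [Function.update_apply]
        split_ifs with h
        · rw [h]
        · exact hI c (by omega)
    · intro τ hfr hv hI
      refine ⟨⟨fun c hc => by rw [hI c hc]; exact env.words _, ?_⟩, fun a ha ha' =>
        hfr a ha (by omega)⟩
      funext c
      simp only [vec, eqVec, Nat.zero_add]
      rw [hI c c.2]
  · simp; omega

/-- A bound for the running time of `cutCoord`. -/
def tCoord (e K m : ℕ) : ℕ := m * (tCut e K + K * 50 + 100) + 100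

theorem cutCoord_spec {W H : ℕ} (hW : Room pb W K N m H) {σ : Mem} (env : CoordEnv pb K N m σ)
    {o i : ℕ} (ho : σ vHp 0 = o) (hoH : o < H) (hi : σ vI 0 = i) (hiN : i < N)
    (hwf : WF pb K (σ aHM) (σ aHR) o) :
    Runs W cutCoord σ (tCoord pb.dim K m) (fun τ =>
      ((∀ x, τ aHM x < p ^ pb.dim) ∧ WF pb K (τ aHM) (τ aHR) o ∧
      sp pb K (τ aHM) (τ aHR) o = sp pb K (σ aHM) (σ aHR) o ⊓ coordSub pb K N m (σ aC) i ∧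
      SameBelow K o (σ aHM) (σ aHR) (τ aHM) (τ aHR)) ∧
      ∀ a, a < 8 ∨ 34 ≤ a → τ a = σ a) := by
  have hW1 := one_lt_of_le hW.field
  have h3 := hW.three_lt
  have hheap := hW.heap
  have hobj := hW.objects
  refine Runs.frame 8 34 rfl ?_
  have hroom : (o + 1) * (K * K) < W := (Nat.mul_le_mul_right _ hoH).trans_lt hheap
  have hmW : m < W := by
    have h1 : m ≤ N * m := Nat.le_mul_of_pos_left _ hW.N_pos
    have h2 : N * m ≤ K * (N * m) := Nat.le_mul_of_pos_left _ hW.width_pos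
    have := hW.words
    omega
  apply Runs.le
  · apply Runs.forLoop 8 33 (n := m) (fun j τ => (∀ x, τ aHM x < p ^ pb.dim) ∧
      WF pb K (τ aHM) (τ aHR) o ∧
      (∀ x, x ∈ sp pb K (τ aHM) (τ aHR) o ↔ x ∈ sp pb K (σ aHM) (σ aHR) o ∧
        ∀ j' < j, eqVec pb K N m (σ aC) i j' ⬝ᵥ x = 0) ∧
      SameBelow K o (σ aHM) (σ aHR) (τ aHM) (τ aHR)) hW1 hmW rfl rfl
    · simpa using ⟨env.cells, hwf, SameBelow.refl _ _ _⟩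
    · intro j τ hj hfr hv hI
      have h : τ 0 = σ 0 := hfr 0 (by omega) (by omega)
      simp [h, env.m_eq]; omega
    · rintro j τ hj hfr hv ⟨h1, h2, h4, h5⟩
      have te : CoordEnv pb K N m τ := env.congr (hfr 0 (by omega) (by omega))
        (hfr 1 (by omega) (by omega)) (hfr 105 (by omega) (by omega))
        (hfr 100 (by omega) (by omega)) h1 (hfr 103 (by omega) (by omega))
      apply Runs.seq (loadEq_spec hW te (by rw [hfr 34 (by omega) (by omega), hi]) hv hiN hj)
      rintro ρ ⟨⟨g1, g2⟩, gfr⟩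
      have g9 := gfr 9 (by omega) (by omega)
      have g8 := gfr 8 (by omega) (by omega)
      refine (cut_spec hW.field (te.toHeapEnv.congr (gfr 0 (by omega) (by omega))
        (gfr 1 (by omega) (by omega)) (gfr 105 (by omega) (by omega))
        (gfr 100 (by omega) (by omega))
        (by rw [g9]; exact h1))
        (by rw [gfr 40 (by omega) (by omega), hfr 40 (by omega) (by omega), ho]) hroom
        g1 (by rw [g9, g8]; exact h2)).mono ?_
      rintro π ⟨⟨k1, k2, k3, k4⟩, -⟩
      simp only [put_ne _ (show (9:ℕ) ≠ 33 by decide), put_ne _ (show (8:ℕ) ≠ 33 by decide)]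
      rw [g8, g9] at k3 k4
      refine ⟨k1, k2, fun x => ?_, h5.trans k4⟩
      rw [k3, Submodule.mem_inf, h4, g2, mem_perp, hfr 103 (by omega) (by omega)]
      constructor
      · rintro ⟨⟨ha, hb⟩, hc⟩
        refine ⟨ha, fun j' hj' => ?_⟩
        rcases Nat.lt_succ_iff_lt_or_eq.mp hj' with h | rfl
        · exact hb j' h
        · exact hc
      · rintro ⟨ha, hb⟩
        exact ⟨⟨ha, fun j' hj' => hb j' (by omega)⟩, hb j (by omega)⟩
    · rintro τ hfr hv ⟨h1, h2, h4, h5⟩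
      refine ⟨h1, h2, ?_, h5⟩
      ext x
      rw [h4, Submodule.mem_inf, mem_coordSub]
  · simp only [eM_cost, tCoord]
    nlinarith

theorem copyObj_spec {W H : ℕ} (hW : Room pb W K N m H) {σ : Mem} (env : HeapEnv pb K σ)
    {o a : ℕ} (ho : σ vHp 0 = o) (hoH : o < H) (ha : σ vMA 0 = a) (hao : a < o)
    (hwf : WF pb K (σ aHM) (σ aHR) a) :
    Runs W copyObj σ (K * K * 30 + 100) (fun τ =>
      ((∀ x, τ aHM x < p ^ pb.dim) ∧ WF pb K (τ aHM) (τ aHR) o ∧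
      sp pb K (τ aHM) (τ aHR) o = sp pb K (σ aHM) (σ aHR) a ∧
      SameBelow K o (σ aHM) (σ aHR) (τ aHM) (τ aHR)) ∧
      ∀ a, a < 8 ∨ 21 ≤ a → τ a = σ a) := by
  have hW1 := one_lt_of_le hW.field
  have h3 := hW.three_lt
  have hheap := hW.heap
  have hobj := hW.objects
  refine Runs.frame 8 21 rfl ?_
  have hroom : (o + 1) * (K * K) < W := (Nat.mul_le_mul_right _ hoH).trans_lt hheap
  rw [Nat.succ_mul] at hroom
  have hao' : a * (K * K) + K * K ≤ o * (K * K) := row_le hao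
  have hKK := le_mul_self' K
  have hK := env.width
  apply Runs.le
  · apply Runs.set_seq_val (n := o * (K * K)) hW1 (by simp [ho, hK]; omega) (by simp [ho, hK])
    apply Runs.set_seq_val (n := a * (K * K)) hW1 (by simp [ha, hK]; omega) (by simp [ha, hK])
    apply Runs.set_seq_val (n := K * K) hW1 (by simp [hK]; omega) (by simp [hK])
    apply Runs.seq (copyCells_spec (dst := aHM) (src := aHM) (d := o * (K * K))
      (s := a * (K * K)) (n := K * K) (by omega) (by omega) hW1 (by simp) (by simp) (by simp)
      (by omega) (by omega) (by omega))
    rintro τ ⟨h1, h2, hfr⟩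
    simp only [put_ne _ (show (9:ℕ) ≠ 12 by decide), put_ne _ (show (9:ℕ) ≠ 11 by decide),
      put_ne _ (show (9:ℕ) ≠ 10 by decide)] at h1 h2
    have f40 : τ 40 = σ 40 := by rw [hfr 40 (by omega) (by omega)]; simp
    have f36 : τ 36 = σ 36 := by rw [hfr 36 (by omega) (by omega)]; simp
    have f8 : τ 8 = σ 8 := by rw [hfr 8 (by omega) (by omega)]; simp
    apply Runs.store hW1 (by simp; omega) (by simp; omega)
    simp only [Expr.val_var, Expr.val_read, f40, f36, f8, ho, ha, put_same,
      put_ne _ (show (9:ℕ) ≠ 8 by decide)]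
    refine ⟨fun x => ?_, hwf.congr h1 (by simp), sp_congr hwf.rank_le h1 (by simp),
      ⟨fun x hx => h2 x (Or.inl hx), fun o' ho' => by rw [Function.update_of_ne (by omega)]⟩⟩
    by_cases hx : x < o * (K * K) ∨ o * (K * K) + K * K ≤ x
    · rw [h2 x hx]; exact env.cells x
    · obtain ⟨y, rfl⟩ := Nat.exists_eq_add_of_le (show o * (K * K) ≤ x by omega)
      rw [h1 y (by omega)]; exact env.cells _
  · simp; omega

/-- A bound for the running time of `meet`. -/
def tMeet (e K : ℕ) : ℕ := K * K * 30 + K * (tCut e K + K * 30 + 200) + 200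

/-- The first subspace is cut with the equations of the second one, one by one. -/
theorem meet_spec {W H : ℕ} (hW : Room pb W K N m H) {σ : Mem} (env : HeapEnv pb K σ)
    {o a b : ℕ} (ho : σ vHp 0 = o) (hoH : o < H) (ha : σ vMA 0 = a) (hao : a < o)
    (hb : σ vMB 0 = b) (hbo : b < o)
    (hwfa : WF pb K (σ aHM) (σ aHR) a) (hwfb : WF pb K (σ aHM) (σ aHR) b) :
    Runs W meet σ (tMeet pb.dim K) (fun τ =>
      ((∀ x, τ aHM x < p ^ pb.dim) ∧ WF pb K (τ aHM) (τ aHR) o ∧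
      sp pb K (τ aHM) (τ aHR) o = sp pb K (σ aHM) (σ aHR) a ⊓ sp pb K (σ aHM) (σ aHR) b ∧
      SameBelow K o (σ aHM) (σ aHR) (τ aHM) (τ aHR)) ∧
      ∀ a, a < 8 ∨ 36 ≤ a → τ a = σ a) := by
  have hW1 := one_lt_of_le hW.field
  have h3 := hW.three_lt
  have hheap := hW.heap
  have hobj := hW.objects
  refine Runs.frame 8 36 rfl ?_
  have hroom : (o + 1) * (K * K) < W := (Nat.mul_le_mul_right _ hoH).trans_lt hheap
  have hroom' := hroom
  rw [Nat.succ_mul] at hroom'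
  have hbo' : b * (K * K) + K * K ≤ o * (K * K) := row_le hbo
  have hKK := le_mul_self' K
  have hrb := hwfb.rank_le
  apply Runs.le
  · apply Runs.seq (copyObj_spec hW env ho hoH ha hao hwfa)
    rintro τ ⟨⟨h1, h2, h4, h5⟩, hfr⟩
    have f100 : τ 100 0 = K := by rw [hfr 100 (by omega), env.width]
    have f37 : τ 37 0 = b := by rw [hfr 37 (by omega), hb]
    have f8 : τ 8 b = σ 8 b := h5.rank b hbo
    -- After `j` rounds the object is the first subspace, cut with `j` equations of the second one.
    apply Runs.forLoop 8 33 (n := K - σ 8 b) (fun j ρ => (∀ x, ρ aHM x < p ^ pb.dim) ∧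
      WF pb K (ρ aHM) (ρ aHR) o ∧
      (∀ x, x ∈ sp pb K (ρ aHM) (ρ aHR) o ↔ x ∈ sp pb K (σ aHM) (σ aHR) a ∧
        ∀ l < j, vec pb K (σ aHM) (b * (K * K) + (σ 8 b + l) * K) ⬝ᵥ x = 0) ∧
      SameBelow K o (σ aHM) (σ aHR) (ρ aHM) (ρ aHR)) hW1 (by omega) rfl rfl
    · simp only [put_ne _ (show (9:ℕ) ≠ 35 by decide), put_ne _ (show (8:ℕ) ≠ 35 by decide), h4]
      exact ⟨h1, h2, by simp, h5⟩
    · rintro j ρ hj gfr hv ⟨-, -, -, g5⟩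
      have e1 : ρ 100 0 = K := by rw [gfr 100 (by omega) (by omega), f100]
      have e2 : ρ 37 0 = b := by rw [gfr 37 (by omega) (by omega), f37]
      have e3 := g5.rank b hbo
      simp [e1, e2, e3]; omega
    · rintro j ρ hj gfr hv ⟨g1, g2, g4, g5⟩
      have e1 : ρ 100 0 = K := by rw [gfr 100 (by omega) (by omega), f100]
      have e2 : ρ 37 0 = b := by rw [gfr 37 (by omega) (by omega), f37]
      have e3 := g5.rank b hbo
      have hrow : (σ 8 b + j) * K + K ≤ K * K := row_le (by omega)
      apply Runs.set_seq_val (n := 0) hW1 (by simp; omega) rfl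
      apply Runs.set_seq_val (n := b * (K * K) + (σ 8 b + j) * K) hW1
        (by
          simp [e1, e2, e3, hv]
          refine ⟨⟨?_, ?_, ?_⟩, ⟨⟨?_, ?_⟩, ?_, ?_⟩, ?_⟩ <;> omega)
        (by simp [e1, e2, e3, hv])
      apply Runs.set_seq_val (n := K) hW1 (by simp; omega) (by simp [e1])
      apply Runs.seq (copyCells_spec (dst := aEv) (src := aHM) (d := 0)
        (s := b * (K * K) + (σ 8 b + j) * K) (n := K) (by omega) (by omega) hW1 (by simp) (by simp)
        (by simp) (by omega) (by omega) (by omega))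
      rintro π ⟨k1, -, kfr⟩
      simp only [put_ne _ (show (9:ℕ) ≠ 12 by decide), put_ne _ (show (9:ℕ) ≠ 11 by decide),
        put_ne _ (show (9:ℕ) ≠ 10 by decide), Nat.zero_add] at k1
      have k9 : π 9 = ρ 9 := by rw [kfr 9 (by omega) (by omega)]; simp
      have k8 : π 8 = ρ 8 := by rw [kfr 8 (by omega) (by omega)]; simp
      have kc : ∀ c < K, π 32 c = σ 9 (b * (K * K) + (σ 8 b + j) * K + c) := by
        intro c hc
        rw [k1 c hc]
        apply g5.mat
        omega
      have hkeep : ∀ x, x < 8 ∨ 36 ≤ x → π x = σ x := by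
        intro x hx
        rw [kfr x (by omega) (by omega), put_ne _ (by omega), put_ne _ (by omega),
          put_ne _ (by omega), gfr x (by omega) (by omega), hfr x (by omega)]
      refine (cut_spec hW.field (env.congr (hkeep 0 (by omega)) (hkeep 1 (by omega))
        (hkeep 105 (by omega)) (hkeep 100 (by omega)) (by rw [k9]; exact g1))
        (by rw [hkeep 40 (by omega), ho]) hroom
        (fun c hc => by rw [kc c hc]; exact env.cells _) (by rw [k9, k8]; exact g2)).mono ?_
      rintro α ⟨⟨a1, a2, a3, a4⟩, -⟩
      simp only [put_ne _ (show (9:ℕ) ≠ 35 by decide), put_ne _ (show (8:ℕ) ≠ 35 by decide)]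
      rw [k8, k9] at a3 a4
      refine ⟨a1, a2, fun x => ?_, g5.trans a4⟩
      have hvec : vec pb K (π 32) 0 = vec pb K (σ 9) (b * (K * K) + (σ 8 b + j) * K) :=
        vec_congr fun c hc => by rw [Nat.zero_add, kc c hc]
      rw [a3, Submodule.mem_inf, g4, mem_perp, hvec]
      constructor
      · rintro ⟨⟨ha, hb⟩, hc⟩
        refine ⟨ha, fun j' hj' => ?_⟩
        rcases Nat.lt_succ_iff_lt_or_eq.mp hj' with h | rfl
        · exact hb j' h
        · exact hc
      · rintro ⟨ha, hb⟩
        exact ⟨⟨ha, fun j' hj' => hb j' (by omega)⟩, hb j (by omega)⟩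
    · rintro ρ gfr hv ⟨g1, g2, g4, g5⟩
      refine ⟨g1, g2, ?_, g5⟩
      ext x
      rw [g4, Submodule.mem_inf, hwfb.mem_iff]
      refine and_congr_right fun _ =>
        ⟨fun h l hl hlK => ?_, fun h l hl => h _ (by omega) (by omega)⟩
      obtain ⟨l', rfl⟩ := Nat.exists_eq_add_of_le hl
      exact h l' (by omega)
  · simp only [Expr.cost_mul, Expr.cost_var, Expr.cost_read, Expr.cost_add, Expr.cost_zero,
      Expr.cost_sub, tMeet]
    have := Nat.mul_le_mul_right (tCut pb.dim K + K * 30 + 200) (show K - σ 8 b ≤ K by omega)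
    nlinarith

/-- A bound for the running time of `find` on `n` positions. -/
def tFind (e K n : ℕ) : ℕ := n * (tMeet e K + 200) + 100

/-- Two subspaces are equal if and only if their ranks are both equal to the rank of their
intersection, which is computed in the first free place of the heap. -/
theorem find_spec {W H : ℕ} (hW : Room pb W K N m H) {σ : Mem} (env : HeapEnv pb K σ)
    {o s n aI aFl vLen : ℕ} (ho : σ vHp 0 = o) (hoH : o < H) (hs : σ vMB 0 = s) (hso : s < o)
    (hI : 42 < aI) (hFl : 42 < aFl) (hLen : 42 < vLen) (hn : σ vLen 0 = n) (hnW : n < W)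
    (hwfs : WF pb K (σ aHM) (σ aHR) s)
    (hids : ∀ b < n, σ aFl b ≠ 0 → σ aI b < o ∧ WF pb K (σ aHM) (σ aHR) (σ aI b)) :
    Runs W (find aI aFl vLen) σ (tFind pb.dim K n) (fun τ =>
      ((∀ x, τ aHM x < p ^ pb.dim) ∧
      ((τ vFound 0 = n ∧ ∀ b < n, σ aFl b ≠ 0 →
        sp pb K (σ aHM) (σ aHR) (σ aI b) ≠ sp pb K (σ aHM) (σ aHR) s) ∨
       (τ vFound 0 < n ∧ σ aFl (τ vFound 0) ≠ 0 ∧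
        sp pb K (σ aHM) (σ aHR) (σ aI (τ vFound 0)) = sp pb K (σ aHM) (σ aHR) s)) ∧
      SameBelow K o (σ aHM) (σ aHR) (τ aHM) (τ aHR)) ∧
      ∀ a, a < 8 ∨ (36 < a ∧ a < 41) ∨ 42 < a → τ a = σ a) := by
  have hW1 := one_lt_of_le hW.field
  have h3 := hW.three_lt
  have hobj := hW.objects
  have hmw : ∀ {lo hi}, lo ≤ 8 → 42 ≤ hi → Program.writesIn lo hi
      (.ite (.read aFl (var vB))
      (.set vMA (.read aI (var vB)) ;; meet ;;
       .ite (((Expr.read aHR (var vHp)).eqE (.read aHR (var vMB))) *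
          ((Expr.read aHR (var vHp)).eqE (.read aHR (var vMA))))
        (.set vFound (var vB)) .skip)
      .skip) = true := by
    intro lo hi h1 h2
    exact Program.writesIn_mono (lo := 8) (hi := 42) h1 h2 rfl
  apply Runs.le
  · apply Runs.set_seq_val (n := n) hW1 (by simp; omega) (by simp [hn])
    apply Runs.forLoop 8 42 (n := n) (fun i τ => (∀ x, τ aHM x < p ^ pb.dim) ∧
      ((τ vFound 0 = n ∧ ∀ b < i, σ aFl b ≠ 0 →
        sp pb K (σ aHM) (σ aHR) (σ aI b) ≠ sp pb K (σ aHM) (σ aHR) s) ∨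
       (τ vFound 0 < n ∧ σ aFl (τ vFound 0) ≠ 0 ∧
        sp pb K (σ aHM) (σ aHR) (σ aI (τ vFound 0)) = sp pb K (σ aHM) (σ aHR) s)) ∧
      SameBelow K o (σ aHM) (σ aHR) (τ aHM) (τ aHR) ∧
      ∀ a, 36 < a → a < 41 → τ a = σ a) hW1 hnW (hmw le_rfl le_rfl) rfl
    · refine ⟨by simpa using env.cells, Or.inl (by simp), by simpa using SameBelow.refl _ _ _, ?_⟩
      intro a h1 h2
      rw [put_ne _ (by omega), put_ne _ (by omega)]
    · intro i τ hi hfr hv _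
      have h : τ vLen = σ vLen := by rw [hfr _ (by omega) (by omega), put_ne _ (by omega)]
      simp [h, hn]; omega
    · rintro i τ hi hfr hv ⟨h1, h2, h4, h5⟩
      have hkeep : ∀ x, x < 8 ∨ (36 < x ∧ x < 41) ∨ 42 < x → τ x = σ x := by
        intro x hx
        by_cases hx' : 36 < x ∧ x < 41
        · exact h5 x hx'.1 hx'.2
        · rw [hfr x (by omega) (by omega), put_ne _ (by omega)]
      have fFl : τ aFl = σ aFl := hkeep _ (by omega)
      have fI : τ aI = σ aI := hkeep _ (by omega)
      have te : HeapEnv pb K τ := env.congr (hkeep 0 (by omega)) (hkeep 1 (by omega))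
        (hkeep 105 (by omega)) (hkeep 100 (by omega)) h1
      apply Runs.ite hW1 (by simp; omega)
      · intro h0
        simp [hv, fFl] at h0
        obtain ⟨hid, hwf⟩ := hids i hi h0
        apply Runs.set_seq_val (n := σ aI i) hW1 (by simp; omega) (by simp [hv, fI])
        apply Runs.seq (meet_spec (a := σ aI i) (b := s) hW
          (te.congr (by simp) (by simp) (by simp) (by simp) (by simpa using h1))
          (by simp [hkeep 40, ho]) hoH (by simp) hid (by simp [hkeep 37, hs]) hso
          (by simpa using h4.wf hid hwf) (by simpa using h4.wf hso hwfs))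
        rintro ρ ⟨⟨g1, g2, g3, g4⟩, gfr⟩
        simp only [put_ne _ (show (9:ℕ) ≠ 36 by decide), put_ne _ (show (8:ℕ) ≠ 36 by decide)]
          at g3 g4
        rw [h4.sp_eq hid hwf, h4.sp_eq hso hwfs] at g3
        have gsame := h4.trans g4
        have g40 : ρ 40 0 = o := by rw [gfr 40 (by omega)]; simp [hkeep 40, ho]
        have g37 : ρ 37 0 = s := by rw [gfr 37 (by omega)]; simp [hkeep 37, hs]
        have g36 : ρ 36 0 = σ aI i := by rw [gfr 36 (by omega)]; simp
        have g42 : ρ 42 0 = i := by rw [gfr 42 (by omega)]; simp [hv]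
        have g41 : ρ 41 = τ 41 := by rw [gfr 41 (by omega)]; simp
        have grs : ρ 8 s = σ 8 s := gsame.rank s hso
        have gri : ρ 8 (σ aI i) = σ 8 (σ aI i) := gsame.rank _ hid
        have hrank : Module.finrank F (sp pb K (σ 9) (σ 8) (σ aI i) ⊓ sp pb K (σ 9) (σ 8) s :
            Submodule F (Fin K → F)) = ρ 8 o := by rw [← g3, g2.finrank_eq]
        have hkeep' : ∀ x, 36 < x → x < 41 → ρ x = σ x := by
          intro x hx hx'
          rw [gfr x (by omega), put_ne _ (by omega)]; exact h5 x hx hx'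
        apply Runs.ite hW1
        · simp [g40, g37, g36]
          split_ifs <;> omega
        · intro h0'
          have heq : ρ 8 o = σ 8 s ∧ ρ 8 o = σ 8 (σ aI i) := by
            by_contra hc
            apply h0'
            simp [g40, g37, g36, grs, gri]
            tauto
          have e1 : sp pb K (σ 9) (σ 8) (σ aI i) = sp pb K (σ 9) (σ 8) s := by
            have i1 := Submodule.eq_of_le_of_finrank_eq (inf_le_left :
              sp pb K (σ 9) (σ 8) (σ aI i) ⊓ sp pb K (σ 9) (σ 8) s ≤ _)
              (by rw [hrank, hwf.finrank_eq, heq.2])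
            have i2 := Submodule.eq_of_le_of_finrank_eq (inf_le_right :
              sp pb K (σ 9) (σ 8) (σ aI i) ⊓ sp pb K (σ 9) (σ 8) s ≤ _)
              (by rw [hrank, hwfs.finrank_eq, heq.1])
            rw [← i1, i2]
          apply Runs.set hW1 (by simp; omega)
          refine ⟨by simpa using g1, Or.inr ?_, by simpa using gsame, fun a ha ha' => ?_⟩
          · simpa [g42] using ⟨hi, h0, e1⟩
          · rw [put_ne _ (by omega), put_ne _ (by omega)]; exact hkeep' a ha ha'
        · intro h0'
          have hne : sp pb K (σ 9) (σ 8) (σ aI i) ≠ sp pb K (σ 9) (σ 8) s := by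
            intro hc
            have e1 : ρ 8 o = σ 8 s := by
              rw [← hrank, hc, inf_idem, hwfs.finrank_eq]
            have e2 : ρ 8 o = σ 8 (σ aI i) := by
              rw [← hrank, ← hc, inf_idem, hwf.finrank_eq]
            simp [g40, g37, g36, grs, gri, e1, e2.symm.trans e1] at h0'
          apply Runs.skip
          refine ⟨by simpa using g1, ?_, by simpa using gsame, fun a ha ha' => ?_⟩
          · simp only [put_ne _ (show (41:ℕ) ≠ 42 by decide), g41]
            rcases h2 with ⟨h2, h2'⟩ | h2
            · refine Or.inl ⟨h2, fun b hb hb0 => ?_⟩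
              rcases Nat.lt_succ_iff_lt_or_eq.mp hb with h | rfl
              · exact h2' b h hb0
              · exact hne
            · exact Or.inr h2
          · rw [put_ne _ (by omega)]; exact hkeep' a ha ha'
      · intro h0
        simp [hv, fFl] at h0
        apply Runs.skip
        refine ⟨by simpa using h1, ?_, by simpa using h4, fun a ha ha' => ?_⟩
        · simp only [put_ne _ (show (41:ℕ) ≠ 42 by decide)]
          rcases h2 with ⟨h2, h2'⟩ | h2
          · refine Or.inl ⟨h2, fun b hb hb0 => ?_⟩
            rcases Nat.lt_succ_iff_lt_or_eq.mp hb with h | rfl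
            · exact h2' b h hb0
            · exact absurd h0 hb0
          · exact Or.inr h2
        · rw [put_ne _ (by omega)]; exact h5 a ha ha'
    · rintro τ hfr hv ⟨h1, h2, h4, h5⟩
      refine ⟨⟨h1, h2, h4⟩, fun a ha => ?_⟩
      by_cases ha' : 36 < a ∧ a < 41
      · exact h5 a ha'.1 ha'.2
      · rw [hfr a (by omega) (by omega), put_ne _ (by omega)]
  · simp only [Expr.cost_mul, Expr.cost_var, Expr.cost_read, Expr.cost_eqE, tFind]
    nlinarith

end

/-! ### Grouping a stream of subspaces -/

section

section grouping

variable {F : Type*} [Field F] {V : Type*} [AddCommGroup V] [Module F V]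

open Classical in
/-- The number of members with index in `[lo, hi)` of a family of subspaces that contain `x`. -/
noncomputable def depth (S : ℕ → Submodule F V) (x : V) (lo hi : ℕ) : ℕ :=
  #{o ∈ Ico lo hi | x ∈ S o}

theorem depth_self (S : ℕ → Submodule F V) (x : V) (lo : ℕ) : depth S x lo lo = 0 := by
  simp [depth]

theorem sum_update_range (C : ℕ → ℕ) {T b : ℕ} (hb : b < T) (v : ℕ) :
    ∑ i ∈ range T, Function.update C b v i + C b = ∑ i ∈ range T, C i + v := by
  rw [sum_update_of_mem (mem_range.mpr hb), sdiff_singleton_eq_erase,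
    ← add_sum_erase _ C (mem_range.mpr hb)]
  omega

open Classical in
theorem depth_le (S : ℕ → Submodule F V) (x : V) (lo hi : ℕ) : depth S x lo hi ≤ hi - lo :=
  (card_filter_le _ _).trans (by simp)

open Classical in
theorem depth_succ (S : ℕ → Submodule F V) (x : V) {lo hi : ℕ} (h : lo ≤ hi) :
    depth S x lo (hi + 1) = depth S x lo hi + if x ∈ S hi then 1 else 0 := by
  rw [depth, ← Finset.insert_Ico_right_eq_Ico_add_one h, filter_insert]
  split_ifs
  · rw [card_insert_of_notMem (by simp), depth]
  · rfl

theorem depth_add (S : ℕ → Submodule F V) (x : V) {lo mid hi : ℕ} (h : lo ≤ mid) (h' : mid ≤ hi) :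
    depth S x lo hi = depth S x lo mid + depth S x mid hi := by
  induction hi, h' using Nat.le_induction with
  | base => rw [depth_self, add_zero]
  | succ n hn ih => rw [depth_succ S x (h.trans hn), depth_succ S x hn, ih, add_assoc]

theorem depth_congr {S S' : ℕ → Submodule F V} {x : V} {lo hi : ℕ}
    (h : ∀ o, lo ≤ o → o < hi → S' o = S o) : depth S' x lo hi = depth S x lo hi := by
  classical
  unfold depth
  congr 1
  refine filter_congr fun o ho => ?_
  rw [mem_Ico] at ho
  rw [h o ho.1 ho.2]

theorem exists_of_depth_pos {S : ℕ → Submodule F V} {x : V} {lo hi : ℕ}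
    (h : 0 < depth S x lo hi) : ∃ o, lo ≤ o ∧ o < hi ∧ x ∈ S o := by
  classical
  obtain ⟨o, ho⟩ := card_pos.mp h
  rw [mem_filter, mem_Ico] at ho
  exact ⟨o, ho.1.1, ho.1.2, ho.2⟩

open Classical in
/-- The number of copies of members containing `x` that are kept in the buckets. -/
noncomputable def bucketDepth (S : ℕ → Submodule F V) (x : V) (T : ℕ) (I C : ℕ → ℕ) : ℕ :=
  ∑ b ∈ range T, if x ∈ S (I b) then C b else 0

/-- The state after the first `j` members of the stream with indices in `[s₀, s₁)` have been
distributed into `T` buckets. Bucket `b` stands for `C b` copies of the subspace `S (I b)`, and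
different buckets in use contain different subspaces. `B` groups of `T` different subspaces have
been removed; for each of them, the intersections of any two of its members have been written to
the next stream, which occupies the indices in `[s₁, hp)`. A subspace in a removed group is charged
to the next stream, except for one per group (`cover`). -/
structure Grouped (S : ℕ → Submodule F V) (s₀ s₁ T j hp : ℕ) (I C : ℕ → ℕ) (B : ℕ) : Prop where
  ids : ∀ b < T, C b ≠ 0 → s₀ ≤ I b ∧ I b < s₁
  distinct : ∀ b < T, ∀ b' < T, b ≠ b' → C b ≠ 0 → C b' ≠ 0 → S (I b) ≠ S (I b')
  count : B * T + ∑ b ∈ range T, C b = j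
  next_eq : hp = s₁ + B * ∑ b ∈ range T, b
  cover : ∀ x, depth S x s₀ (s₀ + j) ≤ bucketDepth S x T I C + depth S x s₁ hp + B

variable {S S' : ℕ → Submodule F V} {s₀ s₁ T j hp hp' : ℕ} {I C I' C' : ℕ → ℕ} {B : ℕ}

theorem Grouped.next_le (h : Grouped S s₀ s₁ T j hp I C B) : s₁ ≤ hp := by
  have := h.next_eq
  omega

theorem bucketDepth_congr {x : V} (hS : ∀ b < T, C b ≠ 0 → (S' (I' b) = S (I b)))
    (hC : ∀ b < T, C' b = C b) : bucketDepth S' x T I' C' = bucketDepth S x T I C := by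
  classical
  refine sum_congr rfl fun b hb => ?_
  rw [mem_range] at hb
  rw [hC b hb]
  by_cases h0 : C b = 0
  · simp [h0]
  · rw [hS b hb h0]

theorem Grouped.congr (h : Grouped S s₀ s₁ T j hp I C B) (hj : s₀ + j ≤ s₁)
    (hS : ∀ o < hp, S' o = S o) (hI : ∀ b < T, I' b = I b) (hC : ∀ b < T, C' b = C b) :
    Grouped S' s₀ s₁ T j hp I' C' B := by
  have hle := h.next_le
  refine ⟨fun b hb h0 => ?_, fun b hb b' hb' hne h0 h0' => ?_, ?_, h.next_eq, fun x => ?_⟩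
  · rw [hI b hb]; rw [hC b hb] at h0; exact h.ids b hb h0
  · rw [hC b hb] at h0
    rw [hC b' hb'] at h0'
    rw [hI b hb, hI b' hb', hS _ ((h.ids b hb h0).2.trans_le hle),
      hS _ ((h.ids b' hb' h0').2.trans_le hle)]
    exact h.distinct b hb b' hb' hne h0 h0'
  · rw [← h.count, sum_congr rfl fun b hb => hC b (mem_range.mp hb)]
  · rw [depth_congr fun o _ ho => hS o (by omega), depth_congr fun o _ ho => hS o ho,
      bucketDepth_congr (S := S) (I := I) (C := C) ?_ hC]
    · exact h.cover x
    · intro b hb h0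
      rw [hI b hb]
      exact hS _ ((h.ids b hb h0).2.trans_le hle)

theorem Grouped.init (S : ℕ → Submodule F V) {s₀ s₁ T : ℕ} (I : ℕ → ℕ) {C : ℕ → ℕ}
    (hC : ∀ b < T, C b = 0) : Grouped S s₀ s₁ T 0 s₁ I C 0 := by
  refine ⟨fun b hb h => absurd (hC b hb) h, fun b hb _ _ _ h => absurd (hC b hb) h, ?_, by simp,
    fun x => by simp [depth_self]⟩
  rw [zero_mul, zero_add]
  exact sum_eq_zero fun b hb => hC b (mem_range.mp hb)

/-- The next member of the stream goes to a bucket with the same subspace. -/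
theorem Grouped.add_found (h : Grouped S s₀ s₁ T j hp I C B) {b : ℕ} (hb : b < T)
    (h0 : C b ≠ 0) (hS : S (I b) = S (s₀ + j)) :
    Grouped S s₀ s₁ T (j + 1) hp I (Function.update C b (C b + 1)) B := by
  classical
  have hup : ∀ b', Function.update C b (C b + 1) b' ≠ 0 → C b' ≠ 0 := by
    intro b' h'
    rw [Function.update_apply] at h'
    split_ifs at h' with hbb
    · rw [hbb]; exact h0
    · exact h'
  refine ⟨fun b' hb' h' => h.ids b' hb' (hup b' h'), fun b₁ hb₁ b₂ hb₂ hne h₁ h₂ =>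
    h.distinct b₁ hb₁ b₂ hb₂ hne (hup _ h₁) (hup _ h₂), ?_, h.next_eq, fun x => ?_⟩
  · have h1 := sum_update_range C hb (C b + 1)
    have h2 := h.count
    omega
  · have h1 : bucketDepth S x T I (Function.update C b (C b + 1)) =
        bucketDepth S x T I C + if x ∈ S (I b) then 1 else 0 := by
      unfold bucketDepth
      rw [← add_sum_erase _ _ (mem_range.mpr hb), ← add_sum_erase _ (fun b' =>
        if x ∈ S (I b') then C b' else 0) (mem_range.mpr hb)]
      have : ∑ b' ∈ (range T).erase b, (if x ∈ S (I b') then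
          Function.update C b (C b + 1) b' else 0) =
          ∑ b' ∈ (range T).erase b, if x ∈ S (I b') then C b' else 0 := by
        refine sum_congr rfl fun b' hb' => ?_
        rw [Function.update_of_ne (mem_erase.mp hb').1]
      rw [this, Function.update_self]
      split_ifs <;> omega
    rw [h1, ← add_assoc, depth_succ S x (Nat.le_add_right _ _), hS]
    have := h.cover x
    omega

/-- The next member of the stream goes to an unused bucket. -/
theorem Grouped.add_fresh (h : Grouped S s₀ s₁ T j hp I C B) {b : ℕ} (hb : b < T)
    (h0 : C b = 0) (hj : s₀ + j < s₁) (hS : ∀ b' < T, C b' ≠ 0 → S (I b') ≠ S (s₀ + j)) :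
    Grouped S s₀ s₁ T (j + 1) hp (Function.update I b (s₀ + j)) (Function.update C b 1) B := by
  classical
  refine ⟨fun b' hb' h' => ?_, fun b₁ hb₁ b₂ hb₂ hne h₁ h₂ => ?_, ?_, h.next_eq, fun x => ?_⟩
  · rw [Function.update_apply]
    split_ifs with hbb
    · omega
    · rw [Function.update_of_ne hbb] at h'
      exact h.ids b' hb' h'
  · by_cases e1 : b₁ = b
    · subst e1
      rw [Function.update_of_ne (Ne.symm hne)] at h₂
      rw [Function.update_self, Function.update_of_ne (Ne.symm hne)]
      exact (hS b₂ hb₂ h₂).symm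
    · rw [Function.update_of_ne e1] at h₁
      rw [Function.update_of_ne e1]
      by_cases e2 : b₂ = b
      · subst e2
        rw [Function.update_self]
        exact hS b₁ hb₁ h₁
      · rw [Function.update_of_ne e2] at h₂
        rw [Function.update_of_ne e2]
        exact h.distinct b₁ hb₁ b₂ hb₂ hne h₁ h₂
  · have h1 := sum_update_range C hb 1
    have h2 := h.count
    omega
  · have h1 : bucketDepth S x T (Function.update I b (s₀ + j)) (Function.update C b 1) =
        bucketDepth S x T I C + if x ∈ S (s₀ + j) then 1 else 0 := by
      unfold bucketDepth
      rw [← add_sum_erase _ _ (mem_range.mpr hb), ← add_sum_erase _ (fun b' =>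
        if x ∈ S (I b') then C b' else 0) (mem_range.mpr hb)]
      have : ∑ b' ∈ (range T).erase b, (if x ∈ S (Function.update I b (s₀ + j) b') then
          Function.update C b 1 b' else 0) =
          ∑ b' ∈ (range T).erase b, if x ∈ S (I b') then C b' else 0 := by
        refine sum_congr rfl fun b' hb' => ?_
        rw [Function.update_of_ne (mem_erase.mp hb').1, Function.update_of_ne (mem_erase.mp hb').1]
      rw [this, Function.update_self, Function.update_self, h0]
      split_ifs <;> omega
    rw [h1, ← add_assoc, depth_succ S x (Nat.le_add_right _ _)]
    have := h.cover x
    omega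

open Classical in
/-- One copy is removed from each bucket, and the pairwise intersections are written to the next
stream. -/
theorem Grouped.emit (h : Grouped S s₀ s₁ T j hp I C B) (hj : s₀ + j ≤ s₁)
    (hC : ∀ b < T, C b ≠ 0) (hhp : hp' = hp + ∑ b ∈ range T, b) (hC' : ∀ b < T, C' b = C b - 1)
    (hS : ∀ o < hp, S' o = S o)
    (hpairs : ∀ x, #{b ∈ range T | x ∈ S (I b)} ≤ depth S' x hp hp' + 1) :
    Grouped S' s₀ s₁ T j hp' I C' (B + 1) := by
  have hle := h.next_le
  refine ⟨fun b hb h' => h.ids b hb (hC b hb), fun b₁ hb₁ b₂ hb₂ hne h₁ h₂ => ?_, ?_, ?_,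
    fun x => ?_⟩
  · rw [hS _ ((h.ids b₁ hb₁ (hC b₁ hb₁)).2.trans_le hle),
      hS _ ((h.ids b₂ hb₂ (hC b₂ hb₂)).2.trans_le hle)]
    exact h.distinct b₁ hb₁ b₂ hb₂ hne (hC b₁ hb₁) (hC b₂ hb₂)
  · rw [← h.count, add_mul, one_mul, add_assoc]
    congr 1
    have : ∑ b ∈ range T, C b = ∑ b ∈ range T, (C' b + 1) := by
      refine sum_congr rfl fun b hb => ?_
      have h1 := hC b (mem_range.mp hb)
      rw [hC' b (mem_range.mp hb)]
      omega
    rw [this, sum_add_distrib]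
    simp [add_comm]
  · rw [hhp, h.next_eq]; ring
  · rw [depth_congr (S := S) fun o _ ho => hS o (by omega),
      depth_add S' x hle (show hp ≤ hp' by omega),
      depth_congr (S := S) (lo := s₁) (hi := hp) fun o _ ho => hS o ho]
    have h1 : bucketDepth S x T I C =
        bucketDepth S' x T I C' + #{b ∈ range T | x ∈ S (I b)} := by
      unfold bucketDepth
      rw [card_filter, ← sum_add_distrib]
      refine sum_congr rfl fun b hb => ?_
      have h1 := hC b (mem_range.mp hb)
      rw [hC' b (mem_range.mp hb), hS _ ((h.ids b (mem_range.mp hb) h1).2.trans_le hle)]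
      split_ifs <;> omega
    have h2 := h.cover x
    have h3 := hpairs x
    omega

theorem two_mul_sum_range_le (T : ℕ) : 2 * ∑ b ∈ range T, b ≤ T * T := by
  have := Finset.sum_range_id_mul_two T
  rw [mul_comm 2, this]
  exact Nat.mul_le_mul_left _ (Nat.sub_le _ _)

theorem Grouped.groups_le (h : Grouped S s₀ s₁ T j hp I C B) : B * T ≤ j := by
  have := h.count
  omega

theorem Grouped.next_size_le (h : Grouped S s₀ s₁ T j hp I C B) : hp - s₁ ≤ j * T := by
  have h1 := h.next_eq
  have h2 := two_mul_sum_range_le T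
  have h3 := h.groups_le
  have h4 : B * ∑ b ∈ range T, b ≤ B * (T * T) := Nat.mul_le_mul_left _ (by omega)
  have h5 : B * T * T ≤ j * T := Nat.mul_le_mul_right _ h3
  rw [mul_assoc] at h5
  omega

/-- The dichotomy behind the algorithm: a vector that lies in at least a fraction `2 / T` of the
members of a stream lies in a subspace that is left in a bucket, or in at least a fraction
`2 / T ^ 2` of the members of the next stream. In the second case `cover` bounds the number `c` of
members that contain the vector by `c' + B`, where `c'` counts members of the next stream, while the
number `B ≤ (s₁ - s₀) / T` of groups satisfies `2 * B ≤ c`; hence `B ≤ c'`, and the next stream has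
at most `B * T ^ 2 / 2` members. -/
theorem Grouped.left_or_next (h : Grouped S s₀ s₁ T (s₁ - s₀) hp I C B) (hs : s₀ ≤ s₁) {x : V}
    (hpos : 0 < depth S x s₀ s₁) (hheavy : 2 * (s₁ - s₀) ≤ depth S x s₀ s₁ * T) :
    (∃ b < T, C b ≠ 0 ∧ x ∈ S (I b)) ∨
      (0 < depth S x s₁ hp ∧ 2 * (hp - s₁) ≤ depth S x s₁ hp * (T * T)) := by
  classical
  by_cases hex : ∃ b < T, C b ≠ 0 ∧ x ∈ S (I b)
  · exact Or.inl hex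
  · right
    have hz : bucketDepth S x T I C = 0 := by
      refine sum_eq_zero fun b hb => ?_
      by_contra hc
      apply hex
      refine ⟨b, mem_range.mp hb, ?_, ?_⟩
      · intro h0; apply hc; simp [h0]
      · by_contra hx; apply hc; simp [hx]
    have hcov := h.cover x
    rw [hz, zero_add, Nat.add_sub_cancel' hs] at hcov
    have hBT := h.groups_le
    set c := depth S x s₀ s₁ with hc
    set c' := depth S x s₁ hp with hc'
    have hT : 0 < T := by
      by_contra h0
      have h0 : T = 0 := by omega
      have h1 := depth_le S x s₀ s₁
      rw [h0, mul_zero] at hheavy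
      omega
    have hBc : 2 * B ≤ c := by
      have : 2 * B * T ≤ c * T := by
        calc 2 * B * T = 2 * (B * T) := by ring
          _ ≤ 2 * (s₁ - s₀) := by omega
          _ ≤ c * T := hheavy
      exact Nat.le_of_mul_le_mul_right this hT
    have hBc' : B ≤ c' := by omega
    refine ⟨by omega, ?_⟩
    have h1 := h.next_eq
    have h2 := two_mul_sum_range_le T
    calc 2 * (hp - s₁) = B * (2 * ∑ b ∈ range T, b) := by
          rw [h1, Nat.add_sub_cancel_left]; ring
      _ ≤ c' * (T * T) := Nat.mul_le_mul hBc' h2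

end grouping

end

/-! ### One level of the stream processing on the word RAM -/

section

-- Loop variables `vB1`, `vB2` for buckets and `vSi` for members of the stream; number of copies
-- `aBC` and object number `aBI` of a bucket; an unused bucket `vFree`; the flag `vFull`; end
-- `vTail` of the queue `aQ`; number `vTb` of buckets; ends `vS0`, `vS1` of the stream.
notation "vB1" => (43 : ℕ)
notation "vB2" => (44 : ℕ)
notation "aBC" => (45 : ℕ)
notation "aBI" => (46 : ℕ)
notation "vFree" => (47 : ℕ)
notation "vFull" => (48 : ℕ)
notation "vSi" => (49 : ℕ)
notation "vTail" => (50 : ℕ)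
notation "aQ" => (51 : ℕ)
notation "vTb" => (52 : ℕ)
notation "vS0" => (53 : ℕ)
notation "vS1" => (54 : ℕ)

/-- Writes the intersections of any two of the subspaces in the buckets to the end of the heap, and
removes one copy from each bucket. -/
def emit : Program :=
  .forLoop vB1 (var vTb)
    (.forLoop vB2 (var vB1)
      (.set vMA (.read aBI (var vB1)) ;; .set vMB (.read aBI (var vB2)) ;; meet ;;
       .set vHp (var vHp + 1)) ;;
     .store aBC (var vB1) (.read aBC (var vB1) - 1))

/-- Puts object `vMB` into a new bucket. -/
def putFresh : Program :=
  .set vFree (var vTb) ;;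
  .forLoop vB1 (var vTb) (.ite (.read aBC (var vB1)) .skip (.set vFree (var vB1))) ;;
  .store aBI (var vFree) (var vMB) ;; .store aBC (var vFree) 1

/-- Puts object `vMB` into a bucket, and calls `emit` when all buckets are in use. -/
def insert : Program :=
  find aBI aBC vTb ;;
  .ite ((var vFound).ltE (var vTb))
    (.store aBC (var vFound) (.read aBC (var vFound) + 1)) putFresh ;;
  .set vFull 1 ;;
  .forLoop vB1 (var vTb) (.ite (.read aBC (var vB1)) .skip (.set vFull 0)) ;;
  .ite (var vFull) emit .skip

/-- Distributes the stream of the objects from `vS0` up to `vS1` into `vTb` buckets, and appends the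
objects that are left in the buckets to the queue. -/
def level : Program :=
  .forLoop vB1 (var vTb) (.store aBC (var vB1) 0) ;;
  .forLoop vSi (var vS1 - var vS0) (.set vMB (var vS0 + var vSi) ;; insert) ;;
  .forLoop vB1 (var vTb)
    (.ite (.read aBC (var vB1))
      (.store aQ (var vTail) (.read aBI (var vB1)) ;; .set vTail (var vTail + 1)) .skip)

variable {p : ℕ} [Fact p.Prime] {F : Type*} [Field F] [Algebra (ZMod p) F]
  {pb : PowerBasis (ZMod p) F} {K N m : ℕ}

theorem finrank_inf_lt {V : Type*} [AddCommGroup V] [Module F V] [FiniteDimensional F V]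
    {P Q : Submodule F V} {d : ℕ} (hne : P ≠ Q) (hP : Module.finrank F P ≤ d)
    (hQ : Module.finrank F Q ≤ d) : Module.finrank F (P ⊓ Q : Submodule F V) < d := by
  by_contra hc
  apply hne
  have h1 := Submodule.eq_of_le_of_finrank_eq (inf_le_left : P ⊓ Q ≤ P)
    (le_antisymm (Submodule.finrank_mono inf_le_left) (by omega))
  have h2 := Submodule.eq_of_le_of_finrank_eq (inf_le_right : P ⊓ Q ≤ Q)
    (le_antisymm (Submodule.finrank_mono inf_le_right) (by omega))
  rw [← h1, h2]

/-- A bound for the running time of `emit` with `T` buckets. -/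
def tEmit (e K T : ℕ) : ℕ := T * (T * (tMeet e K + 100) + 100) + 100

open Classical in
/-- The last conclusion holds because a vector that lies in `n > 0` of the bucket subspaces lies in
the intersections of the first of them with the `n - 1` others. -/
theorem emit_spec {W H : ℕ} (hW : Room pb W K N m H) {σ : Mem} (env : HeapEnv pb K σ)
    {h T : ℕ} (hh : σ vHp 0 = h) (hT : σ vTb 0 = T) (hTW : T < W)
    (hroom : h + ∑ b ∈ range T, b ≤ H)
    (hwf : ∀ o < h, WF pb K (σ aHM) (σ aHR) o) (hids : ∀ b < T, σ aBI b < h)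
    (hcW : ∀ b < T, σ aBC b < W) :
    Runs W emit σ (tEmit pb.dim K T) (fun τ =>
      ((∀ x, τ aHM x < p ^ pb.dim) ∧ τ vHp 0 = h + ∑ b ∈ range T, b ∧
      (∀ o < h + ∑ b ∈ range T, b, WF pb K (τ aHM) (τ aHR) o) ∧
      SameBelow K h (σ aHM) (σ aHR) (τ aHM) (τ aHR) ∧
      (∀ b < T, τ aBC b = σ aBC b - 1) ∧
      (∀ o, h ≤ o → o < h + ∑ b ∈ range T, b → ∃ b < T, ∃ b' < T, b' ≠ b ∧
        sp pb K (τ aHM) (τ aHR) o =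
          sp pb K (σ aHM) (σ aHR) (σ aBI b) ⊓ sp pb K (σ aHM) (σ aHR) (σ aBI b')) ∧
      ∀ x, #{b ∈ range T | x ∈ sp pb K (σ aHM) (σ aHR) (σ aBI b)} ≤
        depth (sp pb K (τ aHM) (τ aHR)) x h (h + ∑ b ∈ range T, b) + 1) ∧
      ∀ a, a < 8 ∨ 46 ≤ a → τ a = σ a) := by
  have hW1 := one_lt_of_le hW.field
  have h3 := hW.three_lt
  have hobj := hW.objects
  refine Runs.frame 8 46 rfl ?_
  apply Runs.le
  · apply Runs.forLoop 8 46 (n := T) (fun i τ =>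
      (∀ x, τ aHM x < p ^ pb.dim) ∧ τ vHp 0 = h + ∑ b ∈ range i, b ∧
      (∀ o < h + ∑ b ∈ range i, b, WF pb K (τ aHM) (τ aHR) o) ∧
      SameBelow K h (σ aHM) (σ aHR) (τ aHM) (τ aHR) ∧
      (∀ b < i, τ aBC b = σ aBC b - 1) ∧ (∀ b, i ≤ b → τ aBC b = σ aBC b) ∧
      (∀ o, h ≤ o → o < h + ∑ b ∈ range i, b → ∃ b < T, ∃ b' < T, b' ≠ b ∧
        sp pb K (τ aHM) (τ aHR) o =
          sp pb K (σ aHM) (σ aHR) (σ aBI b) ⊓ sp pb K (σ aHM) (σ aHR) (σ aBI b')) ∧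
      ∀ x, #{b ∈ range i | x ∈ sp pb K (σ aHM) (σ aHR) (σ aBI b)} ≤
        depth (sp pb K (τ aHM) (τ aHR)) x h (h + ∑ b ∈ range i, b) + 1)
      hW1 hTW rfl rfl
    · refine ⟨by simpa using env.cells, by simp [hh], by simpa using hwf,
        by simpa using SameBelow.refl _ _ _, by simp, by simp, ?_, by simp⟩
      intro o h1 h2
      simp at h2; omega
    · intro i τ hi hfr hv hI
      have f52 := hfr 52 (by omega) (by omega)
      simp [f52, hT]; omega
    · rintro i τ hi hfr hv ⟨h1, h2, h4, h5, h6, h7, h8, h9⟩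
      set g := h + ∑ b ∈ range i, b with hg
      have hgi : g + i = h + ∑ b ∈ range (i + 1), b := by rw [sum_range_succ, hg]; omega
      have hgiH : g + i ≤ H := by
        rw [hgi]
        refine le_trans (Nat.add_le_add_left (sum_le_sum_of_subset ?_) h) hroom
        intro b hb
        rw [mem_range] at hb ⊢; omega
      have f46 := hfr 46 (by omega) (by omega)
      have fenv : HeapEnv pb K τ := env.congr (hfr 0 (by omega) (by omega))
        (hfr 1 (by omega) (by omega)) (hfr 105 (by omega) (by omega))
        (hfr 100 (by omega) (by omega)) h1
      apply Runs.seq (Q := fun ρ => ((∀ x, ρ aHM x < p ^ pb.dim) ∧ ρ vHp 0 = g + i ∧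
        (∀ o < g + i, WF pb K (ρ aHM) (ρ aHR) o) ∧
        SameBelow K g (τ aHM) (τ aHR) (ρ aHM) (ρ aHR) ∧
        (∀ o, g ≤ o → o < g + i → ∃ b' < i, sp pb K (ρ aHM) (ρ aHR) o =
          sp pb K (σ aHM) (σ aHR) (σ aBI i) ⊓ sp pb K (σ aHM) (σ aHR) (σ aBI b')) ∧
        ∀ x ∈ sp pb K (σ aHM) (σ aHR) (σ aBI i),
          #{b ∈ range i | x ∈ sp pb K (σ aHM) (σ aHR) (σ aBI b)} ≤
          depth (sp pb K (ρ aHM) (ρ aHR)) x g (g + i)) ∧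
        ∀ a, a ≠ 44 → a < 8 ∨ 41 ≤ a → ρ a = τ a)
        (T := T * (tMeet pb.dim K + 100) + 50)
      · apply Runs.le
        · apply Runs.forLoop 8 41 (n := i) (fun l ρ => (∀ x, ρ aHM x < p ^ pb.dim) ∧
            ρ vHp 0 = g + l ∧
            (∀ o < g + l, WF pb K (ρ aHM) (ρ aHR) o) ∧
            SameBelow K g (τ aHM) (τ aHR) (ρ aHM) (ρ aHR) ∧
            (∀ o, g ≤ o → o < g + l → ∃ b' < i, sp pb K (ρ aHM) (ρ aHR) o =
              sp pb K (σ aHM) (σ aHR) (σ aBI i) ⊓ sp pb K (σ aHM) (σ aHR) (σ aBI b')) ∧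
            ∀ x ∈ sp pb K (σ aHM) (σ aHR) (σ aBI i),
              #{b ∈ range l | x ∈ sp pb K (σ aHM) (σ aHR) (σ aBI b)} ≤
              depth (sp pb K (ρ aHM) (ρ aHR)) x g (g + l)) hW1 (by omega) rfl rfl
          · refine ⟨by simpa using h1, by simp [h2], by simpa using h4,
              by simpa using SameBelow.refl _ _ _, ?_, by simp⟩
            intro o ho1 ho2; omega
          · intro l ρ hl gfr gv hI
            have e43 := gfr 43 (by omega) (by omega)
            simp [e43, hv]; omega
          · rintro l ρ hl gfr gv ⟨g1, g2, g4, g5, g6, g7⟩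
            have e46 : ρ 46 = σ 46 := by rw [gfr 46 (by omega) (by omega), f46]
            have e43 : ρ 43 0 = i := by rw [gfr 43 (by omega) (by omega), hv]
            have hidi := hids i hi
            have hidl := hids l (by omega)
            have hsame : SameBelow K h (σ 9) (σ 8) (ρ 9) (ρ 8) :=
              h5.trans (g5.mono (by omega))
            apply Runs.set_seq_val (n := σ 46 i) hW1 (by simp; omega) (by simp [e46, e43])
            apply Runs.set_seq_val (n := σ 46 l) hW1 (by simp; omega) (by simp [e46, gv])
            apply Runs.seq (meet_spec (o := g + l) (a := σ 46 i) (b := σ 46 l) hW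
              (fenv.congr (by simp [gfr 0]) (by simp [gfr 1]) (by simp [gfr 105])
                (by simp [gfr 100]) (by simpa using g1))
              (by simp [g2]) (by omega) (by simp) (by omega) (by simp) (by omega)
              (by simpa using g4 _ (by omega)) (by simpa using g4 _ (by omega)))
            rintro π ⟨⟨k1, k2, k3, k4⟩, kfr⟩
            simp only [put_ne _ (show (9:ℕ) ≠ 36 by decide), put_ne _ (show (8:ℕ) ≠ 36 by decide),
              put_ne _ (show (9:ℕ) ≠ 37 by decide), put_ne _ (show (8:ℕ) ≠ 37 by decide)] at k3 k4
            have k40 : π 40 0 = g + l := by rw [kfr 40 (by omega)]; simp [g2]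
            rw [hsame.sp_eq hidi (hwf _ hidi), hsame.sp_eq hidl (hwf _ hidl)] at k3
            apply Runs.set hW1 (by simp [k40]; omega)
            simp only [Expr.val_add, Expr.val_var, Expr.val_one, k40,
              put_ne _ (show (9:ℕ) ≠ 40 by decide), put_ne _ (show (8:ℕ) ≠ 40 by decide),
              put_ne _ (show (9:ℕ) ≠ 44 by decide), put_ne _ (show (8:ℕ) ≠ 44 by decide)]
            have hspEq : ∀ o < g + l, sp pb K (π 9) (π 8) o = sp pb K (ρ 9) (ρ 8) o :=
              fun o ho => k4.sp_eq ho (g4 o ho)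
            refine ⟨k1, by simp; omega, fun o ho => ?_, g5.trans (k4.mono (by omega)),
              fun o ho1 ho2 => ?_, fun x hx => ?_⟩
            · by_cases hol : o < g + l
              · exact k4.wf hol (g4 o hol)
              · rw [show o = g + l by omega]; exact k2
            · by_cases hol : o < g + l
              · rw [hspEq o hol]; exact g6 o ho1 hol
              · rw [show o = g + l by omega, k3]; exact ⟨l, hl, rfl⟩
            · rw [show g + (l + 1) = (g + l) + 1 by omega, depth_succ _ _ (by omega),
                depth_congr fun o _ ho => hspEq o ho, k3, range_add_one, filter_insert]
              have := g7 x hx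
              simp only [Submodule.mem_inf, hx, true_and]
              split_ifs with hxl
              · rw [card_insert_of_notMem (by simp)]; omega
              · omega
          · rintro ρ gfr gv hI
            exact ⟨hI, gfr⟩
        · simp only [Expr.cost_var, Expr.cost_read, Expr.cost_add, Expr.cost_one]
          have := Nat.mul_le_mul_right (tMeet pb.dim K + 100) hi.le
          nlinarith
      · rintro ρ ⟨⟨g1, g2, g4, g5, g6, g7⟩, gfr⟩
        have e43 : ρ 43 0 = i := by rw [gfr 43 (by omega) (by omega), hv]
        have e45 : ρ 45 = τ 45 := gfr 45 (by omega) (by omega)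
        have hspEq : ∀ o < g, sp pb K (ρ 9) (ρ 8) o = sp pb K (τ 9) (τ 8) o :=
          fun o ho => g5.sp_eq ho (h4 o ho)
        apply Runs.store hW1 (by simp; omega)
        · have : σ 45 i = ρ 45 (ρ 43 0) := by rw [e45, e43, h7 i le_rfl]
          simp [← this]
          exact ⟨by omega, by omega, hcW i hi⟩
        · simp only [Expr.val_sub, Expr.val_var, Expr.val_read, Expr.val_one, e43, e45, put_same,
            put_ne _ (show (9:ℕ) ≠ 45 by decide), put_ne _ (show (8:ℕ) ≠ 45 by decide),
            put_ne _ (show (9:ℕ) ≠ 43 by decide), put_ne _ (show (8:ℕ) ≠ 43 by decide),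
            put_ne _ (show (40:ℕ) ≠ 45 by decide), put_ne _ (show (40:ℕ) ≠ 43 by decide),
            put_ne _ (show (45:ℕ) ≠ 43 by decide), ← hgi]
          refine ⟨g1, g2, g4, h5.trans (g5.mono (by omega)), fun b hb => ?_, fun b hb => ?_,
            fun o ho1 ho2 => ?_, fun x => ?_⟩
          · rw [Function.update_apply]
            split_ifs with hbi
            · rw [hbi, h7 i le_rfl]
            · exact h6 b (by omega)
          · rw [Function.update_of_ne (by omega)]
            exact h7 b (by omega)
          · by_cases hog : o < g
            · rw [hspEq o hog]; exact h8 o ho1 hog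
            · obtain ⟨b', hb', he⟩ := g6 o (by omega) ho2
              exact ⟨i, hi, b', by omega, by omega, he⟩
          · rw [depth_add _ x (show h ≤ g by omega) (show g ≤ g + i by omega),
              depth_congr fun o _ ho => hspEq o ho, range_add_one, filter_insert]
            have := h9 x
            split_ifs with hxi
            · rw [card_insert_of_notMem (by simp)]
              have := g7 x hxi
              omega
            · omega
    · rintro τ hfr hv ⟨h1, h2, h4, h5, h6, h7, h8, h9⟩
      exact ⟨h1, h2, h4, h5, h6, h8, h9⟩
  · simp only [Expr.cost_var, Expr.cost_read, Expr.cost_sub, Expr.cost_one, tEmit]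
    nlinarith

theorem putFresh_spec {W : ℕ} (hW : 1 < W) {σ : Mem} {T : ℕ} (hT : σ vTb 0 = T) (hTW : T < W)
    (hfree : ∃ b < T, σ aBC b = 0) :
    Runs W putFresh σ (T * 30 + 100) (fun τ => ∃ b < T, σ aBC b = 0 ∧
      τ aBI = Function.update (σ aBI) b (σ vMB 0) ∧ τ aBC = Function.update (σ aBC) b 1 ∧
      ∀ a, a ≠ vB1 → a ≠ aBC → a ≠ aBI → a ≠ vFree → τ a = σ a) := by
  apply Runs.le
  · apply Runs.set_seq_val (n := T) hW (by simp; omega) (by simp [hT])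
    apply Runs.seq (Q := fun τ => (∃ b < T, σ aBC b = 0 ∧ τ vFree 0 = b) ∧
      ∀ a, a ≠ vB1 → a ≠ vFree → τ a = σ a)
    · apply Runs.forLoop 47 48 (n := T) (fun i τ => (∃ b < i, σ aBC b = 0) →
        ∃ b < T, σ aBC b = 0 ∧ τ vFree 0 = b) hW hTW rfl rfl
      · rintro ⟨b, hb, -⟩
        omega
      · intro i τ hi hfr hv _
        have h : τ 52 = σ 52 := by rw [hfr 52 (by omega) (by omega)]; simp
        simp [h, hT]; omega
      · intro i τ hi hfr hv hI
        have h : τ 45 = σ 45 := by rw [hfr 45 (by omega) (by omega)]; simp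
        apply Runs.ite hW (by simp; omega)
        · intro h0
          simp [h, hv] at h0
          apply Runs.skip
          rintro ⟨b, hb, hb0⟩
          obtain ⟨b', h1, h2, h3⟩ := hI ⟨b, by
            rcases Nat.lt_succ_iff_lt_or_eq.mp hb with h | rfl
            · exact h
            · exact absurd hb0 h0, hb0⟩
          exact ⟨b', h1, h2, by simpa using h3⟩
        · intro h0
          simp [h, hv] at h0
          apply Runs.set hW (by simp; omega)
          intro _
          exact ⟨i, hi, h0, by simp [hv]⟩
      · intro τ hfr hv hI
        exact ⟨hI hfree, fun a h1 h2 => by rw [hfr a h1 (by omega), put_ne _ h2]⟩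
    · rintro τ ⟨⟨b, hb, hb0, h47⟩, hfr⟩
      have h37 := hfr 37 (by omega) (by omega)
      have h45 := hfr 45 (by omega) (by omega)
      have h46 := hfr 46 (by omega) (by omega)
      apply Runs.store_seq hW (by simp; omega) (by simp; omega)
      apply Runs.store hW (by simp; omega) (by simp; omega)
      refine ⟨b, hb, hb0, ?_, ?_, fun a h1 h2 h3 h4 => ?_⟩
      · simp [h46, h37, h47]
      · simp [h45, h47]
      · rw [put_ne _ h2, put_ne _ h3, hfr a h1 h4]
  · simp only [Expr.cost_var, Expr.cost_read, Expr.cost_one]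
    omega

/-- A bound for the running time of `insert` with `T` buckets. -/
def tInsert (e K T : ℕ) : ℕ := tFind e K T + tEmit e K T + T * 60 + 400

/-- One step of the grouping: the next member of the stream is distributed, and afterwards some
bucket is unused again. All new members of the next stream have a rank less than `d`, because they
are intersections of different subspaces. -/
theorem insert_spec {W H : ℕ} (hW : Room pb W K N m H) {σ : Mem} (env : HeapEnv pb K σ)
    {h T s₀ s₁ j B d : ℕ} (hh : σ vHp 0 = h) (hT : σ vTb 0 = T) (hTW : T < W)
    (hG : Grouped (sp pb K (σ aHM) (σ aHR)) s₀ s₁ T j h (σ aBI) (σ aBC) B)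
    (hfree : ∃ b < T, σ aBC b = 0) (hj : s₀ + j < s₁) (hroom : s₁ + (s₁ - s₀) * T < H)
    (hwf : ∀ o < h, WF pb K (σ aHM) (σ aHR) o) (hs : σ vMB 0 = s₀ + j)
    (hrk : ∀ o, s₀ ≤ o → o < s₁ → σ aHR o ≤ d) (hnew : ∀ o, s₁ ≤ o → o < h → σ aHR o < d) :
    Runs W insert σ (tInsert pb.dim K T) (fun τ =>
      ((∀ x, τ aHM x < p ^ pb.dim) ∧ ∃ h' B', τ vHp 0 = h' ∧ h ≤ h' ∧
      Grouped (sp pb K (τ aHM) (τ aHR)) s₀ s₁ T (j + 1) h' (τ aBI) (τ aBC) B' ∧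
      (∃ b < T, τ aBC b = 0) ∧ SameBelow K h (σ aHM) (σ aHR) (τ aHM) (τ aHR) ∧
      (∀ o < h', WF pb K (τ aHM) (τ aHR) o) ∧ ∀ o, s₁ ≤ o → o < h' → τ aHR o < d) ∧
      ∀ a, a < 8 ∨ 49 ≤ a → τ a = σ a) := by
  classical
  have hW1 := one_lt_of_le hW.field
  have h3 := hW.three_lt
  have hobj := hW.objects
  have hsize : ∀ {S : ℕ → Submodule F (Fin K → F)} {j' h' I C B'}, j' ≤ s₁ - s₀ →
      Grouped S s₀ s₁ T j' h' I C B' → h' < H := by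
    intro S j' h' I C B' hj' hG'
    have h1 := hG'.next_size_le
    have h2 := Nat.mul_le_mul_right T hj'
    omega
  have hcount : ∀ {S : ℕ → Submodule F (Fin K → F)} {j' h' I C B'}, j' ≤ s₁ - s₀ →
      Grouped S s₀ s₁ T j' h' I C B' → ∀ b < T, C b ≤ j' := by
    intro S j' h' I C B' hj' hG' b hb
    have h1 := hG'.count
    have h2 := single_le_sum (f := C) (fun _ _ => Nat.zero_le _) (mem_range.mpr hb)
    omega
  have hle := hG.next_le
  have hhH := hsize (by omega) hG
  refine Runs.frame 8 49 rfl ?_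
  apply Runs.le
  · apply Runs.seq (find_spec (aI := aBI) (aFl := aBC) (vLen := vTb) hW env hh hhH hs (by omega)
      (by omega) (by omega) (by omega) hT hTW (hwf _ (by omega)) (fun b hb hb0 => by
        have := (hG.ids b hb hb0).2
        exact ⟨by omega, hwf _ (by omega)⟩))
    rintro τ ⟨⟨h1, h2, h4⟩, hfr⟩
    have f45 := hfr 45 (by omega)
    have f46 := hfr 46 (by omega)
    have f37 := hfr 37 (by omega)
    have hsp : ∀ o < h, sp pb K (τ 9) (τ 8) o = sp pb K (σ 9) (σ 8) o :=
      fun o ho => h4.sp_eq ho (hwf o ho)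
    have hGτ : Grouped (sp pb K (τ aHM) (τ aHR)) s₀ s₁ T j h (τ aBI) (τ aBC) B :=
      hG.congr (by omega) hsp (by simp [f46]) (by simp [f45])
    apply Runs.seq (Q := fun ρ => ρ 9 = τ 9 ∧ ρ 8 = τ 8 ∧
      Grouped (sp pb K (τ aHM) (τ aHR)) s₀ s₁ T (j + 1) h (ρ aBI) (ρ aBC) B ∧
      (∃ b < T, ρ aBC b ≤ 1) ∧ ∀ a, a < 43 ∨ 48 ≤ a → ρ a = τ a) (T := T * 30 + 150)
    · apply Runs.le
      · apply Runs.ite hW1 (by simp; omega)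
        · intro h0
          have hlt : τ 41 0 < T := by
            by_contra hc
            apply h0
            simp [hfr 52, hT]; omega
          rcases h2 with h2 | ⟨-, h2, h2'⟩
          · omega
          · have hb1 := hcount (by omega) hG _ hlt
            apply Runs.store hW1 (by simp; omega) (by simp [f45]; omega)
            refine ⟨by simp, by simp, ?_, ?_, fun a ha => put_ne _ (by omega) _ _⟩
            swap
            · obtain ⟨b, hb, hb0⟩ := hfree
              refine ⟨b, hb, ?_⟩
              have hne : b ≠ τ 41 0 := by
                rintro rfl
                exact h2 hb0
              simp [f45, hne, hb0]
            have := hGτ.add_found hlt (by rw [f45]; exact h2) (by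
              rw [f46, hsp _ (by have := (hG.ids _ hlt h2).2; omega), h2', hsp _ (by omega)])
            simpa using this
        · intro h0
          rcases h2 with ⟨-, h2⟩ | ⟨hlt, -⟩
          · refine (putFresh_spec hW1 (by rw [hfr 52 (by omega), hT]) hTW
              (by rw [f45]; exact hfree)).mono ?_
            rintro ρ ⟨b, hb, hb0, k1, k2, kfr⟩
            refine ⟨kfr 9 (by omega) (by omega) (by omega) (by omega),
              kfr 8 (by omega) (by omega) (by omega) (by omega), ?_,
              ⟨b, hb, by simp [k2]⟩, fun a ha => kfr a (by omega) (by omega) (by omega) (by omega)⟩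
            rw [k1, k2, f37, hs]
            refine hGτ.add_fresh hb hb0 (by omega) fun b' hb' hb0' => ?_
            rw [f45] at hb0'
            rw [f46, hsp _ (by have := (hG.ids _ hb' hb0').2; omega), hsp _ (by omega)]
            exact h2 b' hb' hb0'
          · simp [hfr 52, hT] at h0; omega
      · simp only [Expr.cost_var, Expr.cost_read, Expr.cost_one, Expr.cost_add, Expr.cost_ltE]
        omega
    · rintro ρ ⟨k9, k8, kG, ⟨b₁, hb₁, hb₁'⟩, kfr⟩
      have hkeep : ∀ a, a < 8 ∨ a = 40 ∨ 49 ≤ a → ρ a = σ a := by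
        intro a ha
        rw [kfr a (by omega), hfr a (by omega)]
      apply Runs.set_seq_val (n := 1) hW1 (by simp; omega) rfl
      apply Runs.seq (Q := fun π => π 48 0 = (if ∀ b < T, ρ 45 b ≠ 0 then 1 else 0) ∧
        ∀ a, a ≠ 43 → a ≠ 48 → π a = ρ a) (T := T * 30 + 50)
      · apply Runs.le
        · apply Runs.forLoop 48 49 (n := T) (fun i π =>
            π 48 0 = (if ∀ b < i, ρ 45 b ≠ 0 then 1 else 0)) hW1 hTW rfl rfl
          · simp
          · intro i π hi pfr pv _
            have h : π 52 = σ 52 := by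
              rw [pfr 52 (by omega) (by omega), put_ne _ (by omega), hkeep 52 (by omega)]
            simp [h, hT]; omega
          · intro i π hi pfr pv pI
            have p45 : π 45 = ρ 45 := by rw [pfr 45 (by omega) (by omega)]; simp
            apply Runs.ite hW1 (by simp; omega)
            · intro h0
              simp [p45, pv] at h0
              apply Runs.skip
              rw [put_ne _ (by omega), pI]
              congr 1
              simp only [Nat.lt_succ_iff_lt_or_eq, eq_iff_iff]
              constructor
              · rintro h b (hb | rfl)
                · exact h b hb
                · exact h0
              · exact fun h b hb => h b (Or.inl hb)
            · intro h0
              simp [p45, pv] at h0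
              apply Runs.set hW1 (by simp; omega)
              rw [put_ne _ (by omega), if_neg (fun h => h i (by omega) h0)]
              simp
          · intro π pfr pv pI
            exact ⟨pI, fun a ha hb => by rw [pfr a ha (by omega), put_ne _ hb]⟩
        · simp only [Expr.cost_var, Expr.cost_read, Expr.cost_zero]
          omega
      · rintro π ⟨p48, pfr⟩
        have p45 := pfr 45 (by omega) (by omega)
        have p46 := pfr 46 (by omega) (by omega)
        have p9 : π 9 = τ 9 := by rw [pfr 9 (by omega) (by omega), k9]
        have p8 : π 8 = τ 8 := by rw [pfr 8 (by omega) (by omega), k8]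
        have pkeep : ∀ a, a < 8 ∨ a = 40 ∨ 49 ≤ a → π a = σ a := by
          intro a ha
          rw [pfr a (by omega) (by omega), hkeep a ha]
        have pnew : ∀ o, s₁ ≤ o → o < h → π 8 o < d := fun o ho1 ho2 => by
          rw [p8, h4.rank o ho2]; exact hnew o ho1 ho2
        rw [← p9, ← p8] at kG h4
        rw [← p9] at h1
        rw [← p45, ← p46] at kG
        have pwf : ∀ o < h, WF pb K (π 9) (π 8) o := fun o ho => h4.wf ho (hwf o ho)
        apply Runs.ite hW1 (by simp; omega)
        · intro h0
          simp only [Expr.val_var, p48, ← p45] at h0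
          have hall : ∀ b < T, π 45 b ≠ 0 := by
            by_contra hc
            exact h0 (if_neg hc)
          have hids : ∀ b < T, π 46 b < h := fun b hb => by
            have := (kG.ids b hb (hall b hb)).2
            omega
          have hTle : T ≤ ∑ b ∈ range T, π 45 b := by
            have : ∑ b ∈ range T, 1 ≤ ∑ b ∈ range T, π 45 b :=
              sum_le_sum fun b hb => Nat.one_le_iff_ne_zero.mpr (hall b (mem_range.mp hb))
            simpa using this
          have hroom' : h + ∑ b ∈ range T, b ≤ H := by
            have e1 := kG.next_eq
            have e2 := kG.count
            have e3 := two_mul_sum_range_le T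
            have e4 : (B + 1) * T * T ≤ (s₁ - s₀) * T := by
              apply Nat.mul_le_mul_right
              rw [add_mul, one_mul]; omega
            have e5 : (B + 1) * ∑ b ∈ range T, b ≤ (B + 1) * (T * T) :=
              Nat.mul_le_mul_left _ (by omega)
            rw [add_mul, one_mul] at e5
            rw [mul_assoc] at e4
            omega
          refine (emit_spec hW (env.congr (pkeep 0 (by omega)) (pkeep 1 (by omega))
            (pkeep 105 (by omega)) (pkeep 100 (by omega)) h1) (by rw [pkeep 40 (by omega), hh])
            (by rw [pkeep 52 (by omega), hT]) hTW hroom' pwf hids (fun b hb => by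
              have := hcount (by omega) kG b hb
              omega)).mono ?_
          rintro α ⟨⟨a1, a2, a3, a4, a5, a6, a7⟩, afr⟩
          have a46 := afr 46 (by omega)
          have aG := kG.emit (S' := sp pb K (α 9) (α 8)) (by omega) hall rfl a5
            (fun o ho => a4.sp_eq ho (pwf o ho)) a7
          refine ⟨a1, _, B + 1, a2, by omega, by rw [a46]; exact aG, ?_, h4.trans a4, a3,
            fun o ho1 ho2 => ?_⟩
          · exact ⟨b₁, hb₁, by rw [a5 b₁ hb₁, p45]; omega⟩
          · by_cases hoh : o < h
            · rw [a4.rank o hoh]; exact pnew o ho1 hoh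
            · obtain ⟨b, hb, b', hb', hne, he⟩ := a6 o (by omega) ho2
              rw [← (a3 o ho2).finrank_eq, he]
              have i1 := kG.ids b hb (hall b hb)
              have i2 := kG.ids b' hb' (hall b' hb')
              refine finrank_inf_lt (kG.distinct b hb b' hb' (Ne.symm hne) (hall b hb)
                (hall b' hb')) ?_ ?_
              · rw [(pwf _ (hids b hb)).finrank_eq, h4.rank _ (hids b hb)]
                exact hrk _ i1.1 i1.2
              · rw [(pwf _ (hids b' hb')).finrank_eq, h4.rank _ (hids b' hb')]
                exact hrk _ i2.1 i2.2
        · intro h0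
          simp only [Expr.val_var, p48, ← p45] at h0
          have hex : ∃ b < T, π 45 b = 0 := by
            by_contra hc
            push Not at hc
            rw [if_pos hc] at h0
            omega
          apply Runs.skip
          exact ⟨h1, h, B, by rw [pkeep 40 (by omega), hh], le_rfl, kG, hex, h4, pwf, pnew⟩
  · simp only [Expr.cost_var, Expr.cost_one, tInsert]
    omega

/-- A bound for the running time of `level` with `T` buckets and a stream of `n` members. -/
def tLevel (e K T n : ℕ) : ℕ := n * (tInsert e K T + 50) + T * 100 + 200

/-- The dichotomy `Grouped.left_or_next` for the program: a vector that lies in many members of the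
stream lies in a subspace that has been appended to the queue, or in many members of the next
stream, whose ranks are smaller. -/
theorem level_spec {W H : ℕ} (hW : Room pb W K N m H) {σ : Mem} (env : HeapEnv pb K σ)
    {T s₀ s₁ t d : ℕ} (hT : σ vTb 0 = T) (hTW : T < W) (hTpos : 0 < T) (hs₀ : σ vS0 0 = s₀)
    (hs₁ : σ vS1 0 = s₁) (hh : σ vHp 0 = s₁) (hs : s₀ ≤ s₁) (ht : σ vTail 0 = t)
    (htW : t + T < W) (hroom : s₁ + (s₁ - s₀) * T < H)
    (hwf : ∀ o < s₁, WF pb K (σ aHM) (σ aHR) o)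
    (hrk : ∀ o, s₀ ≤ o → o < s₁ → σ aHR o ≤ d) :
    Runs W level σ (tLevel pb.dim K T (s₁ - s₀)) (fun τ =>
      ((∀ x, τ aHM x < p ^ pb.dim) ∧ ∃ s₂ t', τ vHp 0 = s₂ ∧ s₁ ≤ s₂ ∧
      s₂ - s₁ ≤ (s₁ - s₀) * T ∧ SameBelow K s₁ (σ aHM) (σ aHR) (τ aHM) (τ aHR) ∧
      (∀ o < s₂, WF pb K (τ aHM) (τ aHR) o) ∧ (∀ o, s₁ ≤ o → o < s₂ → τ aHR o < d) ∧
      τ vTail 0 = t' ∧ t ≤ t' ∧ t' ≤ t + T ∧ (∀ i < t, τ aQ i = σ aQ i) ∧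
      (∀ i, t ≤ i → i < t' → s₀ ≤ τ aQ i ∧ τ aQ i < s₁) ∧
      ∀ x, 0 < depth (sp pb K (σ aHM) (σ aHR)) x s₀ s₁ →
        2 * (s₁ - s₀) ≤ depth (sp pb K (σ aHM) (σ aHR)) x s₀ s₁ * T →
        (∃ i, t ≤ i ∧ i < t' ∧ x ∈ sp pb K (σ aHM) (σ aHR) (τ aQ i)) ∨
        (0 < depth (sp pb K (τ aHM) (τ aHR)) x s₁ s₂ ∧
          2 * (s₂ - s₁) ≤ depth (sp pb K (τ aHM) (τ aHR)) x s₁ s₂ * (T * T))) ∧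
      ∀ a, a < 8 ∨ 52 ≤ a → τ a = σ a) := by
  have hW1 := one_lt_of_le hW.field
  have h3 := hW.three_lt
  have hobj := hW.objects
  refine Runs.frame 8 52 rfl ?_
  apply Runs.le
  · apply Runs.seq (Q := fun τ => (∀ b < T, τ aBC b = 0) ∧
      ∀ a, a ≠ vB1 → a ≠ aBC → τ a = σ a) (T := T * 30 + 30)
    · apply Runs.le
      · apply Runs.forLoop 45 46 (n := T) (fun i τ => ∀ b < i, τ aBC b = 0) hW1 hTW rfl rfl
        · simp
        · intro i τ hi hfr hv _
          have h := hfr 52 (by omega) (by omega)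
          simp [h, hT]; omega
        · intro i τ hi hfr hv hI
          apply Runs.store hW1 (by simp; omega) (by simp; omega)
          intro b hb
          rw [put_ne _ (by omega)]
          simp only [Expr.val_var, hv, Expr.val_zero, put_same, Function.update_apply]
          split_ifs with h
          · rfl
          · exact hI b (by omega)
        · intro τ hfr hv hI
          exact ⟨hI, fun a h1 h2 => hfr a h1 (by omega)⟩
      · simp only [Expr.cost_var, Expr.cost_zero]; omega
    rintro τ ⟨τ45, τfr⟩
    have τ9 := τfr 9 (by omega) (by omega)
    have τ8 := τfr 8 (by omega) (by omega)
    apply Runs.seq (Q := fun ρ => ((∀ x, ρ aHM x < p ^ pb.dim) ∧ ∃ h B, ρ vHp 0 = h ∧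
        Grouped (sp pb K (ρ aHM) (ρ aHR)) s₀ s₁ T (s₁ - s₀) h (ρ aBI) (ρ aBC) B ∧
        SameBelow K s₁ (σ aHM) (σ aHR) (ρ aHM) (ρ aHR) ∧
        (∀ o < h, WF pb K (ρ aHM) (ρ aHR) o) ∧ ∀ o, s₁ ≤ o → o < h → ρ aHR o < d) ∧
        ∀ a, a < 8 ∨ 50 ≤ a → ρ a = σ a) (T := (s₁ - s₀) * (tInsert pb.dim K T + 30) + 30)
    · apply Runs.le
      · apply Runs.forLoop 8 49 (n := s₁ - s₀) (fun j ρ => (∀ x, ρ aHM x < p ^ pb.dim) ∧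
          ∃ h B, ρ vHp 0 = h ∧
          Grouped (sp pb K (ρ aHM) (ρ aHR)) s₀ s₁ T j h (ρ aBI) (ρ aBC) B ∧
          (∃ b < T, ρ aBC b = 0) ∧
          SameBelow K s₁ (σ aHM) (σ aHR) (ρ aHM) (ρ aHR) ∧
          (∀ o < h, WF pb K (ρ aHM) (ρ aHR) o) ∧ ∀ o, s₁ ≤ o → o < h → ρ aHR o < d)
          hW1 (by omega) rfl rfl
        · refine ⟨by simpa [τ9] using env.cells, s₁, 0, by simp [τfr 40, hh],
            Grouped.init _ _ (by simpa using τ45), ⟨0, hTpos, by simpa using τ45 0 hTpos⟩,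
            by simpa [τ9, τ8] using SameBelow.refl _ _ _, by simpa [τ9, τ8] using hwf,
            fun o h1 h2 => by omega⟩
        · intro j ρ hj rfr rv _
          have e53 : ρ 53 = σ 53 := by
            rw [rfr 53 (by omega) (by omega), τfr 53 (by omega) (by omega)]
          have e54 : ρ 54 = σ 54 := by
            rw [rfr 54 (by omega) (by omega), τfr 54 (by omega) (by omega)]
          simp [e53, e54, hs₀, hs₁]; omega
        · rintro j ρ hj rfr rv ⟨r1, h, B, r2, r3, r4, r5, r6, r7⟩
          have rkeep : ∀ a, a < 8 ∨ 50 ≤ a → ρ a = σ a := by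
            intro a ha
            rw [rfr a (by omega) (by omega), τfr a (by omega) (by omega)]
          apply Runs.set_seq_val (n := s₀ + j) hW1 (by simp [rkeep 53, hs₀, rv]; omega)
            (by simp [rkeep 53, hs₀, rv])
          have renv : HeapEnv pb K ρ := env.congr (rkeep 0 (by omega)) (rkeep 1 (by omega))
            (rkeep 105 (by omega)) (rkeep 100 (by omega)) r1
          refine (insert_spec (h := h) (T := T) (s₀ := s₀) (s₁ := s₁) (j := j) (B := B) (d := d) hW
            (renv.congr (by simp) (by simp) (by simp) (by simp) (by simpa using r1))
            (by simpa using r2) (by simp [rkeep 52, hT]) hTW (by simpa using r3) (by simpa using r4)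
            (by omega) hroom (by simpa using r6) (by simp) (fun o ho1 ho2 => by
              simpa [r5.rank o ho2] using hrk o ho1 ho2) (by simpa using r7)).mono ?_
          rintro π ⟨⟨p1, h', B', p2, p3, p4, p5, p6, p7, p8⟩, pfr⟩
          simp only [put_ne _ (show (9:ℕ) ≠ 37 by decide), put_ne _ (show (8:ℕ) ≠ 37 by decide)]
            at p6
          simp only [put_ne _ (show (9:ℕ) ≠ 49 by decide), put_ne _ (show (8:ℕ) ≠ 49 by decide),
            put_ne _ (show (40:ℕ) ≠ 49 by decide), put_ne _ (show (45:ℕ) ≠ 49 by decide),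
            put_ne _ (show (46:ℕ) ≠ 49 by decide)]
          exact ⟨p1, h', B', p2, p4, p5, r5.trans (p6.mono r3.next_le), p7, p8⟩
        · rintro ρ rfr rv ⟨r1, h, B, r2, r3, r4, r5, r6, r7⟩
          exact ⟨⟨r1, h, B, r2, r3, r5, r6, r7⟩, fun a ha => by
            rw [rfr a (by omega) (by omega), τfr a (by omega) (by omega)]⟩
      · simp only [Expr.cost_var, Expr.cost_add, Expr.cost_sub]
        nlinarith
    rintro ρ ⟨⟨r1, h, B, r2, r3, r5, r6, r7⟩, rfr⟩
    have hle := r3.next_le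
    apply Runs.forLoop 50 52 (n := T) (fun i π => ∃ t', π vTail 0 = t' ∧ t ≤ t' ∧ t' ≤ t + i ∧
      (∀ i < t, π aQ i = σ aQ i) ∧
      (∀ i, t ≤ i → i < t' → s₀ ≤ π aQ i ∧ π aQ i < s₁) ∧
      ∀ b < i, ρ aBC b ≠ 0 → ∃ i, t ≤ i ∧ i < t' ∧ π aQ i = ρ aBI b) hW1 hTW rfl rfl
    · exact ⟨t, by simp [rfr 50, ht], le_rfl, le_rfl, by simp [rfr 51],
        fun i h1 h2 => by omega, by simp⟩
    · intro i π hi pfr pv _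
      have e52 : π 52 = σ 52 := by rw [pfr 52 (by omega) (by omega), rfr 52 (by omega)]
      simp [e52, hT]; omega
    · rintro i π hi pfr pv ⟨t', p1, p2, p3, p4, p5, p6⟩
      have e45 := pfr 45 (by omega) (by omega)
      have e46 := pfr 46 (by omega) (by omega)
      apply Runs.ite hW1 (by simp; omega)
      · intro h0
        simp [e45, pv] at h0
        have hid := r3.ids i hi h0
        apply Runs.store_seq hW1 (by simp; omega) (by simp; omega)
        apply Runs.set hW1 (by simp [p1]; omega)
        have key : ∀ i', (put (put (put π 51 ((var vTail).val π)
            ((Expr.read aBI (var vB1)).val π)) 50 0 (t' + 1)) 43 0 (i + 1)) 51 i' =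
            if i' = t' then ρ 46 i else π 51 i' := by
          intro i'
          simp [p1, e46, pv, Function.update_apply]
        have hval : (var vTail + 1).val (put π 51 ((var vTail).val π)
            ((Expr.read aBI (var vB1)).val π)) = t' + 1 := by simp [p1]
        rw [hval]
        refine ⟨t' + 1, by simp, by omega, by omega, fun i' hi' => ?_, fun i' h1 h2 => ?_,
          fun b hb hb0 => ?_⟩
        · rw [key, if_neg (by omega)]; exact p4 i' hi'
        · rw [key]
          split_ifs with h
          · exact hid
          · exact p5 i' h1 (by omega)
        · rcases Nat.lt_succ_iff_lt_or_eq.mp hb with hb | rfl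
          · obtain ⟨i', h1, h2, h4⟩ := p6 b hb hb0
            exact ⟨i', h1, by omega, by rw [key, if_neg (by omega), h4]⟩
          · exact ⟨t', p2, by omega, by rw [key, if_pos rfl]⟩
      · intro h0
        simp [e45, pv] at h0
        apply Runs.skip
        refine ⟨t', by simpa using p1, p2, by omega, by simpa using p4, by simpa using p5, ?_⟩
        intro b hb hb0
        rcases Nat.lt_succ_iff_lt_or_eq.mp hb with hb | rfl
        · simpa using p6 b hb hb0
        · exact absurd h0 hb0
    · rintro π pfr pv ⟨t', p1, p2, p3, p4, p5, p6⟩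
      have e9 := pfr 9 (by omega) (by omega)
      have e8 := pfr 8 (by omega) (by omega)
      rw [e9, e8, pfr 40 (by omega) (by omega)]
      have hsp : ∀ o < s₁, sp pb K (ρ 9) (ρ 8) o = sp pb K (σ 9) (σ 8) o :=
        fun o ho => r5.sp_eq ho (hwf o ho)
      refine ⟨r1, h, t', r2, hle, r3.next_size_le, r5, r6, r7, p1, p2, p3, p4, p5,
        fun x hx hx' => ?_⟩
      rw [← depth_congr fun o _ ho => hsp o ho] at hx hx'
      rcases r3.left_or_next hs hx hx' with ⟨b, hb, hb0, hxb⟩ | h'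
      · obtain ⟨i, h1, h2, h4⟩ := p6 b hb hb0
        refine Or.inl ⟨i, h1, h2, ?_⟩
        rw [h4, ← hsp _ (r3.ids b hb hb0).2]
        exact hxb
      · exact Or.inr h'
  · simp only [Expr.cost_var, Expr.cost_read, Expr.cost_add, Expr.cost_one, tLevel]
    nlinarith

end

/-! ### The streams of one subspace -/

section

-- Loop variable `vLev` for levels; number `vItem` of the object under consideration; base `vD` of
-- the numbers of buckets.
notation "vLev" => (55 : ℕ)
notation "vItem" => (56 : ℕ)
notation "vD" => (101 : ℕ)

/-- Writes the intersections of object `vItem` with the subspaces of the coordinates to the end of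
the heap, except for those that are equal to the object. -/
def stream : Program :=
  .set vS0 (var vHp) ;;
  .forLoop vI eN
    (.set vMA (var vItem) ;; copyObj ;; cutCoord ;;
     .ite ((Expr.read aHR (var vHp)).ltE (.read aHR (var vItem))) (.set vHp (var vHp + 1)) .skip) ;;
  .set vS1 (var vHp)

/-- Applies `level` repeatedly, once less than the rank of object `vItem`, with numbers of buckets
`D, D ^ 2, D ^ 4, …`. -/
def levels : Program :=
  .set vTb (var vD) ;;
  .forLoop vLev (.read aHR (var vItem) - 1)
    (level ;; .set vS0 (var vS1) ;; .set vS1 (var vHp) ;; .set vTb (var vTb * var vTb))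

variable {p : ℕ} [Fact p.Prime] {F : Type*} [Field F] [Algebra (ZMod p) F]
  {pb : PowerBasis (ZMod p) F} {K N m : ℕ}

section count

variable {V : Type*} [AddCommGroup V] [Module F V]

open Classical in
/-- The number of members of `S 0, …, S (N - 1)` that do not contain the subspace `L`. -/
noncomputable def offCount (S : ℕ → Submodule F V) (N : ℕ) (L : Submodule F V) : ℕ :=
  #{i ∈ range N | ¬ L ≤ S i}

open Classical in
/-- The number of members of `S 0, …, S (N - 1)` that contain the vector `x`, but not the
subspace `L`. -/
noncomputable def hitCount (S : ℕ → Submodule F V) (N : ℕ) (L : Submodule F V) (x : V) : ℕ :=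
  #{i ∈ range N | ¬ L ≤ S i ∧ x ∈ S i}

end count

/-- A bound for the running time of `stream`. -/
def tStream (e K N m : ℕ) : ℕ := N * (K * K * 30 + tCoord e K m + 200) + 100

/-- The stream of an item `A`: the proper subspaces among the intersections of `A` with the
subspaces of the coordinates. The length of the stream is `offCount`, and a vector of `A` lies in
`hitCount` of its members. -/
theorem stream_spec {W H : ℕ} (hW : Room pb W K N m H) {σ : Mem} (env : CoordEnv pb K N m σ)
    {o a : ℕ} (ho : σ vHp 0 = o) (hoH : o + N < H) (ha : σ vItem 0 = a) (hao : a < o)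
    (hwf : ∀ o' < o, WF pb K (σ aHM) (σ aHR) o') :
    Runs W stream σ (tStream pb.dim K N m) (fun τ =>
      ((∀ x, τ aHM x < p ^ pb.dim) ∧ τ vS0 0 = o ∧ τ vHp 0 = τ vS1 0 ∧
      τ vS1 0 = o + offCount (coordSub pb K N m (σ aC)) N (sp pb K (σ aHM) (σ aHR) a) ∧
      (∀ o' < τ vS1 0, WF pb K (τ aHM) (τ aHR) o') ∧
      SameBelow K o (σ aHM) (σ aHR) (τ aHM) (τ aHR) ∧
      (∀ o', o ≤ o' → o' < τ vS1 0 → τ aHR o' < σ aHR a) ∧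
      ∀ x ∈ sp pb K (σ aHM) (σ aHR) a, depth (sp pb K (τ aHM) (τ aHR)) x o (τ vS1 0) =
        hitCount (coordSub pb K N m (σ aC)) N (sp pb K (σ aHM) (σ aHR) a) x) ∧
      ∀ a, a < 8 ∨ (41 ≤ a ∧ a < 53) ∨ 55 ≤ a → τ a = σ a) := by
  classical
  have hW1 := one_lt_of_le hW.field
  have h3 := hW.three_lt
  have hobj := hW.objects
  have hNW : N < W := by omega
  set A := sp pb K (σ aHM) (σ aHR) a with hA
  set S := coordSub pb K N m (σ aC) with hS
  have hoff : ∀ i ≤ N, offCount S i A ≤ N := fun i hi =>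
    (card_filter_le _ _).trans (by simpa using hi)
  apply Runs.le
  · apply Runs.set_seq_val (n := o) hW1 (by simp; omega) (by simp [ho])
    apply Runs.seq (Q := fun τ => ((∀ x, τ aHM x < p ^ pb.dim) ∧ τ vHp 0 = o + offCount S N A ∧
        (∀ o' < o + offCount S N A, WF pb K (τ aHM) (τ aHR) o') ∧
        SameBelow K o (σ aHM) (σ aHR) (τ aHM) (τ aHR) ∧
        (∀ o', o ≤ o' → o' < o + offCount S N A → τ aHR o' < σ aHR a) ∧
        ∀ x ∈ A, depth (sp pb K (τ aHM) (τ aHR)) x o (o + offCount S N A) = hitCount S N A x) ∧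
        τ vS0 0 = o ∧ ∀ a, a < 8 ∨ (41 ≤ a ∧ a < 53) ∨ 54 ≤ a → τ a = σ a)
    · apply Runs.forLoop 8 41 (n := N) (fun i τ => (∀ x, τ aHM x < p ^ pb.dim) ∧
        τ vHp 0 = o + offCount S i A ∧
        (∀ o' < o + offCount S i A, WF pb K (τ aHM) (τ aHR) o') ∧
        SameBelow K o (σ aHM) (σ aHR) (τ aHM) (τ aHR) ∧
        (∀ o', o ≤ o' → o' < o + offCount S i A → τ aHR o' < σ aHR a) ∧
        ∀ x ∈ A, depth (sp pb K (τ aHM) (τ aHR)) x o (o + offCount S i A) = hitCount S i A x)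
        hW1 hNW rfl rfl
      · have h0 : offCount S 0 A = 0 := by simp [offCount]
        simp only [h0, add_zero, put_ne _ (show (9:ℕ) ≠ 34 by decide),
          put_ne _ (show (8:ℕ) ≠ 34 by decide), put_ne _ (show (40:ℕ) ≠ 34 by decide),
          put_ne _ (show (9:ℕ) ≠ 53 by decide),
          put_ne _ (show (8:ℕ) ≠ 53 by decide), put_ne _ (show (40:ℕ) ≠ 53 by decide)]
        exact ⟨env.cells, ho, hwf, SameBelow.refl _ _ _, fun o' h1 h2 => by omega,
          fun x _ => by simp [depth_self, hitCount]⟩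
      · intro i τ hi hfr hv _
        have h : τ 0 = σ 0 := by rw [hfr 0 (by omega) (by omega)]; simp
        simp [h, env.N_eq]; omega
      · rintro i τ hi hfr hv ⟨h1, h2, h4, h5, h6, h7⟩
        set g := o + offCount S i A with hg
        have hgH : g < H := by
          have := hoff i hi.le
          omega
        have hkeep : ∀ b, b ≠ 34 → b < 8 ∨ 41 ≤ b → b ≠ 53 → τ b = σ b := by
          intro b hb hb' hb''
          rw [hfr b hb hb', put_ne _ hb'']
        have te : CoordEnv pb K N m τ := env.congr (hkeep 0 (by omega) (by omega) (by omega))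
          (hkeep 1 (by omega) (by omega) (by omega)) (hkeep 105 (by omega) (by omega) (by omega))
          (hkeep 100 (by omega) (by omega) (by omega)) h1
          (hkeep 103 (by omega) (by omega) (by omega))
        have e56 : τ 56 0 = a := by rw [hkeep 56 (by omega) (by omega) (by omega), ha]
        apply Runs.set_seq_val (n := a) hW1 (by simp; omega) (by simp [e56])
        apply Runs.seq (copyObj_spec (o := g) (a := a) hW
          (te.toHeapEnv.congr (by simp) (by simp) (by simp) (by simp) (by simpa using h1))
          (by simp [h2]) hgH (by simp) (by omega) (by simpa using h4 a (by omega)))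
        rintro ρ ⟨⟨r1, r2, r3, r4⟩, rfr⟩
        simp only [put_ne _ (show (9:ℕ) ≠ 36 by decide), put_ne _ (show (8:ℕ) ≠ 36 by decide)]
          at r3 r4
        rw [h5.sp_eq hao (hwf a hao)] at r3
        have rkeep : ∀ b, b ≠ 36 → b < 8 ∨ 21 ≤ b → ρ b = τ b := by
          intro b hb hb'
          rw [rfr b hb', put_ne _ hb]
        have re : CoordEnv pb K N m ρ := te.congr (rkeep 0 (by omega) (by omega))
          (rkeep 1 (by omega) (by omega)) (rkeep 105 (by omega) (by omega))
          (rkeep 100 (by omega) (by omega)) r1 (rkeep 103 (by omega) (by omega))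
        apply Runs.seq (cutCoord_spec (o := g) (i := i) hW re
          (by rw [rkeep 40 (by omega) (by omega), h2]) hgH
          (by rw [rkeep 34 (by omega) (by omega), hv]) hi r2)
        rintro π ⟨⟨p1, p2, p3, p4⟩, pfr⟩
        rw [r3, rkeep 103 (by omega) (by omega), hkeep 103 (by omega) (by omega) (by omega), ← hS,
          ← hA] at p3
        have psame := r4.trans p4
        have pso := h5.trans (psame.mono (show o ≤ g by omega))
        have pg : ∀ o' < g, WF pb K (π 9) (π 8) o' := fun o' ho' => psame.wf ho' (h4 o' ho')
        have psp : ∀ o' < g, sp pb K (π 9) (π 8) o' = sp pb K (τ 9) (τ 8) o' :=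
          fun o' ho' => psame.sp_eq ho' (h4 o' ho')
        have p40 : π 40 0 = g := by
          rw [pfr 40 (by omega), rkeep 40 (by omega) (by omega), h2]
        have p56 : π 56 0 = a := by
          rw [pfr 56 (by omega), rkeep 56 (by omega) (by omega), e56]
        have p8a : π 8 a = σ 8 a := pso.rank a hao
        have pfg := p2.finrank_eq
        rw [p3] at pfg
        have pfa : Module.finrank F A = σ 8 a := (hwf a hao).finrank_eq
        have hocc : offCount S (i + 1) A = offCount S i A + if A ≤ S i then 0 else 1 := by
          rw [offCount, range_add_one, filter_insert]
          by_cases h : A ≤ S i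
          · simp [h, offCount]
          · rw [if_pos h, if_neg h, card_insert_of_notMem (by simp), offCount]
        have hhit : ∀ x, hitCount S (i + 1) A x =
            hitCount S i A x + if ¬ A ≤ S i ∧ x ∈ S i then 1 else 0 := by
          intro x
          rw [hitCount, range_add_one, filter_insert]
          split_ifs with h
          · rw [card_insert_of_notMem (by simp), hitCount]
          · simp [hitCount]
        apply Runs.ite hW1 (by simp; omega)
        · intro h0
          simp only [Expr.val_ltE, Expr.val_read, Expr.val_var, p40, p56, p8a] at h0
          have hlt : π 8 g < σ 8 a := by
            by_contra hc
            exact h0 (if_neg hc)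
          have hnle : ¬ A ≤ S i := by
            intro hle
            rw [inf_eq_left.mpr hle] at pfg
            omega
          rw [if_neg hnle] at hocc
          apply Runs.set hW1 (by simp [p40]; omega)
          simp only [Expr.val_add, Expr.val_var, Expr.val_one, p40, hocc, ← add_assoc, ← hg,
            put_ne _ (show (9:ℕ) ≠ 34 by decide), put_ne _ (show (8:ℕ) ≠ 34 by decide),
            put_ne _ (show (40:ℕ) ≠ 34 by decide), put_ne _ (show (9:ℕ) ≠ 40 by decide),
            put_ne _ (show (8:ℕ) ≠ 40 by decide)]
          refine ⟨p1, by simp, fun o' ho' => ?_, pso, fun o' h1' h2' => ?_, fun x hx => ?_⟩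
          · by_cases h : o' < g
            · exact pg o' h
            · rw [show o' = g by omega]; exact p2
          · by_cases h : o' < g
            · rw [psame.rank o' h]; exact h6 o' h1' h
            · rw [show o' = g by omega]; exact hlt
          · rw [depth_succ _ _ (by omega), depth_congr fun o' _ ho' => psp o' ho', h7 x hx, hhit x,
              p3]
            simp [hx, hnle]
        · intro h0
          simp only [Expr.val_ltE, Expr.val_read, Expr.val_var, p40, p56, p8a] at h0
          have hge : σ 8 a ≤ π 8 g := by
            by_contra hc
            rw [if_pos (by omega)] at h0
            omega
          have hle : A ≤ S i := by
            have := Submodule.eq_of_le_of_finrank_le (inf_le_left : A ⊓ S i ≤ A) (by omega)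
            rw [← this]
            exact inf_le_right
          rw [if_pos hle, add_zero] at hocc
          apply Runs.skip
          simp only [hocc, ← hg,
            put_ne _ (show (9:ℕ) ≠ 34 by decide), put_ne _ (show (8:ℕ) ≠ 34 by decide),
            put_ne _ (show (40:ℕ) ≠ 34 by decide)]
          refine ⟨p1, p40, pg, pso, fun o' h1' h2' => ?_, fun x hx => ?_⟩
          · rw [psame.rank o' h2']; exact h6 o' h1' h2'
          · rw [depth_congr fun o' _ ho' => psp o' ho', h7 x hx, hhit x]
            simp [hle]
      · rintro τ hfr hv hI
        refine ⟨hI, by rw [hfr 53 (by omega) (by omega)]; simp, fun b hb => ?_⟩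
        by_cases hb34 : b = 34
        · omega
        · rw [hfr b hb34 (by omega), put_ne _ (by omega)]
    · rintro τ ⟨⟨h1, h2, h4, h5, h6, h7⟩, h53, hfr⟩
      apply Runs.set hW1 (by simp; omega)
      simp only [Expr.val_var, h2, put_same, Function.update_self,
        put_ne _ (show (9:ℕ) ≠ 54 by decide), put_ne _ (show (8:ℕ) ≠ 54 by decide),
        put_ne _ (show (40:ℕ) ≠ 54 by decide), put_ne _ (show (53:ℕ) ≠ 54 by decide)]
      refine ⟨⟨h1, h53, trivial, trivial, h4, h5, h6, h7⟩, fun b hb => ?_⟩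
      rw [put_ne _ (by omega), hfr b (by omega)]
  · simp only [eN_cost, Expr.cost_var, Expr.cost_read, Expr.cost_add, Expr.cost_one,
      Expr.cost_ltE, tStream]
    nlinarith

theorem depth_eq_zero_of_finrank {V : Type*} [AddCommGroup V] [Module F V] [FiniteDimensional F V]
    {S : ℕ → Submodule F V} {x : V} {lo hi : ℕ} (hx : x ≠ 0)
    (h : ∀ o, lo ≤ o → o < hi → Module.finrank F (S o) = 0) : depth S x lo hi = 0 := by
  by_contra hc
  obtain ⟨o, h1, h2, h3⟩ := exists_of_depth_pos (Nat.pos_of_ne_zero hc)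
  rw [Submodule.finrank_eq_zero.mp (h o h1 h2)] at h3
  exact hx ((Submodule.mem_bot F).mp h3)

/-- The potential of the subspaces that are pushed to the queue for a subspace of rank `r` is
smaller than the potential of that subspace. -/
theorem sum_potential_lt {D : ℕ} (hD : 2 ≤ D) (r : ℕ) :
    ∑ v ∈ range (r - 1), D ^ 2 ^ v * D ^ 2 ^ (r - 1 - v) + 1 ≤ D ^ 2 ^ r := by
  rcases Nat.eq_zero_or_pos r with rfl | hr
  · simp; omega
  obtain ⟨n, rfl⟩ : ∃ n, r = n + 1 := ⟨r - 1, by omega⟩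
  rw [Nat.add_sub_cancel]
  have hterm : ∀ v ∈ range n, D ^ 2 ^ v * D ^ 2 ^ (n - v) ≤ D ^ (2 ^ n + 1) := by
    intro v hv
    rw [mem_range] at hv
    rw [← pow_add]
    refine Nat.pow_le_pow_right (by omega) ?_
    obtain ⟨w, rfl⟩ := Nat.exists_eq_add_of_lt hv
    have h1 : 1 ≤ 2 ^ v := Nat.one_le_two_pow
    have h2 : 1 ≤ 2 ^ (v + w + 1 - v) := Nat.one_le_two_pow
    have h3 : 2 ^ (v + w + 1) = 2 ^ v * 2 ^ (v + w + 1 - v) := by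
      rw [← pow_add]; congr 1; omega
    rw [h3]
    nlinarith
  have h1 := sum_le_card_nsmul _ _ _ hterm
  rw [card_range, smul_eq_mul] at h1
  have h2 : 1 ≤ D ^ (2 ^ n + 1) := Nat.one_le_pow _ _ (by omega)
  have h3 : n + 1 ≤ D ^ (2 ^ n - 1) := by
    have e1 : n < 2 ^ n := Nat.lt_two_pow_self
    have e2 : 2 ^ n - 1 < 2 ^ (2 ^ n - 1) := Nat.lt_two_pow_self
    have e3 : 2 ^ (2 ^ n - 1) ≤ D ^ (2 ^ n - 1) := Nat.pow_le_pow_left hD _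
    omega
  have h4 : D ^ 2 ^ (n + 1) = D ^ (2 ^ n - 1) * D ^ (2 ^ n + 1) := by
    rw [← pow_add]
    congr 1
    have : 1 ≤ 2 ^ n := Nat.one_le_two_pow
    rw [pow_succ]; omega
  rw [h4]
  calc _ ≤ n * D ^ (2 ^ n + 1) + D ^ (2 ^ n + 1) := by omega
    _ = (n + 1) * D ^ (2 ^ n + 1) := by ring
    _ ≤ _ := Nat.mul_le_mul_right _ h3

theorem tLevel_mono {e K T T' n n' : ℕ} (hT : T ≤ T') (hn : n ≤ n') :
    tLevel e K T n ≤ tLevel e K T' n' := by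
  unfold tLevel tInsert tFind tEmit
  gcongr

end

section

variable {p : ℕ} [Fact p.Prime] {F : Type*} [Field F] [Algebra (ZMod p) F]
  {pb : PowerBasis (ZMod p) F} {K N m : ℕ}

/-- A bound for the running time of `levels` for a stream of `n` members, where no level has more
than `Z` buckets. -/
def tLevels (e K Z n : ℕ) : ℕ := K * (tLevel e K Z (n * Z) + 100) + 100

/-- A nonzero vector that lies in at least a fraction `2 / D` of the members of the stream ends up
in a subspace that has been appended to the queue, since the last stream consists of zero subspaces.
The potential of all appended subspaces together is less than that of the item. -/
theorem levels_spec {W H : ℕ} (hW : Room pb W K N m H) {σ : Mem} (env : HeapEnv pb K σ)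
    {a r D Z s₀ s₁ t : ℕ} (ha : σ vItem 0 = a) (has : a < s₁) (hr : σ aHR a = r)
    (hD : σ vD 0 = D) (hD2 : 2 ≤ D) (hZ : D ^ 2 ^ (K - 1) ≤ Z) (hs₀ : σ vS0 0 = s₀)
    (hs₁ : σ vS1 0 = s₁) (hh : σ vHp 0 = s₁) (hs : s₀ ≤ s₁) (ht : σ vTail 0 = t)
    (htW : t + K * Z < W) (hroom : s₁ + K * ((s₁ - s₀) * Z) < H)
    (hwf : ∀ o < s₁, WF pb K (σ aHM) (σ aHR) o)
    (hrk : ∀ o, s₀ ≤ o → o < s₁ → σ aHR o < r) :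
    Runs W levels σ (tLevels pb.dim K Z (s₁ - s₀)) (fun τ =>
      ((∀ x, τ aHM x < p ^ pb.dim) ∧ ∃ s₂ t', τ vHp 0 = s₂ ∧ s₁ ≤ s₂ ∧
      s₂ ≤ s₁ + K * ((s₁ - s₀) * Z) ∧ SameBelow K s₁ (σ aHM) (σ aHR) (τ aHM) (τ aHR) ∧
      (∀ o < s₂, WF pb K (τ aHM) (τ aHR) o) ∧
      τ vTail 0 = t' ∧ t ≤ t' ∧ (∀ i < t, τ aQ i = σ aQ i) ∧
      (∀ i, t ≤ i → i < t' → τ aQ i < s₂) ∧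
      ∑ i ∈ Ico t t', D ^ 2 ^ τ aHR (τ aQ i) + 1 ≤ D ^ 2 ^ r ∧
      ∀ x, x ≠ 0 → 0 < depth (sp pb K (σ aHM) (σ aHR)) x s₀ s₁ →
        2 * (s₁ - s₀) ≤ depth (sp pb K (σ aHM) (σ aHR)) x s₀ s₁ * D →
        ∃ i, t ≤ i ∧ i < t' ∧ x ∈ sp pb K (τ aHM) (τ aHR) (τ aQ i)) ∧
      ∀ a, a < 8 ∨ 56 ≤ a → τ a = σ a) := by
  have hW1 := one_lt_of_le hW.field
  have h3 := hW.three_lt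
  have hobj := hW.objects
  have hrK : r ≤ K := by rw [← hr]; exact (hwf a has).rank_le
  have hKpos := hW.width_pos
  have hKZ : Z ≤ K * Z := Nat.le_mul_of_pos_left _ hKpos
  set n := s₁ - s₀ with hn
  have hKnZ : n * Z ≤ K * (n * Z) := Nat.le_mul_of_pos_left _ hKpos
  have hpow : ∀ v, v + 1 ≤ r → D ^ 2 ^ v ≤ Z := fun v hv =>
    (Nat.pow_le_pow_right (by omega) (Nat.pow_le_pow_right (by omega) (by omega))).trans hZ
  have hKW : K < W := by
    have : K ≤ K * (N * m) := Nat.le_mul_of_pos_right _ (Nat.mul_pos hW.N_pos hW.m_pos)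
    have := hW.words
    omega
  refine Runs.frame 8 56 rfl ?_
  apply Runs.le
  · apply Runs.set_seq_val (n := D) hW1 (by simp; omega) (by simp [hD])
    -- After `v` levels there are `D ^ 2 ^ v` buckets, and the ranks in the current stream have
    -- dropped by at least `v`. A vector that has been heavy in the first stream either lies in a
    -- subspace in the queue or is still heavy, relative to the current number of buckets.
    apply Runs.forLoop 8 55 (n := r - 1) (T := tLevel pb.dim K Z (n * Z) + 30)
      (fun v τ => (∀ x, τ aHM x < p ^ pb.dim) ∧ ∃ u₀ u₁ t', τ vS0 0 = u₀ ∧ τ vS1 0 = u₁ ∧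
        τ vHp 0 = u₁ ∧ τ vTb 0 = D ^ 2 ^ v ∧ u₀ ≤ u₁ ∧ s₁ ≤ u₁ ∧ u₁ ≤ s₁ + v * (n * Z) ∧
        u₁ - u₀ ≤ n * D ^ 2 ^ v ∧ SameBelow K s₁ (σ aHM) (σ aHR) (τ aHM) (τ aHR) ∧
        (∀ o < u₁, WF pb K (τ aHM) (τ aHR) o) ∧ (∀ o, u₀ ≤ o → o < u₁ → τ aHR o + v < r) ∧
        τ vTail 0 = t' ∧ t ≤ t' ∧ t' ≤ t + v * Z ∧ (∀ i < t, τ aQ i = σ aQ i) ∧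
        (∀ i, t ≤ i → i < t' → τ aQ i < u₁) ∧
        ∑ i ∈ Ico t t', D ^ 2 ^ τ aHR (τ aQ i) ≤
          ∑ v ∈ range v, D ^ 2 ^ v * D ^ 2 ^ (r - 1 - v) ∧
        ∀ x, 0 < depth (sp pb K (σ aHM) (σ aHR)) x s₀ s₁ →
          2 * n ≤ depth (sp pb K (σ aHM) (σ aHR)) x s₀ s₁ * D →
          (∃ i, t ≤ i ∧ i < t' ∧ x ∈ sp pb K (τ aHM) (τ aHR) (τ aQ i)) ∨
          (0 < depth (sp pb K (τ aHM) (τ aHR)) x u₀ u₁ ∧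
            2 * (u₁ - u₀) ≤ depth (sp pb K (τ aHM) (τ aHR)) x u₀ u₁ * D ^ 2 ^ v))
      hW1 (by omega) rfl rfl
    · simp only [put_ne _ (show (9:ℕ) ≠ 55 by decide), put_ne _ (show (8:ℕ) ≠ 55 by decide),
        put_ne _ (show (9:ℕ) ≠ 52 by decide), put_ne _ (show (8:ℕ) ≠ 52 by decide)]
      refine ⟨env.cells, s₀, s₁, t, by simp [hs₀], by simp [hs₁], by simp [hh], by simp, hs, le_rfl,
        by simp, ?_, SameBelow.refl _ _ _, hwf, by simpa using hrk, by simp [ht], le_rfl, by simp,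
        by simp, fun i h1 h2 => by omega, by simp, fun x hx hx' => Or.inr ⟨hx, ?_⟩⟩
      · rw [pow_zero, pow_one, ← hn]
        exact Nat.le_mul_of_pos_right _ (by omega)
      · simpa [hn] using hx'
    · rintro v τ hv hfr hvv ⟨-, u₀, u₁, t', -, -, -, -, -, -, -, -, h5, -⟩
      have e56 : τ 56 = σ 56 := by rw [hfr 56 (by omega) (by omega)]; simp
      simp [e56, ha, h5.rank a has, hr]; omega
    · rintro v τ hv hfr hvv ⟨h1, u₀, u₁, t', g1, g2, g4, g5, g6, g7, g8, g9, g10, g11, g12, g13,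
        g14, g15, g16, g17, g18, g19⟩
      have hkeep : ∀ b, b < 8 ∨ 56 ≤ b → τ b = σ b := by
        intro b hb
        rw [hfr b (by omega) (by omega), put_ne _ (by omega)]
      have te : HeapEnv pb K τ := env.congr (hkeep 0 (by omega)) (hkeep 1 (by omega))
        (hkeep 105 (by omega)) (hkeep 100 (by omega)) h1
      have hT := hpow v (by omega)
      have hT' := hpow (v + 1) (by omega)
      have hTT : D ^ 2 ^ (v + 1) = D ^ 2 ^ v * D ^ 2 ^ v := by
        rw [← pow_add, pow_succ, mul_two]
      have hTpos : 0 < D ^ 2 ^ v := Nat.pow_pos (by omega)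
      have hnT : (u₁ - u₀) * D ^ 2 ^ v ≤ n * D ^ 2 ^ (v + 1) := by
        rw [hTT, ← mul_assoc]
        exact Nat.mul_le_mul_right _ g9
      have hnT' : n * D ^ 2 ^ (v + 1) ≤ n * Z := Nat.mul_le_mul_left _ hT'
      have hvK : (v + 1) * (n * Z) ≤ K * (n * Z) := Nat.mul_le_mul_right _ (by omega)
      have hvK' : (v + 1) * Z ≤ K * Z := Nat.mul_le_mul_right _ (by omega)
      have hvn : v * (n * Z) + n * Z = (v + 1) * (n * Z) := by ring
      have hvn' : v * Z + Z = (v + 1) * Z := by ring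
      have hn' : u₁ - u₀ ≤ n * Z := g9.trans (Nat.mul_le_mul_left _ hT)
      apply Runs.le
      · apply Runs.seq (level_spec (T := D ^ 2 ^ v) (s₀ := u₀) (s₁ := u₁) (t := t')
          (d := r - 1 - v) hW te g5 (by omega) hTpos g1 g2 g4 g6 g13 (by omega) (by omega) g11
          (fun o h h' => by have := g12 o h h'; omega))
        rintro ρ ⟨⟨r1, u₂, t₂, r2, r3, r4, r5, r6, r7, r8, r9, r10, r11, r12, r13⟩, rfr⟩
        have r52 : ρ 52 0 = D ^ 2 ^ v := by rw [rfr 52 (by omega), g5]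
        have r54 : ρ 54 0 = u₁ := by rw [rfr 54 (by omega), g2]
        apply Runs.set_seq_val (n := u₁) hW1 (by simp; omega) (by simp [r54])
        apply Runs.set_seq_val (n := u₂) hW1 (by simp; omega) (by simp [r2])
        apply Runs.set hW1 (by simp [r52, ← hTT]; omega)
        have hsp : ∀ o < u₁, sp pb K (ρ 9) (ρ 8) o = sp pb K (τ 9) (τ 8) o :=
          fun o ho => r5.sp_eq ho (g11 o ho)
        have hq : ∀ i, t ≤ i → i < t' → ρ 51 i = τ 51 i := fun i _ h => r11 i h
        simp only [put_ne _ (show (9:ℕ) ≠ 55 by decide), put_ne _ (show (8:ℕ) ≠ 55 by decide),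
          put_ne _ (show (9:ℕ) ≠ 52 by decide), put_ne _ (show (8:ℕ) ≠ 52 by decide),
          put_ne _ (show (9:ℕ) ≠ 54 by decide), put_ne _ (show (8:ℕ) ≠ 54 by decide),
          put_ne _ (show (9:ℕ) ≠ 53 by decide), put_ne _ (show (8:ℕ) ≠ 53 by decide),
          put_ne _ (show (51:ℕ) ≠ 55 by decide), put_ne _ (show (51:ℕ) ≠ 52 by decide),
          put_ne _ (show (51:ℕ) ≠ 53 by decide), put_ne _ (show (51:ℕ) ≠ 54 by decide)]
        refine ⟨r1, u₁, u₂, t₂, by simp, by simp, by simp [r2], by simp [r52, hTT], r3, by omega,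
          by omega, by omega, g10.trans (r5.mono g7), r6,
          fun o h h' => by have := r7 o h h'; omega, by simp [r8], by omega, by omega,
          fun i hi => by rw [r11 i (by omega), g16 i hi], fun i h h' => ?_, ?_, fun x hx hx' => ?_⟩
        · by_cases hi : i < t'
          · rw [hq i h hi]
            have := g17 i h hi
            omega
          · have := (r12 i (by omega) h').2
            omega
        · rw [sum_range_succ, ← sum_Ico_consecutive _ g14 r9]
          refine Nat.add_le_add ?_ ?_
          · refine le_of_eq_of_le (sum_congr rfl fun i hi => ?_) g18
            rw [mem_Ico] at hi
            rw [hq i hi.1 hi.2, r5.rank _ (g17 i hi.1 hi.2)]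
          · have : ∀ i ∈ Ico t' t₂, D ^ 2 ^ ρ 8 (ρ 51 i) ≤ D ^ 2 ^ (r - 1 - v) := by
              intro i hi
              rw [mem_Ico] at hi
              have e1 := r12 i hi.1 hi.2
              rw [r5.rank _ e1.2]
              have e2 := g12 _ e1.1 e1.2
              exact Nat.pow_le_pow_right (by omega) (Nat.pow_le_pow_right (by omega) (by omega))
            refine (sum_le_card_nsmul _ _ _ this).trans ?_
            rw [Nat.card_Ico, smul_eq_mul]
            exact Nat.mul_le_mul_right _ (by omega)
        · rcases g19 x hx hx' with ⟨i, i1, i2, i3⟩ | ⟨i1, i2⟩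
          · refine Or.inl ⟨i, i1, by omega, ?_⟩
            rw [hq i i1 i2, hsp _ (g17 i i1 i2)]
            exact i3
          · rcases r13 x i1 i2 with ⟨i, j1, j2, j3⟩ | h
            · refine Or.inl ⟨i, by omega, j2, ?_⟩
              rw [hsp _ (r12 i j1 j2).2]
              exact j3
            · rw [hTT]
              exact Or.inr h
      · have := tLevel_mono (e := pb.dim) (K := K) hT hn'
        simp only [Expr.cost_var, Expr.cost_mul]
        omega
    · rintro τ hfr hvv ⟨h1, u₀, u₁, t', g1, g2, g4, g5, g6, g7, g8, g9, g10, g11, g12, g13, g14,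
        g15, g16, g17, g18, g19⟩
      have hvK : (r - 1) * (n * Z) ≤ K * (n * Z) := Nat.mul_le_mul_right _ (by omega)
      refine ⟨h1, u₁, t', g4, g7, by omega, g10, g11, g13, g14, g16, g17,
        (Nat.add_le_add_right g18 1).trans (sum_potential_lt hD2 r), fun x hx hx1 hx2 => ?_⟩
      rcases g19 x hx1 hx2 with h | ⟨h, -⟩
      · exact h
      · have h0 := depth_eq_zero_of_finrank (S := sp pb K (τ 9) (τ 8)) (lo := u₀) (hi := u₁) hx
          (fun o h h' => by
            rw [(g11 o h').finrank_eq]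
            have := g12 o h h'
            omega)
        omega
  · have := Nat.mul_le_mul_right (tLevel pb.dim K Z (n * Z) + 100) (show r - 1 ≤ K by omega)
    simp only [Expr.cost_var, Expr.cost_read, Expr.cost_sub, Expr.cost_one, tLevels]
    nlinarith

end

/-! ### The work list -/

section

-- Front `vHead` of the queue; number `vNout` of accepted lines; their object numbers `aOI`, and
-- their marks `aOF`.
notation "vHead" => (57 : ℕ)
notation "vNout" => (58 : ℕ)
notation "aOI" => (59 : ℕ)
notation "aOF" => (60 : ℕ)

/-- The input parameter number `i`, as an expression. -/
def ePar (i : ℕ) : Expr := .read 0 (.const i)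

@[simp] theorem ePar_val (σ : Mem) (i : ℕ) : (ePar i).val σ = σ 0 i := rfl
@[simp] theorem ePar_safe (W : ℕ) (σ : Mem) (i : ℕ) : (ePar i).Safe W σ ↔ i < W := Iff.rfl
@[simp] theorem ePar_cost (i : ℕ) : (ePar i).cost = 2 := rfl

/-- The test whether the relative distance `(vS1 - vS0) / N` is less than `Δ - ε`. -/
def eNear : Expr :=
  ((var vS1 - var vS0) * (ePar 6 * ePar 8) + eN * (ePar 7 * ePar 6)).ltE (eN * (ePar 5 * ePar 8))

/-- Adds object `vItem` to the list of accepted objects if it is a line that belongs to a codeword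
near the received word, and if it is not yet in the list. -/
def accept : Program :=
  .ite ((Expr.read aHR (var vItem)).eqE 1)
    (.ite (.read aHM (var vItem * (var vK * var vK)))
      (.ite eNear
        (.set vMB (var vItem) ;; find aOI aOF vNout ;;
         .ite ((var vFound).eqE (var vNout))
          (.store aOI (var vNout) (var vItem) ;; .store aOF (var vNout) 1 ;;
           .set vNout (var vNout + 1))
          .skip)
        .skip)
      .skip)
    .skip

/-- The work list algorithm. -/
def mainLoop : Program :=
  .loop ((var vHead).ltE (var vTail))
    (.set vItem (.read aQ (var vHead)) ;; .set vHead (var vHead + 1) ;;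
     stream ;; accept ;; levels)

variable {p : ℕ} [Fact p.Prime] {F : Type*} [Field F] [Algebra (ZMod p) F]
  {pb : PowerBasis (ZMod p) F} {K N m : ℕ}

/-- A line `L` of coefficient vectors, not contained in the hyperplane of the vectors with first
coefficient `0`, that belongs to a word whose distance from the received word is small: fewer
than `(c - b) / a` of the subspaces `S 0, …, S (N - 1)` do not contain `L`. -/
structure IsNear (S : ℕ → Submodule F (Fin K → F)) (hK : 0 < K) (N a b c : ℕ)
    (L : Submodule F (Fin K → F)) : Prop where
  line : Module.finrank F L = 1
  affine : ∃ x ∈ L, x ⟨0, hK⟩ ≠ 0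
  near : offCount S N L * a + b < c

/-- The first `n` entries of the array `I` are numbers, below `h`, of objects that are different
subspaces with the property `P`. The array `J` marks these entries. -/
structure Listed {V : Type*} (P : V → Prop) (S : ℕ → V) (n h : ℕ) (I J : ℕ → ℕ) : Prop where
  lt : ∀ i < n, I i < h
  mark : ∀ i < n, J i ≠ 0
  prop : ∀ i < n, P (S (I i))
  distinct : ∀ i < n, ∀ j < n, i ≠ j → S (I i) ≠ S (I j)

theorem Listed.congr {V : Type*} {P : V → Prop} {S S' : ℕ → V} {n h h' : ℕ} {I J I' J' : ℕ → ℕ}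
    (hL : Listed P S n h I J) (hh : h ≤ h') (hS : ∀ o < h, S' o = S o) (hI : ∀ i < n, I' i = I i)
    (hJ : ∀ i < n, J' i = J i) : Listed P S' n h' I' J' := by
  refine ⟨fun i hi => ?_, fun i hi => ?_, fun i hi => ?_, fun i hi j hj hij => ?_⟩
  · rw [hI i hi]; exact (hL.lt i hi).trans_le hh
  · rw [hJ i hi]; exact hL.mark i hi
  · rw [hI i hi, hS _ (hL.lt i hi)]; exact hL.prop i hi
  · rw [hI i hi, hI j hj, hS _ (hL.lt i hi), hS _ (hL.lt j hj)]
    exact hL.distinct i hi j hj hij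

theorem Listed.push {V : Type*} {P : V → Prop} {S : ℕ → V} {n h a : ℕ} {I J : ℕ → ℕ}
    (hL : Listed P S n h I J) (ha : a < h) (hP : P (S a)) (hne : ∀ i < n, S (I i) ≠ S a) :
    Listed P S (n + 1) h (Function.update I n a) (Function.update J n 1) := by
  have hlt : ∀ {i}, i < n + 1 → i ≠ n → i < n := fun h1 h2 => by omega
  refine ⟨fun i hi => ?_, fun i hi => ?_, fun i hi => ?_, fun i hi j hj hij => ?_⟩
  · by_cases h : i = n
    · simp [h, ha]
    · simpa [h] using hL.lt i (hlt hi h)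
  · by_cases h : i = n
    · simp [h]
    · simpa [h] using hL.mark i (hlt hi h)
  · by_cases h : i = n
    · simpa [h] using hP
    · simpa [h] using hL.prop i (hlt hi h)
  · by_cases h : i = n
    · have h' : j ≠ n := fun h' => hij (h.trans h'.symm)
      simpa [h, h'] using (hne j (hlt hj h')).symm
    · by_cases h' : j = n
      · simpa [h, h'] using hne i (hlt hi h)
      · simpa [h, h'] using hL.distinct i (hlt hi h) j (hlt hj h') hij

/-- The parameters of the distance test. -/
structure ParamEnv (W N Δn Δd εn εd : ℕ) (σ : Mem) : Prop where
  h5 : σ 0 5 = Δn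
  h6 : σ 0 6 = Δd
  h7 : σ 0 7 = εn
  h8 : σ 0 8 = εd
  eight_lt : 8 < W
  small : N * (Δd * εd) + N * (εn * Δd) < W
  small' : N * (Δn * εd) < W
  prod₁ : Δd * εd < W
  prod₂ : εn * Δd < W
  prod₃ : Δn * εd < W

theorem ParamEnv.congr {W N Δn Δd εn εd : ℕ} {σ τ : Mem} (h : ParamEnv W N Δn Δd εn εd σ)
    (h0 : τ 0 = σ 0) : ParamEnv W N Δn Δd εn εd τ :=
  { h with h5 := by rw [h0, h.h5], h6 := by rw [h0, h.h6], h7 := by rw [h0, h.h7],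
           h8 := by rw [h0, h.h8] }

theorem sp_of_rank_one {A R : ℕ → ℕ} {o : ℕ} (h : R o = 1) :
    sp pb K A R o = Submodule.span F {vec pb K A (o * (K * K))} := by
  rw [sp, h]
  congr 1
  ext y
  simp only [Set.mem_image, Set.mem_Iio, Nat.lt_one_iff, exists_eq_left, zero_mul, add_zero,
    Set.mem_singleton_iff, eq_comm]

theorem exists_mem_span_singleton_ne_zero {w : Fin K → F} (i : Fin K) :
    (∃ x ∈ Submodule.span F {w}, x i ≠ 0) ↔ w i ≠ 0 := by
  constructor
  · rintro ⟨x, hx, hxi⟩ hw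
    obtain ⟨c, rfl⟩ := Submodule.mem_span_singleton.mp hx
    exact hxi (by simp [hw])
  · exact fun h => ⟨w, Submodule.mem_span_singleton_self w, h⟩

/-- For a line, the length `s₁ - s₀` of the stream is the Hamming distance between the received word
and the corresponding word, so the distance test needs no further computation. -/
theorem accept_spec {W H : ℕ} (hW : Room pb W K N m H) {σ : Mem} (env : CoordEnv pb K N m σ)
    {Δn Δd εn εd s₀ s₁ a n : ℕ} (par : ParamEnv W N Δn Δd εn εd σ)
    (hs₀ : σ vS0 0 = s₀) (hs₁ : σ vS1 0 = s₁) (hh : σ vHp 0 = s₁) (ha : σ vItem 0 = a)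
    (has : a < s₁) (hsH : s₁ < H) (hn : σ vNout 0 = n) (hnW : n + 1 < W)
    (hwf : ∀ o < s₁, WF pb K (σ aHM) (σ aHR) o)
    (hoff : s₁ = s₀ + offCount (coordSub pb K N m (σ aC)) N (sp pb K (σ aHM) (σ aHR) a))
    (hL : Listed (IsNear (coordSub pb K N m (σ aC)) hW.width_pos N (Δd * εd) (N * (εn * Δd))
      (N * (Δn * εd))) (sp pb K (σ aHM) (σ aHR)) n s₁ (σ aOI) (σ aOF)) :
    Runs W accept σ (tFind pb.dim K n + 200) (fun τ =>
      (∀ x, τ aHM x < p ^ pb.dim) ∧ SameBelow K s₁ (σ aHM) (σ aHR) (τ aHM) (τ aHR) ∧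
      (∃ n', τ vNout 0 = n' ∧ n ≤ n' ∧ n' ≤ n + 1 ∧
      Listed (IsNear (coordSub pb K N m (σ aC)) hW.width_pos N (Δd * εd) (N * (εn * Δd))
        (N * (Δn * εd))) (sp pb K (σ aHM) (σ aHR)) n' s₁ (τ aOI) (τ aOF) ∧
      (∀ i < n, τ aOI i = σ aOI i) ∧
      (IsNear (coordSub pb K N m (σ aC)) hW.width_pos N (Δd * εd) (N * (εn * Δd))
        (N * (Δn * εd)) (sp pb K (σ aHM) (σ aHR) a) →
        ∃ i < n', sp pb K (σ aHM) (σ aHR) (τ aOI i) = sp pb K (σ aHM) (σ aHR) a)) ∧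
      ∀ b, b < 8 ∨ (37 < b ∧ b < 41) ∨ (42 < b ∧ b < 58) ∨ 61 ≤ b → τ b = σ b) := by
  have hW1 := one_lt_of_le hW.field
  have h3 := hW.three_lt
  have hobj := hW.objects
  have hheap := hW.heap
  have h8 := par.eight_lt
  have hWa := hwf a has
  have hrow : a * (K * K) + K * K ≤ s₁ * (K * K) := row_le has
  have hrow' : s₁ * (K * K) ≤ H * (K * K) := Nat.mul_le_mul_right _ hsH.le
  set P := IsNear (coordSub pb K N m (σ aC)) hW.width_pos N (Δd * εd) (N * (εn * Δd))
      (N * (Δn * εd)) with hP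
  have hskip : ∀ T, 1 ≤ T → ¬ P (sp pb K (σ aHM) (σ aHR) a) → Runs W .skip σ T (fun τ =>
      (∀ x, τ aHM x < p ^ pb.dim) ∧ SameBelow K s₁ (σ aHM) (σ aHR) (τ aHM) (τ aHR) ∧
      (∃ n', τ vNout 0 = n' ∧ n ≤ n' ∧ n' ≤ n + 1 ∧
        Listed P (sp pb K (σ aHM) (σ aHR)) n' s₁ (τ aOI) (τ aOF) ∧
        (∀ i < n, τ aOI i = σ aOI i) ∧ (P (sp pb K (σ aHM) (σ aHR) a) →
        ∃ i < n', sp pb K (σ aHM) (σ aHR) (τ aOI i) = sp pb K (σ aHM) (σ aHR) a)) ∧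
      ∀ b, b < 8 ∨ (37 < b ∧ b < 41) ∨ (42 < b ∧ b < 58) ∨ 61 ≤ b → τ b = σ b) := by
    intro T hT hnot
    refine Runs.le (Runs.skip ?_) hT
    exact ⟨env.cells, SameBelow.refl _ _ _, ⟨n, hn, le_rfl, by omega, hL, fun _ _ => rfl,
      fun h => absurd h hnot⟩, fun _ _ => rfl⟩
  have hK := env.width
  have hoffN : offCount (coordSub pb K N m (σ aC)) N (sp pb K (σ aHM) (σ aHR) a) ≤ N := by
    classical
    exact (card_filter_le _ _).trans (by simp)
  have hmul : (s₁ - s₀) * (Δd * εd) ≤ N * (Δd * εd) := Nat.mul_le_mul_right _ (by omega)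
  have hsmall := par.small
  have hsmall' := par.small'
  have hp1 := par.prod₁
  have hp2 := par.prod₂
  have hp3 := par.prod₃
  apply Runs.le
  · apply Runs.ite hW1 (by simp; omega)
    swap
    · intro h0
      refine hskip 1 le_rfl fun hc => ?_
      have : σ 8 a = 1 := by rw [← hWa.finrank_eq]; exact hc.line
      simp [ha, this] at h0
    intro h0
    have hr : σ 8 a = 1 := by
      by_contra hc
      simp [ha, hc] at h0
    have hsp := sp_of_rank_one (pb := pb) (K := K) (A := σ 9) hr
    apply Runs.ite hW1 (by simp [ha, hK]; omega)
    swap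
    · intro h0
      refine hskip 1 le_rfl fun hc => ?_
      have h1 := hc.affine
      rw [hsp, exists_mem_span_singleton_ne_zero] at h1
      simp [ha, hK] at h0
      apply h1
      simp [vec, h0, dec_zero]
    intro h0
    have haff : ∃ x ∈ sp pb K (σ aHM) (σ aHR) a, x ⟨0, hW.width_pos⟩ ≠ 0 := by
      rw [hsp, exists_mem_span_singleton_ne_zero]
      simp [ha, hK] at h0
      intro hc
      exact h0 ((dec_eq_zero_iff pb (env.cells _)).mp (by simpa [vec] using hc))
    have hoff' : s₁ - s₀ = offCount (coordSub pb K N m (σ aC)) N (sp pb K (σ aHM) (σ aHR) a) := by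
      omega
    have hval : eNear.val σ = if (s₁ - s₀) * (Δd * εd) + N * (εn * Δd) < N * (Δn * εd) then 1
        else 0 := by
      simp [eNear, hs₀, hs₁, par.h5, par.h6, par.h7, par.h8, env.N_eq]
    apply Runs.ite hW1
    · simp [eNear, hs₀, hs₁, par.h5, par.h6, par.h7, par.h8, env.N_eq]
      omega
    swap
    · intro h0
      refine hskip 1 le_rfl fun hc => ?_
      have := hc.near
      rw [← hoff'] at this
      rw [hval, if_pos this] at h0
      omega
    intro h0
    have hlt : (s₁ - s₀) * (Δd * εd) + N * (εn * Δd) < N * (Δn * εd) := by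
      by_contra hc
      rw [hval, if_neg hc] at h0
      omega
    have hPa : P (sp pb K (σ aHM) (σ aHR) a) :=
      ⟨by rw [hWa.finrank_eq, hr], haff, by rw [← hoff']; exact hlt⟩
    apply Runs.set_seq_val (n := a) hW1 (by simp; omega) (by simp [ha])
    apply Runs.seq (find_spec (aI := aOI) (aFl := aOF) (vLen := vNout) (o := s₁) (s := a) (n := n)
      hW (env.toHeapEnv.congr (by simp) (by simp) (by simp) (by simp) (by simpa using env.cells))
      (by simp [hh]) hsH (by simp) has (by omega) (by omega) (by omega) (by simp [hn]) (by omega)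
      (by simpa using hWa) (fun b hb _ => by
        simpa using ⟨hL.lt b hb, hwf _ (hL.lt b hb)⟩))
    rintro τ ⟨⟨h1, h2, h4⟩, hfr⟩
    simp only [put_ne _ (show (9:ℕ) ≠ 37 by decide), put_ne _ (show (8:ℕ) ≠ 37 by decide),
      put_ne _ (show (59:ℕ) ≠ 37 by decide), put_ne _ (show (60:ℕ) ≠ 37 by decide)] at h2 h4
    have hkeep : ∀ b, b < 8 ∨ (37 < b ∧ b < 41) ∨ 42 < b → τ b = σ b := by
      intro b hb
      rw [hfr b (by omega), put_ne _ (by omega)]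
    have e58 : τ 58 0 = n := by rw [hkeep 58 (by omega), hn]
    have e56 : τ 56 0 = a := by rw [hkeep 56 (by omega), ha]
    apply Runs.ite hW1 (by simp; omega)
    · intro h0
      have hf : τ 41 0 = n := by
        by_contra hc
        simp [e58, hc] at h0
      rcases h2 with ⟨-, h2⟩ | ⟨h2, -⟩
      swap
      · omega
      apply Runs.store_seq hW1 (by simp; omega) (by simp; omega)
      apply Runs.store_seq hW1 (by simp; omega) (by simp; omega)
      apply Runs.set hW1 (by simp [e58]; omega)
      have hnew := hL.push has hPa fun i hi => h2 i hi (hL.mark i hi)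
      refine ⟨by simpa using h1, by simpa using h4, ⟨n + 1, by simp [e58], by omega, le_rfl, ?_,
        fun i hi => ?_, fun _ => ⟨n, by omega, ?_⟩⟩, fun b hb => ?_⟩
      · simpa [e58, e56, hkeep 59, hkeep 60] using hnew
      · have : i ≠ n := by omega
        simp [e58, e56, hkeep 59, this]
      · simp [e58, e56, hkeep 59]
      · rw [put_ne _ (by omega), put_ne _ (by omega), put_ne _ (by omega), hkeep b (by omega)]
    · intro h0
      have hf : τ 41 0 ≠ n := by
        intro hc
        simp [e58, hc] at h0
      rcases h2 with ⟨h2, -⟩ | ⟨h2, -, h2'⟩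
      · exact absurd h2 hf
      apply Runs.skip
      refine ⟨h1, h4, ⟨n, e58, le_rfl, by omega, ?_, fun i hi => ?_, fun _ => ⟨_, h2, ?_⟩⟩,
        fun b hb => hkeep b (by omega)⟩
      · rw [hkeep 59 (by omega), hkeep 60 (by omega)]; exact hL
      · rw [hkeep 59 (by omega)]
      · rw [hkeep 59 (by omega)]; exact h2'
  · simp only [eNear, Expr.cost_var, Expr.cost_read, Expr.cost_add, Expr.cost_one, Expr.cost_ltE,
      Expr.cost_mul, Expr.cost_sub, Expr.cost_eqE, eN_cost, ePar_cost]
    omega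

end

section

variable {p : ℕ} [Fact p.Prime] {F : Type*} [Field F] [Algebra (ZMod p) F]
  {pb : PowerBasis (ZMod p) F} {K N m : ℕ}

theorem tLevels_mono {e K Z n n' : ℕ} (hn : n ≤ n') : tLevels e K Z n ≤ tLevels e K Z n' := by
  have := tLevel_mono (e := e) (K := K) (le_refl Z) (Nat.mul_le_mul_right Z hn)
  unfold tLevels
  gcongr

theorem tFind_mono {e K n n' : ℕ} (hn : n ≤ n') : tFind e K n ≤ tFind e K n' := by
  unfold tFind
  gcongr

/-- A bound for the time that `mainLoop` spends on one member of the queue. -/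
def tItem (e K N m Z Q : ℕ) : ℕ := tStream e K N m + tFind e K Q + tLevels e K Z N + 300

theorem offCount_le (S : ℕ → Submodule F (Fin K → F)) (N : ℕ) (L : Submodule F (Fin K → F)) :
    offCount S N L ≤ N := by
  classical
  exact (card_filter_le _ _).trans (by simp)

theorem ne_zero_of_finrank_span {V : Type*} [AddCommGroup V] [Module F V] {x : V}
    (h : Module.finrank F (Submodule.span F {x}) = 1) : x ≠ 0 := by
  rintro rfl
  rw [Submodule.span_zero_singleton, finrank_bot] at h
  omega

/-- The work list algorithm, started with the whole space, lists every line that belongs to a near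
codeword, and no other lines. The hypothesis `hheavy` says that the vectors of these lines are heavy
in the stream of every subspace of dimension at least `2` that contains them. -/
theorem mainLoop_spec {W H : ℕ} (hW : Room pb W K N m H) {σ : Mem} (env : CoordEnv pb K N m σ)
    {Δn Δd εn εd D Z Q : ℕ} (par : ParamEnv W N Δn Δd εn εd σ)
    (hD : σ vD 0 = D) (hD2 : 2 ≤ D) (hZ : D ^ 2 ^ (K - 1) ≤ Z) (hQ : D ^ 2 ^ K ≤ Q)
    (hhead : σ vHead 0 = 0) (htail : σ vTail 0 = 1) (hq : σ aQ 0 = 0) (hh : σ vHp 0 = 1)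
    (hn : σ vNout 0 = 0) (hwf : WF pb K (σ aHM) (σ aHR) 0) (htop : sp pb K (σ aHM) (σ aHR) 0 = ⊤)
    (hroom : 1 + Q * (N + K * (N * Z)) < H) (hQW : Q + K * Z + 1 < W)
    (hheavy : ∀ (L : Submodule F (Fin K → F)) (x : Fin K → F), x ∈ L → 2 ≤ Module.finrank F L →
      IsNear (coordSub pb K N m (σ aC)) hW.width_pos N (Δd * εd) (N * (εn * Δd))
        (N * (Δn * εd)) (Submodule.span F {x}) →
      0 < hitCount (coordSub pb K N m (σ aC)) N L x ∧
      2 * offCount (coordSub pb K N m (σ aC)) N L ≤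
        hitCount (coordSub pb K N m (σ aC)) N L x * D) :
    Runs W mainLoop σ (Q * (tItem pb.dim K N m Z Q + 10) + 10) (fun τ =>
      ((∀ x, τ aHM x < p ^ pb.dim) ∧ ∃ n h, τ vNout 0 = n ∧ n ≤ Q ∧ h ≤ H ∧
      (∀ o < h, WF pb K (τ aHM) (τ aHR) o) ∧
      Listed (IsNear (coordSub pb K N m (σ aC)) hW.width_pos N (Δd * εd) (N * (εn * Δd))
        (N * (Δn * εd))) (sp pb K (τ aHM) (τ aHR)) n h (τ aOI) (τ aOF) ∧
      ∀ x, IsNear (coordSub pb K N m (σ aC)) hW.width_pos N (Δd * εd) (N * (εn * Δd))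
        (N * (Δn * εd)) (Submodule.span F {x}) →
        ∃ i < n, x ∈ sp pb K (τ aHM) (τ aHR) (τ aOI i)) ∧
      ∀ a, a < 8 ∨ 61 ≤ a → τ a = σ a) := by
  have hW1 := one_lt_of_le hW.field
  have h3 := hW.three_lt
  have hobj := hW.objects
  set S := coordSub pb K N m (σ aC) with hS
  set P := IsNear S hW.width_pos N (Δd * εd) (N * (εn * Δd)) (N * (Δn * εd)) with hP
  set X := N + K * (N * Z) with hX
  refine Runs.frame 8 61 rfl ?_
  have hloop := Runs.loop (P := .set vItem (.read aQ (var vHead)) ;;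
      .set vHead (var vHead + 1) ;; stream ;; accept ;; levels) (b := (var vHead).ltE (var vTail))
    (T := tItem pb.dim K N m Z Q) hW1
    (Q := fun τ => (∀ x, τ aHM x < p ^ pb.dim) ∧ ∃ n h, τ vNout 0 = n ∧ n ≤ Q ∧ h ≤ H ∧
      (∀ o < h, WF pb K (τ aHM) (τ aHR) o) ∧
      Listed P (sp pb K (τ aHM) (τ aHR)) n h (τ aOI) (τ aOF) ∧
      ∀ x, P (Submodule.span F {x}) → ∃ i < n, x ∈ sp pb K (τ aHM) (τ aHR) (τ aOI i))
    -- The number `q` is the potential of the queue. It decreases in every round, and `hd + q` does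
    -- not increase, which bounds the number `hd` of rounds. Every vector that has to be found lies
    -- in an accepted line or in a member of the queue.
    (fun q τ => (∀ x, τ aHM x < p ^ pb.dim) ∧ (∀ a, a < 8 ∨ 61 ≤ a → τ a = σ a) ∧
      ∃ hd tl h n, τ vHead 0 = hd ∧ τ vTail 0 = tl ∧ τ vHp 0 = h ∧ τ vNout 0 = n ∧ hd ≤ tl ∧
      q = ∑ i ∈ Ico hd tl, D ^ 2 ^ τ aHR (τ aQ i) ∧ hd + q ≤ Q ∧ n ≤ hd ∧ h ≤ 1 + hd * X ∧
      (∀ o < h, WF pb K (τ aHM) (τ aHR) o) ∧ (∀ i, hd ≤ i → i < tl → τ aQ i < h) ∧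
      Listed P (sp pb K (τ aHM) (τ aHR)) n h (τ aOI) (τ aOF) ∧
      ∀ x, P (Submodule.span F {x}) → (∃ i < n, x ∈ sp pb K (τ aHM) (τ aHR) (τ aOI i)) ∨
        ∃ i, hd ≤ i ∧ i < tl ∧ x ∈ sp pb K (τ aHM) (τ aHR) (τ aQ i))
    (by
      intro q τ _
      simp; omega)
    (by
      rintro q τ ⟨h1, h2, hd, tl, h, n, g1, g2, g3, g4, g5, g6, g7, g8, g9, g10, g11, g12, g13⟩ h0
      have hlt : hd < tl := by
        by_contra hc
        simp [g1, g2, hc] at h0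
      set a := τ 51 hd with ha
      have hah : a < h := g11 hd le_rfl hlt
      have hsum : q = D ^ 2 ^ τ 8 a + ∑ i ∈ Ico (hd + 1) tl, D ^ 2 ^ τ 8 (τ 51 i) := by
        rw [g6, sum_eq_sum_Ico_succ_bot hlt]
      have hpos : ∀ v, 1 ≤ D ^ v := fun v => Nat.one_le_pow _ _ (by omega)
      have hq1 := hpos (2 ^ τ 8 a)
      have htl : tl ≤ Q := by
        have : ∑ i ∈ Ico hd tl, 1 ≤ ∑ i ∈ Ico hd tl, D ^ 2 ^ τ 8 (τ 51 i) :=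
          sum_le_sum fun i _ => hpos _
        simp only [sum_const, Nat.card_Ico, smul_eq_mul, mul_one] at this
        omega
      have hKZ : Z ≤ K * Z := Nat.le_mul_of_pos_left _ hW.width_pos
      have hdX : (hd + 1) * X ≤ Q * X := Nat.mul_le_mul_right _ (by omega)
      have hdX' : (hd + 1) * X = hd * X + X := by ring
      have hXN : N ≤ X := by omega
      refine ⟨by omega, ?_⟩
      have te : CoordEnv pb K N m τ := env.congr (h2 0 (by omega)) (h2 1 (by omega))
        (h2 105 (by omega)) (h2 100 (by omega)) h1 (h2 103 (by omega))
      have f103 := h2 103 (by omega)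
      apply Runs.le
      · apply Runs.set_seq_val (n := a) hW1 (by simp; omega) (by simp [g1, ha])
        apply Runs.set_seq_val (n := hd + 1) hW1 (by simp [g1]; omega) (by simp [g1])
        apply Runs.seq (stream_spec (o := h) (a := a) hW
          (te.congr (by simp) (by simp) (by simp) (by simp) (by simpa using h1) (by simp))
          (by simp [g3]) (by omega) (by simp) hah (by simpa using g10))
        rintro ρ ⟨⟨r1, r2, r3, r4, r5, r6, r7, r8⟩, rfr⟩
        simp only [put_ne _ (show (9:ℕ) ≠ 57 by decide), put_ne _ (show (8:ℕ) ≠ 57 by decide),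
          put_ne _ (show (103:ℕ) ≠ 57 by decide), put_ne _ (show (103:ℕ) ≠ 56 by decide),
          put_ne _ (show (9:ℕ) ≠ 56 by decide), put_ne _ (show (8:ℕ) ≠ 56 by decide), f103, ← hS]
          at r4 r6 r7 r8
        have rkeep : ∀ b, b < 8 ∨ (41 ≤ b ∧ b < 53) ∨ b = 55 ∨ 58 ≤ b → ρ b = τ b := by
          intro b hb
          rw [rfr b (by omega), put_ne _ (by omega), put_ne _ (by omega)]
        have r56 : ρ 56 0 = a := by rw [rfr 56 (by omega)]; simp
        have r57 : ρ 57 0 = hd + 1 := by rw [rfr 57 (by omega)]; simp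
        have rA : sp pb K (ρ 9) (ρ 8) a = sp pb K (τ 9) (τ 8) a := r6.sp_eq hah (g10 a hah)
        have r103 : ρ 103 = σ 103 := by rw [rkeep 103 (by omega), f103]
        generalize hu : ρ 54 0 = u at r3 r4 r5 r7 r8
        have hoffN := offCount_le S N (sp pb K (τ 9) (τ 8) a)
        have hur : u ≤ h + N := by omega
        have re : CoordEnv pb K N m ρ := te.congr (rkeep 0 (by omega)) (rkeep 1 (by omega))
          (rkeep 105 (by omega)) (rkeep 100 (by omega)) r1 (rkeep 103 (by omega))
        have rL : Listed P (sp pb K (ρ 9) (ρ 8)) n u (ρ 59) (ρ 60) :=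
          g12.congr (by omega) (fun o ho => r6.sp_eq ho (g10 o ho)) (by simp [rkeep 59])
            (by simp [rkeep 60])
        have rpar : ParamEnv W N Δn Δd εn εd ρ :=
          par.congr (by rw [rkeep 0 (by omega), h2 0 (by omega)])
        apply Runs.seq (accept_spec (a := a) (n := n) hW re rpar r2 hu r3 r56
          (by omega) (by omega) (by rw [rkeep 58 (by omega), g4]) (by omega) r5
          (by rw [r103, rA]; exact r4) (by rw [r103]; exact rL))
        rintro π ⟨p1, p2, ⟨n', p3, p4, p5, p6, p7, p8⟩, pfr⟩
        rw [r103, ← hS, ← hP] at p6 p8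
        have p8' : π 8 a = τ 8 a := by rw [p2.rank a (by omega), r6.rank a hah]
        have pe : HeapEnv pb K π := re.toHeapEnv.congr (pfr 0 (by omega)) (pfr 1 (by omega))
          (pfr 105 (by omega)) (pfr 100 (by omega)) p1
        have pwf : ∀ o < u, WF pb K (π 9) (π 8) o := fun o ho => p2.wf ho (r5 o ho)
        have psp : ∀ o < u, sp pb K (π 9) (π 8) o = sp pb K (ρ 9) (ρ 8) o :=
          fun o ho => p2.sp_eq ho (r5 o ho)
        have huN : K * ((u - h) * Z) ≤ K * (N * Z) := by
          gcongr; omega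
        have hpre : τ 8 a = π 8 a := p8'.symm
        have hlev := (levels_spec (a := a) (r := π 8 a) (D := D) (Z := Z) (s₀ := h) (s₁ := u)
          (t := tl) hW pe (by rw [pfr 56 (by omega), r56]) (by omega) rfl
          (by rw [pfr 101 (by omega), rkeep 101 (by omega), h2 101 (by omega), hD]) hD2 hZ
          (by rw [pfr 53 (by omega), r2]) (by rw [pfr 54 (by omega), hu])
          (by rw [pfr 40 (by omega), r3]) (by omega)
          (by rw [pfr 50 (by omega), rkeep 50 (by omega), g2]) (by omega) (by omega) pwf
          (fun o h' h'' => by rw [p8', p2.rank o h'']; exact r7 o h' h''))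
        have hlevT := tLevels_mono (e := pb.dim) (K := K) (Z := Z) (show u - h ≤ N by omega)
        apply Runs.le (T := tLevels pb.dim K Z (u - h)) (hT := hlevT)
        apply hlev.mono
        rintro α ⟨⟨a1, s₂, t', a2, a3, a4, a5, a6, a7, a8, a9, a10, a11, a12⟩, afr⟩
        rw [p8'] at a11
        have hsame : SameBelow K h (τ 9) (τ 8) (α 9) (α 8) :=
          (r6.trans (p2.mono (by omega))).trans (a5.mono (by omega))
        have hsp : ∀ o < h, sp pb K (α 9) (α 8) o = sp pb K (τ 9) (τ 8) o :=
          fun o ho => hsame.sp_eq ho (g10 o ho)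
        have hspu : ∀ o < u, sp pb K (α 9) (α 8) o = sp pb K (ρ 9) (ρ 8) o :=
          fun o ho => by rw [a5.sp_eq ho (pwf o ho), psp o ho]
        have aq : ∀ i, i < tl → α 51 i = τ 51 i := fun i hi => by
          rw [a9 i hi, pfr 51 (by omega), rkeep 51 (by omega)]
        have hq' : ∑ i ∈ Ico (hd + 1) tl, D ^ 2 ^ α 8 (α 51 i) =
            ∑ i ∈ Ico (hd + 1) tl, D ^ 2 ^ τ 8 (τ 51 i) := by
          refine sum_congr rfl fun i hi => ?_
          rw [mem_Ico] at hi
          rw [aq i hi.2, hsame.rank _ (g11 i (by omega) hi.2)]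
        have hsum' := sum_Ico_consecutive (fun i => D ^ 2 ^ α 8 (α 51 i))
          (show hd + 1 ≤ tl by omega) a8
        have e59 := afr 59 (by omega)
        have e60 := afr 60 (by omega)
        refine ⟨∑ i ∈ Ico (hd + 1) t', D ^ 2 ^ α 8 (α 51 i), by omega, a1,
          fun b hb => by rw [afr b (by omega), pfr b (by omega), rkeep b (by omega), h2 b hb],
          hd + 1, t', s₂, n', by rw [afr 57 (by omega), pfr 57 (by omega), r57], a7, a2,
          by rw [afr 58 (by omega), p3], by omega, rfl, by omega, by omega, by omega, a6,
          fun i h' h'' => ?_, ?_, fun x hx => ?_⟩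
        · by_cases hi : i < tl
          · rw [aq i hi]
            have := g11 i (by omega) hi
            omega
          · exact a10 i (by omega) h''
        · rw [e59, e60]
          exact p6.congr a3 hspu (fun _ _ => rfl) (fun _ _ => rfl)
        · rw [e59]
          rcases g13 x hx with ⟨i, i1, i2⟩ | ⟨i, i1, i2, i3⟩
          · refine Or.inl ⟨i, by omega, ?_⟩
            rw [p7 i i1, rkeep 59 (by omega), hsp _ (g12.lt i i1)]
            exact i2
          · by_cases hi : i = hd
            · subst hi
              rw [← ha] at i3
              have hx0 := ne_zero_of_finrank_span hx.line
              have hle : Submodule.span F {x} ≤ sp pb K (τ 9) (τ 8) a :=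
                (Submodule.span_singleton_le_iff_mem _ _).mpr i3
              have hge := Submodule.finrank_mono hle
              rw [hx.line] at hge
              -- A line is accepted itself; otherwise the vector is heavy in the stream of the item.
              by_cases h1 : Module.finrank F (sp pb K (τ 9) (τ 8) a) = 1
              · have heq := Submodule.eq_of_le_of_finrank_eq hle (by rw [hx.line, h1])
                obtain ⟨j, j1, j2⟩ := p8 (by rw [rA, ← heq]; exact hx)
                refine Or.inl ⟨j, j1, ?_⟩
                rw [hspu _ (p6.lt j j1), j2, rA]
                exact i3
              · obtain ⟨k1, k2⟩ := hheavy _ x i3 (by omega) hx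
                have hdep : depth (sp pb K (π 9) (π 8)) x h u =
                    hitCount S N (sp pb K (τ 9) (τ 8) a) x := by
                  rw [depth_congr fun o _ ho => psp o ho, r8 x i3]
                obtain ⟨j, j1, j2, j3⟩ := a12 x hx0 (by rw [hdep]; exact k1) (by
                  rw [hdep, show u - h = offCount S N (sp pb K (τ 9) (τ 8) a) by omega]
                  exact k2)
                exact Or.inr ⟨j, by omega, j2, j3⟩
            · refine Or.inr ⟨i, by omega, by omega, ?_⟩
              rw [aq i i2, hsp _ (g11 i i1 i2)]
              exact i3
      · have := tFind_mono (e := pb.dim) (K := K) (show n ≤ Q by omega)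
        simp only [Expr.cost_var, Expr.cost_read, Expr.cost_add, Expr.cost_one, tItem]
        omega)
    (by
      rintro q τ ⟨h1, h2, hd, tl, h, n, g1, g2, g3, g4, g5, g6, g7, g8, g9, g10, g11, g12, g13⟩ h0
      have hle : tl ≤ hd := by
        by_contra hc
        simp [g1, g2] at h0
        omega
      have : hd * X ≤ Q * X := Nat.mul_le_mul_right _ (by omega)
      refine ⟨h1, n, h, g4, by omega, by omega, g10, g12, fun x hx => ?_⟩
      rcases g13 x hx with h' | ⟨i, i1, i2, -⟩
      · exact h'
      · omega)
    (D ^ 2 ^ K) σ (by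
      have hr : σ 8 0 = K := by
        rw [← hwf.finrank_eq, htop, finrank_top, Module.finrank_fin_fun]
      refine ⟨env.cells, fun _ _ => rfl, 0, 1, 1, 0, hhead, htail, hh, hn, by omega, ?_, by omega,
        le_rfl, by omega, fun o ho => ?_, fun i h1 h2 => ?_, ⟨?_, ?_, ?_, ?_⟩, fun x hx => Or.inr
        ⟨0, le_rfl, by omega, ?_⟩⟩
      · simp [hq, hr]
      · rw [show o = 0 by omega]; exact hwf
      · rw [show i = 0 by omega, hq]; omega
      · intro i hi; omega
      · intro i hi; omega
      · intro i hi; omega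
      · intro i hi; omega
      · rw [hq, htop]; trivial)
  refine hloop.le ?_
  have := Nat.mul_le_mul_right (tItem pb.dim K N m Z Q + 10) hQ
  simp only [Expr.cost_ltE, Expr.cost_var]
  nlinarith

end

/-! ### Writing the list of codewords -/

section

-- Address `vSrc` of a coefficient vector; result `vInv`, exponent `vEx` and base `vBs` of an
-- inversion; loop variable `vOut` for codewords; codes `aG` of the entries of the received word.
notation "vSrc" => (61 : ℕ)
notation "vInv" => (62 : ℕ)
notation "vEx" => (63 : ℕ)
notation "vBs" => (64 : ℕ)
notation "vOut" => (70 : ℕ)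
notation "aG" => (104 : ℕ)

/-- Raises the field element `vBs` to the power `q - 2`, by repeated squaring. The result is stored
in `vInv`; it is the inverse of the field element, if that is not `0`. -/
def invert : Program :=
  .set vInv 1 ;; .set vEx (.read aPow eE - .const 2) ;;
  .loop (var vEx)
    (.ite (var vEx % .const 2)
      (.set vX (var vInv) ;; .set vY (var vBs) ;; .set vZ 0 ;; fma ;; .set vInv (var vR)) .skip ;;
     .set vX (var vBs) ;; .set vY (var vBs) ;; .set vZ 0 ;; fma ;; .set vBs (var vR) ;;
     .set vEx (var vEx / .const 2))

/-- Writes entry `vJ` of the symbol at coordinate `vI` of the codeword number `vOut`. The codeword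
is the sum of the received word and of `vInv` times the combination of the words in `aC` with the
coefficients at address `vSrc` of the heap. -/
def entry : Program :=
  loadEq ;; .set vBase (var vSrc) ;; dot aHM ;;
  .set vX (var vR) ;; .set vY (var vInv) ;; .set vZ (.read aG (var vI * eM + var vJ)) ;; fma ;;
  .forLoop vL eE
    (.store 6 (((var vOut * eN + var vI) * eM + var vJ) * eE + var vL) (eDigit (var vR) (var vL)))

/-- Writes the codewords that belong to the accepted lines, and their number. -/
def output : Program :=
  .forLoop vOut (var vNout)
    (.set vSrc (.read aOI (var vOut) * (var vK * var vK)) ;; .set vBs (.read aHM (var vSrc)) ;;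
     invert ;; .forLoop vI eN (.forLoop vJ eM entry)) ;;
  .store 5 0 (var vNout)

variable {p : ℕ} [Fact p.Prime] {F : Type*} [Field F] [Algebra (ZMod p) F]
  {pb : PowerBasis (ZMod p) F} {K N m : ℕ}

/-- A bound for the running time of `invert`, where `2 ^ l` is at least the size of the field. -/
def tInvert (e l : ℕ) : ℕ := l * (2 * tFma e + 100) + 100

theorem two_le_card : 2 ≤ p ^ pb.dim := by
  have h1 := (Fact.out : p.Prime).two_le
  calc 2 ≤ p := h1
    _ = p ^ 1 := (pow_one p).symm
    _ ≤ p ^ pb.dim := Nat.pow_le_pow_right (by omega) pb.dim_pos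

theorem invert_spec {W l : ℕ} (hW : 4 * (p ^ pb.dim) ^ 2 ≤ W) {σ : Mem} (env : ArithEnv pb σ)
    (hl : p ^ pb.dim ≤ 2 ^ l) (hw : σ vBs 0 < p ^ pb.dim) :
    Runs W invert σ (tInvert pb.dim l) (fun τ => (τ vInv 0 < p ^ pb.dim ∧
      dec pb (τ vInv 0) = dec pb (σ vBs 0) ^ (p ^ pb.dim - 2)) ∧
      ∀ a, a < 10 ∨ (20 ≤ a ∧ a < 62) ∨ 65 ≤ a → τ a = σ a) := by
  have hW1 := one_lt_of_le hW
  have hq2 := two_le_card (pb := pb)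
  set q := p ^ pb.dim with hq
  have hqW : 4 * q ≤ W := le_trans (by nlinarith) hW
  have hW2 : 2 < W := by omega
  apply Runs.le
  · apply Runs.set_seq_val (n := 1) hW1 (by simp; omega) rfl
    apply Runs.set_seq_val (n := q - 2) hW1
      (by simp [env.deg_eq, env.pow _ le_rfl, ← hq]; omega)
      (by simp [env.deg_eq, env.pow _ le_rfl, hq])
    -- Square and multiply: `vInv * vBs ^ vEx` is invariant, and `vEx` is halved in every round.
    apply Runs.loop hW1 (T := 2 * tFma pb.dim + 80)
      (fun n τ => (τ vInv 0 < q ∧ τ vBs 0 < q ∧ τ vEx 0 < 2 ^ n ∧ τ vEx 0 < q ∧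
        dec pb (τ vInv 0) * dec pb (τ vBs 0) ^ τ vEx 0 = dec pb (σ vBs 0) ^ (q - 2)) ∧
        ∀ a, a < 10 ∨ (20 ≤ a ∧ a < 62) ∨ 65 ≤ a → τ a = σ a) _ _ _ l
    · simp only [put_same, Function.update_self, put_ne _ (show (62:ℕ) ≠ 63 by decide),
        put_ne _ (show (64:ℕ) ≠ 63 by decide), put_ne _ (show (64:ℕ) ≠ 62 by decide)]
      refine ⟨⟨by omega, hw, by omega, by omega, by rw [dec_one, one_mul]⟩, fun a ha => ?_⟩
      rw [put_ne _ (by omega), put_ne _ (by omega)]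
    · intro n τ _
      simp; omega
    · rintro n τ ⟨⟨h1, h2, h4, h5, h6⟩, hfr⟩ h0
      have h0' : τ 63 0 ≠ 0 := h0
      have hn : 0 < n := by
        by_contra hc
        rw [show n = 0 by omega, pow_zero] at h4
        omega
      refine ⟨hn, ?_⟩
      have te : ArithEnv pb τ := env.congr (hfr 0 (by omega)) (hfr 1 (by omega))
        (hfr 105 (by omega))
      apply Runs.le
      · apply Runs.seq (Q := fun ρ => (ρ vInv 0 < q ∧ dec pb (ρ vInv 0) =
            dec pb (τ vInv 0) * dec pb (τ vBs 0) ^ (τ vEx 0 % 2)) ∧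
            ∀ a, a < 10 ∨ (20 ≤ a ∧ a ≠ 62) → ρ a = τ a)
        · apply Runs.ite hW1 (by simp; omega)
          · intro h1'
            have h1'' : τ 63 0 % 2 = 1 := by
              have : (τ 63 0) % 2 ≠ 0 := h1'
              omega
            apply Runs.set_seq_val (n := τ vInv 0) hW1 (by simp; omega) rfl
            apply Runs.set_seq_val (n := τ vBs 0) hW1 (by simp; omega) (by simp)
            apply Runs.set_seq_val (n := 0) hW1 (by simp; omega) rfl
            apply Runs.seq (fma_spec (pb := pb) hW
              (te.congr (by simp) (by simp) (by simp)) (by simpa using h1) (by simpa using h2)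
              (by simp; omega))
            rintro ρ ⟨⟨r1, r2⟩, rfr⟩
            apply Runs.set hW1 (by simp; omega)
            refine ⟨⟨by simpa using r1, ?_⟩, fun a ha => ?_⟩
            · simp [r2, h1'', dec_zero]
            · rw [put_ne _ (by omega), rfr a (by omega), put_ne _ (by omega), put_ne _ (by omega),
                put_ne _ (by omega)]
          · intro h1'
            have h1'' : τ 63 0 % 2 = 0 := h1'
            apply Runs.skip
            exact ⟨⟨h1, by rw [h1'', pow_zero, mul_one]⟩, fun _ _ => rfl⟩
        · rintro ρ ⟨⟨r1, r2⟩, rfr⟩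
          have e64 := rfr 64 (by omega)
          apply Runs.set_seq_val (n := τ vBs 0) hW1 (by simp; omega) (by simp [e64])
          apply Runs.set_seq_val (n := τ vBs 0) hW1 (by simp; omega) (by simp [e64])
          apply Runs.set_seq_val (n := 0) hW1 (by simp; omega) rfl
          apply Runs.seq (fma_spec (pb := pb) hW
            (te.congr (by simp [rfr 0]) (by simp [rfr 1]) (by simp [rfr 105]))
            (by simpa using h2) (by simpa using h2) (by simp; omega))
          rintro π ⟨⟨p1, p2⟩, pfr⟩
          have p62 : π 62 = ρ 62 := by rw [pfr 62 (by omega)]; simp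
          have p63 : π 63 = τ 63 := by rw [pfr 63 (by omega)]; simp [rfr 63]
          apply Runs.set_seq_val (n := π 13 0) hW1 (by simp; omega) rfl
          have hval : (var vEx / .const 2 : Expr).val (put π 64 0 (π 13 0)) = τ 63 0 / 2 := by
            simp [p63]
          apply Runs.set hW1 (by simp [p63]; omega)
          rw [hval]
          have hlt : τ 63 0 / 2 < 2 ^ (n - 1) := by
            obtain ⟨n', rfl⟩ : ∃ n', n = n' + 1 := ⟨n - 1, by omega⟩
            rw [pow_succ] at h4
            rw [Nat.add_sub_cancel]
            omega
          simp only [put_same, Function.update_self, put_ne _ (show (62:ℕ) ≠ 63 by decide),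
            put_ne _ (show (64:ℕ) ≠ 63 by decide), put_ne _ (show (62:ℕ) ≠ 64 by decide), p62]
          refine ⟨n - 1, by omega, ⟨r1, p1, hlt, by omega, ?_⟩, fun a ha => ?_⟩
          · rw [← h6, p2, r2]
            conv_rhs => rw [← Nat.mod_add_div (τ 63 0) 2, pow_add, pow_mul]
            simp only [put_same, put_ne _ (show (10:ℕ) ≠ 12 by decide),
              put_ne _ (show (10:ℕ) ≠ 11 by decide), put_ne _ (show (11:ℕ) ≠ 12 by decide),
              Function.update_self, dec_zero, zero_add]
            rw [pow_two]
            ring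
          · rw [put_ne _ (by omega), put_ne _ (by omega), pfr a (by omega), put_ne _ (by omega),
              put_ne _ (by omega), put_ne _ (by omega), rfr a (by omega), hfr a ha]
      · simp only [Expr.cost_var, Expr.cost_zero, Expr.cost_mod, Expr.cost_div, Expr.cost_const]
        omega
    · rintro n τ ⟨⟨h1, h2, h4, h5, h6⟩, hfr⟩ h0
      have h0' : τ 63 0 = 0 := h0
      rw [h0', pow_zero, mul_one] at h6
      exact ⟨⟨h1, h6⟩, hfr⟩
  · simp only [Expr.cost_var, Expr.cost_read, Expr.cost_sub, Expr.cost_one, tInvert, eE_cost,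
      Expr.cost_const]
    nlinarith

/-- A bound for the running time of `entry`. -/
def tEntry (e K : ℕ) : ℕ := K * 50 + tDot e K + tFma e + e * 60 + 200

theorem entry_spec {W H : ℕ} (hW : Room pb W K N m H) {σ : Mem} (env : CoordEnv pb K N m σ)
    (hG : ∀ x, σ aG x < p ^ pb.dim) {r i j b : ℕ} (hr : σ vOut 0 = r) (hi : σ vI 0 = i)
    (hj : σ vJ 0 = j) (hiN : i < N) (hjm : j < m) (hb : σ vSrc 0 = b) (hbW : b + K < W)
    (hv : σ vInv 0 < p ^ pb.dim) (hroom : (r + 1) * (N * (m * pb.dim)) < W) :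
    Runs W entry σ (tEntry pb.dim K) (fun τ =>
      (∀ t : Fin pb.dim, τ 6 (((r * N + i) * m + j) * pb.dim + t) =
        (pb.basis.repr (dec pb (σ aG (i * m + j)) +
          (eqVec pb K N m (σ aC) i j ⬝ᵥ vec pb K (σ aHM) b) * dec pb (σ vInv 0)) t).val) ∧
      (∀ x < ((r * N + i) * m + j) * pb.dim, τ 6 x = σ 6 x) ∧
      ∀ a, a ≠ 6 → a < 10 ∨ 33 ≤ a → τ a = σ a) := by
  have hW1 := one_lt_of_le hW.field
  have h3 := hW.three_lt
  have hq2 := two_le_card (pb := pb)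
  have hfield := hW.field
  have hqW : 4 * (p ^ pb.dim) ≤ W := le_trans (by nlinarith) hfield
  have hep := pb.dim_pos
  have hidx : (r * N + i) * m + j < (r + 1) * (N * m) := by
    have h1 : (r * N + i) * m + m ≤ ((r + 1) * N) * m := row_le (by
      rw [Nat.succ_mul]; omega)
    rw [mul_assoc] at h1
    omega
  have hidx' : ((r * N + i) * m + j) * pb.dim + pb.dim ≤ (r + 1) * (N * (m * pb.dim)) := by
    have := row_le (K := pb.dim) hidx
    calc _ ≤ _ := this
      _ = _ := by ring
  have hmid : (r * N + i) * m ≤ ((r * N + i) * m + j) * pb.dim :=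
    (Nat.le_add_right _ _).trans (Nat.le_mul_of_pos_right _ hep)
  have hmid' : (r * N + i) ≤ (r * N + i) * m := Nat.le_mul_of_pos_right _ hW.m_pos
  have hjj : (r * N + i) * m + j ≤ ((r * N + i) * m + j) * pb.dim :=
    Nat.le_mul_of_pos_right _ hep
  have hij : i * m + j < N * m := by
    have : i * m + m ≤ N * m := row_le hiN
    omega
  have hNm : N * m ≤ K * (N * m) := Nat.le_mul_of_pos_left _ hW.width_pos
  have hwords := hW.words
  apply Runs.le
  · apply Runs.seq (loadEq_spec hW env hi hj hiN hjm)
    rintro τ ⟨⟨t1, t2⟩, tfr⟩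
    have tkeep : ∀ a, a ≠ 20 → a ≠ 32 → τ a = σ a := tfr
    apply Runs.set_seq_val (n := b) hW1 (by simp; omega)
      (by simp [tkeep 61, hb])
    apply Runs.seq (dot_spec (K := K) (arr := aHM) (base := b) hfield
      (env.arith.congr (by simp [tkeep 0]) (by simp [tkeep 1]) (by simp [tkeep 105])) (Or.inl rfl)
      (by simp [tkeep 100, env.width]) (by omega) (by simp) (by simpa using t1)
      (by simpa [tkeep 9] using env.cells))
    rintro ρ ⟨⟨r1, r2⟩, rfr⟩
    simp only [put_ne _ (show (9:ℕ) ≠ 21 by decide), put_ne _ (show (32:ℕ) ≠ 21 by decide)] at r2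
    rw [t2, tkeep 9 (by omega) (by omega)] at r2
    have rkeep : ∀ a, a < 10 ∨ 33 ≤ a → ρ a = σ a := by
      intro a ha
      rw [rfr a (by omega), put_ne _ (by omega), tkeep a (by omega) (by omega)]
    apply Runs.set_seq_val (n := ρ 13 0) hW1 (by simp; omega) rfl
    apply Runs.set_seq_val (n := σ vInv 0) hW1 (by simp; omega) (by simp [rkeep 62])
    apply Runs.set_seq_val (n := σ aG (i * m + j)) hW1
      (by simp [rkeep 34, rkeep 33, rkeep 0, hi, hj, env.m_eq]; omega)
      (by simp [rkeep 34, rkeep 33, rkeep 0, rkeep 104, hi, hj, env.m_eq])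
    apply Runs.seq (fma_spec (pb := pb) hfield
      (env.arith.congr (by simp [rkeep 0]) (by simp [rkeep 1]) (by simp [rkeep 105]))
      (by simpa using r1) (by simpa using hv) (by simpa using hG _))
    rintro π ⟨⟨p1, p2⟩, pfr⟩
    have pkeep : ∀ a, a < 10 ∨ 33 ≤ a → π a = σ a := by
      intro a ha
      rw [pfr a (by omega), put_ne _ (by omega), put_ne _ (by omega), put_ne _ (by omega),
        rkeep a ha]
    have hval : dec pb (π 13 0) = dec pb (σ aG (i * m + j)) +
          (eqVec pb K N m (σ aC) i j ⬝ᵥ vec pb K (σ aHM) b) * dec pb (σ vInv 0) := by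
      rw [p2]
      simp [r2]
    rw [← hval]
    apply Runs.forLoop 6 7 (n := pb.dim) (fun t α =>
      (∀ s < t, α 6 (((r * N + i) * m + j) * pb.dim + s) = π 13 0 / p ^ s % p) ∧
      ∀ x < ((r * N + i) * m + j) * pb.dim, α 6 x = σ 6 x) hW1 (by omega) rfl rfl
    · refine ⟨by simp, fun x _ => ?_⟩
      rw [put_ne _ (by omega), pkeep 6 (by omega)]
    · intro t α ht afr av _
      have : α 0 = σ 0 := by rw [afr 0 (by omega) (by omega), pkeep 0 (by omega)]
      simp [this, env.arith.deg_eq]; omega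
    · rintro t α ht afr av ⟨a1, a2⟩
      have akeep : ∀ a, a ≠ 6 → a < 10 ∨ 33 ≤ a → α a = σ a := fun a ha ha' => by
        rw [afr a (by omega) (by omega), pkeep a ha']
      have a13 : α 13 0 = π 13 0 := by rw [afr 13 (by omega) (by omega)]
      have hpow : α 105 t = p ^ t := by
        rw [akeep 105 (by omega) (by omega), env.arith.pow t ht.le]
      have hidxv : (((var vOut * eN + var vI) * eM + var vJ) * eE + var vL).val α =
          ((r * N + i) * m + j) * pb.dim + t := by
        simp [akeep 70, akeep 0, akeep 34, akeep 33, hr, hi, hj, env.N_eq, env.m_eq,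
          env.arith.deg_eq, av]
      have hdig : (eDigit (var vR) (var vL)).val α = π 13 0 / p ^ t % p := by
        simp [a13, av, hpow, akeep 0, env.arith.char_eq]
      have hrN : r * N ≤ r * N + i := Nat.le_add_right _ _
      apply Runs.store hW1
      · simp [akeep 70, akeep 0, akeep 34, akeep 33, hr, hi, hj, env.N_eq, env.m_eq,
          env.arith.deg_eq, av]
        omega
      · have : π 13 0 / p ^ t ≤ π 13 0 := Nat.div_le_self _ _
        simp [a13, av, hpow, akeep 0, env.arith.char_eq]
        omega
      · rw [hidxv, hdig]
        refine ⟨fun s hs => ?_, fun x hx => ?_⟩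
        · rw [put_ne _ (by omega), put_same, Function.update_apply]
          split_ifs with h
          · rw [show s = t by omega]
          · exact a1 s (by omega)
        · rw [put_ne _ (by omega), put_same, Function.update_of_ne (by omega)]
          exact a2 x hx
    · rintro α afr av ⟨a1, a2⟩
      refine ⟨fun t => ?_, a2, fun a h1 h2 => ?_⟩
      · rw [a1 t t.2, repr_dec, ZMod.val_natCast, Nat.mod_mod]
      · by_cases ha : a = 24
        · omega
        · rw [afr a ha (by omega), pkeep a h2]
  · simp only [Expr.cost_var, Expr.cost_read, Expr.cost_add, Expr.cost_mul, eE_cost, eM_cost,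
      eN_cost, tEntry]
    simp
    nlinarith

/-- Entry number `x mod m` of the symbol at coordinate `x / m mod N` of the codeword that belongs to
the line number `x / m / N` of the list. -/
noncomputable def outVal (pb : PowerBasis (ZMod p) F) (K N m : ℕ) (σ : Mem) (x : ℕ) : F :=
  dec pb (σ aG (x / m % N * m + x % m)) +
    (eqVec pb K N m (σ aC) (x / m % N) (x % m) ⬝ᵥ
      vec pb K (σ aHM) (σ aOI (x / m / N) * (K * K))) *
    (dec pb (σ aHM (σ aOI (x / m / N) * (K * K))))⁻¹

/-- Also true for the field with two elements, where the exponent is `0`. -/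
theorem pow_card_sub_two [Finite F] {x : F} (hx : x ≠ 0) : x ^ (p ^ pb.dim - 2) = x⁻¹ := by
  have := Fintype.ofFinite F
  have hcard : Fintype.card F = p ^ pb.dim := by
    rw [Module.card_eq_pow_finrank (K := ZMod p) (V := F), pb.finrank, ZMod.card]
  have h1 := FiniteField.pow_card_sub_one_eq_one x hx
  have h2 := two_le_card (pb := pb)
  rw [hcard] at h1
  refine eq_inv_of_mul_eq_one_left ?_
  rw [← pow_succ, show p ^ pb.dim - 2 + 1 = p ^ pb.dim - 1 by omega, h1]

/-- A bound for the running time of `output` for `n` codewords. -/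
def tOutput (e K N m l n : ℕ) : ℕ :=
  n * (tInvert e l + N * (m * (tEntry e K + 50) + 100) + 200) + 100

/-- The coefficient vector `w` of an accepted line is only known up to a factor; division by `w 0`,
which is not zero for these lines, gives the codeword. -/
theorem output_spec [Finite F] {W H l n h : ℕ} (hW : Room pb W K N m H) {σ : Mem}
    (env : CoordEnv pb K N m σ) (hG : ∀ x, σ aG x < p ^ pb.dim) (hl : p ^ pb.dim ≤ 2 ^ l)
    (hn : σ vNout 0 = n) (hnW : n < W) (hroom : n * (N * (m * pb.dim)) < W) (hhH : h ≤ H)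
    (hid : ∀ i < n, σ aOI i < h) (h0 : ∀ i < n, dec pb (σ aHM (σ aOI i * (K * K))) ≠ 0) :
    Runs W output σ (tOutput pb.dim K N m l n) (fun τ => τ 5 0 = n ∧
      ∀ x < n * (N * m), ∀ t : Fin pb.dim,
        τ 6 (x * pb.dim + t) = (pb.basis.repr (outVal pb K N m σ x) t).val) := by
  have hW1 := one_lt_of_le hW.field
  have h3 := hW.three_lt
  have hwords := hW.words
  have hN : N ≤ N * m := Nat.le_mul_of_pos_right _ hW.m_pos
  have hm : m ≤ N * m := Nat.le_mul_of_pos_left _ hW.N_pos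
  have hNm : N * m ≤ K * (N * m) := Nat.le_mul_of_pos_left _ hW.width_pos
  have hstep : ∀ {u : ℕ} {σ₁ τ : Mem},
      (∀ x < u, ∀ t : Fin pb.dim, σ₁ 6 (x * pb.dim + t) =
        (pb.basis.repr (outVal pb K N m σ x) t).val) →
      (∀ t : Fin pb.dim, τ 6 (u * pb.dim + t) = (pb.basis.repr (outVal pb K N m σ u) t).val) →
      (∀ x < u * pb.dim, τ 6 x = σ₁ 6 x) → ∀ x < u + 1, ∀ t : Fin pb.dim,
        τ 6 (x * pb.dim + t) = (pb.basis.repr (outVal pb K N m σ x) t).val := by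
    intro u σ₁ τ h1 h2 h4 x hx t
    rcases Nat.lt_succ_iff_lt_or_eq.mp hx with hx | rfl
    · rw [h4, h1 x hx t]
      have : x * pb.dim + pb.dim ≤ u * pb.dim := row_le hx
      have := t.2
      omega
    · exact h2 t
  apply Runs.le
  · apply Runs.seq (Q := fun τ => (∀ x < n * (N * m), ∀ t : Fin pb.dim,
        τ 6 (x * pb.dim + t) = (pb.basis.repr (outVal pb K N m σ x) t).val) ∧ τ vNout 0 = n)
    · apply Runs.forLoop 6 66 (n := n) (fun r τ => (∀ x < r * (N * m), ∀ t : Fin pb.dim,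
        τ 6 (x * pb.dim + t) = (pb.basis.repr (outVal pb K N m σ x) t).val) ∧
        ∀ a, a = 8 ∨ a = 9 ∨ a = 58 ∨ a = 59 → τ a = σ a) hW1 hnW rfl rfl
      · exact ⟨by simp, fun a ha => put_ne _ (by omega) _ _⟩
      · rintro r τ hr hfr hv ⟨-, h2⟩
        have := h2 58 (by omega)
        simp [this, hn]; omega
      · rintro r τ hr hfr hv ⟨h1, h2⟩
        have hkeep : ∀ a, a < 6 ∨ a = 8 ∨ a = 9 ∨ a = 58 ∨ a = 59 ∨ 71 ≤ a → τ a = σ a := by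
          intro a ha
          by_cases ha' : a < 6 ∨ 71 ≤ a
          · exact hfr a (by omega) (by omega)
          · exact h2 a (by omega)
        set o := σ aOI r with ho
        set b := o * (K * K) with hb
        have hoh := hid r hr
        have hbW : b + K * K ≤ H * (K * K) := row_le (show o < H by omega)
        have hheap := hW.heap
        have hKK := le_mul_self' K
        apply Runs.set_seq_val (n := b) hW1
          (by simp [hkeep 59, hkeep 100, hv, env.width, ← ho, ← hb]; omega)
          (by simp [hkeep 59, hkeep 100, hv, env.width, ← ho, ← hb])
        apply Runs.set_seq_val (n := σ aHM b) hW1 (by simp; omega) (by simp [hkeep 9])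
        apply Runs.seq (invert_spec (pb := pb) hW.field (env.arith.congr (by simp [hkeep 0])
          (by simp [hkeep 1]) (by simp [hkeep 105])) hl (by simpa using env.cells _))
        rintro ρ ⟨⟨r1, r2⟩, rfr⟩
        simp only [put_same, Function.update_self] at r2
        rw [pow_card_sub_two (h0 r hr)] at r2
        have rkeep : ∀ a, a < 6 ∨ a = 8 ∨ a = 9 ∨ a = 58 ∨ a = 59 ∨ 71 ≤ a → ρ a = σ a := by
          intro a ha
          rw [rfr a (by omega), put_ne _ (by omega), put_ne _ (by omega), hkeep a ha]
        have r6 : ρ 6 = τ 6 := by rw [rfr 6 (by omega)]; simp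
        have r61 : ρ 61 0 = b := by rw [rfr 61 (by omega)]; simp
        have r70 : ρ 70 0 = r := by rw [rfr 70 (by omega)]; simp [hv]
        have hrn : (r + 1) * (N * (m * pb.dim)) < W :=
          (Nat.mul_le_mul_right _ hr).trans_lt hroom
        apply Runs.forLoop 6 34 (n := N) (fun i α =>
          (∀ x < (r * N + i) * m, ∀ t : Fin pb.dim, α 6 (x * pb.dim + t) =
            (pb.basis.repr (outVal pb K N m σ x) t).val) ∧ ∀ a, a = 8 ∨ a = 9 → α a = σ a)
          hW1 (by omega) rfl rfl
        · refine ⟨?_, fun a ha => by rw [put_ne _ (by omega), rkeep a (by omega)]⟩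
          simpa [r6, mul_assoc] using h1
        · intro i α hi afr av _
          have : α 0 = σ 0 := by rw [afr 0 (by omega) (by omega), rkeep 0 (by omega)]
          simp [this, env.N_eq]; omega
        · rintro i α hi afr av ⟨a1, a2⟩
          apply Runs.forLoop 6 33 (n := m) (fun j β =>
            (∀ x < (r * N + i) * m + j, ∀ t : Fin pb.dim, β 6 (x * pb.dim + t) =
              (pb.basis.repr (outVal pb K N m σ x) t).val) ∧ ∀ a, a = 8 ∨ a = 9 → β a = σ a)
            hW1 (by omega) rfl rfl
          · exact ⟨by simpa using a1, fun a ha => by rw [put_ne _ (by omega), a2 a ha]⟩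
          · intro j β hj bfr bv _
            have : β 0 = σ 0 := by
              rw [bfr 0 (by omega) (by omega), afr 0 (by omega) (by omega), rkeep 0 (by omega)]
            simp [this, env.m_eq]; omega
          · rintro j β hj bfr bv ⟨b1, b2⟩
            have bkeep : ∀ a, a < 6 ∨ a = 9 ∨ 71 ≤ a → β a = σ a := by
              intro a ha
              by_cases ha' : a = 9
              · exact b2 a (by omega)
              · rw [bfr a (by omega) (by omega), afr a (by omega) (by omega), rkeep a (by omega)]
            have bρ : ∀ a, 35 ≤ a → β a = ρ a := fun a ha => by
              rw [bfr a (by omega) (by omega), afr a (by omega) (by omega)]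
            have be : CoordEnv pb K N m β := env.congr (bkeep 0 (by omega)) (bkeep 1 (by omega))
              (bkeep 105 (by omega)) (bkeep 100 (by omega))
              (by rw [bkeep 9 (by omega)]; exact env.cells) (bkeep 103 (by omega))
            have hmod : ((r * N + i) * m + j) % m = j := by
              rw [mul_comm, Nat.mul_add_mod, Nat.mod_eq_of_lt hj]
            have hdiv : ((r * N + i) * m + j) / m = r * N + i := by
              rw [mul_comm, Nat.mul_add_div (by omega), Nat.div_eq_of_lt hj, add_zero]
            have hmod' : (r * N + i) % N = i := by
              rw [mul_comm, Nat.mul_add_mod, Nat.mod_eq_of_lt hi]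
            have hdiv' : (r * N + i) / N = r := by
              rw [mul_comm, Nat.mul_add_div (by omega), Nat.div_eq_of_lt hi, add_zero]
            have hout : outVal pb K N m σ ((r * N + i) * m + j) = dec pb (β aG (i * m + j)) +
                (eqVec pb K N m (β aC) i j ⬝ᵥ vec pb K (β aHM) b) * dec pb (β vInv 0) := by
              rw [outVal, hmod, hdiv, hmod', hdiv', bρ 62 (by omega), r2, bkeep 104 (by omega),
                bkeep 103 (by omega), bkeep 9 (by omega)]
            refine (entry_spec (r := r) (i := i) (j := j) (b := b) hW be
              (by rw [bkeep 104 (by omega)]; exact hG) (by rw [bρ 70 (by omega), r70])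
              (by rw [bfr 34 (by omega) (by omega), av]) bv hi hj (by rw [bρ 61 (by omega), r61])
              (by omega) (by rw [bρ 62 (by omega)]; exact r1) hrn).mono ?_
            rintro γ ⟨g1, g2, gfr⟩
            rw [← hout] at g1
            refine ⟨?_, fun a ha => by
              rw [put_ne _ (by omega), gfr a (by omega) (by omega), b2 a ha]⟩
            simpa [add_assoc] using hstep b1 g1 g2
          · rintro β bfr bv ⟨b1, b2⟩
            refine ⟨?_, fun a ha => by rw [put_ne _ (by omega), b2 a ha]⟩
            rw [← add_assoc, Nat.succ_mul]
            simpa using b1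
        · rintro α afr av ⟨a1, a2⟩
          refine ⟨?_, fun a ha => ?_⟩
          · rw [Nat.succ_mul, ← Nat.succ_mul, ← mul_assoc, Nat.succ_mul]
            simpa using a1
          · rw [put_ne _ (by omega)]
            by_cases ha' : a = 8 ∨ a = 9
            · exact a2 a ha'
            · rw [afr a (by omega) (by omega), rkeep a (by omega)]
      · rintro τ hfr hv ⟨h1, h2⟩
        exact ⟨h1, by rw [h2 58 (by omega), hn]⟩
    · rintro τ ⟨h1, h2⟩
      apply Runs.store hW1 (by simp; omega) (by simp; omega)
      exact ⟨by simp [h2], by simpa using h1⟩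
  · simp only [Expr.cost_var, Expr.cost_read, Expr.cost_mul, Expr.cost_zero, eN_cost, eM_cost,
      tOutput]
    nlinarith

end

/-! ### Reading the input -/

section

/-- Stores the powers of `p` up to `p ^ e`. -/
def powers : Program :=
  .store aPow 0 1 ;; .forLoop vB eE (.store aPow (var vB + 1) (.read aPow (var vB) * eP))

/-- Loads the code of the field element whose coordinates are stored in array `src` from address
`vY` on into `vR`. -/
def loadCode (src : ℕ) : Program :=
  .set vR 0 ;;
  .forLoop vC eE (.set vR (var vR + .read src (var vY + var vC) * .read aPow (var vC)))

/-- Stores the codes of the entries of the received word. -/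
def readWord : Program :=
  .forLoop vI (eN * eM) (.set vY (var vI * eE) ;; loadCode 2 ;; .store aG (var vI) (var vR))

/-- Stores the codes of the entries of the difference of the point and the received word. -/
def readPoint : Program :=
  .forLoop vI (eN * eM)
    (.set vY (var vI * eE) ;; loadCode 3 ;; .set vZ (var vR) ;; .set vX (eP - 1) ;;
     .set vY (.read aG (var vI)) ;; fma ;; .store aC (var vI) (var vR))

/-- Stores the codes of the entries of the basis. -/
def readBasis : Program :=
  .forLoop vI (ePar 4 * (eN * eM))
    (.set vY (var vI * eE) ;; loadCode 4 ;; .store aC (eN * eM + var vI) (var vR))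

/-- Object `0` becomes the space of all vectors of coefficients, and the only member of the
queue. -/
def initHeap : Program :=
  .forLoop vI (var vK) (.store aHM (var vI * var vK + var vI) 1) ;; .store aHR 0 (var vK) ;;
  .set vTail 1 ;; .set vHp 1

/-- Prepares the work list algorithm. -/
def setup : Program :=
  powers ;; .set vK (ePar 4 + 1) ;; .set vD (.const 2 * ePar 8 / ePar 7 + 1) ;;
  readWord ;; readPoint ;; readBasis ;; initHeap

variable {p : ℕ} [Fact p.Prime] {F : Type*} [Field F] [Algebra (ZMod p) F]
  {pb : PowerBasis (ZMod p) F} {K N m : ℕ}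

theorem powers_spec {W : ℕ} (hW : 4 * (p ^ pb.dim) ^ 2 ≤ W) {σ : Mem} (h0 : σ 0 0 = p)
    (h1 : σ 0 1 = pb.dim) : Runs W powers σ (pb.dim * 30 + 50) (fun τ =>
      (∀ t ≤ pb.dim, τ aPow t = p ^ t) ∧ ∀ a, a ≠ vB → a ≠ aPow → τ a = σ a) := by
  have hW1 := one_lt_of_le hW
  have hq2 := two_le_card (pb := pb)
  have hqW : 4 * (p ^ pb.dim) ≤ W := le_trans (by nlinarith) hW
  have hp := (Fact.out : p.Prime).two_le
  have hpow : ∀ t ≤ pb.dim, p ^ t ≤ p ^ pb.dim := fun t ht => Nat.pow_le_pow_right (by omega) ht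
  have hdim : pb.dim < p ^ pb.dim := Nat.lt_pow_self (by omega)
  apply Runs.le
  · apply Runs.store_seq hW1 (by simp; omega) (by simp; omega)
    apply Runs.forLoop 105 106 (n := pb.dim) (fun i τ => ∀ t ≤ i, τ aPow t = p ^ t) hW1 (by omega)
      rfl rfl
    · intro t ht
      rw [put_ne _ (by omega)]
      simp [show t = 0 by omega]
    · intro i τ hi hfr hv _
      have : τ 0 = σ 0 := by rw [hfr 0 (by omega) (by omega), put_ne _ (by omega)]
      simp [this, h1]; omega
    · intro i τ hi hfr hv hI
      have e0 : τ 0 = σ 0 := by rw [hfr 0 (by omega) (by omega), put_ne _ (by omega)]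
      have h2 := hpow (i + 1) (by omega)
      rw [pow_succ] at h2
      apply Runs.store hW1 (by simp [hv]; omega)
      · simp [hv, hI i le_rfl, e0, h0]
        omega
      · intro t ht
        rw [put_ne _ (by omega)]
        simp only [Expr.val_mul, Expr.val_read, Expr.val_add, Expr.val_var, Expr.val_one, eP_val,
          hv, e0, h0, hI i le_rfl, put_same, Function.update_apply]
        split_ifs with h
        · rw [h, pow_succ]
        · exact hI t (by omega)
    · intro τ hfr hv hI
      exact ⟨hI, fun a ha hb => by rw [hfr a ha (by omega), put_ne _ hb]⟩
  · simp
    omega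

/-- The coordinates of a field element are packed into a single word, as base-`p` digits. -/
theorem loadCode_spec {W : ℕ} (hW : 4 * (p ^ pb.dim) ^ 2 ≤ W) {σ : Mem} (env : ArithEnv pb σ)
    {src y : ℕ} (hsrc : src < 10) (hy : σ vY 0 = y) (hyW : y + pb.dim < W) (x : F)
    (hx : ∀ t : Fin pb.dim, σ src (y + t) = (pb.basis.repr x t).val) :
    Runs W (loadCode src) σ (pb.dim * 30 + 50) (fun τ => τ vR 0 = enc pb x ∧
      ∀ a, a ≠ vC → a ≠ vR → τ a = σ a) := by
  have hW1 := one_lt_of_le hW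
  have hq2 := two_le_card (pb := pb)
  have hqW : 4 * (p ^ pb.dim) ≤ W := le_trans (by nlinarith) hW
  have hp := (Fact.out : p.Prime).two_le
  have hpow : ∀ t ≤ pb.dim, p ^ t ≤ p ^ pb.dim := fun t ht => Nat.pow_le_pow_right (by omega) ht
  set f : ℕ → ℕ := fun t => if h : t < pb.dim then (pb.basis.repr x ⟨t, h⟩).val else 0 with hf
  apply Runs.le
  · apply Runs.set_seq_val (n := 0) hW1 (by simp; omega) rfl
    apply Runs.forLoop 13 14 (n := pb.dim)
      (fun i τ => τ vR 0 = ∑ t ∈ range i, f t % p * p ^ t) hW1 (by omega) rfl rfl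
    · simp
    · intro i τ hi hfr hv _
      have : τ 0 = σ 0 := by rw [hfr 0 (by omega) (by omega), put_ne _ (by omega)]
      simp [this, env.deg_eq]; omega
    · intro i τ hi hfr hv hI
      have hs : τ src = σ src := by rw [hfr src (by omega) (by omega), put_ne _ (by omega)]
      have h11 : τ 11 = σ 11 := by rw [hfr 11 (by omega) (by omega), put_ne _ (by omega)]
      have h105 : τ 105 = σ 105 := by rw [hfr 105 (by omega) (by omega), put_ne _ (by omega)]
      have hfi : f i = σ src (y + i) := by
        rw [hx ⟨i, hi⟩]
        simp [hf, hi]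
      have hlt : f i % p = f i := by
        refine Nat.mod_eq_of_lt ?_
        simp only [hf, hi, dite_true]
        exact ZMod.val_lt _
      have hsum := sum_digits_lt (prime_pos (p := p)) f (i + 1)
      have hle := hpow (i + 1) hi
      rw [sum_range_succ, ← hI, hlt] at hsum
      apply Runs.set hW1
      · simp [hs, h11, h105, hv, hy, env.pow i hi.le, ← hfi]
        omega
      · rw [put_ne _ (by omega), put_same, sum_range_succ, ← hI, hlt]
        simp [hs, h11, h105, hv, hy, env.pow i hi.le, ← hfi]
    · intro τ hfr hv hI
      refine ⟨hI, fun a ha hb => ?_⟩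
      rw [hfr a ha (by omega), put_ne _ hb]
  · simp
    omega

theorem readWord_spec {W : ℕ} (hW : 4 * (p ^ pb.dim) ^ 2 ≤ W) {σ : Mem} (env : ArithEnv pb σ)
    (hN : σ 0 2 = N) (hm : σ 0 3 = m)
    (hroom : (N * m) * pb.dim + pb.dim < W) (h3 : 3 < W) (g : ℕ → F)
    (hg : ∀ x < N * m, ∀ t : Fin pb.dim, σ 2 (x * pb.dim + t) = (pb.basis.repr (g x) t).val) :
    Runs W readWord σ (N * m * (pb.dim * 30 + 100) + 50) (fun τ =>
      (∀ x < N * m, τ aG x = enc pb (g x)) ∧ (∀ x, N * m ≤ x → τ aG x = σ aG x) ∧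
      ∀ a, a < 10 ∨ 21 ≤ a → a ≠ vI → a ≠ aG → τ a = σ a) := by
  have hW1 := one_lt_of_le hW
  have hep := pb.dim_pos
  have hle : N * m ≤ N * m * pb.dim := Nat.le_mul_of_pos_right _ hep
  apply Runs.le
  · apply Runs.forLoop 0 200 (n := N * m) (fun i τ =>
      (∀ x < i, τ aG x = enc pb (g x)) ∧ (∀ x, i ≤ x → τ aG x = σ aG x) ∧
      ∀ a, a < 10 ∨ 21 ≤ a → a ≠ vI → a ≠ aG → τ a = σ a) hW1 (by omega) rfl rfl
    · exact ⟨by simp, by simp, fun a _ h _ => put_ne _ h _ _⟩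
    · rintro i τ hi hfr hv ⟨-, -, h⟩
      have := h 0 (by omega) (by omega) (by omega)
      simp [this, hN, hm]; omega
    · rintro i τ hi hfr hv ⟨h1, h2, h4⟩
      have hi' : i * pb.dim + pb.dim ≤ N * m * pb.dim := row_le hi
      have e0 := h4 0 (by omega) (by omega) (by omega)
      have e2 := h4 2 (by omega) (by omega) (by omega)
      apply Runs.set_seq_val (n := i * pb.dim) hW1 (by simp [hv, e0, env.deg_eq]; omega)
        (by simp [hv, e0, env.deg_eq])
      apply Runs.seq (loadCode_spec (pb := pb) (y := i * pb.dim) hW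
        (env.congr (by simp [e0]) (by simp [h4 1]) (by simp [h4 105])) (by omega) (by simp)
        (by omega) (g i) (by simpa [e2] using hg i hi))
      rintro ρ ⟨r1, rfr⟩
      have r34 : ρ 34 0 = i := by rw [rfr 34 (by omega) (by omega)]; simp [hv]
      have r104 : ρ 104 = τ 104 := by rw [rfr 104 (by omega) (by omega)]; simp
      apply Runs.store hW1 (by simp; omega) (by simp; omega)
      simp only [Expr.val_var, r1, r34, put_same, put_ne _ (show (104:ℕ) ≠ 34 by decide), r104]
      refine ⟨fun x hx => ?_, fun x hx => ?_, fun a ha hb hc => ?_⟩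
      · rw [Function.update_apply]
        split_ifs with h
        · rw [h]
        · exact h1 x (by omega)
      · rw [Function.update_of_ne (by omega)]
        exact h2 x (by omega)
      · rw [put_ne _ hb, put_ne _ hc, rfr a (by omega) (by omega), put_ne _ (by omega),
          h4 a ha hb hc]
    · exact fun τ _ _ h => h
  · simp
    nlinarith

/-- The negative of a field element is its product with `-1`, whose code is `p - 1`. -/
theorem readPoint_spec {W : ℕ} (hW : 4 * (p ^ pb.dim) ^ 2 ≤ W) {σ : Mem} (env : ArithEnv pb σ)
    (hN : σ 0 2 = N) (hm : σ 0 3 = m)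
    (hroom : (N * m) * pb.dim + pb.dim < W) (h3 : 3 < W) (g h : ℕ → F)
    (hg : ∀ x < N * m, σ aG x = enc pb (g x))
    (hh : ∀ x < N * m, ∀ t : Fin pb.dim, σ 3 (x * pb.dim + t) = (pb.basis.repr (h x) t).val) :
    Runs W readPoint σ (N * m * (pb.dim * 30 + tFma pb.dim + 200) + 50) (fun τ =>
      (∀ x < N * m, τ aC x < p ^ pb.dim ∧ dec pb (τ aC x) = h x - g x) ∧
      (∀ x, N * m ≤ x → τ aC x = σ aC x) ∧
      ∀ a, a < 10 ∨ 21 ≤ a → a ≠ vI → a ≠ aC → τ a = σ a) := by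
  have hW1 := one_lt_of_le hW
  have hep := pb.dim_pos
  have hle : N * m ≤ N * m * pb.dim := Nat.le_mul_of_pos_right _ hep
  have hq2 := two_le_card (pb := pb)
  have hqW : 4 * (p ^ pb.dim) ≤ W := le_trans (by nlinarith) hW
  have hpq : p ≤ p ^ pb.dim := Nat.le_self_pow (by omega) p
  have hp := (Fact.out : p.Prime).two_le
  apply Runs.le
  · apply Runs.forLoop 0 200 (n := N * m) (fun i τ =>
      (∀ x < i, τ aC x < p ^ pb.dim ∧ dec pb (τ aC x) = h x - g x) ∧
      (∀ x, i ≤ x → τ aC x = σ aC x) ∧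
      ∀ a, a < 10 ∨ 21 ≤ a → a ≠ vI → a ≠ aC → τ a = σ a) hW1 (by omega) rfl rfl
    · exact ⟨by simp, by simp, fun a _ h _ => put_ne _ h _ _⟩
    · rintro i τ hi hfr hv ⟨-, -, h⟩
      have := h 0 (by omega) (by omega) (by omega)
      simp [this, hN, hm]; omega
    · rintro i τ hi hfr hv ⟨h1, h2, h4⟩
      have hi' : i * pb.dim + pb.dim ≤ N * m * pb.dim := row_le hi
      have e0 := h4 0 (by omega) (by omega) (by omega)
      have e3 := h4 3 (by omega) (by omega) (by omega)
      apply Runs.set_seq_val (n := i * pb.dim) hW1 (by simp [hv, e0, env.deg_eq]; omega)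
        (by simp [hv, e0, env.deg_eq])
      apply Runs.seq (loadCode_spec (pb := pb) (y := i * pb.dim) hW
        (env.congr (by simp [e0]) (by simp [h4 1]) (by simp [h4 105])) (by omega) (by simp)
        (by omega) (h i) (by simpa [e3] using hh i hi))
      rintro ρ ⟨r1, rfr⟩
      have rkeep : ∀ a, a < 10 ∨ 21 ≤ a → a ≠ vI → a ≠ aC → ρ a = σ a := fun a ha hb hc => by
        rw [rfr a (by omega) (by omega), put_ne _ (by omega), h4 a ha hb hc]
      have r34 : ρ 34 0 = i := by rw [rfr 34 (by omega) (by omega)]; simp [hv]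
      have r103 : ρ 103 = τ 103 := by rw [rfr 103 (by omega) (by omega)]; simp
      apply Runs.set_seq_val (n := enc pb (h i)) hW1 (by simp; omega) (by simp [r1])
      apply Runs.set_seq_val (n := p - 1) hW1 (by simp [rkeep 0, env.char_eq]; omega)
        (by simp [rkeep 0, env.char_eq])
      apply Runs.set_seq_val (n := enc pb (g i)) hW1 (by simp; omega)
        (by simp [r34, rkeep 104, hg i hi])
      apply Runs.seq (fma_spec (pb := pb) hW
        (env.congr (by simp [rkeep 0]) (by simp [rkeep 1]) (by simp [rkeep 105]))
        (by simp; omega) (by simpa using enc_lt pb _) (by simpa using enc_lt pb _))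
      rintro π ⟨⟨p1, p2⟩, pfr⟩
      have hval : dec pb (π 13 0) = h i - g i := by
        rw [p2]
        simp [dec_enc, dec_pred]
        ring
      have p34 : π 34 0 = i := by rw [pfr 34 (by omega)]; simp [r34]
      have p103 : π 103 = τ 103 := by rw [pfr 103 (by omega)]; simp [r103]
      apply Runs.store hW1 (by simp; omega) (by simp; omega)
      simp only [Expr.val_var, p34, put_same, put_ne _ (show (103:ℕ) ≠ 34 by decide), p103]
      refine ⟨fun x hx => ?_, fun x hx => ?_, fun a ha hb hc => ?_⟩
      · rw [Function.update_apply]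
        split_ifs with h
        · rw [h]; exact ⟨p1, hval⟩
        · exact h1 x (by omega)
      · rw [Function.update_of_ne (by omega)]
        exact h2 x (by omega)
      · rw [put_ne _ hb, put_ne _ hc, pfr a (by omega), put_ne _ (by omega), put_ne _ (by omega),
          put_ne _ (by omega), rkeep a ha hb hc]
    · exact fun τ _ _ h => h
  · simp
    nlinarith

theorem readBasis_spec {W k : ℕ} (hW : 4 * (p ^ pb.dim) ^ 2 ≤ W) {σ : Mem} (env : ArithEnv pb σ)
    (hN : σ 0 2 = N) (hm : σ 0 3 = m) (hk : σ 0 4 = k)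
    (hroom : (k + 1) * (N * m) * pb.dim + pb.dim < W) (h4W : 4 < W) (b : ℕ → F)
    (hb : ∀ x < k * (N * m), ∀ t : Fin pb.dim,
      σ 4 (x * pb.dim + t) = (pb.basis.repr (b x) t).val) :
    Runs W readBasis σ (k * (N * m) * (pb.dim * 30 + 150) + 50) (fun τ =>
      (∀ x < k * (N * m), τ aC (N * m + x) = enc pb (b x)) ∧
      (∀ x, x < N * m ∨ (k + 1) * (N * m) ≤ x → τ aC x = σ aC x) ∧
      ∀ a, a < 10 ∨ 21 ≤ a → a ≠ vI → a ≠ aC → τ a = σ a) := by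
  have hW1 := one_lt_of_le hW
  have hep := pb.dim_pos
  have hle : (k + 1) * (N * m) ≤ (k + 1) * (N * m) * pb.dim := Nat.le_mul_of_pos_right _ hep
  have hk1 : (k + 1) * (N * m) = k * (N * m) + N * m := by ring
  have hq2 := two_le_card (pb := pb)
  have hqW : 4 * (p ^ pb.dim) ≤ W := le_trans (by nlinarith) hW
  apply Runs.le
  · apply Runs.forLoop 0 200 (n := k * (N * m)) (fun i τ =>
      (∀ x < i, τ aC (N * m + x) = enc pb (b x)) ∧
      (∀ x, x < N * m ∨ N * m + i ≤ x → τ aC x = σ aC x) ∧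
      ∀ a, a < 10 ∨ 21 ≤ a → a ≠ vI → a ≠ aC → τ a = σ a) hW1 (by omega) rfl rfl
    · exact ⟨by simp, by simp, fun a _ h _ => put_ne _ h _ _⟩
    · rintro i τ hi hfr hv ⟨-, -, h⟩
      have := h 0 (by omega) (by omega) (by omega)
      simp [this, hN, hm, hk]
      omega
    · rintro i τ hi hfr hv ⟨h1, h2, h4⟩
      have hi' : i * pb.dim + pb.dim ≤ k * (N * m) * pb.dim := row_le hi
      have hi'' : k * (N * m) * pb.dim ≤ (k + 1) * (N * m) * pb.dim := by
        gcongr; omega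
      have e0 := h4 0 (by omega) (by omega) (by omega)
      have e3 := h4 4 (by omega) (by omega) (by omega)
      apply Runs.set_seq_val (n := i * pb.dim) hW1 (by simp [hv, e0, env.deg_eq]; omega)
        (by simp [hv, e0, env.deg_eq])
      apply Runs.seq (loadCode_spec (pb := pb) (y := i * pb.dim) hW
        (env.congr (by simp [e0]) (by simp [h4 1]) (by simp [h4 105])) (by omega) (by simp)
        (by omega) (b i) (by simpa [e3] using hb i hi))
      rintro ρ ⟨r1, rfr⟩
      have r34 : ρ 34 0 = i := by rw [rfr 34 (by omega) (by omega)]; simp [hv]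
      have r0 : ρ 0 = σ 0 := by rw [rfr 0 (by omega) (by omega)]; simp [e0]
      have r103 : ρ 103 = τ 103 := by rw [rfr 103 (by omega) (by omega)]; simp
      have hidx : (eN * eM + var vI).val ρ = N * m + i := by simp [r0, r34, hN, hm]
      apply Runs.store hW1 (by simp [r0, r34, hN, hm]; omega) (by simp; omega)
      rw [hidx]
      simp only [Expr.val_var, r1, put_same, put_ne _ (show (103:ℕ) ≠ 34 by decide), r103]
      refine ⟨fun x hx => ?_, fun x hx => ?_, fun a ha hb hc => ?_⟩
      · rw [Function.update_apply]
        split_ifs with h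
        · rw [show x = i by omega]
        · exact h1 x (by omega)
      · rw [Function.update_of_ne (by omega)]
        exact h2 x (by omega)
      · rw [put_ne _ hb, put_ne _ hc, rfr a (by omega) (by omega), put_ne _ (by omega),
          h4 a ha hb hc]
    · rintro τ _ _ ⟨h1, h2, h4⟩
      exact ⟨h1, fun x hx => h2 x (by omega), h4⟩
  · simp
    have := Nat.mul_le_mul_left (k * (N * m))
      (show 8 + (7 + (pb.dim * 30 + 50 + 11)) + 10 ≤ pb.dim * 30 + 150 by omega)
    omega

/-- The identity matrix represents the whole space; there are no equations. -/
theorem initHeap_spec {W : ℕ} (hW : 4 * (p ^ pb.dim) ^ 2 ≤ W) {σ : Mem} (hK : σ vK 0 = K)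
    (hKW : K * K < W) (h9 : ∀ x, σ aHM x = 0) :
    Runs W initHeap σ (K * 30 + 50) (fun τ =>
      (∀ x, τ aHM x < p ^ pb.dim) ∧ WF pb K (τ aHM) (τ aHR) 0 ∧ sp pb K (τ aHM) (τ aHR) 0 = ⊤ ∧
      τ vTail 0 = 1 ∧ τ vHp 0 = 1 ∧
      ∀ a, a ≠ aHM → a ≠ aHR → a ≠ vI → a ≠ vTail → a ≠ vHp → τ a = σ a) := by
  have hW1 := one_lt_of_le hW
  have hq2 := two_le_card (pb := pb)
  have hKK := le_mul_self' K
  apply Runs.le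
  · apply Runs.seq (Q := fun τ => (∀ x, τ aHM x = if ∃ l < K, x = l * K + l then 1 else 0) ∧
      ∀ a, a ≠ aHM → a ≠ vI → τ a = σ a)
    · apply Runs.forLoop 9 10 (n := K)
        (fun i τ => ∀ x, τ aHM x = if ∃ l < i, x = l * K + l then 1 else 0) hW1 (by omega) rfl rfl
      · simpa using h9
      · intro i τ hi hfr hv _
        have := hfr 100 (by omega) (by omega)
        simp [this, hK]; omega
      · intro i τ hi hfr hv hI
        have h100 := hfr 100 (by omega) (by omega)
        have hii : i * K + i < K * K := idx_lt hi hi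
        apply Runs.store hW1 (by simp [h100, hK, hv]; omega) (by simp; omega)
        intro x
        have hx : (var vI * var vK + var vI).val τ = i * K + i := by simp [h100, hK, hv]
        rw [put_ne _ (by omega), hx, put_same, Function.update_apply, hI x]
        by_cases h : x = i * K + i
        · rw [if_pos h, if_pos ⟨i, by omega, h⟩]; rfl
        · rw [if_neg h]
          congr 1
          rw [eq_iff_iff]
          constructor
          · rintro ⟨l, h1, h2⟩
            exact ⟨l, by omega, h2⟩
          · rintro ⟨l, h1, h2⟩
            refine ⟨l, ?_, h2⟩
            rcases Nat.lt_succ_iff_lt_or_eq.mp h1 with h1 | rfl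
            · exact h1
            · exact absurd h2 h
      · intro τ hfr hv hI
        exact ⟨hI, fun a ha hb => hfr a hb (by omega)⟩
    · rintro τ ⟨h1, hfr⟩
      have h100 := hfr 100 (by omega) (by omega)
      apply Runs.store_seq hW1 (by simp; omega) (by simp; omega)
      apply Runs.set_seq_val (n := 1) hW1 (by simp; omega) rfl
      apply Runs.set hW1 (by simp; omega)
      have hvec : ∀ l : Fin K, vec pb K (τ 9) (0 * (K * K) + l * K) = Pi.single l (1 : F) := by
        intro l
        funext c
        simp only [vec]
        rw [h1, zero_mul, zero_add, Pi.single_apply]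
        have hiff : (∃ l' < K, (l : ℕ) * K + c = l' * K + l') ↔ c = l := by
          constructor
          · rintro ⟨l', h1, h2⟩
            have e1 : (l : ℕ) = l' := by
              have := congrArg (· / K) h2
              simpa [mul_comm _ K, Nat.mul_add_div (show 0 < K by omega), Nat.div_eq_of_lt c.2,
                Nat.div_eq_of_lt h1] using this
            ext
            rw [← e1] at h2
            omega
          · rintro rfl
            exact ⟨c, c.2, rfl⟩
        simp only [hiff]
        split_ifs
        · exact dec_one pb
        · exact dec_zero pb
      have e9 : put (put (put τ 8 (Expr.val τ 0) (Expr.val τ (var vK))) 50 0 1) 40 0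
          (Expr.val (put (put τ 8 (Expr.val τ 0) (Expr.val τ (var vK))) 50 0 1) 1) 9 = τ 9 := by
        simp
      have e8 : put (put (put τ 8 (Expr.val τ 0) (Expr.val τ (var vK))) 50 0 1) 40 0
          (Expr.val (put (put τ 8 (Expr.val τ 0) (Expr.val τ (var vK))) 50 0 1) 1) 8 0 = K := by
        simp [h100, hK]
      generalize hα : put (put (put τ 8 (Expr.val τ 0) (Expr.val τ (var vK))) 50 0 1) 40 0
          (Expr.val (put (put τ 8 (Expr.val τ 0) (Expr.val τ (var vK))) 50 0 1) 1) = α at e9 e8 ⊢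
      have htop : sp pb K (α 9) (α 8) 0 = ⊤ := by
        rw [sp, e9, e8, eq_top_iff]
        intro x _
        rw [show x = ∑ l : Fin K, x l • Pi.single l (1 : F) by
          funext c; simp [Finset.sum_apply, Pi.single_apply]]
        exact Submodule.sum_mem _ fun l _ => Submodule.smul_mem _ _
          (Submodule.subset_span ⟨l, l.2, hvec l⟩)
      refine ⟨fun x => ?_, ⟨e8.le, by rw [htop, e8, finrank_top, Module.finrank_fin_fun],
        fun x => ?_⟩, htop, by simp [← hα], by simp [← hα], fun a h1 h2 h4 h5 h6 => ?_⟩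
      · rw [e9, h1]
        split_ifs <;> omega
      · rw [htop, e8]
        exact ⟨fun _ l h h' => by omega, fun _ => trivial⟩
      · rw [← hα, put_ne _ h6, put_ne _ h5, put_ne _ h2, hfr a h1 h4]
  · simp
    omega

/-- A bound for the running time of `setup`. -/
def tSetup (e k N m : ℕ) : ℕ :=
  (k + 2) * (N * m) * (e * 60 + tFma e + 400) + e * 30 + (k + 1) * 30 + 400

theorem setup_spec {W k Δn Δd εn εd : ℕ} (hW : 4 * (p ^ pb.dim) ^ 2 ≤ W) {σ : Mem}
    (h00 : σ 0 0 = p) (h01 : σ 0 1 = pb.dim) (hN : σ 0 2 = N) (hm : σ 0 3 = m) (hk : σ 0 4 = k)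
    (hmod : ∀ s < pb.dim, σ 1 s = ((minpoly (ZMod p) pb.gen).coeff s).val)
    (par : ParamEnv W N Δn Δd εn εd σ)
    (hDW : 2 * εd + 1 < W) (hKW : (k + 1) * (k + 1) < W)
    (hroom : (k + 1) * (N * m) * pb.dim + pb.dim < W) (hz : ∀ a x, 7 ≤ a → σ a x = 0)
    (g h b : ℕ → F)
    (hg : ∀ x < N * m, ∀ t : Fin pb.dim, σ 2 (x * pb.dim + t) = (pb.basis.repr (g x) t).val)
    (hh : ∀ x < N * m, ∀ t : Fin pb.dim, σ 3 (x * pb.dim + t) = (pb.basis.repr (h x) t).val)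
    (hb : ∀ x < k * (N * m), ∀ t : Fin pb.dim,
      σ 4 (x * pb.dim + t) = (pb.basis.repr (b x) t).val) :
    Runs W setup σ (tSetup pb.dim k N m) (fun τ =>
      CoordEnv pb (k + 1) N m τ ∧ τ 0 = σ 0 ∧ (∀ x, τ aG x < p ^ pb.dim) ∧
      (∀ x < N * m, dec pb (τ aG x) = g x) ∧ (∀ x < N * m, dec pb (τ aC x) = h x - g x) ∧
      (∀ x < k * (N * m), dec pb (τ aC (N * m + x)) = b x) ∧ τ vD 0 = 2 * εd / εn + 1 ∧
      τ vHead 0 = 0 ∧ τ vTail 0 = 1 ∧ τ aQ 0 = 0 ∧ τ vHp 0 = 1 ∧ τ vNout 0 = 0 ∧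
      WF pb (k + 1) (τ aHM) (τ aHR) 0 ∧ sp pb (k + 1) (τ aHM) (τ aHR) 0 = ⊤) := by
  have hW1 := one_lt_of_le hW
  have h8 := par.eight_lt
  have hq2 := two_le_card (pb := pb)
  have hk1 : (k + 1) * (N * m) * pb.dim = k * (N * m) * pb.dim + N * m * pb.dim := by ring
  apply Runs.le
  · apply Runs.seq (powers_spec hW h00 h01)
    rintro τ ⟨t1, tfr⟩
    have hkK : k + 1 < W := by nlinarith
    have hdiv : 2 * εd / εn ≤ 2 * εd := Nat.div_le_self _ _
    apply Runs.set_seq_val (n := k + 1) hW1 (by simp [tfr 0, hk]; omega) (by simp [tfr 0, hk])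
    apply Runs.set_seq_val (n := 2 * εd / εn + 1) hW1
      (by simp [tfr 0, par.h7, par.h8]; omega) (by simp [tfr 0, par.h7, par.h8])
    set σ₁ := put (put τ 100 0 (k + 1)) 101 0 (2 * εd / εn + 1) with hσ₁
    have k1 : ∀ a, a ≠ 42 → a ≠ 105 → a ≠ 100 → a ≠ 101 → σ₁ a = σ a := by
      intro a ha hb hc hd
      rw [hσ₁, put_ne _ hd, put_ne _ hc, tfr a ha hb]
    have e1 : ArithEnv pb σ₁ := by
      refine ⟨by rw [k1 0 (by omega) (by omega) (by omega) (by omega), h00],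
        by rw [k1 0 (by omega) (by omega) (by omega) (by omega), h01], ?_, ?_⟩
      · rw [k1 1 (by omega) (by omega) (by omega) (by omega)]; exact hmod
      · simpa [hσ₁] using t1
    have e1K : σ₁ 100 0 = k + 1 := by simp [hσ₁]
    have e1D : σ₁ 101 0 = 2 * εd / εn + 1 := by simp [hσ₁]
    clear_value σ₁
    apply Runs.seq (readWord_spec (N := N) (m := m) hW e1
      (by rw [k1 0 (by omega) (by omega) (by omega) (by omega), hN])
      (by rw [k1 0 (by omega) (by omega) (by omega) (by omega), hm]) (by omega) (by omega) g
      (by rw [k1 2 (by omega) (by omega) (by omega) (by omega)]; exact hg))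
    rintro σ₂ ⟨r1, r2, r3⟩
    have k2 : ∀ a, a < 10 ∨ 21 ≤ a → a ≠ 34 → a ≠ 104 → a ≠ 42 → a ≠ 105 → a ≠ 100 → a ≠ 101 →
        σ₂ a = σ a := by
      intro a h1 h2 h3 h4 h5 h6 h7
      rw [r3 a h1 h2 h3, k1 a h4 h5 h6 h7]
    have f0 : σ₂ 0 = σ 0 :=
      k2 0 (by omega) (by omega) (by omega) (by omega) (by omega) (by omega) (by omega)
    have f3 : σ₂ 3 = σ 3 :=
      k2 3 (by omega) (by omega) (by omega) (by omega) (by omega) (by omega) (by omega)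
    apply Runs.seq (readPoint_spec (N := N) (m := m) hW (e1.congr
      (r3 0 (by omega) (by omega) (by omega)) (r3 1 (by omega) (by omega) (by omega))
      (r3 105 (by omega) (by omega) (by omega))) (by rw [f0, hN]) (by rw [f0, hm]) (by omega)
      (by omega) g h r1 (by rw [f3]; exact hh))
    rintro σ₃ ⟨s1, s2, s3⟩
    have k3 : ∀ a, a < 10 ∨ 21 ≤ a → a ≠ 34 → a ≠ 104 → a ≠ 103 → a ≠ 42 → a ≠ 105 → a ≠ 100 →
        a ≠ 101 → σ₃ a = σ a := by
      intro a h1 h2 h3 h4 h5 h6 h7 h8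
      rw [s3 a h1 h2 h4, k2 a h1 h2 h3 h5 h6 h7 h8]
    have f0' : σ₃ 0 = σ 0 := by rw [s3 0 (by omega) (by omega) (by omega), f0]
    have f4 : σ₃ 4 = σ 4 :=
      k3 4 (by omega) (by omega) (by omega) (by omega) (by omega) (by omega) (by omega) (by omega)
    have e3 : ArithEnv pb σ₃ := e1.congr
      (by rw [s3 0 (by omega) (by omega) (by omega), r3 0 (by omega) (by omega) (by omega)])
      (by rw [s3 1 (by omega) (by omega) (by omega), r3 1 (by omega) (by omega) (by omega)])
      (by rw [s3 105 (by omega) (by omega) (by omega), r3 105 (by omega) (by omega) (by omega)])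
    apply Runs.seq (readBasis_spec (N := N) (m := m) (k := k) hW e3 (by rw [f0', hN])
      (by rw [f0', hm]) (by rw [f0', hk]) hroom (by omega) b (by rw [f4]; exact hb))
    rintro σ₄ ⟨u1, u2, u3⟩
    have k4 : ∀ a, a < 10 ∨ 21 ≤ a → a ≠ 34 → a ≠ 104 → a ≠ 103 → a ≠ 42 → a ≠ 105 → a ≠ 100 →
        a ≠ 101 → σ₄ a = σ a := by
      intro a h1 h2 h3 h4 h5 h6 h7 h8
      rw [u3 a h1 h2 h4, k3 a h1 h2 h3 h4 h5 h6 h7 h8]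
    have c4 : ∀ a, a = 0 ∨ a = 1 ∨ a = 100 ∨ a = 101 ∨ a = 105 → σ₄ a = σ₁ a := by
      intro a ha
      rw [u3 a (by omega) (by omega) (by omega), s3 a (by omega) (by omega) (by omega),
        r3 a (by omega) (by omega) (by omega)]
    refine (initHeap_spec (pb := pb) (K := k + 1) hW (by rw [c4 100 (by omega), e1K]) hKW
      (fun x => by
        rw [k4 9 (by omega) (by omega) (by omega) (by omega) (by omega) (by omega) (by omega)
          (by omega)]
        exact hz 9 x (by omega))).mono ?_
    rintro τ ⟨v1, v2, v3, v4, v5, v6⟩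
    have c5 : ∀ a, a = 0 ∨ a = 1 ∨ a = 100 ∨ a = 101 ∨ a = 105 → τ a = σ₁ a := by
      intro a ha
      rw [v6 a (by omega) (by omega) (by omega) (by omega) (by omega), c4 a ha]
    have k5 : ∀ a, a = 51 ∨ a = 57 ∨ a = 58 → ∀ x, τ a x = 0 := by
      intro a ha x
      rw [v6 a (by omega) (by omega) (by omega) (by omega) (by omega), k4 a (by omega) (by omega)
        (by omega) (by omega) (by omega) (by omega) (by omega) (by omega)]
      exact hz a x (by omega)
    have g0 : τ 0 = σ 0 := by
      rw [c5 0 (by omega), k1 0 (by omega) (by omega) (by omega) (by omega)]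
    have g103 : τ 103 = σ₄ 103 := v6 103 (by omega) (by omega) (by omega) (by omega) (by omega)
    have g104 : τ 104 = σ₂ 104 := by
      rw [v6 104 (by omega) (by omega) (by omega) (by omega) (by omega),
        u3 104 (by omega) (by omega) (by omega), s3 104 (by omega) (by omega) (by omega)]
    have hlow : ∀ x < N * m, σ₄ 103 x = σ₃ 103 x := fun x hx => u2 x (Or.inl hx)
    refine ⟨⟨⟨e1.congr (c5 0 (by omega)) (c5 1 (by omega)) (c5 105 (by omega)),
      by rw [c5 100 (by omega), e1K], v1⟩, by rw [g0, hN], by rw [g0, hm], fun x => ?_⟩, g0,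
      fun x => ?_, fun x hx => ?_, fun x hx => ?_, fun x hx => ?_, by rw [c5 101 (by omega), e1D],
      k5 57 (by omega) 0, v4, k5 51 (by omega) 0, v5, k5 58 (by omega) 0, v2, v3⟩
    · rw [g103]
      by_cases h1 : x < N * m
      · rw [hlow x h1]; exact (s1 x h1).1
      · by_cases h2 : x < (k + 1) * (N * m)
        · obtain ⟨y, rfl⟩ := Nat.exists_eq_add_of_le (show N * m ≤ x by omega)
          rw [u1 y (by rw [add_mul, one_mul] at h2; omega)]
          exact enc_lt pb _
        · rw [u2 x (by omega), s2 x (by omega), r3 103 (by omega) (by omega) (by omega),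
            k1 103 (by omega) (by omega) (by omega) (by omega), hz 103 x (by omega)]
          omega
    · rw [g104]
      by_cases h1 : x < N * m
      · rw [r1 x h1]; exact enc_lt pb _
      · rw [r2 x (by omega), k1 104 (by omega) (by omega) (by omega) (by omega),
          hz 104 x (by omega)]
        omega
    · rw [g104, r1 x hx, dec_enc]
    · rw [g103, hlow x hx]; exact (s1 x hx).2
    · rw [g103, u1 x hx, dec_enc]
  · simp only [Expr.cost_add, Expr.cost_mul, Expr.cost_div, Expr.cost_const, Expr.cost_one,
      ePar_cost, tSetup]
    set X := pb.dim * 60 + tFma pb.dim + 400 with hX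
    have i1 : (k + 2) * (N * m) * X = k * (N * m) * X + N * m * X + N * m * X := by ring
    have i2 : N * m * (pb.dim * 30 + 100) ≤ N * m * X := Nat.mul_le_mul_left _ (by omega)
    have i3 : N * m * (pb.dim * 30 + tFma pb.dim + 200) ≤ N * m * X :=
      Nat.mul_le_mul_left _ (by omega)
    have i4 : k * (N * m) * (pb.dim * 30 + 150) ≤ k * (N * m) * X :=
      Nat.mul_le_mul_left _ (by omega)
    omega

end

/-! ### Lines of coefficient vectors and codewords -/

section

theorem num_toNat_le_den {x : ℚ} (hx : x ≤ 1) : x.num.toNat ≤ x.den := by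
  have h : x.num ≤ x.den := by
    rw [← Rat.num_div_den x, div_le_one (by exact_mod_cast x.den_pos)] at hx
    exact_mod_cast hx
  omega

theorem two_le_branching {ε : ℚ} (hε : 0 < ε) (hε1 : ε ≤ 1) :
    2 ≤ 2 * ε.den / ε.num.toNat + 1 := by
  have h1 := num_toNat_le_den hε1
  have h0 : 0 < ε.num.toNat := by
    have := Rat.num_pos.mpr hε
    omega
  have : 1 ≤ 2 * ε.den / ε.num.toNat := (Nat.one_le_div_iff h0).mpr (by omega)
  omega

/-- Membership in the list, in terms of the numerators and denominators of `Δ` and `ε`. -/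
theorem relDist_lt_iff {F : Type*} [DecidableEq F] {N m : ℕ} {Δ ε : ℚ} (hN : 0 < N) (hΔ : 0 < Δ)
    (hε : 0 < ε) (f g : Word F N m) :
    relDist f g < Δ - ε ↔ hammingDist f g * (Δ.den * ε.den) + N * (ε.num.toNat * Δ.den) <
      N * (Δ.num.toNat * ε.den) := by
  have hd : (0 : ℚ) < Δ.den := by exact_mod_cast Δ.den_pos
  have he : (0 : ℚ) < ε.den := by exact_mod_cast ε.den_pos
  have hN' : (0 : ℚ) < N := by exact_mod_cast hN
  have h1 : Δ * Δ.den = (Δ.num.toNat : ℚ) := by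
    rw [Rat.mul_den_eq_num]
    exact_mod_cast (Int.toNat_of_nonneg (Rat.num_pos.mpr hΔ).le).symm
  have h2 : ε * ε.den = (ε.num.toNat : ℚ) := by
    rw [Rat.mul_den_eq_num]
    exact_mod_cast (Int.toNat_of_nonneg (Rat.num_pos.mpr hε).le).symm
  have h3 : relDist f g * N = hammingDist f g := div_mul_cancel₀ _ hN'.ne'
  have hpos : (0 : ℚ) < N * (Δ.den * ε.den) := by positivity
  rw [← mul_lt_mul_iff_left₀ hpos, ← @Nat.cast_lt ℚ]
  push_cast
  rw [← h1, ← h2, ← h3]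
  constructor <;> intro h <;> nlinarith

section code

variable {F : Type*} [Field F] {N m k : ℕ}

/-- The words whose linear combinations are considered: the difference of the point and the received
word, followed by the basis of the direction. -/
def words (g h : Word F N m) (b : Fin k → Word F N m) : Fin (k + 1) → Word F N m :=
  Fin.cons (h - g) b

/-- The linear combination of words with given coefficients. -/
def comb (c : Fin (k + 1) → Word F N m) (x : Fin (k + 1) → F) : Word F N m := ∑ l, x l • c l

theorem comb_apply (c : Fin (k + 1) → Word F N m) (x : Fin (k + 1) → F) (i : Fin N) (j : Fin m) :
    comb c x i j = ∑ l, x l * c l i j := by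
  simp [comb, Finset.sum_apply]

theorem comb_words (g h : Word F N m) (b : Fin k → Word F N m) (x : Fin (k + 1) → F) :
    comb (words g h b) x = x 0 • (h - g) + ∑ r : Fin k, x r.succ • b r := by
  simp [comb, words, Fin.sum_univ_succ]

/-- The subspaces `S i` consist of the coefficient vectors for which the combination of the words
`c l` vanishes at coordinate `i`. -/
def Vanishing (S : ℕ → Submodule F (Fin (k + 1) → F)) (c : Fin (k + 1) → Word F N m) : Prop :=
  ∀ (i : Fin N) x, x ∈ S i ↔ comb c x i = 0

variable {S : ℕ → Submodule F (Fin (k + 1) → F)} {c : Fin (k + 1) → Word F N m}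

theorem hammingNorm_comb_eq [DecidableEq F] (hS : Vanishing S c) (x : Fin (k + 1) → F) :
    hammingNorm (comb c x) = offCount S N (Submodule.span F {x}) := by
  classical
  rw [hammingNorm, offCount]
  refine card_bij (fun i _ => (i : ℕ)) (fun i hi => ?_) (fun i _ j _ h => Fin.ext h)
    fun i hi => ?_
  · rw [mem_filter] at hi
    rw [mem_filter, mem_range, Submodule.span_singleton_le_iff_mem, hS i]
    exact ⟨i.2, hi.2⟩
  · rw [mem_filter, mem_range, Submodule.span_singleton_le_iff_mem] at hi
    refine ⟨⟨i, hi.1⟩, ?_, rfl⟩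
    rw [mem_filter]
    exact ⟨mem_univ _, fun h => hi.2 ((hS ⟨i, hi.1⟩ x).mpr h)⟩

theorem hammingNorm_le_hitCount [DecidableEq F] (hS : Vanishing S c)
    {L : Submodule F (Fin (k + 1) → F)} {v x : Fin (k + 1) → F} (hv : v ∈ L) :
    hammingNorm (comb c v) ≤ hitCount S N L x + hammingNorm (comb c x) := by
  classical
  rw [hammingNorm_comb_eq hS, hammingNorm_comb_eq hS, offCount, offCount, hitCount]
  refine le_trans (card_le_card ?_) (card_union_le _ _)
  intro i hi
  rw [mem_filter, Submodule.span_singleton_le_iff_mem] at hi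
  rw [mem_union, mem_filter, mem_filter, Submodule.span_singleton_le_iff_mem]
  by_cases hx : x ∈ S i
  · exact Or.inl ⟨hi.1, fun h => hi.2 (h hv), hx⟩
  · exact Or.inr ⟨hi.1, hx⟩

theorem exists_ne_zero_of_two_le_finrank {L : Submodule F (Fin (k + 1) → F)}
    (hL : 2 ≤ Module.finrank F L) {x : Fin (k + 1) → F} (hx : x ∈ L) (hx0 : x 0 ≠ 0) :
    ∃ v ∈ L, v 0 = 0 ∧ v ≠ 0 := by
  have h1 := finrank_inf_perp L (a := Pi.single 0 1) hx (by simpa using hx0)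
  have h2 : 0 < Module.finrank F (L ⊓ perp (Pi.single 0 1) : Submodule F (Fin (k + 1) → F)) := by
    omega
  have h3 : (L ⊓ perp (Pi.single 0 1) : Submodule F (Fin (k + 1) → F)) ≠ ⊥ := by
    intro h
    rw [h, finrank_bot] at h2
    omega
  obtain ⟨v, hv, hv0⟩ := Submodule.exists_mem_ne_zero_of_ne_bot h3
  rw [Submodule.mem_inf, mem_perp] at hv
  exact ⟨v, hv.1, by simpa using hv.2, hv0⟩

variable [DecidableEq F] {C : Submodule F (Word F N m)} {Δ ε : ℚ}

/-- A subspace `L` of dimension at least `2` contains a vector `v ≠ 0` with first coefficient `0`,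
which gives a codeword of weight at least `Δ N`. The combination that belongs to a near vector `x`
of `L` has weight less than `(Δ - ε) N`, so it vanishes at more than `ε N` of the coordinates at
which the codeword does not. At these coordinates `x` lies in `S i`, but `L` is not contained in
`S i`. -/
theorem two_mul_offCount_le (hN : 0 < N) (hdist : HasDistance C Δ) (hε : 0 < ε) (hεΔ : ε < Δ)
    {g h : Word F N m} {b : Fin k → Word F N m} (hb : ∀ r, b r ∈ C) (hbi : LinearIndependent F b)
    (hS : Vanishing S (words g h b)) {L : Submodule F (Fin (k + 1) → F)} {x : Fin (k + 1) → F}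
    (hx : x ∈ L) (hL : 2 ≤ Module.finrank F L)
    (hnear : IsNear S (Nat.succ_pos k) N (Δ.den * ε.den) (N * (ε.num.toNat * Δ.den))
      (N * (Δ.num.toNat * ε.den)) (Submodule.span F {x})) :
    0 < hitCount S N L x ∧
      2 * offCount S N L ≤ hitCount S N L x * (2 * ε.den / ε.num.toNat + 1) := by
  have hx0 : x 0 ≠ 0 := (exists_mem_span_singleton_ne_zero 0).mp hnear.affine
  obtain ⟨v, hvL, hv0, hv⟩ := exists_ne_zero_of_two_le_finrank hL hx hx0
  have hcomb : comb (words g h b) v = ∑ r : Fin k, v r.succ • b r := by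
    rw [comb_words, hv0, zero_smul, zero_add]
  have hne : comb (words g h b) v ≠ 0 := by
    rw [hcomb]
    intro h0
    have := Fintype.linearIndependent_iff.mp hbi _ h0
    apply hv
    funext l
    refine Fin.cases hv0 (fun r => ?_) l
    exact this r
  have hmem : comb (words g h b) v ∈ C := by
    rw [hcomb]
    exact Submodule.sum_mem _ fun r _ => Submodule.smul_mem _ _ (hb r)
  have hw := hdist _ hmem 0 (Submodule.zero_mem _) hne
  have hw' : N * Δ.num.toNat ≤ hammingNorm (comb (words g h b) v) * Δ.den := by
    have hd : (0 : ℚ) < Δ.den := by exact_mod_cast Δ.den_pos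
    have hN' : (0 : ℚ) < N := by exact_mod_cast hN
    have h1 : Δ * Δ.den = (Δ.num.toNat : ℚ) := by
      rw [Rat.mul_den_eq_num]
      exact_mod_cast (Int.toNat_of_nonneg (Rat.num_pos.mpr (hε.trans hεΔ)).le).symm
    rw [relDist, hammingDist_zero_right, le_div_iff₀ hN'] at hw
    rw [← @Nat.cast_le ℚ]
    push_cast
    rw [← h1]
    nlinarith
  have hle := hammingNorm_le_hitCount hS (x := x) hvL
  have hnr := hnear.near
  rw [← hammingNorm_comb_eq hS] at hnr
  have hoff := offCount_le S N L
  set t := hitCount S N L x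
  set w := hammingNorm (comb (words g h b) v)
  set y := hammingNorm (comb (words g h b) x)
  set n := ε.num.toNat with hn
  have hnpos : 0 < n := by
    have := Rat.num_pos.mpr hε
    omega
  have hdpos := Δ.den_pos
  have hepos := ε.den_pos
  have key : N * n < t * ε.den := by
    have e1 : w * (Δ.den * ε.den) ≤ (t + y) * (Δ.den * ε.den) := Nat.mul_le_mul_right _ hle
    have e2 : N * Δ.num.toNat * ε.den ≤ w * Δ.den * ε.den := Nat.mul_le_mul_right _ hw'
    have e3 : N * n * Δ.den < t * ε.den * Δ.den := by nlinarith
    exact Nat.lt_of_mul_lt_mul_right e3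
  refine ⟨Nat.pos_of_ne_zero fun h0 => by rw [h0] at key; omega, ?_⟩
  have hD : 2 * ε.den < (2 * ε.den / n + 1) * n := by
    have := Nat.lt_div_mul_add (a := 2 * ε.den) hnpos
    rw [add_mul, one_mul]
    exact this
  set D := 2 * ε.den / n + 1
  have e4 : 2 * N * ε.den ≤ t * D * ε.den := by
    calc 2 * N * ε.den = N * (2 * ε.den) := by ring
      _ ≤ N * (D * n) := Nat.mul_le_mul_left _ hD.le
      _ = D * (N * n) := by ring
      _ ≤ D * (t * ε.den) := Nat.mul_le_mul_left _ key.le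
      _ = t * D * ε.den := by ring
  have := Nat.le_of_mul_le_mul_right e4 hepos
  omega

/-- The codewords in the list correspond to the lines found by the work list algorithm. -/
theorem isNear_span_iff (hN : 0 < N) (hΔ : 0 < Δ) (hε : 0 < ε) {g h : Word F N m}
    {b : Fin k → Word F N m} (hS : Vanishing S (words g h b)) {x : Fin (k + 1) → F}
    (hx : x 0 = 1) :
    IsNear S (Nat.succ_pos k) N (Δ.den * ε.den) (N * (ε.num.toNat * Δ.den))
      (N * (Δ.num.toNat * ε.den)) (Submodule.span F {x}) ↔
    relDist g (g + comb (words g h b) x) < Δ - ε := by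
  have hx0 : x ≠ 0 := by
    rintro rfl
    simp at hx
  have hd : hammingDist g (g + comb (words g h b) x) = hammingNorm (comb (words g h b) x) := by
    rw [hammingDist_eq_hammingNorm, neg_add_cancel_left]
  rw [relDist_lt_iff hN hΔ hε, hd, hammingNorm_comb_eq hS]
  constructor
  · exact fun h => h.near
  · exact fun h => ⟨finrank_span_singleton hx0, ⟨x, Submodule.mem_span_singleton_self x, by
      simp [hx]⟩, h⟩

end code

end

/-! ### The encoding of words in memory -/

section

theorem length_flatMap_const {α β : Type*} {c : ℕ} {f : α → List β} (hf : ∀ a, (f a).length = c)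
    (l : List α) : (l.flatMap f).length = l.length * c := by
  induction l with
  | nil => simp
  | cons a l ih => rw [List.flatMap_cons, List.length_append, hf, ih, List.length_cons]; ring

/-- In a concatenation of blocks of length `c`, entry number `i c + r` is entry number `r` of block
number `i`. -/
theorem getElem?_flatMap {α β : Type*} {c : ℕ} {f : α → List β} (hf : ∀ a, (f a).length = c)
    {r : ℕ} (hr : r < c) (l : List α) (i : ℕ) :
    (l.flatMap f)[i * c + r]? = l[i]?.bind fun a => (f a)[r]? := by
  induction l generalizing i with
  | nil => simp
  | cons a l ih =>
    rw [List.flatMap_cons]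
    cases i with
    | zero =>
      rw [List.getElem?_append_left (by rw [hf]; omega)]
      simp
    | succ i =>
      rw [List.getElem?_append_right (by rw [hf, add_mul]; omega), hf,
        show (i + 1) * c + r - c = i * c + r by rw [add_mul]; omega, ih]
      simp

/-- Entry number `x` of a word, regarded as a vector of `N m` field elements. -/
def entryAt {F : Type*} [Zero F] {N m : ℕ} (v : Word F N m) (x : ℕ) : F :=
  if h : x / m < N ∧ x % m < m then v ⟨x / m, h.1⟩ ⟨x % m, h.2⟩ else 0

variable {p : ℕ} [Fact p.Prime] {F : Type*} [Field F] [Algebra (ZMod p) F]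
  {pb : PowerBasis (ZMod p) F} {N m k : ℕ}

theorem length_encElem (x : F) : (Format.encElem pb x).length = pb.dim := by
  simp [Format.encElem]

theorem length_encSymbol (v : Fin m → F) :
    ((List.finRange m).flatMap fun j => Format.encElem pb (v j)).length = m * pb.dim := by
  rw [length_flatMap_const (c := pb.dim) fun _ => length_encElem _, List.length_finRange]

theorem length_encWord (v : Word F N m) :
    (Format.encWord pb v).length = N * m * pb.dim := by
  rw [Format.encWord, length_flatMap_const (c := m * pb.dim) fun i => length_encSymbol (v i),
    List.length_finRange, mul_assoc]

theorem row_add_lt {x y c r : ℕ} (hx : x < y) (hr : r < c) : x * c + r < y * c := by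
  have := Nat.mul_le_mul_right c (show x + 1 ≤ y from hx)
  rw [add_mul] at this
  omega

theorem getElem?_encWord (v : Word F N m) {x : ℕ} (hx : x < N * m) (t : Fin pb.dim) :
    (Format.encWord pb v)[x * pb.dim + t]? = some (pb.basis.repr (entryAt v x) t).val := by
  have hm : 0 < m := Nat.pos_of_ne_zero (by rintro rfl; simp at hx)
  have h1 : x / m < N := (Nat.div_lt_iff_lt_mul hm).mpr hx
  have h2 : x % m < m := Nat.mod_lt _ hm
  have h3 : x * pb.dim + t = x / m * (m * pb.dim) + (x % m * pb.dim + t) := by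
    conv_lhs => rw [← Nat.div_add_mod x m]
    ring
  rw [h3, Format.encWord, getElem?_flatMap (c := m * pb.dim) (fun i => length_encSymbol (v i))
    (row_add_lt h2 t.2), List.getElem?_eq_getElem (by simpa using h1), Option.bind_some,
    getElem?_flatMap (c := pb.dim) (fun _ => length_encElem _) t.2,
    List.getElem?_eq_getElem (by simpa using h2), Option.bind_some, entryAt, dif_pos ⟨h1, h2⟩]
  simp [Format.encElem]

theorem getElem?_flatMap_encWord (l : List (Word F N m)) {x : ℕ} (hNm : 0 < N * m)
    (t : Fin pb.dim) (hx : x / (N * m) < l.length) :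
    (l.flatMap (Format.encWord pb))[x * pb.dim + t]? =
      some (pb.basis.repr (entryAt l[x / (N * m)] (x % (N * m))) t).val := by
  have h2 : x % (N * m) < N * m := Nat.mod_lt _ hNm
  have h3 : x * pb.dim + t = x / (N * m) * (N * m * pb.dim) + (x % (N * m) * pb.dim + t) := by
    conv_lhs => rw [← Nat.div_add_mod x (N * m)]
    ring
  rw [h3, getElem?_flatMap (c := N * m * pb.dim) length_encWord (row_add_lt h2 t.2),
    List.getElem?_eq_getElem hx, Option.bind_some, getElem?_encWord _ h2]

/-- The `k N m` field elements of a list of `k` words. -/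
def basisEntry (b : Fin k → Word F N m) (x : ℕ) : F :=
  if h : x / (N * m) < k then entryAt (b ⟨x / (N * m), h⟩) (x % (N * m)) else 0

section input

variable {Δ ε : ℚ} {g h : Word F N m} {b : Fin k → Word F N m}

theorem input_two {x : ℕ} (hx : x < N * m) (t : Fin pb.dim) :
    Format.input pb Δ ε g h b 2 (x * pb.dim + t) = (pb.basis.repr (entryAt g x) t).val := by
  rw [Format.input, List.getD_eq_getElem?_getD, getElem?_encWord g hx, Option.getD_some]

theorem input_three {x : ℕ} (hx : x < N * m) (t : Fin pb.dim) :
    Format.input pb Δ ε g h b 3 (x * pb.dim + t) = (pb.basis.repr (entryAt h x) t).val := by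
  rw [Format.input, List.getD_eq_getElem?_getD, getElem?_encWord h hx, Option.getD_some]

theorem input_four {x : ℕ} (hx : x < k * (N * m)) (t : Fin pb.dim) :
    Format.input pb Δ ε g h b 4 (x * pb.dim + t) = (pb.basis.repr (basisEntry b x) t).val := by
  have hNm : 0 < N * m := Nat.pos_of_ne_zero (by intro h0; simp [h0] at hx)
  have h1 : x / (N * m) < k := (Nat.div_lt_iff_lt_mul hNm).mpr hx
  have hl : (List.finRange k).flatMap (fun r => Format.encWord pb (b r)) =
      ((List.finRange k).map b).flatMap (Format.encWord pb) := by
    rw [List.flatMap_map]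
  have hlen : ((List.finRange k).map b).length = k := by simp
  rw [Format.input, hl, List.getD_eq_getElem?_getD,
    getElem?_flatMap_encWord _ hNm t (by rw [hlen]; exact h1), Option.getD_some, basisEntry,
    dif_pos h1]
  simp

theorem input_one {s : ℕ} (hs : s < pb.dim) :
    Format.input pb Δ ε g h b 1 s = ((minpoly (ZMod p) pb.gen).coeff s).val := by
  rw [Format.input, List.getD_eq_getElem?_getD, Format.encModulus, List.getElem?_ofFn, dif_pos hs,
    Option.getD_some]

theorem input_eq_zero {a : ℕ} (ha : 7 ≤ a) (x : ℕ) : Format.input pb Δ ε g h b a x = 0 := by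
  obtain ⟨a, rfl⟩ := Nat.exists_eq_add_of_le' ha
  rfl

end input

/-- The memory contains a list of words when its arrays `5` and `6` have the expected contents. -/
theorem outputs_ofFn {σ : Mem} {n : ℕ} {f : Fin n → Word F N m} {val : ℕ → F} (hNm : 0 < N * m)
    (h5 : σ 5 0 = n)
    (h6 : ∀ x < n * (N * m), ∀ t : Fin pb.dim, σ 6 (x * pb.dim + t) =
      (pb.basis.repr (val x) t).val)
    (hval : ∀ x < n * (N * m), ∀ hx : x / (N * m) < n,
      val x = entryAt (f ⟨x / (N * m), hx⟩) (x % (N * m))) :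
    Format.Outputs pb σ (List.ofFn f) := by
  refine ⟨by rw [h5, List.length_ofFn], fun x hx => ?_⟩
  have hlen : x < n * (N * m) * pb.dim := by
    rw [length_flatMap_const length_encWord, List.length_ofFn] at hx
    rw [mul_assoc]
    exact hx
  have hy : x / pb.dim < n * (N * m) := (Nat.div_lt_iff_lt_mul pb.dim_pos).mpr hlen
  have hi : x / pb.dim / (N * m) < n := (Nat.div_lt_iff_lt_mul hNm).mpr hy
  have hx' : x = x / pb.dim * pb.dim + (⟨x % pb.dim, Nat.mod_lt _ pb.dim_pos⟩ : Fin pb.dim) :=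
    (Nat.div_add_mod' x pb.dim).symm
  have hget := getElem?_flatMap_encWord (pb := pb) (List.ofFn f) (x := x / pb.dim) hNm
    ⟨x % pb.dim, Nat.mod_lt _ pb.dim_pos⟩ (by rw [List.length_ofFn]; exact hi)
  have h := h6 _ hy ⟨x % pb.dim, Nat.mod_lt _ pb.dim_pos⟩
  rw [← hx'] at hget h
  rw [List.getElem?_eq_getElem hx, Option.some_inj] at hget
  rw [hget, h, hval _ hy hi]
  simp

end

/-! ### Correctness of the program -/

section

/-- The list decoding program. -/
def listDecode : Program := setup ;; mainLoop ;; output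

section codewords

variable {F : Type*} [Field F] {N m k : ℕ}

/-- The codeword near the received word `g` that belongs to the line spanned by `w`. -/
def codewordOf (g h : Word F N m) (b : Fin k → Word F N m) (w : Fin (k + 1) → F) : Word F N m :=
  g + comb (words g h b) ((w 0)⁻¹ • w)

variable {C : Submodule F (Word F N m)} {Δ ε : ℚ} {g : Word F N m}
  {H : AffineSubspace F (Word F N m)} {h₀ : H} {b : Module.Basis (Fin k) F H.direction}
  {S : ℕ → Submodule F (Fin (k + 1) → F)}

theorem add_comb_words (g h : Word F N m) (b : Fin k → Word F N m) {x : Fin (k + 1) → F}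
    (hx : x 0 = 1) : g + comb (words g h b) x = (∑ r : Fin k, x r.succ • b r) + h := by
  rw [comb_words, hx, one_smul]
  abel

theorem inv_smul_apply_zero {w : Fin (k + 1) → F} (hw : w 0 ≠ 0) : ((w 0)⁻¹ • w) 0 = 1 := by
  simp [hw]

theorem linearIndependent_direction :
    LinearIndependent F fun r => (b r : Word F N m) :=
  b.linearIndependent.map' H.direction.subtype (Submodule.ker_subtype _)

theorem direction_mem (h₀ : H) (hHC : (H : Set (Word F N m)) ⊆ C) (v : H.direction) :
    (v : Word F N m) ∈ C := by
  have h1 : (v : Word F N m) +ᵥ (h₀ : Word F N m) ∈ H :=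
    AffineSubspace.vadd_mem_of_mem_direction v.2 h₀.2
  have h2 : (v : Word F N m) = ((v : Word F N m) + h₀) - h₀ := by simp
  rw [h2]
  exact C.sub_mem (hHC h1) (hHC h₀.2)

variable [DecidableEq F]

/-- The accepted lines correspond to the codewords in `H` near the received word. -/
theorem codewords_spec (hN : 0 < N) (hΔ : 0 < Δ) (hε : 0 < ε) (hHC : (H : Set (Word F N m)) ⊆ C)
    (hS : Vanishing S (words g h₀ fun r => (b r : Word F N m))) {n : ℕ}
    {L : ℕ → Submodule F (Fin (k + 1) → F)} {w : ℕ → Fin (k + 1) → F}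
    (hL : ∀ i < n, L i = Submodule.span F {w i}) (hw : ∀ i < n, w i 0 ≠ 0)
    (hnear : ∀ i < n, IsNear S (Nat.succ_pos k) N (Δ.den * ε.den) (N * (ε.num.toNat * Δ.den))
      (N * (Δ.num.toNat * ε.den)) (L i))
    (hne : ∀ i < n, ∀ j < n, i ≠ j → L i ≠ L j)
    (hall : ∀ x, IsNear S (Nat.succ_pos k) N (Δ.den * ε.den) (N * (ε.num.toNat * Δ.den))
      (N * (Δ.num.toNat * ε.den)) (Submodule.span F {x}) → ∃ i < n, x ∈ L i) :
    (List.ofFn fun i : Fin n =>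
      codewordOf g h₀ (fun r => (b r : Word F N m)) (w i)).Nodup ∧
    ∀ f, f ∈ (List.ofFn fun i : Fin n =>
      codewordOf g h₀ (fun r => (b r : Word F N m)) (w i)) ↔
      f ∈ (H : Set (Word F N m)) ∩ codeList C g (Δ - ε) := by
  constructor
  · rw [List.nodup_ofFn]
    intro i j hij
    by_contra hc
    apply hne i i.2 j j.2 fun h => hc (Fin.ext h)
    have hi := inv_smul_apply_zero (hw i i.2)
    have hj := inv_smul_apply_zero (hw j j.2)
    simp only [codewordOf] at hij
    rw [add_comb_words _ _ _ hi, add_comb_words _ _ _ hj, add_left_inj] at hij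
    have h1 := (linearIndependent_direction (b := b)).fintypeLinearCombination_injective
    have h2 : (fun r : Fin k => ((w i 0)⁻¹ • w i) r.succ) =
        fun r : Fin k => ((w j 0)⁻¹ • w j) r.succ := by
      apply h1
      simpa only [Fintype.linearCombination_apply] using hij
    have h3 : (w i 0)⁻¹ • w i = (w j 0)⁻¹ • w j := by
      funext l
      refine Fin.cases ?_ (fun r => ?_) l
      · rw [hi, hj]
      · exact congrFun h2 r
    rw [hL i i.2, hL j j.2,
      ← Submodule.span_singleton_smul_eq (IsUnit.mk0 _ (inv_ne_zero (hw i i.2))) (w i), h3,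
      Submodule.span_singleton_smul_eq (IsUnit.mk0 _ (inv_ne_zero (hw j j.2))) (w j)]
  · intro f
    rw [List.mem_ofFn]
    constructor
    · rintro ⟨i, rfl⟩
      have hi := inv_smul_apply_zero (hw i i.2)
      have hmem : codewordOf g h₀ (fun r => (b r : Word F N m)) (w i) ∈ H := by
        rw [codewordOf, add_comb_words _ _ _ hi]
        refine AffineSubspace.vadd_mem_of_mem_direction ?_ h₀.2
        exact Submodule.sum_mem _ fun r _ => Submodule.smul_mem _ _ (b r).2
      refine ⟨hmem, hHC hmem, ?_⟩
      rw [codewordOf, ← isNear_span_iff hN hΔ hε hS hi,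
        Submodule.span_singleton_smul_eq (IsUnit.mk0 _ (inv_ne_zero (hw i i.2))) (w i),
        ← hL i i.2]
      exact hnear i i.2
    · rintro ⟨hf, -, hfg⟩
      have hfd : f - h₀ ∈ H.direction := AffineSubspace.vsub_mem_direction hf h₀.2
      set x : Fin (k + 1) → F := Fin.cons 1 (b.repr ⟨f - h₀, hfd⟩) with hxdef
      have hx : x 0 = 1 := rfl
      have hfx : f = g + comb (words g h₀ fun r => (b r : Word F N m)) x := by
        rw [add_comb_words _ _ _ hx]
        have h1 := congrArg (Submodule.subtype _) (b.sum_repr ⟨f - h₀, hfd⟩)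
        rw [map_sum] at h1
        simp only [map_smul, Submodule.subtype_apply] at h1
        simp only [hxdef, Fin.cons_succ]
        rw [h1]
        simp
      obtain ⟨i, hi, hxi⟩ := hall x (by
        rw [isNear_span_iff hN hΔ hε hS hx, ← hfx]
        exact hfg)
      refine ⟨⟨i, hi⟩, ?_⟩
      rw [hL i hi] at hxi
      obtain ⟨c, hc⟩ := Submodule.mem_span_singleton.mp hxi
      have hc0 : c = (w i 0)⁻¹ := by
        rw [← hc, Pi.smul_apply, smul_eq_mul] at hx
        exact eq_inv_of_mul_eq_one_left hx
      rw [hfx, ← hc, hc0]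
      rfl

end codewords

variable {p : ℕ} [Fact p.Prime] {F : Type*} [Field F] [Algebra (ZMod p) F]
  {pb : PowerBasis (ZMod p) F} {N m k : ℕ}

theorem entryAt_of_lt (v : Word F N m) {i j : ℕ} (hi : i < N) (hj : j < m) :
    entryAt v (i * m + j) = v ⟨i, hi⟩ ⟨j, hj⟩ := by
  have h1 : (i * m + j) / m = i := by
    rw [mul_comm, Nat.mul_add_div (by omega), Nat.div_eq_of_lt hj, add_zero]
  have h2 : (i * m + j) % m = j := by
    rw [mul_comm, Nat.mul_add_mod, Nat.mod_eq_of_lt hj]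
  simp only [entryAt, h1, h2]
  rw [dif_pos ⟨hi, hj⟩]

/-- The words in memory are the words whose combinations are considered. -/
theorem eqVec_eq {A : ℕ → ℕ} {g h : Word F N m} {b : Fin k → Word F N m}
    (h1 : ∀ x < N * m, dec pb (A x) = entryAt h x - entryAt g x)
    (h2 : ∀ x < k * (N * m), dec pb (A (N * m + x)) = basisEntry b x) {i j : ℕ} (hi : i < N)
    (hj : j < m) (l : Fin (k + 1)) :
    eqVec pb (k + 1) N m A i j l = words g h b l ⟨i, hi⟩ ⟨j, hj⟩ := by
  have hx : i * m + j < N * m := row_add_lt hi hj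
  refine Fin.cases ?_ (fun r => ?_) l
  · rw [eqVec, Fin.val_zero, zero_mul, zero_add, h1 _ hx, entryAt_of_lt _ hi hj,
      entryAt_of_lt _ hi hj]
    rfl
  · have hr : ((r : ℕ) * (N * m) + (i * m + j)) / (N * m) = r := by
      rw [mul_comm, Nat.mul_add_div (by omega), Nat.div_eq_of_lt hx, add_zero]
    have hr' : ((r : ℕ) * (N * m) + (i * m + j)) % (N * m) = i * m + j := by
      rw [mul_comm, Nat.mul_add_mod, Nat.mod_eq_of_lt hx]
    rw [eqVec, Fin.val_succ, show ((r : ℕ) + 1) * (N * m) + (i * m + j) =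
      N * m + ((r : ℕ) * (N * m) + (i * m + j)) by ring, h2 _ (row_add_lt r.2 hx), basisEntry]
    simp only [hr, hr']
    rw [dif_pos r.2, entryAt_of_lt _ hi hj]
    rfl

theorem vanishing_coordSub {A : ℕ → ℕ} {c : Fin (k + 1) → Word F N m}
    (hc : ∀ (i : ℕ) (hi : i < N) (j : ℕ) (hj : j < m) l,
      eqVec pb (k + 1) N m A i j l = c l ⟨i, hi⟩ ⟨j, hj⟩) :
    Vanishing (coordSub pb (k + 1) N m A) c := by
  intro i x
  have hdot : ∀ (j : ℕ) (hj : j < m), eqVec pb (k + 1) N m A i j ⬝ᵥ x = comb c x i ⟨j, hj⟩ := by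
    intro j hj
    rw [comb_apply, dotProduct]
    exact sum_congr rfl fun l _ => by rw [hc i i.2 j hj l, mul_comm]
  rw [mem_coordSub, funext_iff]
  exact ⟨fun h j => (hdot j j.2).symm.trans (h j j.2), fun h j hj => (hdot j hj).trans (h ⟨j, hj⟩)⟩

/-- The values that are written are the entries of the codewords. -/
theorem outVal_eq {σ : Mem} {g h : Word F N m} {b : Fin k → Word F N m}
    (hg : ∀ x < N * m, dec pb (σ aG x) = entryAt g x)
    (hc : ∀ (i : ℕ) (hi : i < N) (j : ℕ) (hj : j < m) l,
      eqVec pb (k + 1) N m (σ aC) i j l = words g h b l ⟨i, hi⟩ ⟨j, hj⟩)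
    (hN : 0 < N) (hm : 0 < m) (x : ℕ) :
    outVal pb (k + 1) N m σ x = entryAt (codewordOf g h b
      (vec pb (k + 1) (σ aHM) (σ aOI (x / (N * m)) * ((k + 1) * (k + 1))))) (x % (N * m)) := by
  have hi : x / m % N < N := Nat.mod_lt _ hN
  have hj : x % m < m := Nat.mod_lt _ hm
  have hx : x % (N * m) = x / m % N * m + x % m := by
    rw [mul_comm N m, Nat.mod_mul, mul_comm]
    ring
  have hy : x / m / N = x / (N * m) := by rw [Nat.div_div_eq_div_mul, mul_comm]
  rw [hx, entryAt_of_lt _ hi hj, codewordOf, Pi.add_apply, Pi.add_apply, comb_apply, outVal,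
    hg _ (row_add_lt hi hj), entryAt_of_lt _ hi hj, hy, dotProduct, sum_mul]
  congr 1
  refine sum_congr rfl fun l _ => ?_
  rw [hc _ hi _ hj l, Pi.smul_apply, smul_eq_mul, vec]
  simp only [Fin.val_zero, add_zero, vec]
  ring

theorem tOutput_mono {e K l n Q : ℕ} (h : n ≤ Q) : tOutput e K N m l n ≤ tOutput e K N m l Q := by
  simp only [tOutput]
  gcongr

/-- The program writes the list of the codewords near the received word. -/
theorem listDecode_spec [Finite F] [DecidableEq F] (hN : 0 < N) (hm : 0 < m)
    {C : Submodule F (Word F N m)} {Δ ε : ℚ} (hdist : HasDistance C Δ) (hΔ1 : Δ ≤ 1) (hε : 0 < ε)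
    (hεΔ : ε < Δ) (g : Word F N m) {H : AffineSubspace F (Word F N m)}
    (hHC : (H : Set (Word F N m)) ⊆ C) (h₀ : H) (b : Module.Basis (Fin k) F H.direction)
    {W D Z Q T l : ℕ} (hW : Room pb W (k + 1) N m T)
    (par : ParamEnv W N Δ.num.toNat Δ.den ε.num.toNat ε.den
      (Format.input pb Δ ε g h₀ fun r => (b r : Word F N m)))
    (hDW : 2 * ε.den + 1 < W) (hKW : (k + 1) * (k + 1) < W)
    (hin : (k + 1) * (N * m) * pb.dim + pb.dim < W) (hD : D = 2 * ε.den / ε.num.toNat + 1)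
    (hZ : D ^ 2 ^ k ≤ Z) (hQ : D ^ 2 ^ (k + 1) ≤ Q)
    (hroom : 1 + Q * (N + (k + 1) * (N * Z)) < T) (hQW : Q + (k + 1) * Z + 1 < W)
    (hout : Q * (N * (m * pb.dim)) < W) (hl : p ^ pb.dim ≤ 2 ^ l) :
    Runs W listDecode (Format.input pb Δ ε g h₀ fun r => (b r : Word F N m))
      (tSetup pb.dim k N m + (Q * (tItem pb.dim (k + 1) N m Z Q + 10) + 10 +
        tOutput pb.dim (k + 1) N m l Q)) (fun τ => ∃ L : List (Word F N m),
        Format.Outputs pb τ L ∧ L.Nodup ∧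
        ∀ f, f ∈ L ↔ f ∈ (H : Set (Word F N m)) ∩ codeList C g (Δ - ε)) := by
  have hΔ : 0 < Δ := hε.trans hεΔ
  have hNm : 0 < N * m := Nat.mul_pos hN hm
  have hD2 : 2 ≤ D := by
    rw [hD]
    exact two_le_branching hε (hεΔ.le.trans hΔ1)
  apply Runs.seq (setup_spec hW.field rfl rfl rfl rfl rfl (fun s hs => input_one hs) par hDW hKW hin
    (fun a x ha => input_eq_zero ha x) (entryAt g) (entryAt (h₀ : Word F N m))
    (basisEntry fun r => (b r : Word F N m)) (fun x hx t => input_two hx t)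
    (fun x hx t => input_three hx t) (fun x hx t => input_four hx t))
  rintro τ ⟨te, t0, tG, tg, th, tb, tD, thead, ttail, tq, thp, tn, twf, ttop⟩
  have hc : ∀ (i : ℕ) (hi : i < N) (j : ℕ) (hj : j < m) l, eqVec pb (k + 1) N m (τ 103) i j l =
      words g (h₀ : Word F N m) (fun r => (b r : Word F N m)) l ⟨i, hi⟩ ⟨j, hj⟩ :=
    fun i hi j hj l => eqVec_eq th tb hi hj l
  have hS := vanishing_coordSub hc
  rw [← hD] at tD
  apply Runs.seq (mainLoop_spec hW te (par.congr t0) tD hD2 (by simpa using hZ) hQ thead ttail tq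
    thp tn twf ttop hroom hQW (by
      intro L x hx hL hnear
      rw [hD]
      exact two_mul_offCount_le hN hdist hε hεΔ (fun r => direction_mem h₀ hHC (b r))
        linearIndependent_direction hS hx hL hnear))
  rintro ρ ⟨⟨rM, n, h, rn, hnQ, hhT, rwf, rL, rall⟩, rfr⟩
  have re : CoordEnv pb (k + 1) N m ρ := te.congr (rfr 0 (by omega)) (rfr 1 (by omega))
    (rfr 105 (by omega)) (rfr 100 (by omega)) rM (rfr 103 (by omega))
  have f103 := rfr 103 (by omega)
  have f104 := rfr 104 (by omega)
  set w : ℕ → Fin (k + 1) → F := fun i =>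
    vec pb (k + 1) (ρ 9) (ρ 59 i * ((k + 1) * (k + 1))) with hw
  have hspan : ∀ i < n, sp pb (k + 1) (ρ 9) (ρ 8) (ρ 59 i) = Submodule.span F {w i} := by
    intro i hi
    apply sp_of_rank_one
    rw [← (rwf _ (rL.lt i hi)).finrank_eq]
    exact (rL.prop i hi).line
  have hw0 : ∀ i < n, w i 0 ≠ 0 := by
    intro i hi
    have h1 := (rL.prop i hi).affine
    rw [hspan i hi] at h1
    exact (exists_mem_span_singleton_ne_zero _).mp h1
  have hcw := codewords_spec (n := n) (w := w) hN hΔ hε hHC hS hspan hw0 rL.prop rL.distinct rall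
  have hnm := tOutput_mono (e := pb.dim) (K := k + 1) (l := l) (N := N) (m := m) hnQ
  apply Runs.le
  · apply Runs.mono (output_spec (h := h) hW re (by rw [f104]; exact tG) hl rn (by omega)
      ((Nat.mul_le_mul_right _ hnQ).trans_lt hout) hhT (fun i hi => rL.lt i hi)
      (fun i hi => by simpa [hw, vec] using hw0 i hi))
    rintro π ⟨h5, h6⟩
    refine ⟨_, outputs_ofFn hNm h5 h6 fun x _ _ => ?_, hcw⟩
    exact outVal_eq (by rw [f104]; exact tg) (by rw [f103]; exact hc) hN hm x
  · exact hnm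

end

/-! ### Running time and word size -/

section

/-- The function `f` is at most `u` times a power of `M`. -/
def Growth {α : Type*} (M u f : α → ℕ) : Prop := ∃ a, ∀ s, f s ≤ u s * M s ^ a

namespace Growth

variable {α : Type*} {M u v f g : α → ℕ}

theorem const (hM : ∀ s, 2 ≤ M s) (c : ℕ) : Growth M (fun _ => 1) fun _ => c :=
  ⟨c, fun s => by
    rw [one_mul]
    exact Nat.lt_two_pow_self.le.trans (Nat.pow_le_pow_left (hM s) c)⟩

theorem of_le (h : ∀ s, f s ≤ M s) : Growth M (fun _ => 1) f := ⟨1, fun s => by simpa using h s⟩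

theorem of_le_sq (h : ∀ s, f s ≤ M s ^ 2) : Growth M (fun _ => 1) f :=
  ⟨2, fun s => by simpa using h s⟩

theorem self (u : α → ℕ) : Growth M u u := ⟨0, fun s => by simp⟩

theorem add (hM : ∀ s, 2 ≤ M s) (hf : Growth M u f) (hg : Growth M u g) :
    Growth M u fun s => f s + g s := by
  obtain ⟨a, ha⟩ := hf
  obtain ⟨b, hb⟩ := hg
  refine ⟨max a b + 1, fun s => ?_⟩
  have h1 : M s ^ a ≤ M s ^ max a b :=
    Nat.pow_le_pow_right (by have := hM s; omega) (le_max_left _ _)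
  have h2 : M s ^ b ≤ M s ^ max a b :=
    Nat.pow_le_pow_right (by have := hM s; omega) (le_max_right _ _)
  calc f s + g s ≤ u s * M s ^ max a b + u s * M s ^ max a b :=
        add_le_add ((ha s).trans (Nat.mul_le_mul_left _ h1))
          ((hb s).trans (Nat.mul_le_mul_left _ h2))
    _ = u s * (M s ^ max a b * 2) := by ring
    _ ≤ u s * (M s ^ max a b * M s) := Nat.mul_le_mul_left _ (Nat.mul_le_mul_left _ (hM s))
    _ = u s * M s ^ (max a b + 1) := by rw [pow_succ]

theorem mul (hf : Growth M u f) (hg : Growth M v g) :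
    Growth M (fun s => u s * v s) fun s => f s * g s := by
  obtain ⟨a, ha⟩ := hf
  obtain ⟨b, hb⟩ := hg
  refine ⟨a + b, fun s => (Nat.mul_le_mul (ha s) (hb s)).trans_eq ?_⟩
  rw [pow_add]
  ring

theorem one_mul (hf : Growth M (fun _ => 1) f) (hg : Growth M u g) :
    Growth M u fun s => f s * g s := by
  simpa only [_root_.one_mul] using hf.mul hg

theorem mul_one (hf : Growth M u f) (hg : Growth M (fun _ => 1) g) :
    Growth M u fun s => f s * g s := by
  simpa only [_root_.mul_one] using hf.mul hg

theorem lift (hu : ∀ s, 0 < u s) (hf : Growth M (fun _ => 1) f) : Growth M u f := by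
  obtain ⟨a, ha⟩ := hf
  exact ⟨a, fun s => (ha s).trans (Nat.mul_le_mul_right _ (hu s))⟩

end Growth

/-- The quantities that determine the running time: the degree `e` of the field, the dimensions `k`
and `K`, the length `N` and the width `m` of the code, the bounds `Z` and `Q` for numbers of
subspaces, and the logarithm `l` of the cardinality of the field. All but `N` and `m` are bounded by
powers of `M`. -/
structure TimeSizes where
  (e k K N m Z Q l M : ℕ)
  two_le : 2 ≤ M
  N_pos : 0 < N
  m_pos : 0 < m
  e_le : e ≤ M
  k_le : k ≤ M
  K_le : K ≤ M
  Z_le : Z ≤ M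
  Q_le : Q ≤ M ^ 2
  l_le : l ≤ M

/-- The running time is at most `N m` times a power of `M`. -/
theorem time_growth : Growth TimeSizes.M (fun s => s.N * s.m) fun s =>
    tSetup s.e s.k s.N s.m + (s.Q * (tItem s.e s.K s.N s.m s.Z s.Q + 10) + 10 +
      tOutput s.e s.K s.N s.m s.l s.Q) := by
  have hM := TimeSizes.two_le
  have hN : ∀ s : TimeSizes, 0 < s.N := TimeSizes.N_pos
  have hm : ∀ s : TimeSizes, 0 < s.m := TimeSizes.m_pos
  have hNm : ∀ s : TimeSizes, 0 < s.N * s.m := fun s => Nat.mul_pos (hN s) (hm s)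
  have c : ∀ n, Growth TimeSizes.M (fun _ => 1) fun _ => n := Growth.const hM
  have e : Growth TimeSizes.M (fun _ => 1) fun s => s.e := Growth.of_le TimeSizes.e_le
  have K : Growth TimeSizes.M (fun _ => 1) fun s => s.K := Growth.of_le TimeSizes.K_le
  have k : Growth TimeSizes.M (fun _ => 1) fun s => s.k := Growth.of_le TimeSizes.k_le
  have Z : Growth TimeSizes.M (fun _ => 1) fun s => s.Z := Growth.of_le TimeSizes.Z_le
  have Q : Growth TimeSizes.M (fun _ => 1) fun s => s.Q := Growth.of_le_sq TimeSizes.Q_le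
  have l : Growth TimeSizes.M (fun _ => 1) fun s => s.l := Growth.of_le TimeSizes.l_le
  have N : Growth TimeSizes.M (fun s => s.N) fun s => s.N := Growth.self _
  have m : Growth TimeSizes.M (fun s => s.m) fun s => s.m := Growth.self _
  have fma : Growth TimeSizes.M (fun _ => 1) fun s => tFma s.e := by
    simp only [tFma]
    with_reducible repeat' first
      | exact c _ | assumption | apply Growth.add hM | apply Growth.one_mul
  have dot : Growth TimeSizes.M (fun _ => 1) fun s => tDot s.e s.K := by
    simp only [tDot]
    with_reducible repeat' first
      | exact c _ | assumption | apply Growth.add hM | apply Growth.one_mul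
  have elim : Growth TimeSizes.M (fun _ => 1) fun s => tElim s.e s.K := by
    simp only [tElim]
    with_reducible repeat' first
      | exact c _ | assumption | apply Growth.add hM | apply Growth.one_mul
  have cut : Growth TimeSizes.M (fun _ => 1) fun s => tCut s.e s.K := by
    simp only [tCut]
    with_reducible repeat' first
      | exact c _ | assumption | apply Growth.add hM | apply Growth.one_mul
  have meet : Growth TimeSizes.M (fun _ => 1) fun s => tMeet s.e s.K := by
    simp only [tMeet]
    with_reducible repeat' first
      | exact c _ | assumption | apply Growth.add hM | apply Growth.one_mul
  have find : Growth TimeSizes.M (fun _ => 1) fun s => tFind s.e s.K s.Q := by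
    simp only [tFind]
    with_reducible repeat' first
      | exact c _ | assumption | apply Growth.add hM | apply Growth.one_mul
  have insert : Growth TimeSizes.M (fun _ => 1) fun s => tInsert s.e s.K s.Z := by
    simp only [tInsert, tEmit, tFind]
    with_reducible repeat' first
      | exact c _ | assumption | apply Growth.add hM | apply Growth.one_mul
  have invert : Growth TimeSizes.M (fun _ => 1) fun s => tInvert s.e s.l := by
    simp only [tInvert]
    with_reducible repeat' first
      | exact c _ | assumption | apply Growth.add hM | apply Growth.one_mul
  have entry : Growth TimeSizes.M (fun _ => 1) fun s => tEntry s.e s.K := by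
    simp only [tEntry]
    with_reducible repeat' first
      | exact c _ | assumption | apply Growth.add hM | apply Growth.one_mul
  have coord : Growth TimeSizes.M (fun s => s.m) fun s => tCoord s.e s.K s.m := by
    simp only [tCoord]
    refine Growth.add hM (m.mul_one ?_) (Growth.lift hm (c _))
    with_reducible repeat' first
      | exact c _ | assumption | apply Growth.add hM | apply Growth.one_mul
  have stream : Growth TimeSizes.M (fun s => s.N * s.m)
      fun s => tStream s.e s.K s.N s.m := by
    simp only [tStream]
    refine Growth.add hM (N.mul (Growth.add hM (Growth.add hM (Growth.lift hm ?_) coord)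
      (Growth.lift hm (c _)))) (Growth.lift hNm (c _))
    with_reducible repeat' first
      | exact c _ | assumption | apply Growth.add hM | apply Growth.one_mul
  have levels : Growth TimeSizes.M (fun s => s.N * s.m)
      fun s => tLevels s.e s.K s.Z s.N := by
    have h : Growth TimeSizes.M (fun s => s.N * s.m) fun s => s.N :=
      N.mul (Growth.lift hm (c 1)) |> fun h => by simpa only [mul_one] using h
    simp only [tLevels, tLevel]
    refine Growth.add hM (K.one_mul (Growth.add hM (Growth.add hM (Growth.add hM
      ((h.mul_one Z).mul_one ?_) (Growth.lift hNm ?_)) (Growth.lift hNm (c _)))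
      (Growth.lift hNm (c _)))) (Growth.lift hNm (c _))
    all_goals with_reducible repeat' first
      | exact c _ | assumption | apply Growth.add hM | apply Growth.one_mul
  have item : Growth TimeSizes.M (fun s => s.N * s.m)
      fun s => tItem s.e s.K s.N s.m s.Z s.Q := by
    simp only [tItem]
    exact Growth.add hM (Growth.add hM (Growth.add hM stream (Growth.lift hNm find)) levels)
      (Growth.lift hNm (c _))
  have output : Growth TimeSizes.M (fun s => s.N * s.m)
      fun s => tOutput s.e s.K s.N s.m s.l s.Q := by
    simp only [tOutput]
    exact Growth.add hM (Q.one_mul (Growth.add hM (Growth.add hM (Growth.lift hNm invert)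
      (N.mul (Growth.add hM (m.mul_one (Growth.add hM entry (c _))) (Growth.lift hm (c _)))))
      (Growth.lift hNm (c _)))) (Growth.lift hNm (c _))
  have setup : Growth TimeSizes.M (fun s => s.N * s.m) fun s => tSetup s.e s.k s.N s.m := by
    simp only [tSetup]
    refine Growth.add hM (Growth.add hM (Growth.add hM
      (((Growth.add hM k (c _)).one_mul (N.mul m)).mul_one ?_) (Growth.lift hNm ?_))
      (Growth.lift hNm ?_)) (Growth.lift hNm (c _))
    all_goals with_reducible repeat' first
      | exact c _ | assumption | apply Growth.add hM | apply Growth.one_mul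
  exact Growth.add hM setup (Growth.add hM (Growth.add hM (Q.one_mul (Growth.add hM item
    (Growth.lift hNm (c _)))) (Growth.lift hNm (c _))) output)

/-- The quantities that determine the size of the words of the machine. All of them are bounded by
powers of `T`. -/
structure WordSizes where
  (K N m e q d d' Z Q T : ℕ)
  two_le : 2 ≤ T
  K_le : K ≤ T
  N_le : N ≤ T
  m_le : m ≤ T
  e_le : e ≤ T
  q_le : q ≤ T
  d_le : d ≤ T
  d'_le : d' ≤ T
  Z_le : Z ≤ T
  Q_le : Q ≤ T ^ 2

/-- The number of subspaces for which there is room in memory. -/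
def numObjects (K N Z Q : ℕ) : ℕ := 2 + Q * (N + K * (N * Z))

/-- All numbers that occur in a run are at most a power of `T`. -/
theorem word_growth : Growth WordSizes.T (fun _ => 1) fun s =>
    4 * (s.q * s.q) + s.K * (s.N * s.m) +
    numObjects s.K s.N s.Z s.Q * (s.K * s.K) + numObjects s.K s.N s.Z s.Q +
    (s.N * (s.d * s.d') + s.N * (s.d' * s.d)) + (s.d * s.d' + s.d' * s.d) + s.K * s.K +
    (2 * s.d' + (s.K * (s.N * s.m) * s.e + s.e)) + (s.Q + s.K * s.Z) +
    s.Q * (s.N * (s.m * s.e)) + 10 := by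
  have hT := WordSizes.two_le
  have c : ∀ n, Growth WordSizes.T (fun _ => 1) fun _ => n := Growth.const hT
  have K : Growth WordSizes.T (fun _ => 1) fun s => s.K := Growth.of_le WordSizes.K_le
  have N : Growth WordSizes.T (fun _ => 1) fun s => s.N := Growth.of_le WordSizes.N_le
  have m : Growth WordSizes.T (fun _ => 1) fun s => s.m := Growth.of_le WordSizes.m_le
  have e : Growth WordSizes.T (fun _ => 1) fun s => s.e := Growth.of_le WordSizes.e_le
  have q : Growth WordSizes.T (fun _ => 1) fun s => s.q := Growth.of_le WordSizes.q_le
  have d : Growth WordSizes.T (fun _ => 1) fun s => s.d := Growth.of_le WordSizes.d_le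
  have d' : Growth WordSizes.T (fun _ => 1) fun s => s.d' := Growth.of_le WordSizes.d'_le
  have Z : Growth WordSizes.T (fun _ => 1) fun s => s.Z := Growth.of_le WordSizes.Z_le
  have Q : Growth WordSizes.T (fun _ => 1) fun s => s.Q := Growth.of_le_sq WordSizes.Q_le
  have H : Growth WordSizes.T (fun _ => 1) fun s => numObjects s.K s.N s.Z s.Q := by
    simp only [numObjects]
    with_reducible repeat' first
      | exact c _ | assumption | apply Growth.add hT | apply Growth.one_mul
  with_reducible repeat' first
    | exact c _ | assumption | apply Growth.add hT | apply Growth.one_mul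

end

/-! ### The bounds in terms of `2 / ε` and the field -/

section

/-- The base `D` of the bounds is at most `(2 / ε) ^ 2`. -/
theorem branching_le {ε : ℚ} (hε : 0 < ε) (hε1 : ε ≤ 1) :
    ((2 * ε.den / ε.num.toNat + 1 : ℕ) : ℚ) ≤ (2 / ε) ^ 2 := by
  have h1 : (ε.num.toNat : ℚ) = ε.num := by
    exact_mod_cast Int.toNat_of_nonneg (Rat.num_pos.mpr hε).le
  have h2 : ((2 * ε.den / ε.num.toNat : ℕ) : ℚ) ≤ 2 / ε := by
    refine Nat.cast_div_le.trans_eq ?_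
    conv_rhs => rw [← Rat.num_div_den ε]
    rw [h1]
    push_cast
    rw [div_div_eq_mul_div]
  have h3 : 2 ≤ 2 / ε := by
    rw [le_div_iff₀ hε]
    linarith
  push_cast
  nlinarith

theorem natCard_eq {p : ℕ} [Fact p.Prime] {F : Type*} [Field F] [Algebra (ZMod p) F]
    (pb : PowerBasis (ZMod p) F) : Nat.card F = p ^ pb.dim := by
  have := pb.finite
  rw [Module.natCard_eq_pow_finrank (K := ZMod p) (V := F), pb.finrank, Nat.card_zmod]

theorem clog_le_two_mul_logb {q : ℕ} (hq : 2 ≤ q) : (Nat.clog 2 q : ℝ) ≤ 2 * Real.logb 2 q := by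
  have hq' : (2 : ℝ) ≤ q := by exact_mod_cast hq
  have h1 : 1 ≤ Real.logb 2 q := by
    rw [Real.le_logb_iff_rpow_le (by norm_num) (by linarith), Real.rpow_one]
    exact hq'
  have h2 := Nat.ceil_lt_add_one (a := Real.logb 2 q) (by linarith)
  have h3 : ⌈Real.logb 2 q⌉₊ = Nat.clog 2 q := by exact_mod_cast Real.natCeil_logb_natCast 2 q
  rw [h3] at h2
  linarith

/-- The time bound, expressed by `2 / ε` and the logarithm of the cardinality of the field. -/
theorem time_le {ε : ℝ} {k Z N m q a c t : ℕ} (hε : 0 < ε) (hε1 : ε ≤ 1)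
    (hZ : (Z : ℝ) ≤ ((2 / ε) ^ 2 ^ k) ^ 2) (hq : 2 ≤ q) (hc : 3 * a ≤ c)
    (ht : t ≤ N * m * (Z * Nat.clog 2 q) ^ a) :
    (t : ℝ) ≤ (2 / ε) ^ (c * 2 ^ k) * N * m * Real.logb 2 q ^ c := by
  have hx : 2 ≤ 2 / ε := by
    rw [le_div_iff₀ hε]
    linarith
  have hq' : (2 : ℝ) ≤ q := by exact_mod_cast hq
  have hL : 1 ≤ Real.logb 2 q := by
    rw [Real.le_logb_iff_rpow_le (by norm_num) (by linarith), Real.rpow_one]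
    exact hq'
  have hl := clog_le_two_mul_logb hq
  set x := 2 / ε
  set L := Real.logb 2 q
  set A := x ^ 2 ^ k with hA
  have hA2 : 2 ≤ A := hx.trans (le_self_pow₀ (by linarith) (by positivity))
  have h1 : ((Z * Nat.clog 2 q : ℕ) : ℝ) ≤ A ^ 3 * L := by
    push_cast
    calc (Z : ℝ) * Nat.clog 2 q ≤ A ^ 2 * (2 * L) := by gcongr
      _ ≤ A ^ 2 * (A * L) := by gcongr
      _ = A ^ 3 * L := by ring
  calc (t : ℝ) ≤ ((N * m * (Z * Nat.clog 2 q) ^ a : ℕ) : ℝ) := by exact_mod_cast ht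
    _ = N * m * ((Z * Nat.clog 2 q : ℕ) : ℝ) ^ a := by push_cast; ring
    _ ≤ N * m * (A ^ 3 * L) ^ a := by gcongr
    _ = N * m * (A ^ (3 * a) * L ^ a) := by rw [mul_pow, ← pow_mul]
    _ ≤ N * m * (A ^ c * L ^ c) := by
        gcongr
        · linarith
        · omega
    _ = x ^ (c * 2 ^ k) * N * m * L ^ c := by rw [hA, ← pow_mul, mul_comm (2 ^ k) c]; ring

/-- The word size, expressed by the bound `Z` for the number of subspaces in a work item. -/
theorem pow_le_wordSize {ε B : ℚ} {k Z N m q d d' w c W : ℕ} (hN : 0 < N) (hm : 0 < m) (hq : 0 < q)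
    (hd : 0 < d) (hd' : 0 < d') (hε : 0 < ε) (hε1 : ε ≤ 1)
    (hZ : (Z : ℚ) ≤ ((2 / ε) ^ 2 ^ k) ^ 2) (hc : 2 * w ≤ c)
    (hB : B = (2 / ε) ^ 2 ^ k * N * m * q * d * d') (hW : B ^ c ≤ W) :
    (Z * N * m * q * d * d') ^ w ≤ W := by
  have hx : 1 ≤ 2 / ε := by
    rw [le_div_iff₀ hε]
    linarith
  have hA : 1 ≤ (2 / ε) ^ 2 ^ k := one_le_pow₀ hx
  set A := (2 / ε) ^ 2 ^ k
  have hu : (1 : ℚ) ≤ N * m * q * d * d' := by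
    exact_mod_cast Nat.mul_pos (Nat.mul_pos (Nat.mul_pos (Nat.mul_pos hN hm) hq) hd) hd'
  have hB' : B = A * (N * m * q * d * d') := by rw [hB]; ring
  set u : ℚ := N * m * q * d * d' with hudef
  have hB1 : 1 ≤ B := by rw [hB']; nlinarith
  have hT : ((Z * N * m * q * d * d' : ℕ) : ℚ) ≤ B ^ 2 := by
    calc ((Z * N * m * q * d * d' : ℕ) : ℚ) = Z * u := by push_cast; ring
      _ ≤ A ^ 2 * (u * u) := by gcongr; nlinarith
      _ = B ^ 2 := by rw [hB']; ring
  have h : (((Z * N * m * q * d * d') ^ w : ℕ) : ℚ) ≤ W := by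
    rw [Nat.cast_pow]
    calc ((Z * N * m * q * d * d' : ℕ) : ℚ) ^ w ≤ (B ^ 2) ^ w := by gcongr
      _ = B ^ (2 * w) := (pow_mul _ _ _).symm
      _ ≤ B ^ c := pow_le_pow_right₀ hB1 hc
      _ ≤ W := hW
  exact_mod_cast h

end

end ListDec

open ListDec in
theorem theorem3p5 :
    ∃ (P : WordRAM.Program) (c : ℕ),
      ∀ (p : ℕ) [Fact p.Prime] (F : Type*) [Field F] [Finite F] [DecidableEq F]
        [Algebra (ZMod p) F] (pb : PowerBasis (ZMod p) F)
        (N m k : ℕ) (_ : 0 < N) (_ : 0 < m)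
        (C : Submodule F (LinCode.Word F N m)) (Δ ε : ℚ)
        (_ : LinCode.HasDistance C Δ) (_ : Δ ≤ 1) (_ : 0 < ε) (_ : ε < Δ)
        (g : LinCode.Word F N m)
        (H : AffineSubspace F (LinCode.Word F N m)) (_ : (H : Set (LinCode.Word F N m)) ⊆ C)
        (h₀ : H) (b : Module.Basis (Fin k) F H.direction)
        (W : ℕ)
        (_ : ((2 / ε) ^ (2 ^ k) * N * m * Nat.card F * Δ.den * ε.den) ^ c ≤ (W : ℚ)),
      ∃ (t : ℕ) (σ : WordRAM.Mem) (l : List (LinCode.Word F N m)),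
        WordRAM.Exec W P (Format.input pb Δ ε g h₀ (fun r => (b r : LinCode.Word F N m))) t σ ∧
        Format.Outputs pb σ l ∧
        l.Nodup ∧
        (∀ f, f ∈ l ↔ f ∈ (H : Set (LinCode.Word F N m)) ∩ LinCode.codeList C g (Δ - ε)) ∧
        (t : ℝ) ≤ (2 / (ε : ℝ)) ^ (c * 2 ^ k) * N * m * Real.logb 2 (Nat.card F) ^ c := by
  obtain ⟨a, ha⟩ := time_growth
  obtain ⟨w, hw⟩ := word_growth
  refine ⟨listDecode, 3 * a + 2 * w, ?_⟩
  intro p _ F _ _ _ _ pb N m k hN hm C Δ ε hdist hΔ1 hε hεΔ g H hHC h₀ b W hW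
  have hε1 : ε ≤ 1 := hεΔ.le.trans hΔ1
  have hq2 : 2 ≤ p ^ pb.dim := two_le_card
  have hcard := natCard_eq pb
  rw [hcard] at hW ⊢
  have hDle := branching_le hε hε1
  have hD2 := two_le_branching hε hε1
  have hεn := num_toNat_le_den hε1
  have hΔn := num_toNat_le_den hΔ1
  set D := 2 * ε.den / ε.num.toNat + 1 with hD
  set Z := D ^ 2 ^ k with hZ
  set q := p ^ pb.dim with hq
  have hZle : (Z : ℚ) ≤ ((2 / ε) ^ 2 ^ k) ^ 2 := by
    rw [hZ, Nat.cast_pow, ← pow_mul, mul_comm, pow_mul]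
    gcongr
  have hQ : D ^ 2 ^ (k + 1) = Z ^ 2 := by rw [hZ, ← pow_mul, ← pow_succ]
  have hKZ : k + 1 ≤ Z := by
    calc k + 1 ≤ 2 ^ k := Nat.lt_two_pow_self
      _ ≤ 2 ^ 2 ^ k := Nat.lt_two_pow_self.le
      _ ≤ Z := Nat.pow_le_pow_left hD2 _
  have hZ2 : 2 ≤ Z := hD2.trans (Nat.le_self_pow (by positivity) D)
  clear_value D Z
  have heq : 2 ^ pb.dim ≤ q := Nat.pow_le_pow_left (Fact.out : p.Prime).two_le _
  -- `T` bounds every quantity that enters the requirements on the word size.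
  set T := Z * N * m * q * Δ.den * ε.den with hT
  have hTW : T ^ w ≤ W := pow_le_wordSize hN hm (by omega) Δ.den_pos ε.den_pos hε hε1 hZle
    (by omega) rfl hW
  have hTpos : 0 < T := by
    have := Δ.den_pos
    have := ε.den_pos
    positivity
  have hZT : Z ≤ T := Nat.le_of_dvd hTpos ⟨N * m * q * Δ.den * ε.den, by rw [hT]; ring⟩
  have hqT : q ≤ T := Nat.le_of_dvd hTpos ⟨Z * N * m * Δ.den * ε.den, by rw [hT]; ring⟩
  clear_value T
  have hwords := hw
    { K := k + 1, N := N, m := m, e := pb.dim, q := q, d := Δ.den, d' := ε.den, Z := Z, Q := Z ^ 2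
      T := T
      two_le := by omega
      K_le := hKZ.trans hZT
      N_le := Nat.le_of_dvd hTpos ⟨Z * m * q * Δ.den * ε.den, by rw [hT]; ring⟩
      m_le := Nat.le_of_dvd hTpos ⟨Z * N * q * Δ.den * ε.den, by rw [hT]; ring⟩
      e_le := (Nat.lt_two_pow_self.le.trans heq).trans hqT
      q_le := hqT
      d_le := Nat.le_of_dvd hTpos ⟨Z * N * m * q * ε.den, by rw [hT]; ring⟩
      d'_le := Nat.le_of_dvd hTpos ⟨Z * N * m * q * Δ.den, by rw [hT]; ring⟩
      Z_le := hZT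
      Q_le := Nat.pow_le_pow_left hZT 2 }
  dsimp only at hwords
  rw [one_mul] at hwords
  replace hwords := hwords.trans hTW
  set O := numObjects (k + 1) N Z (Z ^ 2) with hO
  have hroom : 1 + Z ^ 2 * (N + (k + 1) * (N * Z)) < O := by rw [hO, numObjects]; omega
  clear_value O
  have room : Room pb W (k + 1) N m O :=
    { field := by rw [sq, ← hq]; omega
      words := by omega
      heap := by omega
      objects := by omega
      width_pos := Nat.succ_pos k
      N_pos := hN
      m_pos := hm
      three_lt := by omega }
  have par : ParamEnv W N Δ.num.toNat Δ.den ε.num.toNat ε.den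
      (Format.input pb Δ ε g h₀ fun r => (b r : LinCode.Word F N m)) := by
    have h1 := Nat.mul_le_mul_right Δ.den hεn
    have h2 := Nat.mul_le_mul_right ε.den hΔn
    have h3 := Nat.mul_le_mul_left N h1
    have h4 := Nat.mul_le_mul_left N h2
    exact ⟨rfl, rfl, rfl, rfl, by omega, by omega, by omega, by omega, by omega, by omega⟩
  obtain ⟨t, τ, hexec, ht, L, hout, hnodup, hmem⟩ := listDecode_spec hN hm hdist hΔ1 hε hεΔ g hHC h₀
    b room par (by omega) (by omega) (by omega) hD hZ.ge hQ.le hroom (by omega) (by omega)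
    (Nat.le_pow_clog one_lt_two _)
  refine ⟨t, τ, L, hexec, hout, hnodup, hmem, ?_⟩
  -- The running time is bounded in terms of `Z` and the rounded logarithm of `q`.
  have hl : 0 < Nat.clog 2 q := Nat.clog_pos one_lt_two hq2
  have hel : pb.dim ≤ Nat.clog 2 q :=
    (Nat.pow_le_pow_iff_right one_lt_two).mp (heq.trans (Nat.le_pow_clog one_lt_two _))
  have hZM : Z ≤ Z * Nat.clog 2 q := Nat.le_mul_of_pos_right _ hl
  have hlM : Nat.clog 2 q ≤ Z * Nat.clog 2 q := Nat.le_mul_of_pos_left _ (by omega)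
  have htime := ha
    { e := pb.dim, k := k, K := k + 1, N := N, m := m, Z := Z, Q := Z ^ 2, l := Nat.clog 2 q
      M := Z * Nat.clog 2 q
      two_le := by omega
      N_pos := hN
      m_pos := hm
      e_le := hel.trans hlM
      k_le := by omega
      K_le := by omega
      Z_le := hZM
      Q_le := Nat.pow_le_pow_left hZM 2
      l_le := hlM }
  exact time_le (by exact_mod_cast hε) (by exact_mod_cast hε1) (by exact_mod_cast hZle) hq2
    (by omega) (ht.trans htime)
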